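/- Computations take place on a unit-cost real RAM with words of $w$ bits: memory cells hold either an exact real number or an integer in $\{0,\dots,2^w-1\}$; in one step a program can perform one of $+,-,\cdot,/$ or a comparison on real numbers, one of $+,-,\cdot,\mathrm{div},\mathrm{mod}$ or a comparison on words, convert a word to a real number, round a real number down to a word (values outside $[0,2^w)$ are replaced by the nearest word), or access an array at a computed index. Space is measured by the largest array index accessed. A program is a finite text that does not depend on the input size $n$, and a word has $w=\Theta(\log n)$ bits. A rectangle is a set $(x,x']\times(y,y']$ with $x,x',y,y'\in\mathbb{R}$. **Theorem.** For every constant $c\in\mathbb{N}$ there are a construction program, a query program, an integer $\kappa\ge 1$ and constants $C,K$ such that the following holds for every $n\ge 3$, on words of $w=\kappa(\lfloor\log_2 n\rfloor+1)$ bits. Let $P$ be a set of $n$ points chosen independently and uniformly from $[0,1]^2$. 1. The construction program, run on $P$, uses expected time at most $C\,n\log n\,(\log\log n)^2$ and expected space at most $C\,n\log n\,(\log\log n)^2$. 2. Almost surely it halts, and then the query program, started in the resulting memory, halts after at most $K$ steps on every query rectangle. 3. With probability at least $1-n^{-c}$, the answers of the query program are correct simultaneously for all query rectangles $R$: it reports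 whether $R\cap P\neq\emptyset$. -/

import Mathlib

/-! A unit-cost real RAM with words of `w` bits and a floor operation.

A memory consists of word cells (natural numbers below `2 ^ w`) and real cells (exact real
numbers). Programs are finite texts in a structured imperative language; they do not depend on the
number of input points. Real numbers can only be combined by the four arithmetic operations,
compared, and rounded down to a word. -/

namespace RealRAM

/-- The two kinds of cells. -/
inductive Ty where
  | word
  | real
  deriving DecidableEq

/-- The values held by a cell. -/
abbrev Ty.Val : Ty → Type
  | .word => ℕ
  | .real => ℝ

/-- A memory: for each kind of cell, registers numbered by `ℕ` and arrays numbered by `ℕ`.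
A program text mentions finitely many registers and arrays; the index inside an array is
computed at run time (indirect addressing). -/
structure Mem where
  var : (τ : Ty) → ℕ → τ.Val
  arr : (τ : Ty) → ℕ → ℕ → τ.Val

/-- Word operations; comparisons return `1` or `0`. -/
inductive WordOp where
  | add | sub | mul | div | mod | lt | eq

/-- Real operations. -/
inductive RealOp where
  | add | sub | mul | div

/-- Addition and multiplication are modulo `2 ^ w`, subtraction is truncated at `0`;
`a / 0 = 0` and `a % 0 = a`. -/
def WordOp.eval (w : ℕ) : WordOp → ℕ → ℕ → ℕ
  | .add, a, b => (a + b) % 2 ^ w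
  | .sub, a, b => a - b
  | .mul, a, b => (a * b) % 2 ^ w
  | .div, a, b => a / b
  | .mod, a, b => a % b
  | .lt, a, b => if a < b then 1 % 2 ^ w else 0
  | .eq, a, b => if a = b then 1 % 2 ^ w else 0

/-- Exact real arithmetic, with `x / 0 = 0`. -/
noncomputable def RealOp.eval : RealOp → ℝ → ℝ → ℝ
  | .add, x, y => x + y
  | .sub, x, y => x - y
  | .mul, x, y => x * y
  | .div, x, y => x / y

/-- Expressions. -/
inductive Expr : Ty → Type where
  /-- a word constant -/
  | lit (k : ℕ) : Expr .word
  /-- the content of register `x` -/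
  | var (τ : Ty) (x : ℕ) : Expr τ
  /-- the cell of array `a` at a computed index -/
  | get (τ : Ty) (a : ℕ) (i : Expr .word) : Expr τ
  | wordOp (o : WordOp) (e f : Expr .word) : Expr .word
  | realOp (o : RealOp) (e f : Expr .real) : Expr .real
  /-- the test `e < f` for real numbers -/
  | realLt (e f : Expr .real) : Expr .word
  /-- conversion of a word to a real number -/
  | cast (e : Expr .word) : Expr .real
  /-- rounding down to a word -/
  | floor (e : Expr .real) : Expr .word

/-- The value of an expression. The floor of a real number outside `[0, 2 ^ w)` is replaced by the
nearest word `0` or `2 ^ w - 1`; in particular the floor operation gives no access to the digits of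
large real numbers. -/
noncomputable def Expr.eval (w : ℕ) (s : Mem) : {τ : Ty} → Expr τ → τ.Val
  | _, .lit k => k % 2 ^ w
  | _, .var τ x => s.var τ x
  | _, .get τ a i => s.arr τ a (i.eval w s)
  | _, .wordOp o e f => o.eval w (e.eval w s) (f.eval w s)
  | _, .realOp o e f => o.eval (e.eval w s) (f.eval w s)
  | _, .realLt e f =>
      open Classical in if (show ℝ from e.eval w s) < f.eval w s then 1 % 2 ^ w else 0
  | _, .cast e => ((show ℕ from e.eval w s : ℕ) : ℝ)
  | _, .floor e => min ⌊(show ℝ from e.eval w s)⌋₊ (2 ^ w - 1)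

/-- The time to evaluate an expression: its number of nodes. -/
def Expr.cost : {τ : Ty} → Expr τ → ℕ
  | _, .lit _ => 1
  | _, .var _ _ => 1
  | _, .get _ _ i => i.cost + 1
  | _, .wordOp _ e f => e.cost + f.cost + 1
  | _, .realOp _ e f => e.cost + f.cost + 1
  | _, .realLt e f => e.cost + f.cost + 1
  | _, .cast e => e.cost + 1
  | _, .floor e => e.cost + 1

/-- The least `m` such that evaluating the expression only touches array indices below `m`. -/
noncomputable def Expr.space (w : ℕ) (s : Mem) : {τ : Ty} → Expr τ → ℕ
  | _, .lit _ => 0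
  | _, .var _ _ => 0
  | _, .get _ _ i => max (i.space w s) ((show ℕ from i.eval w s) + 1)
  | _, .wordOp _ e f => max (e.space w s) (f.space w s)
  | _, .realOp _ e f => max (e.space w s) (f.space w s)
  | _, .realLt e f => max (e.space w s) (f.space w s)
  | _, .cast e => e.space w s
  | _, .floor e => e.space w s

/-- Programs. -/
inductive Cmd where
  | skip
  /-- write to register `x` -/
  | set (τ : Ty) (x : ℕ) (e : Expr τ)
  /-- write to the cell of array `a` at a computed index -/
  | put (τ : Ty) (a : ℕ) (i : Expr .word) (e : Expr τ)
  | seq (c d : Cmd)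
  /-- run `c` if the test is nonzero, otherwise `d` -/
  | cond (b : Expr .word) (c d : Cmd)
  /-- repeat `c` as long as the test is nonzero -/
  | loop (b : Expr .word) (c : Cmd)

/-- Overwrite register `x`. -/
def Mem.setVar (s : Mem) (τ : Ty) (x : ℕ) (v : τ.Val) : Mem where
  var := Function.update s.var τ (Function.update (s.var τ) x v)
  arr := s.arr

/-- Overwrite cell `i` of array `a`. -/
def Mem.setArr (s : Mem) (τ : Ty) (a i : ℕ) (v : τ.Val) : Mem where
  var := s.var
  arr := Function.update s.arr τ
    (Function.update (s.arr τ) a (Function.update (s.arr τ a) i v))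

/-- `Exec w c s s' t m`: on words of `w` bits, program `c` started in memory `s` halts in memory
`s'` after `t` steps, having touched only array indices below `m` (and `m` is least). Since a
program has finitely many arrays and registers, the number of cells it uses is at most a constant
(depending on the program text only) times `m + 1`. -/
inductive Exec (w : ℕ) : Cmd → Mem → Mem → ℕ → ℕ → Prop where
  | skip (s : Mem) : Exec w .skip s s 1 0
  | set (s : Mem) (τ : Ty) (x : ℕ) (e : Expr τ) :
      Exec w (.set τ x e) s (s.setVar τ x (e.eval w s)) (e.cost + 1) (e.space w s)
  | put (s : Mem) (τ : Ty) (a : ℕ) (i : Expr .word) (e : Expr τ) :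
      Exec w (.put τ a i e) s (s.setArr τ a (i.eval w s) (e.eval w s)) (i.cost + e.cost + 1)
        (max (max (i.space w s) (e.space w s)) ((show ℕ from i.eval w s) + 1))
  | seq {c d : Cmd} {s s' s'' : Mem} {t t' m m' : ℕ} :
      Exec w c s s' t m → Exec w d s' s'' t' m' →
        Exec w (.seq c d) s s'' (t + t' + 1) (max m m')
  | condTrue {b : Expr .word} {c d : Cmd} {s s' : Mem} {t m : ℕ} :
      b.eval w s ≠ (0 : ℕ) → Exec w c s s' t m →
        Exec w (.cond b c d) s s' (b.cost + t + 1) (max (b.space w s) m)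
  | condFalse {b : Expr .word} {c d : Cmd} {s s' : Mem} {t m : ℕ} :
      b.eval w s = (0 : ℕ) → Exec w d s s' t m →
        Exec w (.cond b c d) s s' (b.cost + t + 1) (max (b.space w s) m)
  | loopTrue {b : Expr .word} {c : Cmd} {s s' s'' : Mem} {t t' m m' : ℕ} :
      b.eval w s ≠ (0 : ℕ) → Exec w c s s' t m → Exec w (.loop b c) s' s'' t' m' →
        Exec w (.loop b c) s s'' (b.cost + t + t' + 1) (max (b.space w s) (max m m'))
  | loopFalse {b : Expr .word} {c : Cmd} {s : Mem} :
      b.eval w s = (0 : ℕ) → Exec w (.loop b c) s s (b.cost + 1) (b.space w s)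

/-- Programs are deterministic: final memory, time and space are determined by the start. -/
theorem Exec.deterministic {w : ℕ} {c : Cmd} {s s₁ s₂ : Mem} {t₁ t₂ m₁ m₂ : ℕ}
    (h₁ : Exec w c s s₁ t₁ m₁) (h₂ : Exec w c s s₂ t₂ m₂) : s₁ = s₂ ∧ t₁ = t₂ ∧ m₁ = m₂ := by
  induction h₁ generalizing s₂ t₂ m₂ with
  | skip s => cases h₂; exact ⟨rfl, rfl, rfl⟩
  | set s τ x e => cases h₂; exact ⟨rfl, rfl, rfl⟩
  | put s τ a i e => cases h₂; exact ⟨rfl, rfl, rfl⟩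
  | seq _ _ ih ih' =>
    cases h₂ with
    | seq k k' =>
      obtain ⟨rfl, rfl, rfl⟩ := ih k
      obtain ⟨rfl, rfl, rfl⟩ := ih' k'
      exact ⟨rfl, rfl, rfl⟩
  | condTrue hb _ ih =>
    cases h₂ with
    | condTrue _ k => obtain ⟨rfl, rfl, rfl⟩ := ih k; exact ⟨rfl, rfl, rfl⟩
    | condFalse hb' _ => exact absurd hb' hb
  | condFalse hb _ ih =>
    cases h₂ with
    | condTrue hb' _ => exact absurd hb hb'
    | condFalse _ k => obtain ⟨rfl, rfl, rfl⟩ := ih k; exact ⟨rfl, rfl, rfl⟩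
  | loopTrue hb _ _ ih ih' =>
    cases h₂ with
    | loopTrue _ k k' =>
      obtain ⟨rfl, rfl, rfl⟩ := ih k
      obtain ⟨rfl, rfl, rfl⟩ := ih' k'
      exact ⟨rfl, rfl, rfl⟩
    | loopFalse hb' => exact absurd hb' hb
  | loopFalse hb =>
    cases h₂ with
    | loopTrue hb' _ _ => exact absurd hb hb'
    | loopFalse _ => exact ⟨rfl, rfl, rfl⟩

open scoped ENNReal in
/-- The running time of `c` from `s`; it is `∞` if `c` does not halt. As a function of the
input reals this is Borel measurable for every `c`, since each path of execution is a Borel event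
and there are countably many. -/
noncomputable def runTime (w : ℕ) (c : Cmd) (s : Mem) : ℝ≥0∞ :=
  ⨅ (s' : Mem) (t : ℕ) (m : ℕ) (_ : Exec w c s s' t m), (t : ℝ≥0∞)

open scoped ENNReal in
/-- The space used by `c` from `s`; it is `∞` if `c` does not halt. -/
noncomputable def runSpace (w : ℕ) (c : Cmd) (s : Mem) : ℝ≥0∞ :=
  ⨅ (s' : Mem) (t : ℕ) (m : ℕ) (_ : Exec w c s s' t m), (m : ℝ≥0∞)

/-- The start memory for `n` points: `n` is in word register `0`, the abscissae and ordinates of the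
points are in the real arrays `0` and `1`, and every other cell is `0`. -/
noncomputable def inputMem {n : ℕ} (P : Fin n → ℝ × ℝ) : Mem where
  var
    | .word => fun x => if x = 0 then n else 0
    | .real => fun _ => 0
  arr
    | .word => fun _ _ => 0
    | .real => fun a i =>
        if h : i < n then (if a = 0 then (P ⟨i, h⟩).1 else if a = 1 then (P ⟨i, h⟩).2 else 0) else 0

/-- Hand over the query rectangle `(x, x'] × (y, y']` in the real registers `0`, `1`, `2`, `3`. -/
def Mem.withQuery (s : Mem) (x x' y y' : ℝ) : Mem :=
  (((s.setVar .real 0 x).setVar .real 1 x').setVar .real 2 y).setVar .real 3 y'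

/-- The answer of a query program: whether word register `0` is nonzero when it halts. -/
def Mem.answer (s : Mem) : Prop := s.var .word 0 ≠ (0 : ℕ)

end RealRAM

namespace RandomPoints

open RealRAM MeasureTheory

/-- The law of `n` independent uniform points of the unit square. -/
noncomputable def law (n : ℕ) : Measure (Fin n → ℝ × ℝ) :=
  Measure.pi fun _ => (volume : Measure (ℝ × ℝ)).restrict (Set.Icc 0 1 ×ˢ Set.Icc 0 1)

/-- The half-open axis-aligned rectangle `(x, x'] × (y, y']`. -/
def rectangle (x x' y y' : ℝ) : Set (ℝ × ℝ) := Set.Ioc x x' ×ˢ Set.Ioc y y'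

/-- In the memory `s`, program `query` halts within `K` steps on every query rectangle. -/
def FastQueries (w : ℕ) (query : Cmd) (K : ℕ) (s : Mem) : Prop :=
  ∀ x x' y y' : ℝ, ∃ s' t m, Exec w query (s.withQuery x x' y y') s' t m ∧ t ≤ K

/-- In the memory `s`, program `query` decides correctly, for every query rectangle, whether it
contains a point of `P`. All queries start from the same memory `s`. -/
def CorrectQueries (w : ℕ) (query : Cmd) {n : ℕ} (P : Fin n → ℝ × ℝ) (s : Mem) : Prop :=
  ∀ x x' y y' : ℝ, ∃ s' t m, Exec w query (s.withQuery x x' y y') s' t m ∧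
    (s'.answer ↔ ∃ i, P i ∈ rectangle x x' y y')

/-- Program `build`, run on the points `P`, halts in a memory satisfying `Q`. -/
def BuildsWith (w : ℕ) (build : Cmd) {n : ℕ} (P : Fin n → ℝ × ℝ) (Q : Mem → Prop) : Prop :=
  ∃ s t m, Exec w build (inputMem P) s t m ∧ Q s

end RandomPoints

namespace RealRAM

open scoped ENNReal

/-! ### Memory access -/

/-! Let ℓ be the binary length of n and choose J with 2^(-J) of order ℓ/n. On each level i ≤ J the
unit square is cut into cells of width 2^(-i) and height 2^(-(J-i)), so all cells have area 2^(-J).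
With high probability every cell has O(ℓ) points, and every dyadic box of width 2^(-(i+2)) and
height 2^(-(J-i+1)) has at least one (`law_not_typical_le`). For a query, take the level with the
narrowest columns that are still at least as wide as the rectangle. If the rectangle is taller than
a cell of that level, it contains one of those boxes and the answer is yes. Otherwise it meets at
most two columns and two rows, and four cells have to be inspected (`runs_level`).

Inside a cell the sides of the rectangle are replaced by their ranks among the points of the cell.
For each prefix of the list sorted by abscissa a word is stored whose bits are the positions of
these points in the list sorted by ordinate. The difference of two such words describes the points
in the horizontal range, and one `mod` and one `div` by powers of two decide whether some bit lies
in the vertical range (`mask_test`, `maskSum_test`, `cell_test`). These words have O(ℓ) bits, which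
is why the word length is a large multiple of ℓ.

It remains to find ranks in constant time. A coordinate is rounded to a key of b = ℓ/4 bits relative
to its cell. With high probability fewer than a constant t points of a cell share a key, so a search
among the keys gives the rank up to 2t, and real comparisons finish (`find_rank`, `runs_rank`). The
keys are searched blindly, as in a compressed trie: the heights at which consecutive sorted keys
branch determine where the descent of a word q ends, without access to the keys (`cand_spec`).
Comparing q with the key found there gives the height where q leaves the trie; a second descent,
with the bits of q below that height set to all zeros or all ones, gives the position of q
(`search_spec`). The lists are divided into blocks of order √ℓ keys with one top node of block heads
(`find_spec`). The branching heights of a node form a code of O(√ℓ log ℓ) bits, so all results can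
be tabulated by code and q in a table of at most n entries.

The construction fills tables by recursion, sorts by buckets, and appends each of the (J+1)n pairs
of a level and a point to its cell in sorted order, at constant cost per pair. This takes O(nℓ) time
and space on typical inputs. To obtain the same bound on all inputs, the program is run with a fuel
counter and reduced array indices: it always halts within the bound (`Cmd.guard_halts`), and on
typical inputs it does the same as before (`Cmd.guard_sim`). The query program has no loop, so it
takes constant time in every memory. Inputs of bounded size are not preprocessed but scanned. The
bound O(nℓ) is stronger than the required one, up to constants. -/

@[simp] theorem Mem.setVar_arr (s : Mem) (τ : Ty) (x : ℕ) (v : τ.Val) :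
    (s.setVar τ x v).arr = s.arr := rfl

@[simp] theorem Mem.setArr_var (s : Mem) (τ : Ty) (a i : ℕ) (v : τ.Val) :
    (s.setArr τ a i v).var = s.var := rfl

@[simp] theorem Mem.setVar_var_same (s : Mem) (τ : Ty) (x y : ℕ) (v : τ.Val) :
    (s.setVar τ x v).var τ y = if y = x then v else s.var τ y := by
  simp [Mem.setVar, Function.update_apply]

@[simp] theorem Mem.setVar_real_var_word (s : Mem) (x : ℕ) (v : ℝ) :
    (s.setVar .real x v).var .word = s.var .word := by
  simp [Mem.setVar]

@[simp] theorem Mem.setVar_word_var_real (s : Mem) (x : ℕ) (v : ℕ) :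
    (s.setVar .word x v).var .real = s.var .real := by
  simp [Mem.setVar]

@[simp] theorem Mem.setArr_arr_same (s : Mem) (τ : Ty) (a b i : ℕ) (v : τ.Val) :
    (s.setArr τ a i v).arr τ b = if b = a then Function.update (s.arr τ a) i v else s.arr τ b := by
  simp only [Mem.setArr, Function.update_self, Function.update_apply]

@[simp] theorem Mem.setArr_real_arr_word (s : Mem) (a i : ℕ) (v : ℝ) :
    (s.setArr .real a i v).arr .word = s.arr .word := by
  simp [Mem.setArr]

@[simp] theorem Mem.setArr_word_arr_real (s : Mem) (a i : ℕ) (v : ℕ) :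
    (s.setArr .word a i v).arr .real = s.arr .real := by
  simp [Mem.setArr]

theorem Mem.setVar_var_ne (s : Mem) {τ σ : Ty} {x y : ℕ} (v : τ.Val) (h : ¬(σ = τ ∧ y = x)) :
    (s.setVar τ x v).var σ y = s.var σ y := by
  by_cases hσ : σ = τ
  · subst hσ
    have : y ≠ x := fun h' => h ⟨rfl, h'⟩
    simp [this]
  · simp [Mem.setVar, Function.update_of_ne hσ]

theorem Mem.setArr_arr_ne (s : Mem) {τ σ : Ty} {a b i : ℕ} (v : τ.Val) (h : ¬(σ = τ ∧ b = a)) :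
    (s.setArr τ a i v).arr σ b = s.arr σ b := by
  by_cases hσ : σ = τ
  · subst hσ
    have : b ≠ a := fun h' => h ⟨rfl, h'⟩
    simp [this]
  · simp [Mem.setArr, Function.update_of_ne hσ]

/-- The content of a word register. -/
def Mem.wv (s : Mem) (x : ℕ) : ℕ := s.var .word x

/-- The content of a real register. -/
def Mem.rv (s : Mem) (x : ℕ) : ℝ := s.var .real x

/-- The content of a word array. -/
def Mem.wa (s : Mem) (a : ℕ) : ℕ → ℕ := s.arr .word a

/-- The content of a real array. -/
def Mem.ra (s : Mem) (a : ℕ) : ℕ → ℝ := s.arr .real a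

/-- The value of a word expression. -/
noncomputable def Expr.evalW (w : ℕ) (s : Mem) (e : Expr .word) : ℕ := e.eval w s

/-- The value of a real expression. -/
noncomputable def Expr.evalR (w : ℕ) (s : Mem) (e : Expr .real) : ℝ := e.eval w s

section
variable (s : Mem) (w x y a b i : ℕ)

@[simp] theorem Mem.wv_setVar_word (v : ℕ) :
    (s.setVar .word x v).wv y = if y = x then v else s.wv y := Mem.setVar_var_same ..
@[simp] theorem Mem.rv_setVar_real (v : ℝ) :
    (s.setVar .real x v).rv y = if y = x then v else s.rv y := Mem.setVar_var_same ..
@[simp] theorem Mem.wv_setVar_real (v : ℝ) : (s.setVar .real x v).wv y = s.wv y :=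
  congrFun (Mem.setVar_real_var_word ..) y
@[simp] theorem Mem.rv_setVar_word (v : ℕ) : (s.setVar .word x v).rv y = s.rv y :=
  congrFun (Mem.setVar_word_var_real ..) y
@[simp] theorem Mem.wa_setVar (τ : Ty) (v : τ.Val) : (s.setVar τ x v).wa a = s.wa a := rfl
@[simp] theorem Mem.ra_setVar (τ : Ty) (v : τ.Val) : (s.setVar τ x v).ra a = s.ra a := rfl
@[simp] theorem Mem.wv_setArr (τ : Ty) (v : τ.Val) : (s.setArr τ a i v).wv x = s.wv x := rfl
@[simp] theorem Mem.rv_setArr (τ : Ty) (v : τ.Val) : (s.setArr τ a i v).rv x = s.rv x := rfl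
@[simp] theorem Mem.wa_setArr_word (v : ℕ) :
    (s.setArr .word a i v).wa b = if b = a then Function.update (s.wa a) i v else s.wa b :=
  Mem.setArr_arr_same ..
@[simp] theorem Mem.ra_setArr_real (v : ℝ) :
    (s.setArr .real a i v).ra b = if b = a then Function.update (s.ra a) i v else s.ra b :=
  Mem.setArr_arr_same ..
@[simp] theorem Mem.wa_setArr_real (v : ℝ) : (s.setArr .real a i v).wa b = s.wa b :=
  congrFun (Mem.setArr_real_arr_word ..) b
@[simp] theorem Mem.ra_setArr_word (v : ℕ) : (s.setArr .word a i v).ra b = s.ra b :=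
  congrFun (Mem.setArr_word_arr_real ..) b

@[simp] theorem Expr.evalW_lit (k : ℕ) : (Expr.lit k).evalW w s = k % 2 ^ w := rfl
@[simp] theorem Expr.evalW_var : (Expr.var .word x).evalW w s = s.wv x := rfl
@[simp] theorem Expr.evalR_var : (Expr.var .real x).evalR w s = s.rv x := rfl
@[simp] theorem Expr.evalW_get (e : Expr .word) :
    (Expr.get .word a e).evalW w s = s.wa a (e.evalW w s) := rfl
@[simp] theorem Expr.evalR_get (e : Expr .word) :
    (Expr.get .real a e).evalR w s = s.ra a (e.evalW w s) := rfl
@[simp] theorem Expr.evalW_wordOp (o : WordOp) (e f : Expr .word) :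
    (Expr.wordOp o e f).evalW w s = o.eval w (e.evalW w s) (f.evalW w s) := rfl
@[simp] theorem Expr.evalR_realOp (o : RealOp) (e f : Expr .real) :
    (Expr.realOp o e f).evalR w s = o.eval (e.evalR w s) (f.evalR w s) := rfl
open Classical in
@[simp] theorem Expr.evalW_realLt (e f : Expr .real) :
    (Expr.realLt e f).evalW w s = if e.evalR w s < f.evalR w s then 1 % 2 ^ w else 0 := rfl
@[simp] theorem Expr.evalR_cast (e : Expr .word) :
    (Expr.cast e).evalR w s = (e.evalW w s : ℝ) := rfl
@[simp] theorem Expr.evalW_floor (e : Expr .real) :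
    (Expr.floor e).evalW w s = min ⌊e.evalR w s⌋₊ (2 ^ w - 1) := rfl
end

/-! ### Loop-free programs -/

/-- The program contains no loop. -/
def Cmd.loopFree : Cmd → Bool
  | .skip => true
  | .set _ _ _ => true
  | .put _ _ _ _ => true
  | .seq c d => c.loopFree && d.loopFree
  | .cond _ c d => c.loopFree && d.loopFree
  | .loop _ _ => false

/-- An upper bound for the running time of a program in which every loop makes one round. -/
def Cmd.maxTime : Cmd → ℕ
  | .skip => 1
  | .set _ _ e => e.cost + 1
  | .put _ _ i e => i.cost + e.cost + 1
  | .seq c d => c.maxTime + d.maxTime + 1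
  | .cond b c d => b.cost + max c.maxTime d.maxTime + 1
  | .loop b c => b.cost + c.maxTime + 1

/-- The source of constant query time: the bound depends on the program text alone, so it holds also
in memories where the data structure is meaningless. -/
theorem Cmd.exists_exec_of_loopFree (w : ℕ) : ∀ (c : Cmd), c.loopFree = true → ∀ s,
    ∃ s' t m, Exec w c s s' t m ∧ t ≤ c.maxTime := by
  intro c
  induction c with
  | skip => exact fun _ s => ⟨s, 1, 0, .skip s, le_rfl⟩
  | set τ x e => exact fun _ s => ⟨_, _, _, .set s τ x e, le_rfl⟩
  | put τ a i e => exact fun _ s => ⟨_, _, _, .put s τ a i e, le_rfl⟩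
  | seq c d ihc ihd =>
    intro h s
    simp only [Cmd.loopFree, Bool.and_eq_true] at h
    obtain ⟨s', t, m, h1, ht⟩ := ihc h.1 s
    obtain ⟨s'', t', m', h2, ht'⟩ := ihd h.2 s'
    exact ⟨_, _, _, .seq h1 h2, by simp only [Cmd.maxTime]; omega⟩
  | cond b c d ihc ihd =>
    intro h s
    simp only [Cmd.loopFree, Bool.and_eq_true] at h
    by_cases hb : b.eval w s = (0 : ℕ)
    · obtain ⟨s', t, m, h1, ht⟩ := ihd h.2 s
      exact ⟨_, _, _, .condFalse hb h1, by simp only [Cmd.maxTime]; omega⟩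
    · obtain ⟨s', t, m, h1, ht⟩ := ihc h.1 s
      exact ⟨_, _, _, .condTrue hb h1, by simp only [Cmd.maxTime]; omega⟩
  | loop b c => intro h; simp [Cmd.loopFree] at h

theorem Exec.time_le_maxTime {w : ℕ} {c : Cmd} {s s' : Mem} {t m : ℕ} (h : Exec w c s s' t m)
    (hc : c.loopFree = true) : t ≤ c.maxTime := by
  obtain ⟨s₁, t₁, m₁, h₁, ht⟩ := c.exists_exec_of_loopFree w hc s
  obtain ⟨-, rfl, -⟩ := h.deterministic h₁
  exact ht

/-! ### Cells that a program leaves unchanged -/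

/-- The program may write to register `x`. -/
def Cmd.writesVar (τ : Ty) (x : ℕ) : Cmd → Bool
  | .skip => false
  | .set σ y _ => decide (τ = σ) && decide (x = y)
  | .put _ _ _ _ => false
  | .seq c d => c.writesVar τ x || d.writesVar τ x
  | .cond _ c d => c.writesVar τ x || d.writesVar τ x
  | .loop _ c => c.writesVar τ x

/-- The program may write to array `a`. -/
def Cmd.writesArr (τ : Ty) (a : ℕ) : Cmd → Bool
  | .skip => false
  | .set _ _ _ => false
  | .put σ b _ _ => decide (τ = σ) && decide (a = b)
  | .seq c d => c.writesArr τ a || d.writesArr τ a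
  | .cond _ c d => c.writesArr τ a || d.writesArr τ a
  | .loop _ c => c.writesArr τ a

/-- Preservation is read off the program text, so for a concrete program the hypothesis is closed by
`rfl`. All later frame arguments rest on this and on `Exec.arr_eq`. -/
theorem Exec.var_eq {w : ℕ} {c : Cmd} {s s' : Mem} {t m : ℕ} (h : Exec w c s s' t m) {τ : Ty}
    {x : ℕ} (hx : c.writesVar τ x = false) : s'.var τ x = s.var τ x := by
  induction h with
  | skip s => rfl
  | set s σ y e =>
    refine Mem.setVar_var_ne _ _ fun h => ?_
    simp [Cmd.writesVar, h.1, h.2] at hx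
  | put s σ a i e => rfl
  | seq _ _ ih ih' =>
    simp only [Cmd.writesVar, Bool.or_eq_false_iff] at hx
    rw [ih' hx.2, ih hx.1]
  | condTrue _ _ ih =>
    simp only [Cmd.writesVar, Bool.or_eq_false_iff] at hx
    exact ih hx.1
  | condFalse _ _ ih =>
    simp only [Cmd.writesVar, Bool.or_eq_false_iff] at hx
    exact ih hx.2
  | loopTrue _ _ _ ih ih' => rw [ih' hx, ih hx]
  | loopFalse _ => rfl

theorem Exec.arr_eq {w : ℕ} {c : Cmd} {s s' : Mem} {t m : ℕ} (h : Exec w c s s' t m) {τ : Ty}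
    {a : ℕ} (ha : c.writesArr τ a = false) : s'.arr τ a = s.arr τ a := by
  induction h with
  | skip s => rfl
  | set s σ y e => rfl
  | put s σ b i e =>
    refine Mem.setArr_arr_ne _ _ fun h => ?_
    simp [Cmd.writesArr, h.1, h.2] at ha
  | seq _ _ ih ih' =>
    simp only [Cmd.writesArr, Bool.or_eq_false_iff] at ha
    rw [ih' ha.2, ih ha.1]
  | condTrue _ _ ih =>
    simp only [Cmd.writesArr, Bool.or_eq_false_iff] at ha
    exact ih ha.1
  | condFalse _ _ ih =>
    simp only [Cmd.writesArr, Bool.or_eq_false_iff] at ha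
    exact ih ha.2
  | loopTrue _ _ _ ih ih' => rw [ih' ha, ih ha]
  | loopFalse _ => rfl

/-! ### Bounding the time and the space of an arbitrary program

`c.guard f k` behaves as `c` as long as the number of steps is at most the content of register `f`
and the array indices are below the content of register `k`, and it always halts. -/

/-- Reduce every array index modulo register `k`. -/
def Expr.guard (k : ℕ) : {τ : Ty} → Expr τ → Expr τ
  | _, .lit j => .lit j
  | _, .var τ x => .var τ x
  | _, .get τ a i => .get τ a (.wordOp .mod (i.guard k) (.var .word k))
  | _, .wordOp o e e' => .wordOp o (e.guard k) (e'.guard k)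
  | _, .realOp o e e' => .realOp o (e.guard k) (e'.guard k)
  | _, .realLt e e' => .realLt (e.guard k) (e'.guard k)
  | _, .cast e => .cast (e.guard k)
  | _, .floor e => .floor (e.guard k)

/-- Reduce every array index modulo register `k`, and allow as many iterations of loops as
register `f` says. -/
def Cmd.guard (f k : ℕ) : Cmd → Cmd
  | .skip => .skip
  | .set τ x e => .set τ x (e.guard k)
  | .put τ a i e => .put τ a (.wordOp .mod (i.guard k) (.var .word k)) (e.guard k)
  | .seq c d => .seq (c.guard f k) (d.guard f k)
  | .cond b c d => .cond (b.guard k) (c.guard f k) (d.guard f k)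
  | .loop b c =>
      .loop (.wordOp .mul (.wordOp .lt (.lit 0) (.var .word f))
          (.wordOp .lt (.lit 0) (b.guard k)))
        (.seq (.set .word f (.wordOp .sub (.var .word f) (.lit 1))) (c.guard f k))

/-- All word registers in the expression have numbers below `N`. -/
def Expr.varsBelow (N : ℕ) : {τ : Ty} → Expr τ → Bool
  | _, .lit _ => true
  | _, .var .word x => decide (x < N)
  | _, .var .real _ => true
  | _, .get _ _ i => i.varsBelow N
  | _, .wordOp _ e e' => e.varsBelow N && e'.varsBelow N
  | _, .realOp _ e e' => e.varsBelow N && e'.varsBelow N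
  | _, .realLt e e' => e.varsBelow N && e'.varsBelow N
  | _, .cast e => e.varsBelow N
  | _, .floor e => e.varsBelow N

/-- All word registers in the program have numbers below `N`. -/
def Cmd.varsBelow (N : ℕ) : Cmd → Bool
  | .skip => true
  | .set .word x e => decide (x < N) && e.varsBelow N
  | .set .real _ e => e.varsBelow N
  | .put _ _ i e => i.varsBelow N && e.varsBelow N
  | .seq c d => c.varsBelow N && d.varsBelow N
  | .cond b c d => b.varsBelow N && (c.varsBelow N && d.varsBelow N)
  | .loop b c => b.varsBelow N && c.varsBelow N

/-- Positivity of the register matters: reduction modulo zero would leave the index as it is. -/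
theorem Expr.space_guard_le (w k : ℕ) (s : Mem) (hk : 0 < s.wv k) :
    ∀ {τ : Ty} (e : Expr τ), (e.guard k).space w s ≤ s.wv k := by
  intro τ e
  induction e with
  | lit j => simp [Expr.guard, Expr.space]
  | var τ x => simp [Expr.guard, Expr.space]
  | get τ a i ih =>
    simp only [Expr.guard, Expr.space, Expr.eval, WordOp.eval]
    exact max_le (max_le ih (Nat.zero_le _)) (Nat.mod_lt _ hk)
  | wordOp o e e' ih ih' => exact max_le ih ih'
  | realOp o e e' ih ih' => exact max_le ih ih'
  | realLt e e' ih ih' => exact max_le ih ih'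
  | cast e ih => exact ih
  | floor e ih => exact ih

/-- An amortized bound with the fuel register as potential. Each round of any loop, nested or not,
pays one unit, and between two payments only a bounded number of steps (depending on the text) can
occur. The final fuel appears on the left so that the bounds of consecutive programs can be added.
The registers `f` and `k` must not be written by the program itself. -/
theorem Cmd.guard_halts {f k : ℕ} (hfk : f ≠ k) : ∀ c : Cmd,
    c.writesVar .word f = false → c.writesVar .word k = false →
    ∃ K : ℕ, ∀ w, 1 ≤ w → ∀ s : Mem, 0 < s.wv k → ∃ s' t m, Exec w (c.guard f k) s s' t m ∧
      m ≤ s.wv k ∧ s'.wv k = s.wv k ∧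
      s'.wv f ≤ s.wv f ∧
      t + K * s'.wv f ≤ K * (s.wv f + 1) := by
  intro c
  induction c with
  | skip =>
    intro _ _
    exact ⟨1, fun w hw s hs => ⟨s, 1, 0, .skip s, Nat.zero_le _, rfl, le_rfl, by omega⟩⟩
  | set τ x e =>
    intro hf hk
    refine ⟨(e.guard k).cost + 1, fun w hw s hs => ⟨_, _, _, .set s τ x _,
      Expr.space_guard_le w k s hs e, ?_⟩⟩
    have ef := (Exec.set (w := w) s τ x (e.guard k)).var_eq (τ := .word) (x := f) hf
    have ek := (Exec.set (w := w) s τ x (e.guard k)).var_eq (τ := .word) (x := k) hk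
    refine ⟨ek, ef.le, ?_⟩
    rw [show Mem.wv _ _ = s.wv f from ef]
    exact le_of_eq (by ring)
  | put τ a i e =>
    intro hf hk
    refine ⟨(Expr.wordOp .mod (i.guard k) (.var .word k)).cost + (e.guard k).cost + 1,
      fun w hw s hs => ⟨_, _, _, .put s τ a _ _, ?_, rfl, le_rfl, le_of_eq ?_⟩⟩
    rotate_left
    · rw [mul_add, mul_one, add_comm]; rfl
    · refine max_le (max_le ?_ (Expr.space_guard_le w k s hs e)) (Nat.mod_lt _ hs)
      exact max_le (Expr.space_guard_le w k s hs i) (Nat.zero_le _)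
  | seq c d ihc ihd =>
    intro hf hk
    simp only [Cmd.writesVar, Bool.or_eq_false_iff] at hf hk
    obtain ⟨K₁, h₁⟩ := ihc hf.1 hk.1
    obtain ⟨K₂, h₂⟩ := ihd hf.2 hk.2
    refine ⟨K₁ + K₂ + 1, fun w hw s hs => ?_⟩
    obtain ⟨s₁, t₁, m₁, e₁, a₁, b₁, c₁, d₁⟩ := h₁ w hw s hs
    obtain ⟨s₂, t₂, m₂, e₂, a₂, b₂, c₂, d₂⟩ := h₂ w hw s₁ (b₁ ▸ hs)
    refine ⟨s₂, _, _, .seq e₁ e₂, max_le a₁ (b₁ ▸ a₂), b₂.trans b₁, c₂.trans c₁, ?_⟩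
    generalize s.wv f = F at *
    generalize s₁.wv f = F₁ at *
    generalize s₂.wv f = F₂ at *
    obtain ⟨x, rfl⟩ := Nat.exists_eq_add_of_le c₂
    obtain ⟨y, rfl⟩ := Nat.exists_eq_add_of_le c₁
    nlinarith [Nat.zero_le (K₁ * x), Nat.zero_le (K₂ * y)]
  | cond b c d ihc ihd =>
    intro hf hk
    simp only [Cmd.writesVar, Bool.or_eq_false_iff] at hf hk
    obtain ⟨K₁, h₁⟩ := ihc hf.1 hk.1
    obtain ⟨K₂, h₂⟩ := ihd hf.2 hk.2
    refine ⟨K₁ + K₂ + (b.guard k).cost + 1, fun w hw s hs => ?_⟩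
    by_cases hb : (b.guard k).eval w s = (0 : ℕ)
    · obtain ⟨s₂, t₂, m₂, e₂, a₂, b₂, c₂, d₂⟩ := h₂ w hw s hs
      refine ⟨s₂, _, _, .condFalse hb e₂, max_le (Expr.space_guard_le w k s hs b) a₂, b₂, c₂, ?_⟩
      generalize s.wv f = F at *
      generalize s₂.wv f = F₂ at *
      obtain ⟨x, rfl⟩ := Nat.exists_eq_add_of_le c₂
      nlinarith [Nat.zero_le (K₁ * x), Nat.zero_le ((b.guard k).cost * x)]
    · obtain ⟨s₁, t₁, m₁, e₁, a₁, b₁, c₁, d₁⟩ := h₁ w hw s hs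
      refine ⟨s₁, _, _, .condTrue hb e₁, max_le (Expr.space_guard_le w k s hs b) a₁, b₁, c₁, ?_⟩
      generalize s.wv f = F at *
      generalize s₁.wv f = F₁ at *
      obtain ⟨x, rfl⟩ := Nat.exists_eq_add_of_le c₁
      nlinarith [Nat.zero_le (K₂ * x), Nat.zero_le ((b.guard k).cost * x)]
  | loop b c ih =>
    intro hf hk
    simp only [Cmd.writesVar] at hf hk
    obtain ⟨K₁, h₁⟩ := ih hf hk
    -- The product of two comparisons with values 0 and 1 serves as a conjunction and cannot
    -- overflow.
    set B : Expr .word := .wordOp .mul (.wordOp .lt (.lit 0) (.var .word f))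
          (.wordOp .lt (.lit 0) (b.guard k)) with hB
    refine ⟨K₁ + B.cost + 10, fun w hw s hs => ?_⟩
    have h1w : 1 % 2 ^ w = 1 := Nat.mod_eq_of_lt (Nat.one_lt_two_pow (by omega))
    obtain ⟨F, hF⟩ : ∃ F, s.wv f = F := ⟨_, rfl⟩
    have hsp : ∀ s : Mem, 0 < s.wv k → B.space w s ≤ s.wv k := by
      intro s hs
      simp only [hB, Expr.space]
      exact max_le (by simp) (max_le (Nat.zero_le _) (Expr.space_guard_le w k s hs b))
    induction F using Nat.strong_induction_on generalizing s with
    | _ F IH =>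
      by_cases hb : B.eval w s = (0 : ℕ)
      · refine ⟨s, _, _, .loopFalse hb, hsp s hs, rfl, le_rfl, ?_⟩
        rw [hF]
        nlinarith
      · have hF0 : F ≠ 0 := by
          rintro rfl
          apply hb
          change B.evalW w s = 0
          simp [hB, WordOp.eval, hF]
        let s₀ := s.setVar .word f (F - 1 : ℕ)
        have hset : Exec w (.set .word f (.wordOp .sub (.var .word f) (.lit 1))) s s₀ 4 0 := by
          have := Exec.set (w := w) s .word f (.wordOp .sub (.var .word f) (.lit 1))
          have e : Expr.eval w s (.wordOp .sub (.var .word f) (.lit 1)) = (F - 1 : ℕ) := by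
            change Expr.evalW w s _ = _
            simp [WordOp.eval, h1w, hF]
          rw [e] at this
          exact this
        have hk0 : s₀.wv k = s.wv k := by simp [s₀, hfk.symm]
        have hf0 : s₀.wv f = (F - 1 : ℕ) := by simp [s₀]
        obtain ⟨s₁, t₁, m₁, e₁, a₁, b₁, c₁, d₁⟩ := h₁ w hw s₀ (hk0 ▸ hs)
        rw [hf0] at c₁ d₁
        obtain ⟨s₂, t₂, m₂, e₂, a₂, b₂, c₂, d₂⟩ := IH (s₁.wv f) (by omega) s₁
          (by rw [b₁, hk0]; exact hs) rfl
        refine ⟨s₂, _, _, .loopTrue hb (.seq hset e₁) e₂, ?_, ?_, ?_, ?_⟩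
        · rw [b₁, hk0] at a₂
          rw [hk0] at a₁
          exact max_le (hsp s hs) (max_le (max_le (Nat.zero_le _) a₁) a₂)
        · rw [b₂, b₁, hk0]
        · rw [hF]; omega
        · rw [hF]
          generalize s₁.wv f = F₁ at *
          generalize s₂.wv f = F₂ at *
          obtain ⟨x, rfl⟩ := Nat.exists_eq_add_of_le c₂
          obtain ⟨y, hy⟩ := Nat.exists_eq_add_of_le c₁
          obtain rfl : F = F₂ + x + y + 1 := by omega
          have : F₂ + x + y + 1 - 1 = F₂ + x + y := by omega
          rw [this] at d₁
          nlinarith [Nat.zero_le (B.cost * y)]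

/-- `s'` is `s` up to the registers `f` and `k`. -/
def Mem.Agree (f k : ℕ) (s s' : Mem) : Prop :=
  s'.arr = s.arr ∧ s'.var .real = s.var .real ∧
    ∀ x, x ≠ f → x ≠ k → s'.var .word x = s.var .word x

/-- Reduction modulo register `k` is the identity on indices that are small enough. The expression
itself cannot see `f` and `k`, since their numbers are at least `N`. -/
theorem Expr.eval_guard {w f k N : ℕ} {s s' : Mem} (h : Mem.Agree f k s s') (hf : N ≤ f)
    (hk : N ≤ k) : ∀ {τ : Ty} (e : Expr τ), e.varsBelow N = true →
    e.space w s ≤ s'.wv k → (e.guard k).eval w s' = e.eval w s := by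
  intro τ e
  induction e with
  | lit j => intros; rfl
  | var τ x =>
    intro hb _
    cases τ with
    | word =>
      simp only [Expr.varsBelow, decide_eq_true_eq] at hb
      exact h.2.2 x (by omega) (by omega)
    | real => exact congrFun h.2.1 x
  | get τ a i ih =>
    intro hb hs
    simp only [Expr.varsBelow] at hb
    simp only [Expr.space, max_le_iff] at hs
    simp only [Expr.guard, Expr.eval, WordOp.eval]
    have e : (i.eval w s : ℕ) % s'.wv k = i.eval w s := Nat.mod_eq_of_lt hs.2
    rw [ih hb hs.1, show s'.var .word k = s'.wv k from rfl, e, h.1]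
  | wordOp o e e' ih ih' =>
    intro hb hs
    simp only [Expr.varsBelow, Bool.and_eq_true] at hb
    simp only [Expr.space, max_le_iff] at hs
    simp only [Expr.guard, Expr.eval]
    rw [ih hb.1 hs.1, ih' hb.2 hs.2]
  | realOp o e e' ih ih' =>
    intro hb hs
    simp only [Expr.varsBelow, Bool.and_eq_true] at hb
    simp only [Expr.space, max_le_iff] at hs
    simp only [Expr.guard, Expr.eval]
    rw [ih hb.1 hs.1, ih' hb.2 hs.2]
  | realLt e e' ih ih' =>
    intro hb hs
    simp only [Expr.varsBelow, Bool.and_eq_true] at hb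
    simp only [Expr.space, max_le_iff] at hs
    simp only [Expr.guard, Expr.eval]
    rw [ih hb.1 hs.1, ih' hb.2 hs.2]
  | cast e ih =>
    intro hb hs
    simp only [Expr.guard, Expr.eval]
    rw [ih hb hs]
  | floor e ih =>
    intro hb hs
    simp only [Expr.guard, Expr.eval]
    rw [ih hb hs]

/-- A loop round costs at least one step, so fuel equal to the running time of the original is never
exhausted. The last conclusion, that fuel decreases by at most the elapsed time, is what carries the
induction through sequences and loops. -/
theorem Cmd.guard_sim {w f k N : ℕ} (hw : 1 ≤ w) (hfk : f ≠ k) (hf : N ≤ f) (hk : N ≤ k)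
    {c : Cmd} {s s' : Mem} {t m : ℕ} (h : Exec w c s s' t m) : c.varsBelow N = true →
    ∀ r : Mem, Mem.Agree f k s r → m ≤ r.wv k → t ≤ r.wv f →
      ∃ r' t' m', Exec w (c.guard f k) r r' t' m' ∧ Mem.Agree f k s' r' ∧
        r'.wv k = r.wv k ∧ r.wv f ≤ r'.wv f + t := by
  have h1w : 1 % 2 ^ w = 1 := Nat.mod_eq_of_lt (Nat.one_lt_two_pow (by omega))
  induction h with
  | skip s => exact fun _ r hr _ _ => ⟨r, _, _, .skip r, hr, rfl, by omega⟩
  | set s τ x e =>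
    intro hb r hr hm ht
    have key : e.varsBelow N = true ∧ (τ = .word → x < N) := by
      cases τ with
      | word => simpa [Cmd.varsBelow, and_comm] using hb
      | real => simpa [Cmd.varsBelow] using hb
    refine ⟨_, _, _, .set r τ x _, ?_, ?_, ?_⟩
    · rw [Expr.eval_guard hr hf hk e key.1 hm]
      refine ⟨hr.1, ?_, ?_⟩
      · cases τ with
        | word => simpa using hr.2.1
        | real => funext y; simp [hr.2.1]
      · intro y hy hy'
        cases τ with
        | word => simp [hr.2.2 y hy hy']
        | real => simpa using hr.2.2 y hy hy'
    · refine Mem.setVar_var_ne _ _ fun h => ?_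
      have := key.2 h.1.symm
      omega
    · refine le_trans (le_of_eq (Eq.symm ?_)) (Nat.le_add_right _ _)
      refine Mem.setVar_var_ne _ _ fun h => ?_
      have := key.2 h.1.symm
      omega
  | put s τ a i e =>
    intro hb r hr hm ht
    simp only [Cmd.varsBelow, Bool.and_eq_true] at hb
    simp only [max_le_iff] at hm
    refine ⟨_, _, _, .put r τ a _ _, ?_, rfl, Nat.le_add_right _ _⟩
    rw [Expr.eval_guard hr hf hk e hb.2 hm.1.2]
    have : Expr.eval w r (.wordOp .mod (i.guard k) (.var .word k)) = i.eval w s := by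
      simp only [Expr.eval, WordOp.eval]
      rw [Expr.eval_guard hr hf hk i hb.1 hm.1.1]
      exact Nat.mod_eq_of_lt hm.2
    rw [this]
    refine ⟨?_, hr.2.1, hr.2.2⟩
    simp only [Mem.setArr, hr.1]
  | seq h₁ h₂ ih₁ ih₂ =>
    intro hb r hr hm ht
    simp only [Cmd.varsBelow, Bool.and_eq_true] at hb
    simp only [max_le_iff] at hm
    obtain ⟨r₁, t₁, m₁, e₁, a₁, b₁, c₁⟩ := ih₁ hb.1 r hr hm.1 (by omega)
    obtain ⟨r₂, t₂, m₂, e₂, a₂, b₂, c₂⟩ := ih₂ hb.2 r₁ a₁ (b₁ ▸ hm.2) (by omega)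
    exact ⟨r₂, _, _, .seq e₁ e₂, a₂, b₂.trans b₁, by omega⟩
  | condTrue hb₀ h ih =>
    intro hb r hr hm ht
    simp only [Cmd.varsBelow, Bool.and_eq_true] at hb
    simp only [max_le_iff] at hm
    obtain ⟨r₁, t₁, m₁, e₁, a₁, b₁, c₁⟩ := ih hb.2.1 r hr hm.2 (by omega)
    refine ⟨r₁, _, _, .condTrue ?_ e₁, a₁, b₁, by omega⟩
    rwa [Expr.eval_guard hr hf hk _ hb.1 hm.1]
  | condFalse hb₀ h ih =>
    intro hb r hr hm ht
    simp only [Cmd.varsBelow, Bool.and_eq_true] at hb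
    simp only [max_le_iff] at hm
    obtain ⟨r₁, t₁, m₁, e₁, a₁, b₁, c₁⟩ := ih hb.2.2 r hr hm.2 (by omega)
    refine ⟨r₁, _, _, .condFalse ?_ e₁, a₁, b₁, by omega⟩
    rwa [Expr.eval_guard hr hf hk _ hb.1 hm.1]
  | @loopTrue b c s s₁ s₂ t₁ t₂ m₁ m₂ hb₀ h₁ h₂ ih₁ ih₂ =>
    intro hb r hr hm ht
    have hb' := hb
    simp only [Cmd.varsBelow, Bool.and_eq_true] at hb
    simp only [max_le_iff] at hm
    obtain ⟨F, hF⟩ : ∃ F : ℕ, r.wv f = F := ⟨_, rfl⟩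
    rw [hF] at ht ⊢
    let r₀ := r.setVar .word f (F - 1 : ℕ)
    have hset : Exec w (.set .word f (.wordOp .sub (.var .word f) (.lit 1))) r r₀ 4 0 := by
      have := Exec.set (w := w) r .word f (.wordOp .sub (.var .word f) (.lit 1))
      have e : Expr.eval w r (.wordOp .sub (.var .word f) (.lit 1)) = (F - 1 : ℕ) := by
        change Expr.evalW w r _ = _
        simp [WordOp.eval, h1w, hF]
      rw [e] at this
      exact this
    have hk0 : r₀.wv k = r.wv k := by simp [r₀, hfk.symm]
    have hf0 : r₀.wv f = (F - 1 : ℕ) := by simp [r₀]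
    have hr0 : Mem.Agree f k s r₀ :=
      ⟨hr.1, by simpa [r₀] using hr.2.1, fun x hx hx' => by simp [r₀, hx, hr.2.2 x hx hx']⟩
    obtain ⟨q₁, u₁, v₁, e₁, a₁, b₁, c₁⟩ := ih₁ hb.2 r₀ hr0 (hk0 ▸ hm.2.1) (by rw [hf0]; omega)
    rw [hf0] at c₁
    obtain ⟨q₂, u₂, v₂, e₂, a₂, b₂, c₂⟩ := ih₂ hb' q₁ a₁ (by rw [b₁, hk0]; exact hm.2.2) (by omega)
    refine ⟨q₂, _, _, .loopTrue ?_ (.seq hset e₁) e₂, a₂, by rw [b₂, b₁, hk0], by omega⟩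
    have h1 : 0 < F := by omega
    have h2 : 0 < b.evalW w s := Nat.pos_of_ne_zero hb₀
    have h3 : (b.guard k).evalW w r = b.evalW w s := Expr.eval_guard hr hf hk _ hb.1 hm.1
    change Expr.evalW w r _ ≠ 0
    simp [WordOp.eval, h1, h2, h3, hF, h1w]
  | @loopFalse b c s hb₀ =>
    intro hb r hr hm ht
    simp only [Cmd.varsBelow, Bool.and_eq_true] at hb
    refine ⟨r, _, _, .loopFalse ?_, hr, rfl, by omega⟩
    have h3 : (b.guard k).evalW w r = 0 := (Expr.eval_guard hr hf hk _ hb.1 hm).trans hb₀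
    change Expr.evalW w r _ = 0
    simp [WordOp.eval, h3]

end RealRAM

namespace BlindSearch

/-! ### Searching a sorted list of words by the positions where consecutive words branch -/

/-- The least `j` such that `u` and `v` agree above the lowest `j` bits. -/
def sep (u v : ℕ) : ℕ := if u = v then 0 else sep (u / 2) (v / 2) + 1
termination_by u + v
decreasing_by omega

/-- `sep u v` is the height of the lowest common ancestor of two leaves of the binary trie. This
equivalence replaces the recursion in nearly all arguments below. -/
theorem sep_le_iff {u v j : ℕ} : sep u v ≤ j ↔ u / 2 ^ j = v / 2 ^ j := by
  induction j generalizing u v with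
  | zero =>
    rw [sep]
    split_ifs with h <;> simp [h]
  | succ j ih =>
    rw [sep]
    split_ifs with h
    · simp [h]
    · rw [Nat.add_le_add_iff_right, ih, Nat.div_div_eq_div_mul, Nat.div_div_eq_div_mul, pow_succ']

theorem sep_le_of_lt {u v b : ℕ} (hu : u < 2 ^ b) (hv : v < 2 ^ b) : sep u v ≤ b := by
  rw [sep_le_iff, Nat.div_eq_of_lt hu, Nat.div_eq_of_lt hv]

/-- The bit of `q` just below height `M`; it is `0` at height `0`. -/
def bitBelow (q M : ℕ) : ℕ := 2 * q / 2 ^ M % 2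

theorem bitBelow_zero (q : ℕ) : bitBelow q 0 = 0 := by simp [bitBelow]

theorem bitBelow_succ (q M : ℕ) : bitBelow q (M + 1) = q / 2 ^ M % 2 := by
  rw [bitBelow, pow_succ', Nat.mul_div_mul_left _ _ (by norm_num)]

theorem bitBelow_eq_zero_or_one (q M : ℕ) : bitBelow q M = 0 ∨ bitBelow q M = 1 :=
  Nat.mod_two_eq_zero_or_one _

theorem bitBelow_congr {q r d M : ℕ} (h : q / 2 ^ d = r / 2 ^ d) (hM : d < M) :
    bitBelow q M = bitBelow r M := by
  obtain ⟨e, rfl⟩ := Nat.exists_eq_add_of_lt hM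
  rw [bitBelow_succ, bitBelow_succ, pow_add, ← Nat.div_div_eq_div_mul, ← Nat.div_div_eq_div_mul, h]

/-- Just below their common ancestor two words go to different children, and the smaller one goes
left. -/
theorem bitBelow_sep {u v : ℕ} (huv : u < v) :
    bitBelow u (sep u v) = 0 ∧ bitBelow v (sep u v) = 1 := by
  obtain ⟨h, hh⟩ : ∃ h, sep u v = h + 1 := by
    refine ⟨sep u v - 1, ?_⟩
    have : sep u v ≠ 0 := by
      intro h0
      have := sep_le_iff.1 h0.le
      simp at this
      omega
    omega
  have h1 : u / 2 ^ (h + 1) = v / 2 ^ (h + 1) := sep_le_iff.1 hh.le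
  have h2 : ¬ u / 2 ^ h = v / 2 ^ h := fun h' => by
    have := sep_le_iff.2 h'
    omega
  have h3 : u / 2 ^ h ≤ v / 2 ^ h := Nat.div_le_div_right huv.le
  rw [hh, bitBelow_succ, bitBelow_succ]
  rw [pow_succ, ← Nat.div_div_eq_div_mul, ← Nat.div_div_eq_div_mul] at h1
  generalize u / 2 ^ h = U at *
  generalize v / 2 ^ h = V at *
  omega

/-- Prefixes of sorted words are sorted, so the outer prefixes of a given length agree exactly when
both neighbouring pairs agree. Hence heights between consecutive words determine the height between
any two words of a sorted list. -/
theorem sep_eq_max {u v x : ℕ} (huv : u ≤ v) (hvx : v ≤ x) :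
    sep u x = max (sep u v) (sep v x) := by
  refine eq_of_forall_ge_iff fun j => ?_
  rw [max_le_iff, sep_le_iff, sep_le_iff, sep_le_iff]
  have h1 : u / 2 ^ j ≤ v / 2 ^ j := Nat.div_le_div_right huv
  have h2 : v / 2 ^ j ≤ x / 2 ^ j := Nat.div_le_div_right hvx
  omega

theorem sep_self (u : ℕ) : sep u u = 0 := by rw [sep]; simp

theorem sep_comm (u v : ℕ) : sep u v = sep v u := by
  refine eq_of_forall_ge_iff fun j => ?_
  rw [sep_le_iff, sep_le_iff, eq_comm]

/-- One step of the search for `q`. The state consists of the candidate, of the height where the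
candidate branches from the last word, and of the number of the last word. -/
def step (q : ℕ) (σ : ℕ × ℕ × ℕ) (h : ℕ) : ℕ × ℕ × ℕ :=
  if bitBelow q (max σ.2.1 h) = 1 then (σ.2.2 + 1, 0, σ.2.2 + 1)
  else (σ.1, max σ.2.1 h, σ.2.2 + 1)

/-- The state of the search for `q` after the branching heights given by the digits of a code in
base `β`. -/
def tab (β q κ : ℕ) : ℕ × ℕ × ℕ :=
  if κ < β ∨ β < 2 then (0, 0, 0) else step q (tab β q (κ / β)) (κ % β)
termination_by κ
decreasing_by
  apply Nat.div_lt_self <;> omega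

/-- The code of the words `s 0, …, s k`. -/
def code (β : ℕ) (s : ℕ → ℕ) : ℕ → ℕ
  | 0 => 1
  | k + 1 => code β s k * β + sep (s k) (s (k + 1))

theorem code_pos {β : ℕ} (hβ : 0 < β) (s : ℕ → ℕ) (k : ℕ) : 0 < code β s k := by
  induction k with
  | zero => simp [code]
  | succ k ih => simp only [code]; positivity

/-- The factor 2 is the price of the leading digit `1`, which makes the code determine the number of
its digits. -/
theorem code_lt {β : ℕ} {s : ℕ → ℕ} {k : ℕ} (h : ∀ i < k, sep (s i) (s (i + 1)) < β) :
    code β s k < 2 * β ^ k := by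
  induction k with
  | zero => simp [code]
  | succ k ih =>
    simp only [code]
    have h1 := ih fun i hi => h i (by omega)
    have h2 := h k (by omega)
    calc code β s k * β + sep (s k) (s (k + 1)) < (code β s k + 1) * β := by rw [add_mul]; omega
      _ ≤ (2 * β ^ k) * β := Nat.mul_le_mul_right _ h1
      _ = 2 * β ^ (k + 1) := by ring

theorem tab_code_succ {β q : ℕ} (hβ : 2 ≤ β) (s : ℕ → ℕ) {k : ℕ}
    (h : sep (s k) (s (k + 1)) < β) :
    tab β q (code β s (k + 1)) = step q (tab β q (code β s k)) (sep (s k) (s (k + 1))) := by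
  have hpos := code_pos (β := β) (by omega) s k
  have h1 : ¬ (code β s k * β + sep (s k) (s (k + 1)) < β ∨ β < 2) := by
    have : β ≤ code β s k * β := Nat.le_mul_of_pos_left β hpos
    omega
  have h2 : (code β s k * β + sep (s k) (s (k + 1))) / β = code β s k := by
    rw [add_comm, Nat.add_mul_div_right _ _ (by omega), Nat.div_eq_of_lt h, zero_add]
  have h3 : (code β s k * β + sep (s k) (s (k + 1))) % β = sep (s k) (s (k + 1)) := by
    rw [add_comm, Nat.add_mul_mod_self_right, Nat.mod_eq_of_lt h]
  rw [code, tab, if_neg h1, h2, h3]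

/-- The result of the search. -/
def cand (β q : ℕ) (s : ℕ → ℕ) (k : ℕ) : ℕ := (tab β q (code β s k)).1

section
variable {β q : ℕ} {s : ℕ → ℕ} {k : ℕ}

theorem monotone_upto (hs : ∀ i < k, s i ≤ s (i + 1)) {i j : ℕ} (hij : i ≤ j) (hj : j ≤ k) :
    s i ≤ s j := by
  induction j, hij using Nat.le_induction with
  | base => exact le_rfl
  | succ j hij ih => exact (ih (by omega)).trans (hs j (by omega))

/-- The invariant behind the definition of `step`: by `sep_eq_max`, the height between the candidate
and the last word can be updated from the next consecutive height alone, so the words themselves are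
never consulted. -/
theorem tab_code (hβ : 2 ≤ β) (hs : ∀ i < k, s i ≤ s (i + 1))
    (hd : ∀ i < k, sep (s i) (s (i + 1)) < β) :
    cand β q s k ≤ k ∧
      tab β q (code β s k) = (cand β q s k, sep (s (cand β q s k)) (s k), k) := by
  induction k with
  | zero =>
    have h : tab β q (code β s 0) = (0, 0, 0) := by
      rw [code, tab, if_pos (by omega)]
    simp [cand, h, sep_self]
  | succ k ih =>
    obtain ⟨h1, h2⟩ := ih (fun i hi => hs i (by omega)) (fun i hi => hd i (by omega))
    have h3 := tab_code_succ (q := q) hβ s (hd k (by omega))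
    have hm : max (sep (s (cand β q s k)) (s k)) (sep (s k) (s (k + 1))) =
        sep (s (cand β q s k)) (s (k + 1)) :=
      (sep_eq_max (monotone_upto (fun i hi => hs i (by omega)) h1 le_rfl) (hs k (by omega))).symm
    rw [h2] at h3
    simp only [step, hm] at h3
    have h4 : cand β q s (k + 1) = (tab β q (code β s (k + 1))).1 := rfl
    rw [h3] at h4
    rw [h3, h4]
    split_ifs with hb
    · simp [sep_self]
    · simp; omega

theorem cand_le (hβ : 2 ≤ β) (hs : ∀ i < k, s i ≤ s (i + 1))
    (hd : ∀ i < k, sep (s i) (s (i + 1)) < β) : cand β q s k ≤ k :=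
  (tab_code hβ hs hd).1

/-- At the branching height the candidate has bit 0 and a larger new word has bit 1. The search
moves to the new word exactly when `q` takes the right child there. -/
theorem cand_succ (hβ : 2 ≤ β) (hs : ∀ i < k + 1, s i ≤ s (i + 1))
    (hd : ∀ i < k + 1, sep (s i) (s (i + 1)) < β) :
    cand β q s (k + 1) =
      if bitBelow q (sep (s (cand β q s k)) (s (k + 1))) = 1 then k + 1 else cand β q s k := by
  have h12 := tab_code (q := q) hβ (fun i (hi : i < k) => hs i (by omega))
    (fun i hi => hd i (by omega))
  have h3 := tab_code_succ (q := q) hβ s (hd k (by omega))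
  have hm : max (sep (s (cand β q s k)) (s k)) (sep (s k) (s (k + 1))) =
      sep (s (cand β q s k)) (s (k + 1)) :=
    (sep_eq_max (monotone_upto (fun i hi => hs i (by omega)) h12.1 le_rfl) (hs k (by omega))).symm
  rw [h12.2] at h3
  simp only [step, hm] at h3
  have h4 : cand β q s (k + 1) = (tab β q (code β s (k + 1))).1 := rfl
  rw [h4, h3]
  split_ifs <;> rfl

/-- If some word agrees with `q` above height `d`, then so does the candidate; it is the first one
if the low bits of `q` are zeros, and a largest one if they are ones. -/
theorem cand_spec (hβ : 2 ≤ β) (hs : ∀ i < k, s i ≤ s (i + 1))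
    (hd : ∀ i < k, sep (s i) (s (i + 1)) < β) {d i : ℕ} (hi : i ≤ k)
    (hq : s i / 2 ^ d = q / 2 ^ d) :
    s (cand β q s k) / 2 ^ d = q / 2 ^ d ∧
    ((∀ M ≤ d, bitBelow q M = 0) → cand β q s k ≤ i) ∧
    ((∀ M ≤ d, 0 < M → bitBelow q M = 1) → s i ≤ s (cand β q s k)) := by
  induction k generalizing i with
  | zero =>
    obtain rfl : i = 0 := by omega
    have : cand β q s 0 = 0 := Nat.le_zero.1 (cand_le hβ hs hd)
    rw [this]
    exact ⟨hq, fun _ => le_rfl, fun _ => le_rfl⟩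
  | succ k ih =>
    have hs' : ∀ i < k, s i ≤ s (i + 1) := fun i hi => hs i (by omega)
    have hd' : ∀ i < k, sep (s i) (s (i + 1)) < β := fun i hi => hd i (by omega)
    have hc := cand_le (q := q) hβ hs' hd'
    have hcs := cand_succ (q := q) hβ hs hd
    have hle : s (cand β q s k) ≤ s (k + 1) := monotone_upto hs (by omega) le_rfl
    set c := cand β q s k with hcdef
    -- The words agreeing with `q` above height `d` are consecutive in the list. The cases are
    -- whether they began before the new word, and if so whether the new word still belongs to them.
    by_cases hex : ∃ j ≤ k, s j / 2 ^ d = q / 2 ^ d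
    · obtain ⟨j, hj, hjq⟩ := hex
      have hcb : s c / 2 ^ d = q / 2 ^ d := (ih hs' hd' hj hjq).1
      by_cases hk : s (k + 1) / 2 ^ d = q / 2 ^ d
      · have hH : sep (s c) (s (k + 1)) ≤ d := sep_le_iff.2 (hcb.trans hk.symm)
        rcases bitBelow_eq_zero_or_one q (sep (s c) (s (k + 1))) with h0 | h1
        · rw [if_neg (by omega)] at hcs
          rw [hcs]
          refine ⟨hcb, fun hz => ?_, fun ho => ?_⟩
          · by_cases hik : i ≤ k
            · exact (ih hs' hd' hik hq).2.1 hz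
            · omega
          -- If the low bits of `q` are ones, a bit 0 is only possible at height 0, where the two
          -- words are equal. This is why the third claim compares words and not positions.
          · have : ¬ 0 < sep (s c) (s (k + 1)) := fun h => by
              have := ho _ hH h
              omega
            have heq : s c = s (k + 1) := by
              have := sep_le_iff.1 (show sep (s c) (s (k + 1)) ≤ 0 by omega)
              simpa using this
            rw [heq]
            exact monotone_upto hs hi le_rfl
        · rw [if_pos h1] at hcs
          rw [hcs]
          refine ⟨hk, fun hz => ?_, fun ho => monotone_upto hs hi le_rfl⟩
          have := hz _ hH
          omega
      · have hne : s c ≠ s (k + 1) := fun h => hk (h ▸ hcb)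
        have hlt : s c < s (k + 1) := lt_of_le_of_ne hle hne
        have hH : d < sep (s c) (s (k + 1)) := by
          by_contra hcon
          exact hk ((sep_le_iff.1 (not_lt.1 hcon)).symm.trans hcb)
        -- The branching is above height `d`, where `q` looks like the candidate; hence it goes left
        -- and the candidate stays.
        have hb : bitBelow q (sep (s c) (s (k + 1))) = 0 := by
          rw [← bitBelow_congr hcb hH]
          exact (bitBelow_sep hlt).1
        rw [if_neg (by omega)] at hcs
        have hik : i ≤ k := by
          by_contra hcon
          obtain rfl : i = k + 1 := by omega
          exact hk hq
        rw [hcs]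
        exact ih hs' hd' hik hq
    · have hik : i = k + 1 := by
        by_contra hcon
        exact hex ⟨i, by omega, hq⟩
      subst hik
      have hcn : s c / 2 ^ d ≠ q / 2 ^ d := fun h => hex ⟨c, hc, h⟩
      have hne : s c ≠ s (k + 1) := fun h => hcn (h ▸ hq)
      have hlt : s c < s (k + 1) := lt_of_le_of_ne hle hne
      have hH : d < sep (s c) (s (k + 1)) := by
        by_contra hcon
        exact hcn ((sep_le_iff.1 (not_lt.1 hcon)).trans hq)
      have hb : bitBelow q (sep (s c) (s (k + 1))) = 1 := by
        rw [← bitBelow_congr hq hH]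
        exact (bitBelow_sep hlt).2
      rw [if_pos hb] at hcs
      rw [hcs]
      exact ⟨hq, fun _ => le_rfl, fun _ => le_rfl⟩

/-- `q` with the lowest `d` bits replaced by zeros or by ones. -/
def fillBits (q d o : ℕ) : ℕ := q / 2 ^ d * 2 ^ d + o * (2 ^ d - 1)

theorem fillBits_div {q d o : ℕ} (ho : o ≤ 1) : fillBits q d o / 2 ^ d = q / 2 ^ d := by
  have h2 : 0 < 2 ^ d := by positivity
  rw [fillBits, add_comm, Nat.add_mul_div_right _ _ h2, Nat.div_eq_of_lt, zero_add]
  interval_cases o <;> omega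

theorem bitBelow_fillBits_zero {q d M : ℕ} (hM : M ≤ d) : bitBelow (fillBits q d 0) M = 0 := by
  cases M with
  | zero => exact bitBelow_zero _
  | succ M =>
    obtain ⟨e, rfl⟩ := Nat.exists_eq_add_of_le hM
    have : fillBits q (M + 1 + e) 0 = 2 ^ M * (2 * (q / 2 ^ (M + 1 + e) * 2 ^ e)) := by
      simp only [fillBits]
      ring
    rw [bitBelow_succ, this, Nat.mul_div_cancel_left _ (by positivity)]
    omega

theorem bitBelow_fillBits_one {q d M : ℕ} (hM : M ≤ d) (h0 : 0 < M) :
    bitBelow (fillBits q d 1) M = 1 := by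
  obtain ⟨M, rfl⟩ := Nat.exists_eq_add_of_lt h0
  obtain ⟨e, rfl⟩ := Nat.exists_eq_add_of_le hM
  rw [zero_add] at *
  have h1 : 1 ≤ 2 ^ M := Nat.one_le_two_pow
  have h2 : 1 ≤ 2 ^ e := Nat.one_le_two_pow
  have : fillBits q (M + 1 + e) 1 =
      (2 ^ M - 1) + 2 ^ M * (2 * (q / 2 ^ (M + 1 + e) * 2 ^ e + (2 ^ e - 1)) + 1) := by
    simp only [fillBits]
    obtain ⟨a, ha⟩ := Nat.exists_eq_add_of_le h1
    obtain ⟨b, hb⟩ := Nat.exists_eq_add_of_le h2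
    have h3 : 2 ^ (M + 1 + e) = (1 + a) * 2 * (1 + b) := by rw [pow_add, pow_succ, ha, hb]
    generalize q / 2 ^ (M + 1 + e) = Q
    rw [h3, ha, hb]
    have h4 : (1 + a) * 2 * (1 + b) - 1 = a + (1 + a) * (2 * b + 1) := by
      have : (1 + a) * 2 * (1 + b) = a + (1 + a) * (2 * b + 1) + 1 := by ring
      omega
    rw [h4]
    simp only [Nat.add_sub_cancel_left]
    ring
  rw [bitBelow_succ, this, Nat.add_mul_div_left _ _ (by positivity), Nat.div_eq_of_lt (by omega)]
  omega

/-- The second candidate, obtained from the height where `q` branches from the first. -/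
def search (β q : ℕ) (s : ℕ → ℕ) (k : ℕ) : ℕ :=
  cand β (fillBits q (sep q (s (cand β q s k))) (if s (cand β q s k) < q then 1 else 0)) s k

/-- Let `d` be the height where `q` branches from the first candidate. No word agrees with `q`
further down, so all words in the subtree below height `d` lie on the same side of `q`. If they are
smaller, the second search, with ones below, ends at a largest of them; otherwise, with zeros, at
the first of them. In both cases the position of `q` is found, up to words equal to the one at the
position returned. -/
theorem search_spec (hβ : 2 ≤ β) (hs : ∀ i < k, s i ≤ s (i + 1))
    (hd : ∀ i < k, sep (s i) (s (i + 1)) < β) :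
    search β q s k ≤ k ∧ (∀ i < search β q s k, s i < q) ∧
      ∀ i ≤ k, search β q s k ≤ i → s i = s (search β q s k) ∨ q ≤ s i := by
  have hck := cand_le (q := q) hβ hs hd
  have hrk : search β q s k ≤ k := cand_le hβ hs hd
  refine ⟨hrk, ?_⟩
  set c := cand β q s k with hc
  set d := sep q (s c) with hdd
  have hcd : s c / 2 ^ d = q / 2 ^ d := (sep_le_iff.1 hdd.ge).symm
  -- The first candidate shares the longest possible prefix with `q`: apply `cand_spec` at the
  -- height where `q` and `s i` meet.
  have hmin : ∀ i ≤ k, d ≤ sep q (s i) := by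
    intro i hi
    have := (cand_spec hβ hs hd hi ((sep_le_iff (j := sep q (s i))).1 le_rfl).symm).1
    exact sep_le_iff.2 this.symm
  by_cases hlt : s c < q
  · have hr : search β q s k = cand β (fillBits q d 1) s k := by
      simp only [search, ← hc, ← hdd, if_pos hlt]
    have hfd : fillBits q d 1 / 2 ^ d = q / 2 ^ d := fillBits_div le_rfl
    set r := search β q s k with hrdef
    have hspec : ∀ i ≤ k, s i / 2 ^ d = q / 2 ^ d → s r / 2 ^ d = q / 2 ^ d ∧ s i ≤ s r := by
      intro i hi hiq
      have := cand_spec (q := fillBits q d 1) hβ hs hd hi (hiq.trans hfd.symm)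
      rw [← hr, hfd] at this
      exact ⟨this.1, this.2.2 fun M hM h0 => bitBelow_fillBits_one hM h0⟩
    have hrb : s r / 2 ^ d = q / 2 ^ d := (hspec c hck hcd).1
    -- A word of the subtree above `q` would branch from `q` at height `d` with bit 0 in `q`, but
    -- `q` has bit 1 there because the first candidate is smaller.
    have hrq : s r < q := by
      by_contra hcon
      have hd0 : sep q (s r) = d := le_antisymm (sep_le_iff.2 hrb.symm) (hmin r hrk)
      rcases (not_lt.1 hcon).eq_or_lt with h | h
      · rw [← h, sep_self] at hd0
        rw [← hd0] at hcd
        simp at hcd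
        omega
      · have h1 := (bitBelow_sep h).1
        have h2 := (bitBelow_sep hlt).2
        rw [hd0] at h1
        rw [sep_comm, ← hdd] at h2
        omega
    refine ⟨fun i hi => (monotone_upto hs hi.le hrk).trans_lt hrq, fun i hi hri => ?_⟩
    have hge := monotone_upto hs hri hi
    by_cases hib : s i / 2 ^ d = q / 2 ^ d
    · exact .inl (le_antisymm (hspec i hi hib).2 hge)
    · right
      by_contra hcon
      have h1 : s r / 2 ^ d ≤ s i / 2 ^ d := Nat.div_le_div_right hge
      have h2 : s i / 2 ^ d ≤ q / 2 ^ d := Nat.div_le_div_right (by omega)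
      omega
  · have hr : search β q s k = cand β (fillBits q d 0) s k := by
      simp only [search, ← hc, ← hdd, if_neg hlt]
    have hfd : fillBits q d 0 / 2 ^ d = q / 2 ^ d := fillBits_div (by norm_num)
    set r := search β q s k with hrdef
    have hspec : ∀ i ≤ k, s i / 2 ^ d = q / 2 ^ d → s r / 2 ^ d = q / 2 ^ d ∧ r ≤ i := by
      intro i hi hiq
      have := cand_spec (q := fillBits q d 0) hβ hs hd hi (hiq.trans hfd.symm)
      rw [← hr, hfd] at this
      exact ⟨this.1, this.2.1 fun M hM => bitBelow_fillBits_zero hM⟩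
    have hrb : s r / 2 ^ d = q / 2 ^ d := (hspec c hck hcd).1
    have hqr : q ≤ s r := by
      by_contra hcon
      have hd0 : sep q (s r) = d := le_antisymm (sep_le_iff.2 hrb.symm) (hmin r hrk)
      have h1 := (bitBelow_sep (not_le.1 hcon)).2
      rw [sep_comm, hd0] at h1
      rcases (not_lt.1 hlt).eq_or_lt with h | h
      · rw [← h, sep_self] at hdd
        rw [hdd, bitBelow_zero] at h1
        omega
      · have h2 := (bitBelow_sep h).1
        rw [← hdd] at h2
        omega
    refine ⟨fun i hi => ?_, fun i hi hri => .inr (hqr.trans (monotone_upto hs hri hi))⟩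
    have hle := monotone_upto hs hi.le hrk
    by_contra hcon
    have h1 : s i / 2 ^ d ≤ s r / 2 ^ d := Nat.div_le_div_right hle
    have h2 : q / 2 ^ d ≤ s i / 2 ^ d := Nat.div_le_div_right (not_lt.1 hcon)
    have := (hspec i (by omega) (by omega)).2
    omega

end

/-! ### Two levels -/

/-- The block found in the list `s 0, …, s (m - 1)` divided into blocks of length `D`. -/
def findBlock (β D q : ℕ) (s : ℕ → ℕ) (m : ℕ) : ℕ :=
  let j := search β q (fun i => s (i * D)) ((m - 1) / D)
  j - (1 - if s (j * D) < q then 1 else 0)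

/-- The last position in block `j`, relative to the start of the block. -/
def blockLast (D m j : ℕ) : ℕ := min (D - 1) (m - 1 - j * D)

/-- The position found in the list `s 0, …, s (m - 1)` divided into blocks of length `D`. -/
def find (β D q : ℕ) (s : ℕ → ℕ) (m : ℕ) : ℕ :=
  findBlock β D q s m * D +
    search β q (fun i => s (findBlock β D q s m * D + i)) (blockLast D m (findBlock β D q s m))

/-- The last block whose head is below `q` has to be taken: the block found if its head is smaller
than `q`, else the one before it. `search_spec` leaves open how many equal heads follow the one
found; the hypothesis that no word recurs at distance `D` excludes this. -/
theorem findBlock_spec {β D q m : ℕ} {s : ℕ → ℕ} (hβ : 2 ≤ β) (hD : 0 < D) (hm : 0 < m)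
    (hs : ∀ i j, i ≤ j → j < m → s i ≤ s j) (hd : ∀ i j, i < m → j < m → sep (s i) (s j) < β)
    (ht : ∀ i, i + D < m → s i ≠ s (i + D)) :
    findBlock β D q s m * D < m ∧ (∀ i < findBlock β D q s m * D, s i < q) ∧
      ∀ i < m, (findBlock β D q s m + 1) * D ≤ i → q ≤ s i := by
  have hk : ∀ i ≤ (m - 1) / D, i * D < m := by
    intro i hi
    have := (Nat.le_div_iff_mul_le hD).1 hi
    omega
  have hS := search_spec (q := q) (s := fun i => s (i * D)) (k := (m - 1) / D) hβ
    (fun i hi => hs _ _ (Nat.mul_le_mul_right _ (by omega)) (hk _ hi))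
    (fun i hi => hd _ _ (hk _ (by omega)) (hk _ hi))
  simp only [findBlock]
  set j := search β q (fun i => s (i * D)) ((m - 1) / D)
  obtain ⟨h1, h2, h3⟩ := hS
  by_cases hj : s (j * D) < q
  · simp only [if_pos hj, Nat.sub_self, Nat.sub_zero]
    refine ⟨hk j h1, fun i hi => (hs _ _ hi.le (hk j h1)).trans_lt hj, fun i hi hji => ?_⟩
    have hj1 : j + 1 ≤ (m - 1) / D := (Nat.le_div_iff_mul_le hD).2 (by omega)
    have hlt := hk _ hj1
    -- The next head equals the one found, which is impossible at distance `D`, or it is at least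
    -- `q`.
    rcases h3 (j + 1) hj1 (by omega) with h | h
    · exfalso
      have e : (j + 1) * D = j * D + D := by ring
      rw [e] at h hlt
      exact ht _ hlt h.symm
    · exact h.trans (hs _ _ hji hi)
  · simp only [if_neg hj, Nat.sub_zero]
    rcases Nat.eq_zero_or_pos j with h0 | h0
    · rw [h0] at hj ⊢
      simp only [Nat.zero_sub, zero_mul] at hj ⊢
      exact ⟨hm, fun i hi => absurd hi (by omega),
        fun i hi _ => (not_lt.1 hj).trans (hs _ _ (Nat.zero_le _) hi)⟩
    · refine ⟨hk _ (by omega), fun i hi => ?_, fun i hi hji => ?_⟩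
      · exact (hs _ _ hi.le (hk _ (by omega))).trans_lt (h2 (j - 1) (by omega))
      · rw [Nat.sub_add_cancel h0] at hji
        exact (not_lt.1 hj).trans (hs _ _ hji hi)

/-- All words before the block are smaller than `q` and all words after it are at least `q`, so the
search inside the block decides. -/
theorem find_spec {β D q m : ℕ} {s : ℕ → ℕ} (hβ : 2 ≤ β) (hD : 0 < D) (hm : 0 < m)
    (hs : ∀ i j, i ≤ j → j < m → s i ≤ s j) (hd : ∀ i j, i < m → j < m → sep (s i) (s j) < β)
    (ht : ∀ i, i + D < m → s i ≠ s (i + D)) :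
    find β D q s m < m ∧ (∀ i < find β D q s m, s i < q) ∧
      ∀ i < m, find β D q s m ≤ i → s i = s (find β D q s m) ∨ q ≤ s i := by
  obtain ⟨h1, h2, h3⟩ := findBlock_spec (q := q) hβ hD hm hs hd ht
  simp only [find]
  set j := findBlock β D q s m
  have hk : ∀ i ≤ blockLast D m j, j * D + i < m := fun i hi => by
    simp only [blockLast] at hi
    omega
  obtain ⟨a1, a2, a3⟩ := search_spec (q := q) (s := fun i => s (j * D + i)) (k := blockLast D m j)
    hβ (fun i hi => hs _ _ (by omega) (hk _ hi)) (fun i hi => hd _ _ (hk _ (by omega)) (hk _ hi))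
  set r := search β q (fun i => s (j * D + i)) (blockLast D m j)
  refine ⟨hk _ a1, fun i hi => ?_, fun i hi hri => ?_⟩
  · by_cases hij : i < j * D
    · exact h2 i hij
    · have := a2 (i - j * D) (by omega)
      rwa [Nat.add_sub_cancel' (by omega)] at this
  · by_cases hij : (j + 1) * D ≤ i
    · exact .inr (h3 i hi hij)
    · have e : (j + 1) * D = j * D + D := by ring
      have := a3 (i - j * D) (by simp only [blockLast]; omega) (by omega)
      rwa [Nat.add_sub_cancel' (by omega)] at this

end BlindSearch

/-! ### The uniform law: tail bounds for the number of points in a box -/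

namespace RandomPoints

open MeasureTheory

/-- The uniform law on the unit square. -/
noncomputable def square : Measure (ℝ × ℝ) :=
  (volume : Measure (ℝ × ℝ)).restrict (Set.Icc 0 1 ×ˢ Set.Icc 0 1)

instance : IsProbabilityMeasure square := by
  constructor
  rw [square, Measure.restrict_apply_univ, Measure.volume_eq_prod, Measure.prod_prod]
  simp

theorem law_eq (n : ℕ) : law n = Measure.pi fun _ => square := rfl

instance (n : ℕ) : IsProbabilityMeasure (law n) := by
  rw [law_eq]; infer_instance

-- A union bound over the sets of `k` indices: there are n choose k of them, at most n^k/k!, and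
-- each has all its points in `R` with probability at most a^k. The set `R` need not be measurable.
open Classical in
theorem law_le_card_le {n k : ℕ} {R : Set (ℝ × ℝ)} {a : ℝ} (ha : 0 ≤ a)
    (hRa : square R ≤ ENNReal.ofReal a) :
    law n {P | k ≤ (Finset.univ.filter fun i => P i ∈ R).card} ≤
      ENNReal.ofReal ((n * a) ^ k / k.factorial) := by
  have hsub : {P : Fin n → ℝ × ℝ | k ≤ (Finset.univ.filter fun i => P i ∈ R).card} ⊆
      ⋃ T ∈ Finset.powersetCard k (Finset.univ : Finset (Fin n)),
        Set.univ.pi fun i => if i ∈ T then R else Set.univ := by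
    intro P hP
    obtain ⟨T, hT, hTk⟩ := Finset.exists_subset_card_eq (Set.mem_ofPred.1 hP)
    simp only [Set.mem_iUnion]
    refine ⟨T, Finset.mem_powersetCard.2 ⟨Finset.subset_univ _, hTk⟩, fun i _ => ?_⟩
    by_cases hi : i ∈ T
    · simpa [hi] using (Finset.mem_filter.1 (hT hi)).2
    · simp [hi]
  have hone : ∀ T ∈ Finset.powersetCard k (Finset.univ : Finset (Fin n)),
      law n (Set.univ.pi fun i => if i ∈ T then R else Set.univ) ≤ ENNReal.ofReal (a ^ k) := by
    intro T hT
    rw [law_eq, Measure.pi_pi]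
    have : ∀ i : Fin n, square (if i ∈ T then R else Set.univ) = if i ∈ T then square R else 1 := by
      intro i
      split_ifs <;> simp
    simp only [this]
    rw [Finset.prod_ite, Finset.prod_const_one, mul_one, Finset.prod_const,
      Finset.filter_mem_eq_inter, Finset.univ_inter, (Finset.mem_powersetCard.1 hT).2,
      ENNReal.ofReal_pow ha]
    exact pow_le_pow_left' hRa k
  calc law n {P | k ≤ (Finset.univ.filter fun i => P i ∈ R).card}
      ≤ ∑ T ∈ Finset.powersetCard k (Finset.univ : Finset (Fin n)),
          law n (Set.univ.pi fun i => if i ∈ T then R else Set.univ) :=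
        (measure_mono hsub).trans (measure_biUnion_finset_le _ _)
    _ ≤ ∑ _T ∈ Finset.powersetCard k (Finset.univ : Finset (Fin n)), ENNReal.ofReal (a ^ k) :=
        Finset.sum_le_sum hone
    _ = ENNReal.ofReal (n.choose k * a ^ k) := by
        rw [Finset.sum_const, Finset.card_powersetCard, Finset.card_univ, Fintype.card_fin,
          nsmul_eq_mul, ENNReal.ofReal_mul (by positivity), ENNReal.ofReal_natCast]
    _ ≤ ENNReal.ofReal ((n * a) ^ k / k.factorial) := by
        apply ENNReal.ofReal_le_ofReal
        have h := Nat.choose_le_pow_div (α := ℝ) k n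
        calc (n.choose k : ℝ) * a ^ k ≤ ((n : ℝ) ^ k / k.factorial) * a ^ k :=
              mul_le_mul_of_nonneg_right h (by positivity)
          _ = (n * a) ^ k / k.factorial := by rw [mul_pow]; ring

/-- By independence the probability is (1 - |R|)^n, and 1 - a ≤ exp(-a). -/
theorem law_forall_notMem_le {n : ℕ} {R : Set (ℝ × ℝ)} (hR : MeasurableSet R) {a : ℝ} (ha : 0 ≤ a)
    (hRa : ENNReal.ofReal a ≤ square R) :
    law n {P | ∀ i, P i ∉ R} ≤ ENNReal.ofReal (Real.exp (-(n * a))) := by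
  have h1 : {P : Fin n → ℝ × ℝ | ∀ i, P i ∉ R} = Set.univ.pi fun _ => Rᶜ := by
    ext P; simp
  have h2 : square Rᶜ ≤ ENNReal.ofReal (Real.exp (-a)) := by
    rw [prob_compl_eq_one_sub hR]
    calc 1 - square R ≤ 1 - ENNReal.ofReal a := tsub_le_tsub_left hRa 1
      _ = ENNReal.ofReal (1 - a) := by rw [ENNReal.ofReal_sub _ ha, ENNReal.ofReal_one]
      _ ≤ _ := ENNReal.ofReal_le_ofReal (Real.one_sub_le_exp_neg a)
  rw [h1, law_eq, Measure.pi_pi, Finset.prod_const, Finset.card_univ, Fintype.card_fin]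
  calc square Rᶜ ^ n ≤ ENNReal.ofReal (Real.exp (-a)) ^ n := pow_le_pow_left' h2 n
    _ = _ := by
      rw [← ENNReal.ofReal_pow (Real.exp_pos _).le, ← Real.exp_nat_mul]
      congr 2
      ring

/-! ### Dyadic boxes -/

/-- The dyadic box number `(u, v)` of width `2 ^ (-α)` and height `2 ^ (-β)`. -/
def box (α β u v : ℕ) : Set (ℝ × ℝ) := {p | ⌊p.1 * 2 ^ α⌋₊ = u ∧ ⌊p.2 * 2 ^ β⌋₊ = v}

theorem measurableSet_box (α β u v : ℕ) : MeasurableSet (box α β u v) := by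
  have h1 : Measurable fun p : ℝ × ℝ => ⌊p.1 * 2 ^ α⌋₊ :=
    Nat.measurable_floor.comp (measurable_fst.mul_const _)
  have h2 : Measurable fun p : ℝ × ℝ => ⌊p.2 * 2 ^ β⌋₊ :=
    Nat.measurable_floor.comp (measurable_snd.mul_const _)
  exact (h1 (measurableSet_singleton u)).inter (h2 (measurableSet_singleton v))

theorem floor_mul_two_pow_eq_iff {x : ℝ} (hx : 0 ≤ x) (α u : ℕ) :
    ⌊x * 2 ^ α⌋₊ = u ↔ x ∈ Set.Ico ((u : ℝ) / 2 ^ α) ((u + 1) / 2 ^ α) := by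
  have h2 : (0 : ℝ) < 2 ^ α := by positivity
  rw [Nat.floor_eq_iff (by positivity), Set.mem_Ico, div_le_iff₀ h2, lt_div_iff₀ h2]

/-- `Nat.floor` sends negative numbers to 0, so a box with index 0 is unbounded; only its trace on
the unit square is an ordinary dyadic rectangle. -/
theorem square_box_le (α β u v : ℕ) :
    square (box α β u v) ≤ ENNReal.ofReal (1 / 2 ^ (α + β)) := by
  rw [square, Measure.restrict_apply (measurableSet_box ..)]
  have hsub : box α β u v ∩ Set.Icc 0 1 ×ˢ Set.Icc 0 1 ⊆
      Set.Ico ((u : ℝ) / 2 ^ α) ((u + 1) / 2 ^ α) ×ˢ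
        Set.Ico ((v : ℝ) / 2 ^ β) ((v + 1) / 2 ^ β) := by
    rintro ⟨x, y⟩ ⟨⟨h1, h2⟩, h3, h4⟩
    exact ⟨(floor_mul_two_pow_eq_iff h3.1 _ _).1 h1, (floor_mul_two_pow_eq_iff h4.1 _ _).1 h2⟩
  refine (measure_mono hsub).trans ?_
  rw [Measure.volume_eq_prod, Measure.prod_prod, Real.volume_Ico, Real.volume_Ico,
    ← ENNReal.ofReal_mul (by rw [← sub_div, add_sub_cancel_left]; positivity)]
  apply ENNReal.ofReal_le_ofReal
  rw [← sub_div, ← sub_div, pow_add]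
  simp only [add_sub_cancel_left]
  rw [one_div_mul_one_div]

theorem le_square_box {α β u v : ℕ} (hu : u < 2 ^ α) (hv : v < 2 ^ β) :
    ENNReal.ofReal (1 / 2 ^ (α + β)) ≤ square (box α β u v) := by
  rw [square, Measure.restrict_apply (measurableSet_box ..)]
  have key : ∀ {α u : ℕ}, u < 2 ^ α → ∀ {x : ℝ},
      x ∈ Set.Ico ((u : ℝ) / 2 ^ α) ((u + 1) / 2 ^ α) → 0 ≤ x ∧ x ≤ 1 := by
    intro α u hu x hx
    have h2 : (0 : ℝ) < 2 ^ α := by positivity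
    refine ⟨le_trans (by positivity) hx.1, hx.2.le.trans ?_⟩
    rw [div_le_one h2]
    exact_mod_cast hu
  have hsub : Set.Ico ((u : ℝ) / 2 ^ α) ((u + 1) / 2 ^ α) ×ˢ
        Set.Ico ((v : ℝ) / 2 ^ β) ((v + 1) / 2 ^ β) ⊆
      box α β u v ∩ Set.Icc 0 1 ×ˢ Set.Icc 0 1 := by
    rintro ⟨x, y⟩ ⟨h1, h2⟩
    have hx := key hu h1
    have hy := key hv h2
    exact ⟨⟨(floor_mul_two_pow_eq_iff hx.1 _ _).2 h1, (floor_mul_two_pow_eq_iff hy.1 _ _).2 h2⟩,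
      hx, hy⟩
  refine le_trans ?_ (measure_mono hsub)
  rw [Measure.volume_eq_prod, Measure.prod_prod, Real.volume_Ico, Real.volume_Ico,
    ← ENNReal.ofReal_mul (by rw [← sub_div, add_sub_cancel_left]; positivity)]
  apply ENNReal.ofReal_le_ofReal
  rw [← sub_div, ← sub_div, pow_add]
  simp only [add_sub_cancel_left]
  rw [one_div_mul_one_div]

/-- All points lie in the open unit square. -/
def Inside {n : ℕ} (P : Fin n → ℝ × ℝ) : Prop :=
  ∀ i, P i ∈ Set.Ioo (0 : ℝ) 1 ×ˢ Set.Ioo (0 : ℝ) 1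

/-- The boundary of the square is a null set. -/
theorem law_not_inside (n : ℕ) : law n {P | ¬ Inside P} = 0 := by
  have h : ∀ᵐ p ∂square, p ∈ Set.Ioo (0 : ℝ) 1 ×ˢ Set.Ioo (0 : ℝ) 1 := by
    have : square = (volume : Measure (ℝ × ℝ)).restrict
        (Set.Ioo (0 : ℝ) 1 ×ˢ Set.Ioo (0 : ℝ) 1) := by
      rw [square, Measure.volume_eq_prod, ← Measure.prod_restrict, ← Measure.prod_restrict,
        restrict_Ioo_eq_restrict_Icc]
    rw [this]
    exact ae_restrict_mem (measurableSet_Ioo.prod measurableSet_Ioo)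
  have h' : ∀ᵐ P ∂(law n), ∀ i, P i ∈ Set.Ioo (0 : ℝ) 1 ×ˢ Set.Ioo (0 : ℝ) 1 := by
    rw [law_eq, ae_all_iff]
    intro i
    exact (Measure.quasiMeasurePreserving_eval (fun _ : Fin n => square) i).ae h
  exact h'

theorem floor_lt_two_pow {x : ℝ} (h1 : x < 1) (α : ℕ) : ⌊x * 2 ^ α⌋₊ < 2 ^ α := by
  rw [Nat.floor_lt' (by positivity)]
  push_cast
  have : (0 : ℝ) < 2 ^ α := by positivity
  nlinarith

-- Points inside the open square occupy only 2^(α+β) boxes, and a crowded box is nonempty because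
-- `k` is positive. So a union bound over these boxes suffices.
open Classical in
theorem law_crowded_box_le (n α β : ℕ) {k : ℕ} (hk : 0 < k) :
    law n {P | Inside P ∧ ∃ u v, k ≤ (Finset.univ.filter fun i => P i ∈ box α β u v).card} ≤
      ENNReal.ofReal (2 ^ (α + β) * ((n / 2 ^ (α + β)) ^ k / k.factorial)) := by
  have hsub : {P : Fin n → ℝ × ℝ | Inside P ∧
        ∃ u v, k ≤ (Finset.univ.filter fun i => P i ∈ box α β u v).card} ⊆
      ⋃ q ∈ Finset.range (2 ^ α) ×ˢ Finset.range (2 ^ β),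
        {P | k ≤ (Finset.univ.filter fun i => P i ∈ box α β q.1 q.2).card} := by
    rintro P ⟨hP, u, v, huv⟩
    obtain ⟨i, hi⟩ := Finset.card_pos.1 (hk.trans_le huv)
    obtain ⟨h1, h2⟩ := (Finset.mem_filter.1 hi).2
    simp only [Set.mem_iUnion]
    refine ⟨(u, v), Finset.mem_product.2 ⟨Finset.mem_range.2 ?_, Finset.mem_range.2 ?_⟩, huv⟩
    · rw [← h1]; exact floor_lt_two_pow (hP i).1.2 α
    · rw [← h2]; exact floor_lt_two_pow (hP i).2.2 β
  refine (measure_mono hsub).trans ((measure_biUnion_finset_le _ _).trans ?_)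
  refine (Finset.sum_le_sum fun q _ => law_le_card_le
    (by positivity) (square_box_le α β q.1 q.2)).trans ?_
  rw [Finset.sum_const, Finset.card_product, Finset.card_range, Finset.card_range, nsmul_eq_mul,
    ENNReal.ofReal_mul (by positivity), ← pow_add, mul_one_div]
  refine mul_le_mul_left (le_of_eq ?_) _
  have := ENNReal.ofReal_natCast (2 ^ (α + β))
  rw [← this]
  push_cast
  rfl

theorem law_empty_box_le (n α β : ℕ) :
    law n {P | ∃ u v, u < 2 ^ α ∧ v < 2 ^ β ∧ ∀ i, P i ∉ box α β u v} ≤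
      ENNReal.ofReal (2 ^ (α + β) * Real.exp (-(n / 2 ^ (α + β)))) := by
  have hsub : {P : Fin n → ℝ × ℝ | ∃ u v, u < 2 ^ α ∧ v < 2 ^ β ∧ ∀ i, P i ∉ box α β u v} ⊆
      ⋃ q ∈ Finset.range (2 ^ α) ×ˢ Finset.range (2 ^ β), {P | ∀ i, P i ∉ box α β q.1 q.2} := by
    rintro P ⟨u, v, hu, hv, huv⟩
    simp only [Set.mem_iUnion]
    exact ⟨(u, v), Finset.mem_product.2 ⟨Finset.mem_range.2 hu, Finset.mem_range.2 hv⟩, huv⟩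
  refine (measure_mono hsub).trans ((measure_biUnion_finset_le _ _).trans ?_)
  refine (Finset.sum_le_sum fun q hq => law_forall_notMem_le (measurableSet_box ..)
    (by positivity) (le_square_box (Finset.mem_range.1 (Finset.mem_product.1 hq).1)
      (Finset.mem_range.1 (Finset.mem_product.1 hq).2))).trans ?_
  rw [Finset.sum_const, Finset.card_product, Finset.card_range, Finset.card_range, nsmul_eq_mul,
    ENNReal.ofReal_mul (by positivity), ← pow_add, mul_one_div]
  refine mul_le_mul_left (le_of_eq ?_) _
  have := ENNReal.ofReal_natCast (2 ^ (α + β))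
  rw [← this]
  push_cast
  rfl

end RandomPoints

/-! ### Typical point sets and their probability -/

namespace RandomPoints

open MeasureTheory

/-- The abscissae of the points, with value `0` beyond the last one. -/
noncomputable def abscissa {n : ℕ} (P : Fin n → ℝ × ℝ) (p : ℕ) : ℝ :=
  if h : p < n then (P ⟨p, h⟩).1 else 0

/-- The ordinates of the points, with value `0` beyond the last one. -/
noncomputable def ordinate {n : ℕ} (P : Fin n → ℝ × ℝ) (p : ℕ) : ℝ :=
  if h : p < n then (P ⟨p, h⟩).2 else 0

/-- What the data structure needs to know about the points: they are in general position in the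
open unit square, a cell of area `2 ^ (-J)` has fewer than `S` points, a strip of area
`2 ^ (-J - b)` in a cell has fewer than `t` points, and every box of area `2 ^ (-J - 3)` has a
point. -/
structure Typical (n J S b t : ℕ) (X Y : ℕ → ℝ) : Prop where
  X_mem : ∀ p < n, 0 < X p ∧ X p < 1
  Y_mem : ∀ p < n, 0 < Y p ∧ Y p < 1
  X_ne : ∀ p < n, ∀ q < n, p ≠ q → X p ≠ X q
  Y_ne : ∀ p < n, ∀ q < n, p ≠ q → Y p ≠ Y q
  load : ∀ i ≤ J, ∀ u v, ((Finset.range n).filter fun p =>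
    ⌊X p * 2 ^ i⌋₊ = u ∧ ⌊Y p * 2 ^ (J - i)⌋₊ = v).card < S
  stripX : ∀ i ≤ J, ∀ u v, ((Finset.range n).filter fun p =>
    ⌊X p * 2 ^ (i + b)⌋₊ = u ∧ ⌊Y p * 2 ^ (J - i)⌋₊ = v).card < t
  stripY : ∀ i ≤ J, ∀ u v, ((Finset.range n).filter fun p =>
    ⌊X p * 2 ^ i⌋₊ = u ∧ ⌊Y p * 2 ^ (J - i + b)⌋₊ = v).card < t
  big : ∀ i ≤ J, ∀ u < 2 ^ (i + 2), ∀ v < 2 ^ (J - i + 1), ∃ p < n,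
    ⌊X p * 2 ^ (i + 2)⌋₊ = u ∧ ⌊Y p * 2 ^ (J - i + 1)⌋₊ = v

open Classical in
theorem card_box_eq {n : ℕ} (P : Fin n → ℝ × ℝ) (α β u v : ℕ) :
    ((Finset.range n).filter fun p =>
      ⌊abscissa P p * 2 ^ α⌋₊ = u ∧ ⌊ordinate P p * 2 ^ β⌋₊ = v).card =
    (Finset.univ.filter fun i => P i ∈ box α β u v).card := by
  rw [Finset.card_filter, Finset.card_filter, ← Fin.sum_univ_eq_sum_range]
  refine Finset.sum_congr rfl fun i _ => ?_
  simp only [abscissa, ordinate, box, i.2, dif_pos, Fin.eta, Set.mem_ofPred_eq]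
  congr

open Classical in
/-- Some dyadic box of the given size has at least `k` points. -/
def Crowded (n α β k : ℕ) : Set (Fin n → ℝ × ℝ) :=
  {P | Inside P ∧ ∃ u v, k ≤ (Finset.univ.filter fun i => P i ∈ box α β u v).card}

/-- Some dyadic box of the given size has no point. -/
def Vacant (n α β : ℕ) : Set (Fin n → ℝ × ℝ) :=
  {P | ∃ u v, u < 2 ^ α ∧ v < 2 ^ β ∧ ∀ i, P i ∉ box α β u v}

/-- General position is implied by a quantitative event: no vertical or horizontal strip of width
2^(-g) contains two points. Thus every defect of a point set is a crowded or a vacant dyadic box.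
The strips are boxes with one side equal to 1, whose index in that direction is 0. -/
theorem not_typical_subset (n J S b t g : ℕ) :
    {P : Fin n → ℝ × ℝ | ¬ Typical n J S b t (abscissa P) (ordinate P)} ⊆
      {P | ¬ Inside P} ∪ (Crowded n g 0 2 ∪ (Crowded n 0 g 2 ∪
        ⋃ i ∈ Finset.range (J + 1), (Crowded n i (J - i) S ∪ (Crowded n (i + b) (J - i) t ∪
          (Crowded n i (J - i + b) t ∪ Vacant n (i + 2) (J - i + 1)))))) := by
  classical
  intro P hP
  by_contra hcon
  simp only [Set.mem_union, not_or, Set.mem_iUnion, not_exists, Finset.mem_range] at hcon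
  obtain ⟨h0, h1, h2, h3⟩ := hcon
  have hin : Inside P := by simpa using h0
  have key : ∀ {α β k : ℕ}, P ∉ Crowded n α β k → ∀ u v, ((Finset.range n).filter fun p =>
      ⌊abscissa P p * 2 ^ α⌋₊ = u ∧ ⌊ordinate P p * 2 ^ β⌋₊ = v).card < k := by
    intro α β k h u v
    rw [card_box_eq]
    by_contra hc
    exact h ⟨hin, u, v, not_lt.1 hc⟩
  have hX : ∀ p < n, 0 < abscissa P p ∧ abscissa P p < 1 := fun p hp => by
    simpa [abscissa, hp] using (hin ⟨p, hp⟩).1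
  have hY : ∀ p < n, 0 < ordinate P p ∧ ordinate P p < 1 := fun p hp => by
    simpa [ordinate, hp] using (hin ⟨p, hp⟩).2
  apply hP
  refine ⟨hX, hY, ?_, ?_, fun i hi => key (h3 i (by omega)).1,
    fun i hi => key (h3 i (by omega)).2.1, fun i hi => key (h3 i (by omega)).2.2.1, ?_⟩
  · intro p hp q hq hpq he
    have := key h1 ⌊abscissa P p * 2 ^ g⌋₊ 0
    refine absurd this (not_lt.2 ?_)
    rw [← Finset.card_pair hpq]
    apply Finset.card_le_card
    intro r hr
    simp only [Finset.mem_insert, Finset.mem_singleton] at hr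
    have hr' : r < n := by rcases hr with rfl | rfl <;> assumption
    refine Finset.mem_filter.2 ⟨Finset.mem_range.2 hr', ?_, ?_⟩
    · rcases hr with rfl | rfl
      · rfl
      · rw [he]
    · have := floor_lt_two_pow (hY r hr').2 0
      simpa using this
  · intro p hp q hq hpq he
    have := key h2 0 ⌊ordinate P p * 2 ^ g⌋₊
    refine absurd this (not_lt.2 ?_)
    rw [← Finset.card_pair hpq]
    apply Finset.card_le_card
    intro r hr
    simp only [Finset.mem_insert, Finset.mem_singleton] at hr
    have hr' : r < n := by rcases hr with rfl | rfl <;> assumption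
    refine Finset.mem_filter.2 ⟨Finset.mem_range.2 hr', ?_, ?_⟩
    · have := floor_lt_two_pow (hX r hr').2 0
      simpa using this
    · rcases hr with rfl | rfl
      · rfl
      · rw [he]
  · intro i hi u hu v hv
    have := (h3 i (by omega)).2.2.2
    by_contra hc
    push Not at hc
    refine this ⟨u, v, hu, hv, fun j hj => ?_⟩
    have h5 := hc j j.2
    simp only [abscissa, ordinate, j.2, dif_pos] at h5
    exact h5 hj.1 hj.2

/-- With suitable parameters random points are typical. -/
theorem law_not_typical_le {n c ℓ J b : ℕ} (hn : 1 ≤ n) (hnℓ : n < 2 ^ ℓ) (hℓ : 3 ≤ ℓ)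
    (hJℓ : J + 1 ≤ ℓ) (hJ : 2 ^ J * (8 * (c + 4) * ℓ) ≤ n)
    (hJ' : n ≤ 2 ^ (J + 1) * (8 * (c + 4) * ℓ)) (hb : b ≤ ℓ) (hb' : ℓ ≤ 8 * b)
    (hbA : (2 * (8 * (c + 4) * ℓ)) ^ 2 ≤ 2 ^ b) :
    law n {P | ¬ Typical n J ((8 * (8 * (c + 4)) + c + 4) * ℓ) b (16 * (c + 5)) (abscissa P)
      (ordinate P)} ≤ ENNReal.ofReal (1 / (n : ℝ) ^ c) := by
  set A := 8 * (c + 4) with hA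
  set S := (8 * A + c + 4) * ℓ with hS
  -- The budget: ε for each global defect, and δ for each of the four kinds of defect on each level.
  -- There are at most 2^ℓ levels and ε = 2^ℓ δ.
  set ε : ℝ := 1 / 2 ^ ((c + 2) * ℓ) with hε
  set δ : ℝ := 1 / 2 ^ ((c + 3) * ℓ) with hδ
  have hδ0 : 0 ≤ δ := by positivity
  have hnℓ' : (n : ℝ) ≤ 2 ^ ℓ := by exact_mod_cast hnℓ.le
  have hJ2 : (2 : ℝ) ^ J ≤ 2 ^ ℓ := pow_le_pow_right₀ (by norm_num) (by omega)
  have hx : (n : ℝ) / 2 ^ J ≤ 2 * (A * ℓ) := by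
    rw [div_le_iff₀ (by positivity)]
    have : (n : ℝ) ≤ 2 ^ (J + 1) * (A * ℓ) := by exact_mod_cast hJ'
    rw [pow_succ] at this
    linarith
  -- general position
  have hdist : ∀ α β : ℕ, α + β = (c + 4) * ℓ → law n (Crowded n α β 2) ≤ ENNReal.ofReal ε := by
    intro α β hαβ
    refine (law_crowded_box_le n α β (by norm_num)).trans (ENNReal.ofReal_le_ofReal ?_)
    rw [hαβ]
    have e : (2 : ℝ) ^ ((c + 4) * ℓ) = 2 ^ ((c + 2) * ℓ) * (2 ^ ℓ * 2 ^ ℓ) := by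
      rw [← pow_add, ← pow_add]; congr 1; ring
    have h1 : (n : ℝ) * n ≤ 2 ^ ℓ * 2 ^ ℓ := mul_le_mul hnℓ' hnℓ' (by positivity) (by positivity)
    set Z : ℝ := 2 ^ ((c + 4) * ℓ) with hZ
    have hZ0 : 0 < Z := by positivity
    have h2 : Z * ((n / Z) ^ 2 / (Nat.factorial 2 : ℕ)) = (n * n) / Z / 2 := by
      simp only [Nat.factorial]
      field_simp
      norm_num
    rw [h2, hε]
    calc (n : ℝ) * n / Z / 2 ≤ n * n / Z := half_le_self (by positivity)
      _ ≤ (2 ^ ℓ * 2 ^ ℓ) / Z := by gcongr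
      _ = 1 / 2 ^ ((c + 2) * ℓ) := by
        rw [e]; field_simp
  -- number of points in a cell
  have hload : ∀ i ≤ J, law n (Crowded n i (J - i) S) ≤ ENNReal.ofReal δ := by
    intro i hi
    have hS0 : 0 < S := by rw [hS]; positivity
    refine (law_crowded_box_le n i (J - i) hS0).trans (ENNReal.ofReal_le_ofReal ?_)
    rw [Nat.add_sub_cancel' hi]
    have hx0 : (0 : ℝ) ≤ n / 2 ^ J := by positivity
    set x : ℝ := n / 2 ^ J
    -- A Chernoff-type bound for the mean load x ≤ 2Aℓ. Since e < 4, exp(2x) is at most 2^(8Aℓ). The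
    -- summand 8Aℓ of `S` cancels this, and of the remaining (c+4)ℓ one ℓ pays for the number of
    -- cells.
    have h1 : x ^ S / S.factorial ≤ Real.exp (2 * x) / 2 ^ S := by
      rw [le_div_iff₀ (by positivity)]
      calc x ^ S / S.factorial * 2 ^ S = (2 * x) ^ S / S.factorial := by rw [mul_pow]; ring
        _ ≤ Real.exp (2 * x) := Real.pow_div_factorial_le_exp _ (by positivity) _
    have h2 : Real.exp (2 * x) ≤ 2 ^ (8 * A * ℓ) := by
      calc Real.exp (2 * x) ≤ Real.exp ((4 * A * ℓ : ℕ) : ℝ) := by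
            apply Real.exp_le_exp.2
            push_cast
            linarith
        _ = Real.exp 1 ^ (4 * A * ℓ) := by rw [← Real.exp_nat_mul, mul_one]
        _ ≤ (2 ^ 2) ^ (4 * A * ℓ) := by
            apply pow_le_pow_left₀ (Real.exp_pos _).le
            have := Real.exp_one_lt_d9
            linarith
        _ = 2 ^ (8 * A * ℓ) := by rw [← pow_mul]; congr 1; ring
    have e : (2 : ℝ) ^ S = 2 ^ (8 * A * ℓ) * (2 ^ ((c + 3) * ℓ) * 2 ^ ℓ) := by
      rw [← pow_add, ← pow_add, hS]; congr 1; ring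
    calc (2 : ℝ) ^ J * (x ^ S / S.factorial) ≤ 2 ^ ℓ * (2 ^ (8 * A * ℓ) / 2 ^ S) := by
          refine mul_le_mul hJ2 (h1.trans ?_) (by positivity) (by positivity)
          gcongr
      _ = δ := by rw [e, hδ]; field_simp
  -- number of points in a strip
  have hstrip : ∀ α β : ℕ, α + β = J + b → law n (Crowded n α β (16 * (c + 5))) ≤
      ENNReal.ofReal δ := by
    intro α β hαβ
    refine (law_crowded_box_le n α β (by positivity)).trans (ENNReal.ofReal_le_ofReal ?_)
    rw [hαβ]
    set y : ℝ := n / 2 ^ (J + b) with hy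
    have hy0 : 0 ≤ y := by positivity
    -- The mean number of points in a strip is at most 2Aℓ/2^b, which is at most 2^(-b/2) by `hbA`.
    -- As ℓ ≤ 8b, the power 16(c+5) of it is at most 2^(-(c+5)ℓ); two factors 2^ℓ pay for the number
    -- of strips.
    have h1 : y ^ 2 ≤ 1 / 2 ^ b := by
      have : y ≤ 2 * (A * ℓ) / 2 ^ b := by
        rw [hy, pow_add, ← div_div]
        gcongr
      have hA2 : ((2 * (A * ℓ) : ℝ)) ^ 2 ≤ 2 ^ b := by exact_mod_cast hbA
      calc y ^ 2 ≤ (2 * (A * ℓ) / 2 ^ b) ^ 2 := pow_le_pow_left₀ hy0 this 2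
        _ = (2 * (A * ℓ)) ^ 2 / (2 ^ b * 2 ^ b) := by rw [div_pow]; ring
        _ ≤ 2 ^ b / (2 ^ b * 2 ^ b) := by gcongr
        _ = 1 / 2 ^ b := by field_simp
    have h2 : y ^ (16 * (c + 5)) ≤ 1 / 2 ^ ((c + 5) * ℓ) := by
      calc y ^ (16 * (c + 5)) = (y ^ 2) ^ (8 * (c + 5)) := by rw [← pow_mul]; congr 1; ring
        _ ≤ (1 / 2 ^ b) ^ (8 * (c + 5)) := pow_le_pow_left₀ (by positivity) h1 _
        _ = 1 / 2 ^ (b * (8 * (c + 5))) := by rw [div_pow, one_pow, ← pow_mul]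
        _ ≤ 1 / 2 ^ ((c + 5) * ℓ) := by
          apply one_div_le_one_div_of_le (by positivity)
          apply pow_le_pow_right₀ (by norm_num)
          nlinarith
    have h3 : y ^ (16 * (c + 5)) / (16 * (c + 5)).factorial ≤ y ^ (16 * (c + 5)) :=
      div_le_self (by positivity) (by exact_mod_cast Nat.one_le_of_lt (Nat.factorial_pos _))
    have h4 : (2 : ℝ) ^ (J + b) ≤ 2 ^ ℓ * 2 ^ ℓ := by
      rw [← pow_add]
      exact pow_le_pow_right₀ (by norm_num) (by omega)
    have e : (2 : ℝ) ^ ((c + 5) * ℓ) = 2 ^ ((c + 3) * ℓ) * (2 ^ ℓ * 2 ^ ℓ) := by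
      rw [← pow_add, ← pow_add]; congr 1; ring
    calc (2 : ℝ) ^ (J + b) * (y ^ (16 * (c + 5)) / (16 * (c + 5)).factorial)
        ≤ (2 ^ ℓ * 2 ^ ℓ) * (1 / 2 ^ ((c + 5) * ℓ)) :=
          mul_le_mul h4 (h3.trans h2) (by positivity) (by positivity)
      _ = δ := by rw [e, hδ]; field_simp
  -- no empty box
  have hvac : ∀ i ≤ J, law n (Vacant n (i + 2) (J - i + 1)) ≤ ENNReal.ofReal δ := by
    intro i hi
    refine (law_empty_box_le n _ _).trans (ENNReal.ofReal_le_ofReal ?_)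
    have e0 : i + 2 + (J - i + 1) = J + 3 := by omega
    rw [e0]
    have h0 : (2 : ℝ) ^ J * (A * ℓ) ≤ n := by exact_mod_cast hJ
    have hAc : (A : ℝ) = 8 * (c + 4) := by rw [hA]; push_cast; ring
    -- The factor 8 in `A` compensates for the area 2^(-J-3) of the box, which is an eighth of that
    -- of a cell.
    have h1 : ((c + 4) * ℓ : ℝ) ≤ n / 2 ^ (J + 3) := by
      rw [le_div_iff₀ (by positivity), pow_add]
      rw [hAc] at h0
      linarith
    have h2 : (2 : ℝ) ^ (J + 3) ≤ 2 ^ ℓ := by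
      refine le_trans ?_ hnℓ'
      have hl : (1 : ℝ) ≤ ℓ := by exact_mod_cast (by omega : 1 ≤ ℓ)
      have hA8 : (8 : ℝ) ≤ A * ℓ := by rw [hAc]; nlinarith [(Nat.cast_nonneg c : (0 : ℝ) ≤ c)]
      rw [pow_add]
      nlinarith [(by positivity : (0 : ℝ) < 2 ^ J)]
    have h3 : Real.exp (-(n / 2 ^ (J + 3))) ≤ 1 / 2 ^ ((c + 4) * ℓ) := by
      rw [Real.exp_neg, ← one_div]
      apply one_div_le_one_div_of_le (by positivity)
      calc (2 : ℝ) ^ ((c + 4) * ℓ) ≤ Real.exp 1 ^ ((c + 4) * ℓ) := by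
            apply pow_le_pow_left₀ (by norm_num)
            have := Real.add_one_le_exp (1 : ℝ)
            linarith
        _ = Real.exp (((c + 4) * ℓ : ℕ) : ℝ) := by rw [← Real.exp_nat_mul, mul_one]
        _ ≤ _ := Real.exp_le_exp.2 (by push_cast; exact h1)
    have e : (2 : ℝ) ^ ((c + 4) * ℓ) = 2 ^ ((c + 3) * ℓ) * 2 ^ ℓ := by
      rw [← pow_add]; congr 1; ring
    calc (2 : ℝ) ^ (J + 3) * Real.exp (-(n / 2 ^ (J + 3)))
        ≤ 2 ^ ℓ * (1 / 2 ^ ((c + 4) * ℓ)) := mul_le_mul h2 h3 (Real.exp_pos _).le (by positivity)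
      _ = δ := by rw [e, hδ]; field_simp
  have hsum : law n (⋃ i ∈ Finset.range (J + 1), (Crowded n i (J - i) S ∪
      (Crowded n (i + b) (J - i) (16 * (c + 5)) ∪ (Crowded n i (J - i + b) (16 * (c + 5)) ∪
        Vacant n (i + 2) (J - i + 1))))) ≤ ENNReal.ofReal (4 * ε) := by
    refine (measure_biUnion_finset_le _ _).trans ?_
    have h4 : ∀ i ∈ Finset.range (J + 1), law n (Crowded n i (J - i) S ∪
        (Crowded n (i + b) (J - i) (16 * (c + 5)) ∪ (Crowded n i (J - i + b) (16 * (c + 5)) ∪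
          Vacant n (i + 2) (J - i + 1)))) ≤ ENNReal.ofReal (4 * δ) := by
      intro i hi
      have hi' : i ≤ J := by simpa [Nat.lt_succ_iff] using hi
      have e : ENNReal.ofReal (4 * δ) = ENNReal.ofReal δ + (ENNReal.ofReal δ +
          (ENNReal.ofReal δ + ENNReal.ofReal δ)) := by
        rw [← ENNReal.ofReal_add hδ0 hδ0, ← ENNReal.ofReal_add hδ0 (by positivity),
          ← ENNReal.ofReal_add hδ0 (by positivity)]
        congr 1; ring
      rw [e]
      refine (measure_union_le _ _).trans (add_le_add (hload i hi') ?_)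
      refine (measure_union_le _ _).trans (add_le_add (hstrip _ _ (by omega)) ?_)
      exact (measure_union_le _ _).trans (add_le_add (hstrip _ _ (by omega)) (hvac i hi'))
    refine (Finset.sum_le_sum h4).trans ?_
    rw [Finset.sum_const, Finset.card_range, nsmul_eq_mul, ← ENNReal.ofReal_natCast,
      ← ENNReal.ofReal_mul (by positivity)]
    apply ENNReal.ofReal_le_ofReal
    have hJn : ((J + 1 : ℕ) : ℝ) ≤ 2 ^ ℓ := by
      exact_mod_cast hJℓ.trans Nat.lt_two_pow_self.le
    have e : ε = 2 ^ ℓ * δ := by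
      have : (2 : ℝ) ^ ((c + 3) * ℓ) = 2 ^ ((c + 2) * ℓ) * 2 ^ ℓ := by
        rw [← pow_add]; congr 1; ring
      rw [hε, hδ, this]; field_simp
    rw [e]
    nlinarith
  have hε0 : 0 ≤ ε := by positivity
  refine (measure_mono (not_typical_subset n J S b (16 * (c + 5)) ((c + 4) * ℓ))).trans ?_
  refine (measure_union_le _ _).trans ?_
  rw [law_not_inside, zero_add]
  refine (measure_union_le _ _).trans ((add_le_add (hdist _ _ (by ring)) ((measure_union_le _ _).trans
    (add_le_add (hdist _ _ (by ring)) hsum))).trans ?_)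
  rw [← ENNReal.ofReal_add hε0 (by positivity), ← ENNReal.ofReal_add hε0 (by positivity)]
  apply ENNReal.ofReal_le_ofReal
  have h8 : (8 : ℝ) ≤ 2 ^ ℓ := by
    calc (8 : ℝ) = 2 ^ 3 := by norm_num
      _ ≤ 2 ^ ℓ := pow_le_pow_right₀ (by norm_num) hℓ
  have hnc : (n : ℝ) ^ c ≤ 2 ^ (c * ℓ) := by
    rw [mul_comm, pow_mul]
    exact pow_le_pow_left₀ (by positivity) hnℓ' c
  have hn0 : (0 : ℝ) < n := by exact_mod_cast hn
  have e : (2 : ℝ) ^ ((c + 2) * ℓ) = 2 ^ (c * ℓ) * (2 ^ ℓ * 2 ^ ℓ) := by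
    rw [← pow_add, ← pow_add]; congr 1; ring
  -- Two defects of general position and four kinds of local defects; the factor 6 is absorbed by
  -- 2^(2ℓ).
  calc ε + (ε + 4 * ε) = 6 * ε := by ring
    _ ≤ 1 / 2 ^ (c * ℓ) := by
      rw [hε, e, mul_one_div, div_le_div_iff₀ (by positivity) (by positivity)]
      have h9 : (0 : ℝ) < 2 ^ (c * ℓ) := by positivity
      have h10 : (6 : ℝ) ≤ 2 ^ ℓ * 2 ^ ℓ := by nlinarith
      nlinarith
    _ ≤ 1 / (n : ℝ) ^ c := one_div_le_one_div_of_le (by positivity) hnc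

end RandomPoints

namespace RealRAM

/-! ### Program logic -/

instance : Add (Expr .word) := ⟨.wordOp .add⟩
instance : Sub (Expr .word) := ⟨.wordOp .sub⟩
instance : Mul (Expr .word) := ⟨.wordOp .mul⟩
instance : Div (Expr .word) := ⟨.wordOp .div⟩
instance : Mod (Expr .word) := ⟨.wordOp .mod⟩
instance : Sub (Expr .real) := ⟨.realOp .sub⟩
instance : Mul (Expr .real) := ⟨.realOp .mul⟩
instance : Div (Expr .real) := ⟨.realOp .div⟩

/-- A word register. -/
abbrev W (x : ℕ) : Expr .word := .var .word x
/-- A real register. -/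
abbrev R (x : ℕ) : Expr .real := .var .real x
/-- A cell of a word array. -/
abbrev WA (a : ℕ) (i : Expr .word) : Expr .word := .get .word a i
/-- A cell of a real array. -/
abbrev RA (a : ℕ) (i : Expr .word) : Expr .real := .get .real a i
/-- A word constant. -/
abbrev Lit (k : ℕ) : Expr .word := .lit k
/-- The test `e < f` for words. -/
abbrev Lt (e f : Expr .word) : Expr .word := .wordOp .lt e f
/-- The test `e = f` for words. -/
abbrev Eq' (e f : Expr .word) : Expr .word := .wordOp .eq e f
/-- Assignment to a word register. -/
abbrev setW (x : ℕ) (e : Expr .word) : Cmd := .set .word x e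
/-- Assignment to a real register. -/
abbrev setR (x : ℕ) (e : Expr .real) : Cmd := .set .real x e
/-- Assignment to a cell of a word array. -/
abbrev putW (a : ℕ) (i e : Expr .word) : Cmd := .put .word a i e
/-- Assignment to a cell of a real array. -/
abbrev putR (a : ℕ) (i : Expr .word) (e : Expr .real) : Cmd := .put .real a i e

/-- The smaller of two words. -/
abbrev minE (e f : Expr .word) : Expr .word := e - (e - f)
/-- The larger of two words. -/
abbrev maxE (e f : Expr .word) : Expr .word := e + (f - e)

infixr:40 ";;" => Cmd.seq

/-- In memory `s` the word expression has value `v`, and its evaluation only touches indices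
below `S`. -/
def Gives (w : ℕ) (S : ℕ∞) (s : Mem) (e : Expr .word) (v : ℕ) : Prop :=
  e.evalW w s = v ∧ (e.space w s : ℕ∞) ≤ S

/-- In memory `s` the real expression has value `v`, and its evaluation only touches indices
below `S`. -/
def GivesR (w : ℕ) (S : ℕ∞) (s : Mem) (e : Expr .real) (v : ℝ) : Prop :=
  e.evalR w s = v ∧ (e.space w s : ℕ∞) ≤ S

section
variable {w : ℕ} {S : ℕ∞} {s : Mem} {e f : Expr .word} {u v : ℕ} {e' f' : Expr .real} {x y : ℝ}

/-- Space bounds are extended naturals, so that the same rules serve the construction, with a finite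
bound, and the queries, with bound `⊤`. -/
theorem space_max {m k : ℕ} (h : (m : ℕ∞) ≤ S) (h' : (k : ℕ∞) ≤ S) : ((max m k : ℕ) : ℕ∞) ≤ S := by
  rcases le_total m k with hh | hh
  · rwa [max_eq_right hh]
  · rwa [max_eq_left hh]

theorem Gives.cast (h : Gives w S s e u) (huv : u = v) : Gives w S s e v := huv ▸ h

theorem GivesR.cast (h : GivesR w S s e' x) (hxy : x = y) : GivesR w S s e' y := hxy ▸ h

theorem gives_lit {k : ℕ} (hk : k < 2 ^ w) : Gives w S s (Lit k) k :=
  ⟨Nat.mod_eq_of_lt hk, by simp [Expr.space]⟩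

theorem gives_var {r : ℕ} (h : s.wv r = v) : Gives w S s (W r) v :=
  ⟨h, by simp [Expr.space]⟩

theorem givesR_var {r : ℕ} (h : s.rv r = x) : GivesR w S s (R r) x :=
  ⟨h, by simp [Expr.space]⟩

theorem Gives.get {a i : ℕ} (hi : Gives w S s e i) (hS : ((i + 1 : ℕ) : ℕ∞) ≤ S)
    (h : s.wa a i = v) : Gives w S s (WA a e) v := by
  refine ⟨by rw [← h, ← hi.1]; rfl, space_max hi.2 ?_⟩
  have : (Expr.eval w s e : ℕ) = i := hi.1
  rw [this]
  exact hS

theorem Gives.getR {a i : ℕ} (hi : Gives w S s e i) (hS : ((i + 1 : ℕ) : ℕ∞) ≤ S)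
    (h : s.ra a i = x) : GivesR w S s (RA a e) x := by
  refine ⟨by rw [← h, ← hi.1]; rfl, space_max hi.2 ?_⟩
  have : (Expr.eval w s e : ℕ) = i := hi.1
  rw [this]
  exact hS

theorem Gives.add (he : Gives w S s e u) (hf : Gives w S s f v) (h : u + v < 2 ^ w) :
    Gives w S s (e + f) (u + v) := by
  refine ⟨?_, space_max he.2 hf.2⟩
  change (e.evalW w s + f.evalW w s) % 2 ^ w = _
  rw [he.1, hf.1, Nat.mod_eq_of_lt h]

theorem Gives.sub (he : Gives w S s e u) (hf : Gives w S s f v) : Gives w S s (e - f) (u - v) := by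
  refine ⟨?_, space_max he.2 hf.2⟩
  change e.evalW w s - f.evalW w s = _
  rw [he.1, hf.1]

theorem Gives.mul (he : Gives w S s e u) (hf : Gives w S s f v) (h : u * v < 2 ^ w) :
    Gives w S s (e * f) (u * v) := by
  refine ⟨?_, space_max he.2 hf.2⟩
  change (e.evalW w s * f.evalW w s) % 2 ^ w = _
  rw [he.1, hf.1, Nat.mod_eq_of_lt h]

theorem Gives.div (he : Gives w S s e u) (hf : Gives w S s f v) : Gives w S s (e / f) (u / v) := by
  refine ⟨?_, space_max he.2 hf.2⟩
  change e.evalW w s / f.evalW w s = _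
  rw [he.1, hf.1]

theorem Gives.mod (he : Gives w S s e u) (hf : Gives w S s f v) : Gives w S s (e % f) (u % v) := by
  refine ⟨?_, space_max he.2 hf.2⟩
  change e.evalW w s % f.evalW w s = _
  rw [he.1, hf.1]

theorem one_mod_two_pow (hw : 1 ≤ w) : 1 % 2 ^ w = 1 :=
  Nat.mod_eq_of_lt (Nat.one_lt_two_pow (by omega))

theorem Gives.lt (hw : 1 ≤ w) (he : Gives w S s e u) (hf : Gives w S s f v) :
    Gives w S s (Lt e f) (if u < v then 1 else 0) := by
  refine ⟨?_, space_max he.2 hf.2⟩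
  simp only [Expr.evalW_wordOp, WordOp.eval, he.1, hf.1, one_mod_two_pow hw]

theorem Gives.eq (hw : 1 ≤ w) (he : Gives w S s e u) (hf : Gives w S s f v) :
    Gives w S s (Eq' e f) (if u = v then 1 else 0) := by
  refine ⟨?_, space_max he.2 hf.2⟩
  simp only [Expr.evalW_wordOp, WordOp.eval, he.1, hf.1, one_mod_two_pow hw]

theorem Gives.minE (he : Gives w S s e u) (hf : Gives w S s f v) :
    Gives w S s (minE e f) (min u v) :=
  (he.sub (he.sub hf)).cast (by omega)

theorem Gives.maxE (he : Gives w S s e u) (hf : Gives w S s f v) (h : max u v < 2 ^ w) :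
    Gives w S s (maxE e f) (max u v) :=
  (he.add (hf.sub he) (by omega)).cast (by omega)

open Classical in
theorem GivesR.lt (hw : 1 ≤ w) (he : GivesR w S s e' x) (hf : GivesR w S s f' y) :
    Gives w S s (.realLt e' f') (if x < y then 1 else 0) := by
  refine ⟨?_, space_max he.2 hf.2⟩
  simp only [Expr.evalW_realLt, he.1, hf.1, one_mod_two_pow hw]

theorem GivesR.floor (he : GivesR w S s e' x) (h : ⌊x⌋₊ < 2 ^ w) :
    Gives w S s (.floor e') ⌊x⌋₊ := by
  refine ⟨?_, he.2⟩
  rw [Expr.evalW_floor, he.1]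
  omega

/-- The saturating form is needed for the reciprocal of the width of a rectangle, which is
unbounded. -/
theorem GivesR.floor_min (he : GivesR w S s e' x) :
    Gives w S s (.floor e') (min ⌊x⌋₊ (2 ^ w - 1)) := by
  refine ⟨?_, he.2⟩
  rw [Expr.evalW_floor, he.1]

theorem Gives.toReal (he : Gives w S s e u) : GivesR w S s (.cast e) (u : ℝ) :=
  ⟨by rw [Expr.evalR_cast, he.1], he.2⟩

theorem GivesR.sub (he : GivesR w S s e' x) (hf : GivesR w S s f' y) :
    GivesR w S s (e' - f') (x - y) :=
  ⟨by change e'.evalR w s - f'.evalR w s = _; rw [he.1, hf.1], space_max he.2 hf.2⟩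

theorem GivesR.mul (he : GivesR w S s e' x) (hf : GivesR w S s f' y) :
    GivesR w S s (e' * f') (x * y) :=
  ⟨by change e'.evalR w s * f'.evalR w s = _; rw [he.1, hf.1], space_max he.2 hf.2⟩

theorem GivesR.div (he : GivesR w S s e' x) (hf : GivesR w S s f' y) :
    GivesR w S s (e' / f') (x / y) :=
  ⟨by change e'.evalR w s / f'.evalR w s = _; rw [he.1, hf.1], space_max he.2 hf.2⟩

end

/-- The program halts, it only touches indices below `S`, and the final memory satisfies `Q`. -/
def Runs (w : ℕ) (S : ℕ∞) (c : Cmd) (s : Mem) (Q : Mem → Prop) : Prop :=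
  ∃ s' t m, Exec w c s s' t m ∧ (m : ℕ∞) ≤ S ∧ Q s'

section
variable {w : ℕ} {S : ℕ∞} {s : Mem} {Q Q' : Mem → Prop} {c d : Cmd}

theorem Runs.mono (h : Runs w S c s Q) (hQ : ∀ s', Q s' → Q' s') : Runs w S c s Q' := by
  obtain ⟨s', t, m, h1, h2, h3⟩ := h
  exact ⟨s', t, m, h1, h2, hQ _ h3⟩

theorem runs_skip (h : Q s) : Runs w S .skip s Q := ⟨s, _, _, .skip s, by simp, h⟩

theorem runs_setW {x : ℕ} {e : Expr .word} {v : ℕ} (he : Gives w S s e v)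
    (h : Q (s.setVar .word x v)) : Runs w S (setW x e) s Q :=
  ⟨_, _, _, .set s .word x e, he.2, by rwa [show Expr.eval w s e = v from he.1]⟩

theorem runs_setR {x : ℕ} {e : Expr .real} {v : ℝ} (he : GivesR w S s e v)
    (h : Q (s.setVar .real x v)) : Runs w S (setR x e) s Q :=
  ⟨_, _, _, .set s .real x e, he.2, by rwa [show Expr.eval w s e = v from he.1]⟩

theorem runs_putW {a : ℕ} {i e : Expr .word} {j v : ℕ} (hi : Gives w S s i j)
    (he : Gives w S s e v) (hj : ((j + 1 : ℕ) : ℕ∞) ≤ S) (h : Q (s.setArr .word a j v)) :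
    Runs w S (putW a i e) s Q := by
  have h1 : (Expr.eval w s i : ℕ) = j := hi.1
  have h2 : (Expr.eval w s e : ℕ) = v := he.1
  refine ⟨_, _, _, .put s .word a i e, space_max (space_max hi.2 he.2) ?_, ?_⟩
  · rw [h1]; exact hj
  · rw [h1, h2]; exact h

theorem runs_putR {a : ℕ} {i : Expr .word} {e : Expr .real} {j : ℕ} {v : ℝ} (hi : Gives w S s i j)
    (he : GivesR w S s e v) (hj : ((j + 1 : ℕ) : ℕ∞) ≤ S) (h : Q (s.setArr .real a j v)) :
    Runs w S (putR a i e) s Q := by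
  have h1 : (Expr.eval w s i : ℕ) = j := hi.1
  have h2 : (Expr.eval w s e : ℝ) = v := he.1
  refine ⟨_, _, _, .put s .real a i e, space_max (space_max hi.2 he.2) ?_, ?_⟩
  · rw [h1]; exact hj
  · rw [h1, h2]; exact h

theorem Runs.seq (h : Runs w S c s fun s' => Runs w S d s' Q) : Runs w S (c ;; d) s Q := by
  obtain ⟨s', t, m, h1, h2, s'', t', m', h3, h4, h5⟩ := h
  exact ⟨s'', _, _, .seq h1 h3, space_max h2 h4, h5⟩

theorem runs_cond {b : Expr .word} {v : ℕ} (hb : Gives w S s b v) (hc : v ≠ 0 → Runs w S c s Q)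
    (hd : v = 0 → Runs w S d s Q) : Runs w S (.cond b c d) s Q := by
  by_cases h0 : v = 0
  · obtain ⟨s', t, m, h1, h2, h3⟩ := hd h0
    exact ⟨s', _, _, .condFalse (hb.1.trans h0) h1, space_max hb.2 h2, h3⟩
  · obtain ⟨s', t, m, h1, h2, h3⟩ := hc h0
    exact ⟨s', _, _, .condTrue (fun h => h0 (hb.1.symm.trans h)) h1, space_max hb.2 h2, h3⟩

end

/-- The memories agree on all cells that the program does not write. -/
structure Frame (c : Cmd) (s s' : Mem) : Prop where
  wv : ∀ {x : ℕ}, c.writesVar .word x = false → s'.wv x = s.wv x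
  rv : ∀ {x : ℕ}, c.writesVar .real x = false → s'.rv x = s.rv x
  wa : ∀ {a : ℕ}, c.writesArr .word a = false → s'.wa a = s.wa a
  ra : ∀ {a : ℕ}, c.writesArr .real a = false → s'.ra a = s.ra a

theorem Exec.frame {w : ℕ} {c : Cmd} {s s' : Mem} {t m : ℕ} (h : Exec w c s s' t m) :
    Frame c s s' :=
  ⟨fun hx => h.var_eq hx, fun hx => h.var_eq hx, fun hx => h.arr_eq hx, fun hx => h.arr_eq hx⟩

theorem Runs.frame {w : ℕ} {S : ℕ∞} {s : Mem} {Q : Mem → Prop} {c : Cmd} (h : Runs w S c s Q) :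
    Runs w S c s fun s' => Frame c s s' ∧ Q s' := by
  obtain ⟨s', t, m, h1, h2, h3⟩ := h
  exact ⟨s', t, m, h1, h2, h1.frame, h3⟩

/-- The program halts in time `O(S)`, it only touches indices below `S`, and the final memory
satisfies `Q`. -/
def RunsIn (w S : ℕ) (c : Cmd) (s : Mem) (Q : Mem → Prop) : Prop :=
  ∃ s' t m, Exec w c s s' t m ∧ t ≤ 20 * S * c.maxTime ∧ m ≤ S ∧ Q s'

section
variable {w S : ℕ} {s : Mem} {Q Q' : Mem → Prop} {c d : Cmd}

theorem RunsIn.mono (h : RunsIn w S c s Q) (hQ : ∀ s', Q s' → Q' s') : RunsIn w S c s Q' := by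
  obtain ⟨s', t, m, h1, h2, h3, h4⟩ := h
  exact ⟨s', t, m, h1, h2, h3, hQ _ h4⟩

theorem Runs.runsIn (h : Runs w S c s Q) (hc : c.loopFree = true) (hS : 1 ≤ S) :
    RunsIn w S c s Q := by
  obtain ⟨s', t, m, h1, h2, h3⟩ := h
  refine ⟨s', t, m, h1, ?_, by exact_mod_cast h2, h3⟩
  have := h1.time_le_maxTime hc
  nlinarith

/-- `maxTime` counts one round of every loop and is additive, up to the step for the sequence
itself, so one factor proportional to `S` can be kept for an arbitrarily long chain of programs. -/
theorem RunsIn.seq (h : RunsIn w S c s fun s' => RunsIn w S d s' Q) (hS : 1 ≤ S) :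
    RunsIn w S (c ;; d) s Q := by
  obtain ⟨s', t, m, h1, h2, h3, s'', t', m', h4, h5, h6, h7⟩ := h
  refine ⟨s'', _, _, .seq h1 h4, ?_, max_le h3 h6, h7⟩
  simp only [Cmd.maxTime]
  rw [mul_add, mul_add]
  omega

theorem RunsIn.frame (h : RunsIn w S c s Q) :
    RunsIn w S c s fun s' => Frame c s s' ∧ Q s' := by
  obtain ⟨s', t, m, h1, h2, h3, h4⟩ := h
  exact ⟨s', t, m, h1, h2, h3, h1.frame, h4⟩

end

/-- `for W 21 < N do body`; the bound is evaluated once and kept in register `20`. -/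
def forCmd (N : Expr .word) (body : Cmd) : Cmd :=
  setW 20 N ;; setW 21 (Lit 0) ;;
    .loop (Lt (W 21) (W 20)) (body ;; setW 21 (W 21 + Lit 1))

/-- The rule for an invariant `I`. The body is loop-free, so a round costs at most its `maxTime`,
and there are at most `S` rounds. Loops are never nested: double loops are flattened by taking
quotient and remainder of the counter. The factor 20 in `RunsIn` leaves room for the overhead of the
counter. -/
theorem runsIn_for {w S : ℕ} (hw : 1 ≤ w) {s : Mem} {N : Expr .word} {B : ℕ} {body : Cmd}
    (hN : Gives w S s N B) (hB : B < 2 ^ w) (hBS : B ≤ S) (hS : 1 ≤ S) (hlf : body.loopFree = true)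
    (h20 : body.writesVar .word 20 = false) (h21 : body.writesVar .word 21 = false)
    (I : ℕ → Mem → Prop)
    (h0 : I 0 ((s.setVar .word 20 B).setVar .word 21 0))
    (hstep : ∀ k < B, ∀ s', Frame (forCmd N body) s s' → s'.wv 20 = B → s'.wv 21 = k → I k s' →
      Runs w S body s' fun s'' => I (k + 1) (s''.setVar .word 21 (k + 1))) :
    RunsIn w S (forCmd N body) s (I B) := by
  have h1w := one_mod_two_pow hw
  have hloop : ∀ j, ∀ k, k + j = B → ∀ s', Frame (forCmd N body) s s' → s'.wv 20 = B →
      s'.wv 21 = k → I k s' →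
      ∃ s'' t m, Exec w (.loop (Lt (W 21) (W 20)) (body ;; setW 21 (W 21 + Lit 1))) s' s'' t m ∧
        t ≤ j * (body.maxTime + 10) + 4 ∧ m ≤ S ∧ I B s'' := by
    intro j
    induction j with
    | zero =>
      intro k hk s' _ h20' h21' hI
      refine ⟨s', _, _, .loopFalse ?_, ?_, ?_, ?_⟩
      · change Expr.evalW w s' _ = 0
        simp [WordOp.eval, h20', h21', ← hk]
      · simp [Expr.cost]
      · simp [Expr.space]
      · rwa [← hk, add_zero]
    | succ j ih =>
      intro k hk s' hF h20' h21' hI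
      obtain ⟨s₁, t₁, m₁, e₁, a₁, b₁⟩ := hstep k (by omega) s' hF h20' h21' hI
      have ht₁ := e₁.time_le_maxTime hlf
      have f1 : s₁.wv 21 = k := (e₁.frame.wv h21).trans h21'
      have f0 : s₁.wv 20 = B := (e₁.frame.wv h20).trans h20'
      have g := (gives_var (w := w) (S := S) f1).add
        (gives_lit (w := w) (S := S) (s := s₁) (k := 1) (Nat.one_lt_two_pow (by omega)))
        (by omega)
      have e₂ : Exec w (setW 21 (W 21 + Lit 1)) s₁ (s₁.setVar .word 21 (k + 1)) 4 0 := by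
        have := Exec.set (w := w) s₁ .word 21 (W 21 + Lit 1)
        rw [show Expr.eval w s₁ (W 21 + Lit 1) = k + 1 from g.1] at this
        exact this
      have e₃ : Exec w (body ;; setW 21 (W 21 + Lit 1)) s' _ _ _ := .seq e₁ e₂
      have hF' : Frame (forCmd N body) s (s₁.setVar .word 21 (k + 1)) := by
        have hf := e₃.frame
        refine ⟨fun {x} hx => (hf.wv ?_).trans (hF.wv hx), fun {x} hx => (hf.rv ?_).trans (hF.rv hx),
          fun {a} ha => (hf.wa ?_).trans (hF.wa ha), fun {a} ha => (hf.ra ?_).trans (hF.ra ha)⟩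
        · simp only [forCmd, Cmd.writesVar, Bool.or_eq_false_iff] at hx ⊢; exact hx.2.2
        · simp only [forCmd, Cmd.writesVar, Bool.or_eq_false_iff] at hx ⊢; exact hx.2.2
        · simp only [forCmd, Cmd.writesArr, Bool.or_eq_false_iff] at ha ⊢; exact ha.2.2
        · simp only [forCmd, Cmd.writesArr, Bool.or_eq_false_iff] at ha ⊢; exact ha.2.2
      obtain ⟨s₂, t₂, m₂, e₄, ht₂, hm₂, hI₂⟩ := ih (k + 1) (by omega) _ hF'
        (by simpa using f0) (by simp) b₁
      refine ⟨s₂, _, _, .loopTrue ?_ e₃ e₄, ?_, ?_, hI₂⟩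
      · change Expr.evalW w s' _ ≠ 0
        simp only [Expr.evalW_wordOp, WordOp.eval, Expr.evalW_var, h20', h21', h1w]
        rw [if_pos (by omega)]
        norm_num
      · simp only [Expr.cost]
        rw [add_mul]
        omega
      · have : m₁ ≤ S := by exact_mod_cast a₁
        simp [Expr.space]
        omega
  have e₁ : Exec w (setW 20 N) s (s.setVar .word 20 B) (N.cost + 1) (N.space w s) := by
    have := Exec.set (w := w) s .word 20 N
    rwa [show Expr.eval w s N = B from hN.1] at this
  have e₂ : Exec w (setW 21 (Lit 0)) (s.setVar .word 20 B)
      ((s.setVar .word 20 B).setVar .word 21 0) 2 0 := by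
    have := Exec.set (w := w) (s.setVar .word 20 B) .word 21 (Lit 0)
    rw [show Expr.eval w (s.setVar .word 20 B) (Lit 0) = (0 : ℕ) from by simp [Expr.eval]] at this
    exact this
  have hF : Frame (forCmd N body) s ((s.setVar .word 20 B).setVar .word 21 0) := by
    refine ⟨fun {x} hx => ?_, fun {x} hx => ?_, fun {a} ha => rfl, fun {a} ha => rfl⟩
    · simp only [forCmd, Cmd.writesVar, Bool.or_eq_false_iff] at hx
      simp at hx
      simp [hx]
    · simp
  obtain ⟨s₂, t₂, m₂, e₄, ht₂, hm₂, hI₂⟩ := hloop B 0 (by omega) _ hF (by simp) (by simp) h0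
  refine ⟨s₂, _, _, .seq e₁ (.seq e₂ e₄), ?_, ?_, hI₂⟩
  · have h1 : B * (body.maxTime + 10) ≤ S * (body.maxTime + 10) := Nat.mul_le_mul_right _ hBS
    have h2 : (forCmd N body).maxTime = N.cost + body.maxTime + 14 := by
      simp only [forCmd, Cmd.maxTime, Expr.cost]
      omega
    rw [h2]
    nlinarith
  have : N.space w s ≤ S := by exact_mod_cast hN.2
  omega

end RealRAM

namespace RealRAM

open BlindSearch

theorem le_space {j S : ℕ} (h : j < S) : ((j + 1 : ℕ) : ℕ∞) ≤ (S : ℕ∞) := by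
  exact_mod_cast h

/-! ### Tables of powers and logarithms -/

/-- Compute the powers of two up to exponent `W 2` in array `0`. -/
def powCmd : Cmd :=
  putW 0 (Lit 0) (Lit 1) ;; forCmd (W 2) (putW 0 (W 21 + Lit 1) (Lit 2 * WA 0 (W 21)))

/-- Compute the binary logarithms up to `W 0 + 1` in array `1`. -/
def logCmd : Cmd :=
  forCmd (W 0) (putW 1 (W 21 + Lit 2) (WA 1 ((W 21 + Lit 2) / Lit 2) + Lit 1))

theorem runsIn_pow {w SP S : ℕ} {s : Mem} (hS : s.wv 2 = S) (hSw : S < w) (hSP : S < SP)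
    (hw : SP < 2 ^ w) :
    RunsIn w SP powCmd s fun s' => ∀ k ≤ S, s'.wa 0 k = 2 ^ k := by
  have h1 : 1 < 2 ^ w := by omega
  have h2S : ∀ k ≤ S, 2 ^ k < 2 ^ w := fun k hk => Nat.pow_lt_pow_right (by norm_num) (by omega)
  refine RunsIn.seq (RunsIn.mono (Runs.runsIn (Q := fun s' => s'.wa 0 0 = 1 ∧ s'.wv 2 = S)
    (runs_putW (gives_lit (by omega)) (gives_lit h1) (le_space (by omega)) ?_) rfl (by omega)) ?_)
    (by omega)
  · simp [hS]
  rintro s' ⟨h0, hS'⟩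
  refine runsIn_for (by omega) (gives_var hS') (by omega) (by omega) (by omega) rfl rfl rfl
    (fun k s' => ∀ j ≤ k, s'.wa 0 j = 2 ^ j) ?_ ?_
  · intro j hj
    obtain rfl : j = 0 := by omega
    simpa using h0
  · intro k hk r _ _ h21 hI
    have e1 : 2 * 2 ^ k = 2 ^ (k + 1) := by ring
    refine runs_putW ((gives_var h21).add (gives_lit h1) (by omega))
      (((gives_lit (k := 2) (by omega)).mul
        ((gives_var h21).get (le_space (by omega)) (hI k le_rfl))
        (by rw [e1]; exact h2S _ (by omega))).cast e1) (le_space (by omega)) ?_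
    intro j hj
    simp only [Mem.wa_setVar, Mem.wa_setArr_word, if_true, Function.update_apply]
    split_ifs with h
    · rw [h]
    · exact hI j (by omega)

/-- The recursion log k = log (k/2) + 1 for k ≥ 2. The values at 0 and 1 are the zeros initially
present in the array. -/
theorem runsIn_log {w SP n : ℕ} {s : Mem} (hn : s.wv 0 = n) (hz : s.wa 1 = 0)
    (hSP : n + 2 ≤ SP) (hw : 2 * SP < 2 ^ w) :
    RunsIn w SP logCmd s fun s' => ∀ k ≤ n, s'.wa 1 k = Nat.log 2 k := by
  have h1 : 1 < 2 ^ w := by omega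
  refine (runsIn_for (by by_contra h; interval_cases w; omega) (gives_var hn) (by omega) (by omega) (by omega) rfl rfl rfl
    (fun k s' => ∀ j < k + 2, s'.wa 1 j = Nat.log 2 j) ?_ ?_).mono (fun _ h k hk => h k (by omega))
  · intro j hj
    interval_cases j <;> simp [hz]
  · intro k hk r _ _ h21 hI
    have hg := (gives_var (w := w) (S := (SP : ℕ∞)) h21).add (gives_lit (k := 2) (by omega))
      (by omega)
    have hlog : Nat.log 2 ((k + 2) / 2) + 1 = Nat.log 2 (k + 2) := by
      rw [Nat.log_div_base]
      have : 0 < Nat.log 2 (k + 2) := Nat.log_pos (by norm_num) (by omega)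
      omega
    have hle : Nat.log 2 (k + 2) < k + 2 := Nat.log_lt_self 2 (by omega)
    refine runs_putW hg (((((hg.div (gives_lit (k := 2) (by omega))).get (le_space (by omega))
      (hI _ (by omega))).add (gives_lit h1) (by omega))).cast hlog) (le_space (by omega)) ?_
    intro j hj
    simp only [Mem.wa_setVar, Mem.wa_setArr_word, if_true, Function.update_apply]
    split_ifs with h
    · rw [h]
    · exact hI j (by omega)

/-! ### Tables for the blind search -/

/-- Compute the heights where two words branch in array `2`. -/
def sepCmd : Cmd :=
  forCmd (W 6 * W 6) (putW 2 (W 21) ((Lit 1 - Eq' (W 21 / W 6) (W 21 % W 6)) *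
    (WA 2 (W 21 / W 6 / Lit 2 * W 6 + W 21 % W 6 / Lit 2) + Lit 1)))

theorem div_mod_index {a r B : ℕ} (hr : r < B) : (a * B + r) / B = a ∧ (a * B + r) % B = r := by
  constructor
  · rw [add_comm, Nat.add_mul_div_right _ _ (by omega), Nat.div_eq_of_lt hr, zero_add]
  · rw [add_comm, Nat.add_mul_mod_self_right, Nat.mod_eq_of_lt hr]

theorem index_lt {a r A B : ℕ} (ha : a < A) (hr : r < B) : a * B + r < A * B := by
  calc a * B + r < (a + 1) * B := by rw [add_mul]; omega
    _ ≤ A * B := Nat.mul_le_mul_right _ ha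

/-- The recursive definition of `sep`, evaluated in the order of the indices `u * 2 ^ b + v`. -/
theorem runsIn_sep {w SP b : ℕ} {s : Mem} (hB : s.wv 6 = 2 ^ b)
    (hSP : 2 ^ b * 2 ^ b ≤ SP) (hw : 2 * SP < 2 ^ w) (hb : b < SP) :
    RunsIn w SP sepCmd s fun s' =>
      ∀ u < 2 ^ b, ∀ v < 2 ^ b, s'.wa 2 (u * 2 ^ b + v) = sep u v := by
  have hw1 : 1 ≤ w := by by_contra h; interval_cases w; omega
  have h1 : 1 < 2 ^ w := Nat.one_lt_two_pow (by omega)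
  set B := 2 ^ b with hBdef
  have hB0 : 0 < B := by positivity
  refine (runsIn_for hw1 ((gives_var hB).mul (gives_var hB) (by omega)) (by omega) (by omega) (by omega) rfl rfl rfl
    (fun k s' => ∀ j < k, s'.wa 2 j = sep (j / B) (j % B)) ?_ ?_).mono ?_
  · intro j hj; omega
  · intro k hk r hF _ h21 hI
    have hB' : r.wv 6 = B := (hF.wv rfl).trans hB
    have hu : k / B < B := Nat.div_lt_of_lt_mul hk
    have hv : k % B < B := Nat.mod_lt _ hB0
    have hkuv : k / B * B + k % B = k := Nat.div_add_mod' k B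
    have hidx : k / B / 2 * B + k % B / 2 ≤ k := by
      have : k / B / 2 * B ≤ k / B * B := Nat.mul_le_mul_right _ (Nat.div_le_self _ _)
      omega
    have hdm := div_mod_index (a := k / B / 2) (r := k % B / 2) (B := B) (by omega)
    have gu := (gives_var (w := w) (S := (SP : ℕ∞)) h21).div (gives_var hB')
    have gv := (gives_var (w := w) (S := (SP : ℕ∞)) h21).mod (gives_var hB')
    have gi := ((gu.div (gives_lit (k := 2) (by omega))).mul (gives_var hB') (by omega)).add
      (gv.div (gives_lit (k := 2) (by omega))) (by omega)
    have hval : (1 - if k / B = k % B then 1 else 0) *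
        (r.wa 2 (k / B / 2 * B + k % B / 2) + 1) = sep (k / B) (k % B) := by
      rw [sep]
      split_ifs with h
      · simp
      -- Halving both words of a pair of different words gives an earlier pair.
      · have hlt : k / B / 2 * B + k % B / 2 < k := by
          rcases Nat.eq_zero_or_pos (k / B) with h0 | h0
          · rw [h0] at hkuv ⊢
            simp at hkuv ⊢
            omega
          · have : k / B / 2 * B < k / B * B := Nat.mul_lt_mul_of_pos_right (by omega) hB0
            omega
        rw [hI _ hlt, hdm.1, hdm.2]
        omega
    have hsl : sep (k / B) (k % B) ≤ b := sep_le_of_lt hu hv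
    by_cases heq : k / B = k % B
    -- For equal words the cell read may not have been computed and adding 1 may overflow, so the
    -- rules for sums and products do not apply; the factor 0 makes the result correct regardless.
    · have gz : Gives w (SP : ℕ∞) r ((Lit 1 - Eq' (W 21 / W 6) (W 21 % W 6)) *
          (WA 2 (W 21 / W 6 / Lit 2 * W 6 + W 21 % W 6 / Lit 2) + Lit 1)) 0 := by
        have g1 := (gives_lit (s := r) (S := (SP : ℕ∞)) h1).sub (gu.eq hw1 gv)
        rw [if_pos heq] at g1
        have g2 := gi.get (le_space (by omega)) (rfl : r.wa 2 _ = _)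
        refine ⟨?_, space_max g1.2 (space_max g2.2 (by simp [Expr.space]))⟩
        change (Expr.evalW w r _ * Expr.evalW w r _) % 2 ^ w = 0
        rw [g1.1]
        simp
      refine runs_putW (gives_var h21) gz (le_space (by omega)) ?_
      intro j hj
      simp only [Mem.wa_setVar, Mem.wa_setArr_word, if_true, Function.update_apply]
      split_ifs with h
      · rw [h, ← hval, if_pos heq]
        simp
      · exact hI j (by omega)
    · rw [if_neg heq] at hval
      have g1 := (gives_lit (s := r) (S := (SP : ℕ∞)) h1).sub (gu.eq hw1 gv)
      rw [if_neg heq] at g1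
      have g2 := (gi.get (le_space (by omega)) (rfl : r.wa 2 _ = _)).add (gives_lit h1) (by omega)
      refine runs_putW (gives_var h21) ((g1.mul g2 (by omega)).cast hval) (le_space (by omega)) ?_
      intro j hj
      simp only [Mem.wa_setVar, Mem.wa_setArr_word, if_true, Function.update_apply]
      split_ifs with h
      · rw [h]
      · exact hI j (by omega)
  · intro s' h u hu v hv
    have hdm := div_mod_index (a := u) hv
    rw [h _ (index_lt hu hv), hdm.1, hdm.2]

/-- Compute the states of the blind search in the arrays `3`, `4` and `5`. -/
def tabCmd : Cmd :=
  forCmd (WA 0 (W 9 * W 7 + Lit 1) * W 6)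
    (.cond (Lt (W 21 / W 6) (W 8)) .skip
      (setW 22 (W 21 / W 6 / W 8 * W 6 + W 21 % W 6) ;;
      setW 23 (maxE (WA 4 (W 22)) (W 21 / W 6 % W 8)) ;;
      setW 24 (Lit 2 * (W 21 % W 6) / WA 0 (W 23) % Lit 2) ;;
      putW 5 (W 21) (WA 5 (W 22) + Lit 1) ;;
      putW 4 (W 21) ((Lit 1 - W 24) * W 23) ;;
      putW 3 (W 21) (W 24 * (WA 5 (W 22) + Lit 1) + (Lit 1 - W 24) * WA 3 (W 22))))

/-- Used to see that the entries fit in words and that the stored heights are valid indices of the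
table of powers. -/
theorem tab_bounds {β : ℕ} (hβ : 2 ≤ β) (q κ : ℕ) :
    (tab β q κ).1 ≤ (tab β q κ).2.2 ∧ (tab β q κ).2.1 < β ∧ (tab β q κ).2.2 ≤ κ := by
  induction κ using Nat.strong_induction_on with
  | _ κ ih =>
    rw [tab]
    split_ifs with h
    · simp; omega
    · have hlt : κ / β < κ := Nat.div_lt_self (by omega) (by omega)
      obtain ⟨h1, h2, h3⟩ := ih _ hlt
      have hm : κ % β < β := Nat.mod_lt _ (by omega)
      simp only [step]
      split_ifs <;> simp <;> omega

theorem tab_of_lt {β q κ : ℕ} (h : κ < β) : tab β q κ = (0, 0, 0) := by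
  rw [tab, if_pos (.inl h)]

theorem tab_of_le {β q κ : ℕ} (hβ : 2 ≤ β) (h : β ≤ κ) :
    tab β q κ = step q (tab β q (κ / β)) (κ % β) := by
  rw [tab, if_neg (by omega)]

/-- The three components of a state are kept in three arrays, and the state for a code is computed
from that for the code without its last digit, which has a smaller index. The bound 2^(eD+1) exceeds
all codes with at most `D` digits in base 2^e. -/
theorem runsIn_tab {w SP S b e D : ℕ} {s : Mem} (hB : s.wv 6 = 2 ^ b) (hD : s.wv 7 = D)
    (hβ : s.wv 8 = 2 ^ e) (he : s.wv 9 = e) (hpow : ∀ k ≤ S, s.wa 0 k = 2 ^ k)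
    (hz3 : s.wa 3 = 0) (hz4 : s.wa 4 = 0) (hz5 : s.wa 5 = 0) (he1 : 1 ≤ e) (heS : 2 ^ e ≤ S)
    (heD : e * D + 1 ≤ S) (hSS : S < SP) (hSP : 2 ^ (e * D + 1) * 2 ^ b ≤ SP)
    (hw : 4 * SP < 2 ^ w) :
    RunsIn w SP tabCmd s fun s' =>
      ∀ κ < 2 ^ (e * D + 1), ∀ q < 2 ^ b, s'.wa 3 (κ * 2 ^ b + q) = (tab (2 ^ e) q κ).1 := by
  have hw1 : 1 ≤ w := by by_contra h; interval_cases w; omega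
  have h1 : 1 < 2 ^ w := Nat.one_lt_two_pow (by omega)
  have hβ2 : 2 ≤ 2 ^ e := by
    calc 2 = 2 ^ 1 := rfl
      _ ≤ 2 ^ e := Nat.pow_le_pow_right (by norm_num) he1
  set B := 2 ^ b with hBdef
  set β := 2 ^ e with hβdef
  set Z := 2 ^ (e * D + 1) with hZ
  have hB0 : 0 < B := by positivity
  have hZ0 : 0 < Z := by positivity
  have hZZ : Z ≤ Z * B := Nat.le_mul_of_pos_right _ hB0
  have hBB : B ≤ Z * B := Nat.le_mul_of_pos_left _ hZ0
  have gN : Gives w SP s (WA 0 (W 9 * W 7 + Lit 1) * W 6) (Z * B) :=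
    Gives.mul (((((gives_var he).mul (gives_var hD) (by omega)).add
      (gives_lit h1) (by omega)).get (le_space (by omega)) (hpow _ heD))) (gives_var hB) (by omega)
  refine (runsIn_for hw1 gN (by omega) (by omega) (by omega) rfl rfl rfl
    (fun k s' => (∀ j < k, (s'.wa 3 j, s'.wa 4 j, s'.wa 5 j) = tab β (j % B) (j / B)) ∧
      ∀ j, k ≤ j → (s'.wa 3 j, s'.wa 4 j, s'.wa 5 j) = (0, 0, 0)) ?_ ?_).mono ?_
  · refine ⟨fun j hj => by omega, fun j _ => by simp [hz3, hz4, hz5]⟩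
  · intro k hk r hF _ h21 hI
    have hB' : r.wv 6 = B := (hF.wv rfl).trans hB
    have hβ' : r.wv 8 = β := (hF.wv rfl).trans hβ
    have hpow' : ∀ k ≤ S, r.wa 0 k = 2 ^ k := by rw [hF.wa rfl]; exact hpow
    have hκ : k / B < Z := Nat.div_lt_of_lt_mul (by rwa [mul_comm])
    have hq : k % B < B := Nat.mod_lt _ hB0
    have gκ := (gives_var (w := w) (S := (SP : ℕ∞)) h21).div (gives_var hB')
    refine runs_cond (gκ.lt hw1 (gives_var hβ')) (fun h => runs_skip ?_) (fun h => ?_)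
    -- Codes with a single digit have the state (0, 0, 0). Nothing is written, and the second half
    -- of the invariant says that the cells are still zero.
    · have hlt : k / B < β := by by_contra hc; simp [hc] at h
      simp only [Mem.wa_setVar]
      refine ⟨fun j hj => ?_, fun j hj => hI.2 j (by omega)⟩
      by_cases hjk : j = k
      · rw [hjk, tab_of_lt hlt]
        exact hI.2 k le_rfl
      · exact hI.1 j (by omega)
    · have hge : β ≤ k / B := by by_contra hc; simp [not_le.1 hc] at h
      set κ := k / B with hκdef
      set q := k % B with hqdef
      have hκβ : κ / β < κ := Nat.div_lt_self (by omega) (by omega)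
      have hkk : κ * B + q = k := Nat.div_add_mod' k B
      set pr := κ / β * B + q with hpr
      have hprB := Nat.mul_lt_mul_of_pos_right hκβ hB0
      have hprk : pr < k := by omega
      have hdm := div_mod_index (a := κ / β) hq
      have htab := hI.1 pr hprk
      rw [hpr, hdm.1, hdm.2, ← hpr] at htab
      obtain ⟨b1, b2, b3⟩ := tab_bounds hβ2 q (κ / β)
      have hstep := tab_of_le (q := q) hβ2 hge
      rw [← htab] at hstep b1 b2 b3
      simp only at b1 b2 b3
      have hmod : κ % β < β := Nat.mod_lt _ (by omega)
      have hmaxβ : max (r.wa 4 pr) (κ % β) < β := max_lt b2 hmod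
      apply Runs.seq
      refine runs_setW (v := pr) (((gκ.div (gives_var hβ')).mul (gives_var hB')
        (by omega)).add ((gives_var h21).mod (gives_var hB')) (by omega)) ?_
      apply Runs.seq
      refine runs_setW (v := max (r.wa 4 pr) (κ % β)) (Gives.maxE
        ((gives_var (v := pr) (by simp)).get (le_space (by omega)) (by simp))
        (((gives_var (by simpa using h21)).div (gives_var (by simpa using hB'))).mod
          (gives_var (by simpa using hβ'))) (by omega)) ?_
      apply Runs.seq
      refine runs_setW (v := bitBelow q (max (r.wa 4 pr) (κ % β)))
        (((((gives_lit (k := 2) (by omega)).mul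
          ((gives_var (by simpa using h21)).mod (gives_var (by simpa using hB'))) (by omega)).div
          ((gives_var (v := max (r.wa 4 pr) (κ % β)) (by simp)).get (le_space (by omega))
            (by simpa using hpow' _ (by omega)))).mod (gives_lit (by omega)))) ?_
      set M := max (r.wa 4 pr) (κ % β) with hM
      set t := bitBelow q M with ht
      have ht01 : t = 0 ∨ t = 1 := bitBelow_eq_zero_or_one _ _
      have hres : ((if t = 1 then (r.wa 5 pr + 1, 0, r.wa 5 pr + 1)
          else (r.wa 3 pr, M, r.wa 5 pr + 1)) : ℕ × ℕ × ℕ) = tab β q κ := hstep.symm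
      apply Runs.seq
      refine runs_putW (gives_var (v := k) (by simpa using h21))
        (((gives_var (v := pr) (by simp)).get (v := r.wa 5 pr) (le_space (by omega)) (by simp)).add
          (gives_lit h1) (by omega)) (le_space (by omega)) ?_
      apply Runs.seq
      refine runs_putW (gives_var (v := k) (by simpa using h21))
        (v := (1 - t) * M) (((gives_lit h1).sub (gives_var (by simp))).mul (gives_var (by simp))
          (by rcases ht01 with h | h <;> rw [h] <;> simp <;> omega)) (le_space (by omega)) ?_
      -- Array 5 is read at the predecessor once more after it has been overwritten at the current
      -- index.
      have hne : pr ≠ k := by omega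
      refine runs_putW (gives_var (v := k) (by simpa using h21))
        (v := t * (r.wa 5 pr + 1) + (1 - t) * r.wa 3 pr)
        (((gives_var (by simp)).mul (((gives_var (v := pr) (by simp)).get (le_space (by omega))
          (by simp [hne])).add (gives_lit h1) (by omega))
          (by rcases ht01 with h | h <;> rw [h] <;> simp <;> omega)).add
          (((gives_lit h1).sub (gives_var (by simp))).mul ((gives_var (v := pr) (by simp)).get
          (le_space (by omega)) (by simp)) (by rcases ht01 with h | h <;> rw [h] <;> simp <;> omega))
          (by rcases ht01 with h | h <;> rw [h] <;> simp <;> omega)) (le_space (by omega)) ?_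
      simp only [Mem.wa_setVar, Mem.wa_setArr_word]
      norm_num only
      simp only [if_true, Function.update_apply]
      refine ⟨fun j hj => ?_, fun j hj => ?_⟩
      · by_cases hjk : j = k
        · subst hjk
          simp only [if_true]
          rw [← hκdef, ← hqdef, ← hres]
          rcases ht01 with h | h <;> simp [h]
        · simp only [hjk, if_false, Function.update_apply]
          exact hI.1 j (by omega)
      · have hjk : j ≠ k := by omega
        simp only [hjk, if_false, Function.update_apply]
        exact hI.2 j (by omega)
  · intro s' h κ hκ q hq
    have hdm := div_mod_index (a := κ) hq
    have := h.1 _ (index_lt hκ hq)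
    rw [hdm.1, hdm.2] at this
    rw [← this]

end RealRAM

namespace RealRAM

/-! ### Distribution of items into lists -/

/-- The number of earlier items in the same list as item `z`. -/
def pos (f : ℕ → ℕ) (z : ℕ) : ℕ := Nat.count (fun y => f y = f z) z

theorem pos_lt_count {f : ℕ → ℕ} {z k : ℕ} (h : z < k) :
    pos f z < Nat.count (fun y => f y = f z) k :=
  Nat.count_strict_mono (p := fun y => f y = f z) rfl h

/-- Within one list positions increase strictly, and different lists use disjoint ranges of length
`S`. -/
theorem slot_ne {f : ℕ → ℕ} {S y z : ℕ} (hyz : y < z) (hy : pos f y < S) (hz : pos f z < S) :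
    f y * S + pos f y ≠ f z * S + pos f z := by
  intro h
  have h1 := congrArg (· / S) h
  have h2 := congrArg (· % S) h
  simp only [(div_mod_index hy).1, (div_mod_index hy).2, (div_mod_index hz).1,
    (div_mod_index hz).2] at h1 h2
  have := pos_lt_count (f := f) hyz
  rw [h1, ← pos] at this
  omega

theorem pos_nth {f : ℕ → ℕ} {g r k : ℕ} (hr : r < Nat.count (fun y => f y = g) k) :
    Nat.nth (fun y => f y = g) r < k ∧ f (Nat.nth (fun y => f y = g) r) = g ∧
      pos f (Nat.nth (fun y => f y = g) r) = r := by
  have h1 : Nat.nth (fun y => f y = g) r < k := Nat.nth_lt_of_lt_count hr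
  have h2 : ∀ hf : (Set.ofPred fun y => f y = g).Finite, r < hf.toFinset.card := fun hf =>
    hr.trans_le (Nat.count_le_card hf k)
  have h3 : f (Nat.nth (fun y => f y = g) r) = g := Nat.nth_mem r h2
  refine ⟨h1, h3, ?_⟩
  rw [pos, h3]
  exact Nat.count_nth h2

/-! ### Sorting -/

/-- The positions in increasing order of the coordinate. -/
structure IsOrder (n : ℕ) (V : ℕ → ℝ) (ord : ℕ → ℕ) : Prop where
  lt : ∀ r < n, ord r < n
  mono : ∀ r r', r < r' → r' < n → V (ord r) < V (ord r')
  surj : ∀ p < n, ∃ r < n, ord r = p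

open Classical in
/-- The number of points with a smaller coordinate. -/
noncomputable def rank (n : ℕ) (V : ℕ → ℝ) (p : ℕ) : ℕ := ((Finset.range n).filter (V · < V p)).card

theorem rank_lt_rank {n p q : ℕ} {V : ℕ → ℝ} (hp : p < n) (h : V p < V q) :
    rank n V p < rank n V q := by
  refine Finset.card_lt_card ((Finset.ssubset_iff_of_subset ?_).2 ⟨p, ?_⟩)
  · intro r
    simp only [Finset.mem_filter, Finset.mem_range]
    exact fun hr => ⟨hr.1, hr.2.trans h⟩
  · simp [hp, h]

theorem rank_lt {n p : ℕ} {V : ℕ → ℝ} (hp : p < n) : rank n V p < n := by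
  refine (Finset.card_lt_card (Finset.filter_ssubset.2 ⟨p, ?_⟩)).trans_eq (Finset.card_range n)
  simp [hp]

/-- Distinct coordinates have distinct ranks below `n`, so the ranks are a permutation. -/
theorem isOrder_of_rank {n : ℕ} {V : ℕ → ℝ} {ord : ℕ → ℕ}
    (hV : ∀ p < n, ∀ q < n, p ≠ q → V p ≠ V q) (h : ∀ p < n, ord (rank n V p) = p) :
    IsOrder n V ord := by
  have hs : ∀ r < n, ∃ p < n, rank n V p = r := by
    have := Finset.surj_on_of_inj_on_of_card_le (s := Finset.range n) (t := Finset.range n)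
      (fun p _ => rank n V p) (fun p hp => Finset.mem_range.2 (rank_lt (Finset.mem_range.1 hp)))
      (fun p q hp hq hpq => by
        by_contra hne
        have hp := Finset.mem_range.1 hp
        have hq := Finset.mem_range.1 hq
        rcases lt_or_gt_of_ne (hV p hp q hq hne) with hlt | hlt
        · exact absurd hpq (rank_lt_rank hp hlt).ne
        · exact absurd hpq (rank_lt_rank hq hlt).ne') le_rfl
    intro r hr
    obtain ⟨p, hp, hpr⟩ := this r (Finset.mem_range.2 hr)
    exact ⟨p, Finset.mem_range.1 hp, hpr.symm⟩
  refine ⟨fun r hr => ?_, fun r r' hrr hr' => ?_, fun p hp => ⟨_, rank_lt hp, h p hp⟩⟩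
  · obtain ⟨p, hp, rfl⟩ := hs r hr
    rwa [h p hp]
  · obtain ⟨p, hp, rfl⟩ := hs r (hrr.trans hr')
    obtain ⟨q, hq, rfl⟩ := hs r' hr'
    rw [h p hp, h q hq]
    by_contra hc
    rcases (not_lt.1 hc).lt_or_eq with hlt | heq
    · exact absurd (rank_lt_rank hq hlt) (by omega)
    · by_cases hpq : p = q
      · rw [hpq] at hrr; omega
      · exact hV p hp q hq hpq heq.symm

/-- The slab of a point. -/
noncomputable def slab (J : ℕ) (V : ℕ → ℝ) (p : ℕ) : ℕ := ⌊V p * 2 ^ J⌋₊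

-- The slab is a monotone function of the coordinate: a smaller coordinate lies in an earlier slab,
-- or in the same slab.
open Classical in
theorem count_slab_add {n J p : ℕ} {V : ℕ → ℝ} :
    Nat.count (fun q => slab J V q < slab J V p) n +
      ((Finset.range n).filter fun q => slab J V q = slab J V p ∧ V q < V p).card = rank n V p := by
  rw [Nat.count_eq_card_filter_range, ← Finset.card_union_of_disjoint, rank]
  · congr 1
    ext q
    simp only [Finset.mem_union, Finset.mem_filter, Finset.mem_range]
    have hmono : V q ≤ V p → slab J V q ≤ slab J V p := fun h =>
      Nat.floor_le_floor (mul_le_mul_of_nonneg_right h (by positivity))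
    have hmono' : V p ≤ V q → slab J V p ≤ slab J V q := fun h =>
      Nat.floor_le_floor (mul_le_mul_of_nonneg_right h (by positivity))
    constructor
    · rintro (⟨h1, h2⟩ | ⟨h1, h2, h3⟩)
      · exact ⟨h1, by by_contra hc; exact absurd (hmono' (not_lt.1 hc)) (by omega)⟩
      · exact ⟨h1, h3⟩
    · rintro ⟨h1, h2⟩
      have := hmono h2.le
      rcases this.lt_or_eq with h | h
      · exact .inl ⟨h1, h⟩
      · exact .inr ⟨h1, h, h2⟩
  · rw [Finset.disjoint_left]
    simp only [Finset.mem_filter]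
    rintro q ⟨_, h1⟩ ⟨_, h2, _⟩
    omega

/-- Distribute the points into slabs of width `1 / W 4`. -/
def slabCmd (a : ℕ) : Cmd :=
  forCmd (W 0)
    (setW 22 (.floor (RA a (W 21) * .cast (W 4))) ;;
    putW (16 + a) (W 22 * W 2 + WA (14 + a) (W 22)) (W 21) ;;
    putW (14 + a) (W 22) (WA (14 + a) (W 22) + Lit 1))

/-- Compute the number of points in the slabs before each slab. -/
def startCmd (a : ℕ) : Cmd :=
  forCmd (W 4) (putW (18 + a) (W 21 + Lit 1) (WA (18 + a) (W 21) + WA (14 + a) (W 21)))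

/-- Compute the rank of each point in its slab. -/
def slabRankCmd (a : ℕ) : Cmd :=
  forCmd (W 0 * W 2)
    (setW 22 (W 21 / W 2) ;;
    setW 23 (.floor (RA a (W 22) * .cast (W 4))) ;;
    .cond (Lt (W 21 % W 2) (WA (14 + a) (W 23)))
      (.cond (.realLt (RA a (WA (16 + a) (W 23 * W 2 + W 21 % W 2))) (RA a (W 22)))
        (putW (20 + a) (W 22) (WA (20 + a) (W 22) + Lit 1)) .skip) .skip)

/-- Write the points in increasing order. -/
def orderCmd (a : ℕ) : Cmd :=
  forCmd (W 0)
    (setW 22 (.floor (RA a (W 21) * .cast (W 4))) ;;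
    putW (6 + a) (WA (18 + a) (W 22) + WA (20 + a) (W 21)) (W 21))

/-- Sort the points by coordinate `a`. -/
def sortCmd (a : ℕ) : Cmd := slabCmd a ;; startCmd a ;; slabRankCmd a ;; orderCmd a

section
variable {w SP n S J a : ℕ} {V : ℕ → ℝ} {s : Mem}

theorem gives_slab {S : ℕ∞} {p : ℕ} {s : Mem} {e : Expr .word} (he : Gives w S s e p)
    (hp : ((p + 1 : ℕ) : ℕ∞) ≤ S)
    (h4 : s.wv 4 = 2 ^ J) (hV : s.ra a = V) (hw : slab J V p < 2 ^ w) :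
    Gives w S s (.floor (RA a e * .cast (W 4))) (slab J V p) := by
  refine GivesR.floor (x := V p * 2 ^ J) (((he.getR hp (by rw [hV])).mul
    (gives_var h4).toReal).cast (by push_cast; rfl)) hw

/-- The counter of a slab just before a point is entered is the number of earlier points in it,
hence the next free slot. -/
theorem runsIn_slab (ha : a = 0 ∨ a = 1) (h0 : s.wv 0 = n) (h2 : s.wv 2 = S) (h4 : s.wv 4 = 2 ^ J)
    (hV : s.ra a = V) (hz : s.wa (14 + a) = 0) (hf : ∀ p < n, slab J V p < 2 ^ J)
    (hload : ∀ g, Nat.count (fun q => slab J V q = g) n < S)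
    (hn : n < SP) (hGS : 2 ^ J * S ≤ SP) (hw : 4 * SP < 2 ^ w) :
    RunsIn w SP (slabCmd a) s fun s' =>
      (∀ g, s'.wa (14 + a) g = Nat.count (fun q => slab J V q = g) n) ∧
      ∀ p < n, s'.wa (16 + a) (slab J V p * S + pos (slab J V) p) = p := by
  have hw1 : 1 ≤ w := by by_contra h; interval_cases w; omega
  have hS1 : 1 ≤ S := by have := hload 0; omega
  have hG : 2 ^ J ≤ SP := (Nat.le_mul_of_pos_right _ hS1).trans hGS
  have hpos : ∀ p < n, pos (slab J V) p < S := fun p hp =>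
    (pos_lt_count hp).trans (hload _)
  rcases ha with rfl | rfl
  all_goals
    refine runsIn_for hw1 (gives_var h0) (by omega) (by omega) (by omega) rfl rfl rfl
      (fun k s' => (∀ g, s'.wa _ g = Nat.count (fun q => slab J V q = g) k) ∧
        ∀ p < k, s'.wa _ (slab J V p * S + pos (slab J V) p) = p) ?_ ?_
    · simp [hz]
    · rintro k hk r hF - h21 ⟨hI1, hI2⟩
      have h2' : r.wv 2 = S := (hF.wv rfl).trans h2
      have h4' : r.wv 4 = 2 ^ J := (hF.wv rfl).trans h4
      have hV' : r.ra _ = V := (hF.ra rfl).trans hV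
      have hfk := hf k hk
      have hpk := hpos k hk
      have hidx := index_lt hfk hpk
      have hcnt := hI1 (slab J V k)
      rw [← pos] at hcnt
      apply Runs.seq
      refine runs_setW (gives_slab (gives_var h21) (le_space (by omega)) h4' hV' (by omega)) ?_
      apply Runs.seq
      refine runs_putW (((gives_var (v := slab J V k) (by simp)).mul
        (gives_var (by simpa using h2')) (by omega)).add ((gives_var (v := slab J V k)
        (by simp)).get (le_space (by omega)) (by simpa using hcnt)) (by omega))
        (gives_var (by simpa using h21))
        (le_space (by omega)) ?_
      refine runs_putW (gives_var (v := slab J V k) (by simp))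
        (((gives_var (v := slab J V k) (by simp)).get
        (le_space (by omega)) (by simpa using hcnt)).add (gives_lit (by omega)) (by omega))
        (le_space (by omega)) ?_
      constructor
      · intro g
        simp only [Nat.count_succ]
        by_cases hg : g = slab J V k
        · subst hg
          simp [pos]
        · simp [hg, Ne.symm hg, hI1]
      · intro p hp
        by_cases hpk' : p = k
        · subst hpk'
          simp
        · have := slot_ne (f := slab J V) (show p < k by omega) (hpos p (by omega)) hpk
          simpa [this] using hI2 p (by omega)

theorem runsIn_start (ha : a = 0 ∨ a = 1) (h4 : s.wv 4 = 2 ^ J)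
    (hz : s.wa (18 + a) = 0) (hc : ∀ g, s.wa (14 + a) g = Nat.count (fun q => slab J V q = g) n)
    (hn : n < SP) (hG : 2 ^ J < SP) (hw : 4 * SP < 2 ^ w) :
    RunsIn w SP (startCmd a) s fun s' =>
      ∀ g ≤ 2 ^ J, s'.wa (18 + a) g = Nat.count (fun q => slab J V q < g) n := by
  have hw1 : 1 ≤ w := by by_contra h; interval_cases w; omega
  have hadd : ∀ g, Nat.count (fun q => slab J V q < g) n + Nat.count (fun q => slab J V q = g) n =
      Nat.count (fun q => slab J V q < g + 1) n := by
    intro g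
    rw [Nat.count_eq_card_filter_range, Nat.count_eq_card_filter_range,
      Nat.count_eq_card_filter_range, ← Finset.card_union_of_disjoint]
    · congr 1
      ext q
      simp only [Finset.mem_union, Finset.mem_filter, Finset.mem_range]
      omega
    · rw [Finset.disjoint_left]
      simp only [Finset.mem_filter]
      omega
  have hle : ∀ g, Nat.count (fun q => slab J V q < g) n ≤ n := fun g => Nat.count_le _
  rcases ha with rfl | rfl
  all_goals
    refine runsIn_for hw1 (gives_var h4) (by omega) (by omega) (by omega) rfl rfl rfl
      (fun k s' => ∀ g ≤ k, s'.wa _ g = Nat.count (fun q => slab J V q < g) n) ?_ ?_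
    · intro g hg
      obtain rfl : g = 0 := by omega
      simp [hz]
    · rintro k hk r hF - h21 hI
      have hc' := hc k
      rw [← hF.wa rfl] at hc'
      have hI' := hI k le_rfl
      have := hle (k + 1)
      refine runs_putW ((gives_var h21).add (gives_lit (by omega)) (by omega))
        ((((gives_var h21).get (le_space (by omega)) hI').add ((gives_var h21).get
        (le_space (by omega)) hc') (by rw [hadd]; omega)).cast (hadd k)) (le_space (by omega)) ?_
      intro g hg
      by_cases hgk : g = k + 1
      · subst hgk
        simp
      · simpa [hgk] using hI g (by omega)

-- Each point is compared with all members of its slab, in one flattened loop of `n * S` rounds.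
open Classical in
theorem runsIn_slabRank (ha : a = 0 ∨ a = 1) (h0 : s.wv 0 = n) (h2 : s.wv 2 = S)
    (h4 : s.wv 4 = 2 ^ J) (hV : s.ra a = V) (hz : s.wa (20 + a) = 0)
    (hc : ∀ g, s.wa (14 + a) g = Nat.count (fun q => slab J V q = g) n)
    (hslot : ∀ p < n, s.wa (16 + a) (slab J V p * S + pos (slab J V) p) = p)
    (hf : ∀ p < n, slab J V p < 2 ^ J)
    (hload : ∀ g, Nat.count (fun q => slab J V q = g) n < S)
    (hn : n < SP) (hnS : n * S ≤ SP) (hGS : 2 ^ J * S ≤ SP) (hw : 4 * SP < 2 ^ w) :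
    RunsIn w SP (slabRankCmd a) s fun s' => ∀ p < n, s'.wa (20 + a) p =
      ((Finset.range n).filter fun q => slab J V q = slab J V p ∧ V q < V p).card := by
  have hw1 : 1 ≤ w := by by_contra h; interval_cases w; omega
  have hS1 : 1 ≤ S := by have := hload 0; omega
  have hG : 2 ^ J ≤ SP := (Nat.le_mul_of_pos_right _ hS1).trans hGS
  have hpos : ∀ p < n, pos (slab J V) p < S := fun p hp =>
    (pos_lt_count hp).trans (hload _)
  have hslot' : ∀ p < n, ∀ j < Nat.count (fun q => slab J V q = slab J V p) n,
      s.wa (16 + a) (slab J V p * S + j) = Nat.nth (fun q => slab J V q = slab J V p) j := by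
    intro p hp j hj
    obtain ⟨e1, e2, e3⟩ := pos_nth hj
    have := hslot _ e1
    rwa [e2, e3] at this
  let hit (p j : ℕ) : Prop := j < Nat.count (fun q => slab J V q = slab J V p) n ∧
    V (Nat.nth (fun q => slab J V q = slab J V p) j) < V p
  -- The successful rounds for `p` correspond to the smaller points of its slab, a point being
  -- identified with its slot.
  have hfin : ∀ p < n, Nat.count (fun z => z / S = p ∧ hit p (z % S)) (n * S) =
      ((Finset.range n).filter fun q => slab J V q = slab J V p ∧ V q < V p).card := by
    intro p hp
    rw [Nat.count_eq_card_filter_range]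
    symm
    refine Finset.card_bij (fun q _ => p * S + pos (slab J V) q) ?_ ?_ ?_
    · intro q hq
      simp only [Finset.mem_filter, Finset.mem_range] at hq ⊢
      obtain ⟨hq, hqp, hlt⟩ := hq
      have hdm := div_mod_index (a := p) (hpos q hq)
      refine ⟨index_lt hp (hpos q hq), hdm.1, ?_⟩
      rw [hdm.2]
      have h1 := pos_lt_count (f := slab J V) hq
      rw [hqp] at h1
      refine ⟨h1, ?_⟩
      rwa [pos, hqp, Nat.nth_count (p := fun q => slab J V q = slab J V p) hqp]
    · intro q hq q' hq' h
      simp only [Finset.mem_filter, Finset.mem_range] at hq hq'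
      have h : pos (slab J V) q = pos (slab J V) q' := by omega
      simp only [pos, hq.2.1, hq'.2.1] at h
      exact Nat.count_injective (p := fun q => slab J V q = slab J V p) hq.2.1 hq'.2.1 h
    · intro z hz
      simp only [Finset.mem_filter, Finset.mem_range] at hz
      obtain ⟨hz, hzp, hj, hlt⟩ := hz
      obtain ⟨e1, e2, e3⟩ := pos_nth hj
      refine ⟨_, Finset.mem_filter.2 ⟨Finset.mem_range.2 e1, e2, hlt⟩, ?_⟩
      rw [e3, ← hzp]
      exact Nat.div_add_mod' z S
  rcases ha with rfl | rfl
  all_goals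
    refine (runsIn_for hw1 ((gives_var h0).mul (gives_var h2) (by omega)) (by omega) (by omega)
      (by omega) rfl rfl rfl
      (fun k s' => ∀ p, s'.wa _ p = Nat.count (fun z => z / S = p ∧ hit p (z % S)) k) ?_ ?_).mono
      (fun s' h p hp => (h p).trans (hfin p hp))
    · simp [hz]
    · rintro k hk r hF - h21 hI
      have h2' : r.wv 2 = S := (hF.wv rfl).trans h2
      have h4' : r.wv 4 = 2 ^ J := (hF.wv rfl).trans h4
      have hV' : r.ra _ = V := (hF.ra rfl).trans hV
      have hp : k / S < n := Nat.div_lt_of_lt_mul (by rwa [mul_comm])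
      have hj : k % S < S := Nat.mod_lt _ hS1
      have hfk := hf _ hp
      have hidx := index_lt hfk hj
      have hcnt := hc (slab J V (k / S))
      rw [← hF.wa rfl] at hcnt
      have hslr := hslot' _ hp (k % S)
      rw [← hF.wa rfl] at hslr
      have hle : Nat.count (fun z => z / S = k / S ∧ hit (k / S) (z % S)) k ≤ k := Nat.count_le _
      have hfalse : ¬ hit (k / S) (k % S) → ∀ p,
          Nat.count (fun z => z / S = p ∧ hit p (z % S)) (k + 1) =
            Nat.count (fun z => z / S = p ∧ hit p (z % S)) k := by
        intro hh p
        rw [Nat.count_succ, if_neg, add_zero]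
        rintro ⟨rfl, h⟩
        exact hh h
      apply Runs.seq
      refine runs_setW ((gives_var h21).div (gives_var h2')) ?_
      apply Runs.seq
      refine runs_setW (gives_slab (p := k / S) (gives_var (by simp)) (le_space (by omega))
        (by simpa using h4') (by simpa using hV') (by omega)) ?_
      refine runs_cond (((gives_var (by simpa using h21)).mod (gives_var (by simpa using h2'))).lt hw1
        ((gives_var (v := slab J V (k / S)) (by simp)).get (le_space (by omega))
        (by simpa using hcnt))) (fun h => ?_) (fun h => runs_skip ?_)
      · have hlt : k % S < Nat.count (fun q => slab J V q = slab J V (k / S)) n := by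
          by_contra hh; simp [hh] at h
        have hnth := (pos_nth hlt).1
        refine runs_cond (GivesR.lt hw1 (Gives.getR (Gives.get
          (((gives_var (v := slab J V (k / S)) (by simp)).mul (gives_var (by simpa using h2'))
            (by omega)).add ((gives_var (by simpa using h21)).mod (gives_var (by simpa using h2')))
            (by omega)) (le_space (by omega)) (by simpa using hslr hlt)) (le_space (by omega))
            (by simp; rw [hV']))
          (Gives.getR (gives_var (v := k / S) (by simp)) (le_space (by omega)) (by simp; rw [hV'])))
            (fun h' => ?_) (fun h' => runs_skip ?_)
        · have hlt' : V (Nat.nth (fun q => slab J V q = slab J V (k / S)) (k % S)) < V (k / S) := by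
            by_contra hh; simp [hh] at h'
          refine runs_putW (gives_var (v := k / S) (by simp)) (((gives_var (v := k / S)
            (by simp)).get (le_space (by omega)) (by simpa using hI (k / S))).add
            (gives_lit (by omega)) (by omega)) (le_space (by omega)) ?_
          intro p
          rw [Nat.count_succ]
          by_cases hpk : p = k / S
          · subst hpk
            rw [if_pos ⟨rfl, hlt, hlt'⟩]
            simp
          · rw [if_neg (fun h => hpk h.1.symm)]
            simpa [hpk] using hI p
        · intro p
          rw [hfalse (fun hh => by simp [hh.2] at h')]
          simpa using hI p
      · intro p
        rw [hfalse (fun hh => by simp [hh.1] at h)]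
        simpa using hI p

open Classical in
theorem runsIn_order (ha : a = 0 ∨ a = 1) (h0 : s.wv 0 = n)
    (h4 : s.wv 4 = 2 ^ J) (hV : s.ra a = V)
    (hst : ∀ g ≤ 2 ^ J, s.wa (18 + a) g = Nat.count (fun q => slab J V q < g) n)
    (hrk : ∀ p < n, s.wa (20 + a) p =
      ((Finset.range n).filter fun q => slab J V q = slab J V p ∧ V q < V p).card)
    (hf : ∀ p < n, slab J V p < 2 ^ J) (hne : ∀ p < n, ∀ q < n, p ≠ q → V p ≠ V q)
    (hn : n < SP) (hG : 2 ^ J ≤ SP) (hw : 4 * SP < 2 ^ w) :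
    RunsIn w SP (orderCmd a) s fun s' => IsOrder n V (s'.wa (6 + a)) := by
  have hw1 : 1 ≤ w := by by_contra h; interval_cases w; omega
  rcases ha with rfl | rfl
  all_goals
    refine (runsIn_for hw1 (gives_var h0) (by omega) (by omega)
      (by omega) rfl rfl rfl
      (fun k s' => ∀ p < k, s'.wa _ (rank n V p) = p) ?_ ?_).mono
      (fun s' h => isOrder_of_rank hne h)
    · intro p hp; omega
    · rintro k hk r hF - h21 hI
      have h4' : r.wv 4 = 2 ^ J := (hF.wv rfl).trans h4
      have hV' : r.ra _ = V := (hF.ra rfl).trans hV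
      have hfk := hf k hk
      have e1 := hst _ hfk.le
      have e2 := hrk _ hk
      rw [← hF.wa rfl] at e1 e2
      have e3 := count_slab_add (n := n) (J := J) (p := k) (V := V)
      have e4 := rank_lt (V := V) hk
      apply Runs.seq
      refine runs_setW (gives_slab (gives_var h21) (le_space (by omega)) h4' hV' (by omega)) ?_
      refine runs_putW ((((gives_var (v := slab J V k) (by simp)).get (le_space (by omega))
        (by simpa using e1)).add ((gives_var (by simpa using h21)).get (le_space (by omega))
        (by simpa using e2)) (by omega)).cast e3) (gives_var (by simpa using h21))
        (le_space (by omega)) ?_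
      intro p hp
      by_cases hpk : p = k
      · subst hpk
        simp
      · have : rank n V p ≠ rank n V k := by
          rcases lt_or_gt_of_ne (hne p (by omega) k hk hpk) with h | h
          · exact (rank_lt_rank (by omega) h).ne
          · exact (rank_lt_rank hk h).ne'
        simpa [this] using hI p (by omega)

/-- A bucket sort with comparison of all pairs inside the buckets. The scratch arrays for the two
coordinates have different parity, so the second sort still finds them zero. -/
theorem runsIn_sort (ha : a = 0 ∨ a = 1) (h0 : s.wv 0 = n) (h2 : s.wv 2 = S) (h4 : s.wv 4 = 2 ^ J)
    (hV : s.ra a = V) (hz : ∀ x, 14 ≤ x → x < 22 → x % 2 = a → s.wa x = 0)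
    (hf : ∀ p < n, slab J V p < 2 ^ J) (hne : ∀ p < n, ∀ q < n, p ≠ q → V p ≠ V q)
    (hload : ∀ g, Nat.count (fun q => slab J V q = g) n < S)
    (hn : n < SP) (hnS : n * S ≤ SP) (hG : 2 ^ J < SP) (hGS : 2 ^ J * S ≤ SP)
    (hw : 4 * SP < 2 ^ w) :
    RunsIn w SP (sortCmd a) s fun s' => IsOrder n V (s'.wa (6 + a)) := by
  have hS : 1 ≤ SP := by omega
  have ha' := ha
  rcases ha' with rfl | rfl
  all_goals
    refine ((runsIn_slab ha h0 h2 h4 hV (hz _ (by omega) (by omega) (by omega)) hf hload hn hGS hw).frame.mono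
      ?_).seq hS
    rintro s₁ ⟨F₁, c₁, d₁⟩
    refine ((runsIn_start ha ((F₁.wv rfl).trans h4) ((F₁.wa rfl).trans (hz _ (by omega) (by omega) (by omega)))
      c₁ hn hG hw).frame.mono ?_).seq hS
    rintro s₂ ⟨F₂, c₂⟩
    refine ((runsIn_slabRank ha ((F₂.wv rfl).trans ((F₁.wv rfl).trans h0))
      ((F₂.wv rfl).trans ((F₁.wv rfl).trans h2)) ((F₂.wv rfl).trans ((F₁.wv rfl).trans h4))
      ((F₂.ra rfl).trans ((F₁.ra rfl).trans hV))
      ((F₂.wa rfl).trans ((F₁.wa rfl).trans (hz _ (by omega) (by omega) (by omega))))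
      (by rw [F₂.wa rfl]; exact c₁) (by rw [F₂.wa rfl]; exact d₁) hf hload hn hnS hGS hw).frame.mono
      ?_).seq hS
    rintro s₃ ⟨F₃, c₃⟩
    exact runsIn_order ha ((F₃.wv rfl).trans ((F₂.wv rfl).trans ((F₁.wv rfl).trans h0)))
      ((F₃.wv rfl).trans ((F₂.wv rfl).trans ((F₁.wv rfl).trans h4)))
      ((F₃.ra rfl).trans ((F₂.ra rfl).trans ((F₁.ra rfl).trans hV)))
      (by rw [F₃.wa rfl]; exact c₂) c₃ hf hne hn hG.le hw

end

end RealRAM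

/-! ### How the codes of a list change when a word is appended -/

namespace BlindSearch

/-- The code of block `j` of the list `s 0, …, s (m - 1)` divided into blocks of length `D`. -/
def blockCode (β D : ℕ) (s : ℕ → ℕ) (m j : ℕ) : ℕ :=
  code β (fun i => s (j * D + i)) (blockLast D m j)

/-- The code of the first words of the blocks. -/
def topCode (β D : ℕ) (s : ℕ → ℕ) (m : ℕ) : ℕ := code β (fun i => s (i * D)) ((m - 1) / D)

section
variable {β D r : ℕ} {s : ℕ → ℕ}

theorem blockCode_start (h : r % D = 0) : blockCode β D s (r + 1) (r / D) = 1 := by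
  have : r / D * D + r % D = r := Nat.div_add_mod' r D
  rw [blockCode, blockLast, show min (D - 1) (r + 1 - 1 - r / D * D) = 0 by omega, code]

/-- A word that does not start a block adds one digit to the code of the last block, the height
where it branches from its predecessor. -/
theorem blockCode_succ (hD : 0 < D) (h : r % D ≠ 0) :
    blockCode β D s (r + 1) (r / D) =
      blockCode β D s r (r / D) * β + sep (s (r - 1)) (s r) := by
  have h1 : r / D * D + r % D = r := Nat.div_add_mod' r D
  have h2 : r % D < D := Nat.mod_lt _ hD
  obtain ⟨x, hx⟩ := Nat.exists_eq_succ_of_ne_zero h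
  have h3 : blockLast D (r + 1) (r / D) = x + 1 := by rw [blockLast]; omega
  have h4 : blockLast D r (r / D) = x := by rw [blockLast]; omega
  rw [blockCode, blockCode, h3, h4, code, show r / D * D + x = r - 1 by omega,
    show r / D * D + (x + 1) = r by omega]

theorem blockCode_of_ne {j : ℕ} (hj : j * D < r) (h : j ≠ r / D) :
    blockCode β D s (r + 1) j = blockCode β D s r j := by
  have hD : 0 < D ∨ D = 0 := by omega
  rcases hD with hD | rfl
  · have h1 : j ≤ r / D := (Nat.le_div_iff_mul_le hD).2 hj.le
    have h2 : (j + 1) * D ≤ r := (Nat.le_div_iff_mul_le hD).1 (by omega)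
    have h3 : (j + 1) * D = j * D + D := by ring
    have : blockLast D (r + 1) j = blockLast D r j := by rw [blockLast, blockLast]; omega
    rw [blockCode, blockCode, this]
  · simp [blockCode, blockLast]

theorem topCode_one : topCode β D s 1 = 1 := by simp [topCode, code]

theorem topCode_of_mod_ne (hD : 0 < D) (h : r % D ≠ 0) : topCode β D s (r + 1) = topCode β D s r := by
  have h1 : r / D * D + r % D = r := Nat.div_add_mod' r D
  have h2 : r % D < D := Nat.mod_lt _ hD
  have : (r - 1) / D = r / D := by
    rw [Nat.div_eq_iff hD]
    omega
  rw [topCode, topCode, this, Nat.add_sub_cancel]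

/-- A new head branches from the previous head, which is `D` positions earlier. -/
theorem topCode_succ (hD : 0 < D) (h : r % D = 0) (h0 : r ≠ 0) :
    topCode β D s (r + 1) = topCode β D s r * β + sep (s (r - D)) (s r) := by
  have h1 : r / D * D + r % D = r := Nat.div_add_mod' r D
  have h2 : r / D ≠ 0 := by
    intro h
    rw [h] at h1
    omega
  obtain ⟨x, hx⟩ := Nat.exists_eq_succ_of_ne_zero h2
  rw [hx, h, Nat.succ_eq_add_one, add_mul] at h1
  have h3 : (r - 1) / D = x := by
    rw [Nat.div_eq_iff hD]
    omega
  rw [topCode, topCode, h3, Nat.add_sub_cancel, hx, code, show x * D = r - D by omega,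
    show (x + 1) * D = r by rw [add_mul]; omega]

theorem blockCode_lt {m j : ℕ} (hβ : 0 < β) (h : ∀ i j, sep (s i) (s j) < β) :
    blockCode β D s m j < 2 * β ^ D :=
  (code_lt fun i _ => h _ _).trans_le (Nat.mul_le_mul_left 2 (Nat.pow_le_pow_right hβ
    (by rw [blockLast]; omega)))

/-- A list of at most D² words has at most `D` blocks, so the top node is no larger than a block and
one search table serves both levels. -/
theorem topCode_lt {m : ℕ} (hβ : 0 < β) (h : ∀ i j, sep (s i) (s j) < β)
    (hm : m ≤ D * D) : topCode β D s m < 2 * β ^ D :=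
  (code_lt fun i _ => h _ _).trans_le (Nat.mul_le_mul_left 2 (Nat.pow_le_pow_right hβ
    (Nat.div_le_of_le_mul (by omega))))

end

end BlindSearch

namespace RealRAM

open BlindSearch

/-! ### Lists with codes and masks -/

/-- The number of items below `k` in list `g`. -/
def cntOf (f : ℕ → ℕ) (k g : ℕ) : ℕ := Nat.count (fun y => f y = g) k

/-- Item `r` of list `g`. -/
noncomputable def el (f : ℕ → ℕ) (g r : ℕ) : ℕ := Nat.nth (fun y => f y = g) r

/-- The bits of the first `r` items of list `g`. -/
noncomputable def maskSum (f ρ : ℕ → ℕ) (g r : ℕ) : ℕ := ∑ i ∈ Finset.range r, 2 ^ ρ (el f g i)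

/-- The lists of the first `k` items with their counters, coordinates, keys, masks, and codes of the
blocks. -/
structure Lists (a S D β : ℕ) (f : ℕ → ℕ) (val : ℕ → ℝ) (key ρ : ℕ → ℕ) (k : ℕ) (s : Mem) :
    Prop where
  cnt : ∀ g, s.wa (30 + a) g = cntOf f k g
  vals : ∀ g, ∀ r < cntOf f k g, s.ra (2 + a) (g * S + r) = val (el f g r)
  keys : ∀ g, ∀ r < cntOf f k g, s.wa (32 + a) (g * S + r) = key (el f g r)
  mask : ∀ g, ∀ r ≤ cntOf f k g, s.wa (34 + a) (g * S + r) = maskSum f ρ g r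
  leaf : ∀ g j, j * D < cntOf f k g →
    s.wa (36 + a) (g * S + j) = blockCode β D (fun i => key (el f g i)) (cntOf f k g) j
  top : ∀ g, 0 < cntOf f k g →
    s.wa (38 + a) g = topCode β D (fun i => key (el f g i)) (cntOf f k g)

theorem index_inj {g g' r r' S : ℕ} (hr : r < S) (hr' : r' < S) :
    g * S + r = g' * S + r' ↔ g = g' ∧ r = r' := by
  refine ⟨fun h => ?_, fun h => by rw [h.1, h.2]⟩
  have h1 := congrArg (· / S) h
  have h2 := congrArg (· % S) h
  simpa only [(div_mod_index hr).1, (div_mod_index hr).2, (div_mod_index hr').1,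
    (div_mod_index hr').2] using And.intro h1 h2

theorem cntOf_succ (f : ℕ → ℕ) (k g : ℕ) :
    cntOf f (k + 1) g = if g = f k then pos f k + 1 else cntOf f k g := by
  rw [cntOf, Nat.count_succ]
  by_cases h : g = f k
  · simp [h, pos]
  · simp [h, Ne.symm h, cntOf]

theorem cntOf_self (f : ℕ → ℕ) (k : ℕ) : cntOf f k (f k) = pos f k := rfl

theorem el_pos (f : ℕ → ℕ) (k : ℕ) : el f (f k) (pos f k) = k :=
  Nat.nth_count (p := fun y => f y = f k) rfl

theorem cntOf_le {f : ℕ → ℕ} {k K : ℕ} (h : k ≤ K) (g : ℕ) : cntOf f k g ≤ cntOf f K g :=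
  Nat.count_monotone _ h

theorem el_spec {f : ℕ → ℕ} {k g r : ℕ} (h : r < cntOf f k g) :
    el f g r < k ∧ f (el f g r) = g ∧ pos f (el f g r) = r := pos_nth h

section
variable {a S D β k : ℕ} {f : ℕ → ℕ} {val : ℕ → ℝ} {key ρ : ℕ → ℕ} {s s' : Mem}

theorem lists_zero (h : s.wa (30 + a) = 0) (h' : s.wa (34 + a) = 0) :
    Lists a S D β f val key ρ 0 s where
  cnt g := by simp [h, cntOf]
  vals g r hr := by simp [cntOf] at hr
  keys g r hr := by simp [cntOf] at hr
  mask g r hr := by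
    simp only [cntOf, Nat.count_zero, Nat.le_zero] at hr
    simp [h', hr, maskSum]
  leaf g j hj := by simp [cntOf] at hj
  top g hg := by simp [cntOf] at hg

theorem Lists.congr (h : Lists a S D β f val key ρ k s) (h1 : s'.wa (30 + a) = s.wa (30 + a))
    (h2 : s'.ra (2 + a) = s.ra (2 + a)) (h3 : s'.wa (32 + a) = s.wa (32 + a))
    (h4 : s'.wa (34 + a) = s.wa (34 + a)) (h5 : s'.wa (36 + a) = s.wa (36 + a))
    (h6 : s'.wa (38 + a) = s.wa (38 + a)) : Lists a S D β f val key ρ k s' :=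
  ⟨h1 ▸ h.cnt, h2 ▸ h.vals, h3 ▸ h.keys, h4 ▸ h.mask, h5 ▸ h.leaf, h6 ▸ h.top⟩

/-- The capacity is strictly larger than the number of items because a list of m items has m+1
prefix masks, stored with the same stride `S`. Only the code of the last block, and possibly the top
code, changes. -/
theorem Lists.push (h : Lists a S D β f val key ρ k s) (hS : ∀ g, cntOf f (k + 1) g < S)
    (hD : 0 < D)
    (hcnt : s'.wa (30 + a) = Function.update (s.wa (30 + a)) (f k) (pos f k + 1))
    (hvals : s'.ra (2 + a) = Function.update (s.ra (2 + a)) (f k * S + pos f k) (val k))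
    (hkeys : s'.wa (32 + a) = Function.update (s.wa (32 + a)) (f k * S + pos f k) (key k))
    (hmask : s'.wa (34 + a) = Function.update (s.wa (34 + a)) (f k * S + pos f k + 1)
      (maskSum f ρ (f k) (pos f k) + 2 ^ ρ k))
    (hleaf : s'.wa (36 + a) = Function.update (s.wa (36 + a)) (f k * S + pos f k / D)
      (blockCode β D (fun i => key (el f (f k) i)) (pos f k + 1) (pos f k / D)))
    (htop : ∀ g, s'.wa (38 + a) g =
      if g = f k then topCode β D (fun i => key (el f (f k) i)) (pos f k + 1)
      else s.wa (38 + a) g) : Lists a S D β f val key ρ (k + 1) s' := by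
  have hpS : pos f k + 1 < S := by
    have := hS (f k)
    rwa [cntOf_succ, if_pos rfl] at this
  have hdS : pos f k / D < S := (Nat.div_le_self _ _).trans_lt (by omega)
  constructor
  · intro g
    rw [cntOf_succ, hcnt, Function.update_apply, h.cnt]
  · intro g r hr
    have hrS := hr.trans (hS g)
    rw [cntOf_succ] at hr
    simp only [hvals, Function.update_apply, index_inj hrS (show pos f k < S by omega)]
    split_ifs at hr ⊢ with h1 h2 h2
    · rw [h1.1, h1.2, el_pos]
    · exact absurd h1.1 h2
    · subst h2
      exact h.vals _ r (by rw [cntOf_self]; omega)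
    · exact h.vals _ r hr
  · intro g r hr
    have hrS := hr.trans (hS g)
    rw [cntOf_succ] at hr
    simp only [hkeys, Function.update_apply, index_inj hrS (show pos f k < S by omega)]
    split_ifs at hr ⊢ with h1 h2 h2
    · rw [h1.1, h1.2, el_pos]
    · exact absurd h1.1 h2
    · subst h2
      exact h.keys _ r (by rw [cntOf_self]; omega)
    · exact h.keys _ r hr
  · intro g r hr
    have hrS := hr.trans_lt (hS g)
    rw [cntOf_succ] at hr
    simp only [hmask, Function.update_apply, add_assoc, index_inj hrS hpS]
    split_ifs at hr ⊢ with h1 h2 h2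
    · rw [h1.1, h1.2, maskSum, maskSum, Finset.sum_range_succ, el_pos]
    · exact absurd h1.1 h2
    · subst h2
      exact h.mask _ r (by rw [cntOf_self]; omega)
    · exact h.mask _ r hr
  · intro g j hj
    have hjS : j < S := (Nat.le_mul_of_pos_right _ hD).trans_lt (hj.trans (hS g))
    rw [cntOf_succ] at hj ⊢
    simp only [hleaf, Function.update_apply, index_inj hjS hdS]
    split_ifs at hj ⊢ with h1 h2 h2
    · rw [h1.1, h1.2]
    · exact absurd h1.1 h2
    · subst h2
      have hne : j ≠ pos f k / D := fun hh => h1 ⟨rfl, hh⟩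
      have hlt : j * D < pos f k := by
        rcases (Nat.lt_succ_iff.1 hj).lt_or_eq with hh | hh
        · exact hh
        · exact absurd (Nat.eq_div_of_mul_eq_left hD.ne' hh) hne
      rw [blockCode_of_ne hlt hne]
      have := h.leaf (f k) j (by rwa [cntOf_self])
      rwa [cntOf_self] at this
    · exact h.leaf _ j hj
  · intro g hg
    rw [cntOf_succ] at hg ⊢
    rw [htop]
    split_ifs at hg ⊢ with h1
    · rw [h1]
    · exact h.top _ hg

end

/-- Append an item to list `W 26` with counter `W 28`, whose array starts at `W 29`. The item has
coordinate `R 10`, key `W 27`, and bit `W 30`. -/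
def appendCmd (a : ℕ) : Cmd :=
  putR (2 + a) (W 29 + W 28) (R 10) ;;
  putW (34 + a) (W 29 + W 28 + Lit 1) (WA (34 + a) (W 29 + W 28) + WA 0 (W 30)) ;;
  Cmd.cond (W 28 % W 7)
    (putW (36 + a) (W 29 + W 28 / W 7) (WA (36 + a) (W 29 + W 28 / W 7) * W 8 +
      WA 2 (WA (32 + a) (W 29 + W 28 - Lit 1) * W 6 + W 27)))
    (putW (36 + a) (W 29 + W 28 / W 7) (Lit 1) ;;
    Cmd.cond (W 28)
      (putW (38 + a) (W 26) (WA (38 + a) (W 26) * W 8 +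
        WA 2 (WA (32 + a) (W 29 + W 28 - W 7) * W 6 + W 27)))
      (putW (38 + a) (W 26) (Lit 1))) ;;
  putW (32 + a) (W 29 + W 28) (W 27) ;;
  putW (30 + a) (W 26) (W 28 + Lit 1)

/-- The tables and parameters used for the lists. -/
structure Tables (S b e D : ℕ) (s : Mem) : Prop where
  B : s.wv 6 = 2 ^ b
  D : s.wv 7 = D
  β : s.wv 8 = 2 ^ e
  pow : ∀ k ≤ S, s.wa 0 k = 2 ^ k
  sep : ∀ u < 2 ^ b, ∀ v < 2 ^ b, s.wa 2 (u * 2 ^ b + v) = sep u v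

theorem Tables.congr {S b e D : ℕ} {s s' : Mem} (h : Tables S b e D s) (h1 : s'.wv 6 = s.wv 6)
    (h2 : s'.wv 7 = s.wv 7) (h3 : s'.wv 8 = s.wv 8) (h4 : s'.wa 0 = s.wa 0)
    (h5 : s'.wa 2 = s.wa 2) : Tables S b e D s' :=
  ⟨h1.trans h.B, h2.trans h.D, h3.trans h.β, h4 ▸ h.pow, h5 ▸ h.sep⟩

/-- The parameters are small compared to the space and to the words. -/
structure Small (w SP S N b e D : ℕ) : Prop where
  D_pos : 0 < D
  S_le : S ≤ D * D
  D_lt : D < S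
  b_lt : b < 2 ^ e
  S_lt : S < SP
  N_lt : N < SP
  NS : N * S ≤ SP
  BB : 2 ^ b * 2 ^ b ≤ SP
  code : 2 * (2 ^ e) ^ D ≤ SP
  word : 4 * SP < 2 ^ w

theorem Small.one_le {w SP S N b e D : ℕ} (h : Small w SP S N b e D) : 1 ≤ w := by
  by_contra hh
  have h1 := h.word
  have h2 := h.S_lt
  interval_cases w
  omega

/-- The cases are those of the code: inside a block, at the start of a later block, and at the start
of the list. The new digit is looked up in the table of `sep`, which is why constant time suffices.
The hypothesis on `maskSum` excludes overflow of the new mask. -/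
theorem runs_append {a w SP S N b e D k : ℕ} {f : ℕ → ℕ} {val : ℕ → ℝ} {key ρ : ℕ → ℕ} {s : Mem}
    (ha : a = 0 ∨ a = 1) (hs : Small w SP S N b e D) (ht : Tables S b e D s)
    (h26 : s.wv 26 = f k) (h27 : s.wv 27 = key k) (h28 : s.wv 28 = pos f k)
    (h29 : s.wv 29 = f k * S) (h30 : s.wv 30 = ρ k) (h10 : s.rv 10 = val k)
    (hf : f k < N) (hkey : ∀ z, key z < 2 ^ b) (hρ : ρ k ≤ S)
    (hm : maskSum f ρ (f k) (pos f k + 1) < 2 ^ w)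
    (hS : ∀ g, cntOf f (k + 1) g < S) (hL : Lists a S D (2 ^ e) f val key ρ k s) :
    Runs w SP (appendCmd a) s (Lists a S D (2 ^ e) f val key ρ (k + 1)) := by
  have hpS : pos f k + 1 < S := by
    have := hS (f k)
    rwa [cntOf_succ, if_pos rfl] at this
  obtain ⟨hD0, hSD, hDS, hbe, hSSP, hNSP, hNS, hBB, hcode, hw⟩ := hs
  have hw1 := Small.one_le ⟨hD0, hSD, hDS, hbe, hSSP, hNSP, hNS, hBB, hcode, hw⟩
  have h1 : 1 < 2 ^ w := by omega
  have hidx := index_lt hf (show pos f k + 1 < S by omega)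
  have hdS : pos f k / D ≤ pos f k := Nat.div_le_self _ _
  have hβ0 : 0 < 2 ^ e := by positivity
  have hB0 : 2 ^ b ≤ 2 ^ b * 2 ^ b := Nat.le_mul_of_pos_left _ (by positivity)
  have hsep : ∀ i j, BlindSearch.sep (key (el f (f k) i)) (key (el f (f k) j)) < 2 ^ e :=
    fun i j => (sep_le_of_lt (hkey _) (hkey _)).trans_lt hbe
  have hel := el_pos f k
  have hk : key (el f (f k) (pos f k)) = key k := by rw [hel]
  have hmask := hL.mask (f k) (pos f k) le_rfl
  have hms : maskSum f ρ (f k) (pos f k) + 2 ^ ρ k = maskSum f ρ (f k) (pos f k + 1) := by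
    rw [maskSum, maskSum, Finset.sum_range_succ, hel]
  have hpow := ht.pow _ hρ
  have hrec : pos f k < cntOf f (k + 1) (f k) := by rw [cntOf_succ, if_pos rfl]; omega
  have hmd : pos f k / D * D + pos f k % D = pos f k := Nat.div_add_mod' _ D
  have hkeyidx : ∀ i, key (el f (f k) i) * 2 ^ b + key k < SP := fun i =>
    (index_lt (hkey _) (hkey _)).trans_le hBB
  have hlc := blockCode_lt (β := 2 ^ e) (D := D) (m := pos f k + 1) (j := pos f k / D) hβ0 hsep
  have htc := topCode_lt (β := 2 ^ e) (D := D) (m := pos f k + 1) hβ0 hsep (by omega)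
  have gi : ∀ s' : Mem, s'.wv 29 = f k * S → s'.wv 28 = pos f k →
      Gives w SP s' (W 29 + W 28) (f k * S + pos f k) := fun s' h h' =>
    (gives_var h).add (gives_var h') (by omega)
  have gd : ∀ s' : Mem, s'.wv 29 = f k * S → s'.wv 28 = pos f k → s'.wv 7 = D →
      Gives w SP s' (W 29 + W 28 / W 7) (f k * S + pos f k / D) := fun s' h h' h'' =>
    (gives_var h).add ((gives_var h').div (gives_var h'')) (by omega)
  have hB := ht.B
  have hD := ht.D
  have hβ := ht.β
  rcases ha with rfl | rfl
  all_goals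
    simp only [Nat.add_zero, Nat.reduceAdd] at hmask
    apply Runs.seq
    refine runs_putR (gi _ h29 h28) (givesR_var h10) (le_space (by omega)) ?_
    apply Runs.seq
    refine runs_putW ((gi _ (by simpa using h29) (by simpa using h28)).add (gives_lit h1) (by omega))
      (((gi _ (by simpa using h29) (by simpa using h28)).get (le_space (by omega))
        (by simpa using hmask)).add ((gives_var (by simpa using h30)).get (le_space (by omega))
        (by simpa using hpow)) (by omega)) (le_space (by omega)) ?_
    apply Runs.seq
    refine runs_cond ((gives_var (by simpa using h28)).mod (gives_var (by simpa using hD)))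
      (fun hmod => ?_) (fun hmod => ?_)
    · have hp0 : pos f k ≠ 0 := by
        intro h
        rw [h] at hmod
        simp at hmod
      have e1 := blockCode_succ (β := 2 ^ e) (s := fun i => key (el f (f k) i)) hD0 hmod
      simp only [hk] at e1
      have e2 := hL.leaf (f k) (pos f k / D) (by rw [cntOf_self]; omega)
      rw [cntOf_self] at e2
      have e3 := hL.keys (f k) (pos f k - 1) (by rw [cntOf_self]; omega)
      rw [← Nat.add_sub_assoc (by omega)] at e3
      have e4 := ht.sep _ (hkey (el f (f k) (pos f k - 1))) _ (hkey k)
      have e5 := hkeyidx (pos f k - 1)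
      simp only [Nat.add_zero, Nat.reduceAdd] at e2 e3
      refine runs_putW (gd _ (by simpa using h29) (by simpa using h28) (by simpa using hD))
        (((((gd _ (by simpa using h29) (by simpa using h28) (by simpa using hD)).get
          (le_space (by omega)) (by simpa using e2)).mul (gives_var (by simpa using hβ))
          (by omega)).add ((((((gi _ (by simpa using h29) (by simpa using h28)).sub
          (gives_lit h1)).get (le_space (by omega)) (by simpa using e3)).mul
          (gives_var (by simpa using hB)) (by omega)).add (gives_var (by simpa using h27))
          (by omega)).get (le_space (by omega)) (by simpa using e4)) (by omega)).cast e1.symm)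
        (le_space (by omega)) ?_
      apply Runs.seq
      refine runs_putW (gi _ (by simpa using h29) (by simpa using h28))
        (gives_var (by simpa using h27)) (le_space (by omega)) ?_
      refine runs_putW (gives_var (by simpa using h26))
        ((gives_var (by simpa using h28)).add (gives_lit h1) (by omega)) (le_space (by omega)) ?_
      refine hL.push hS hD0 (by simp) (by simp) (by simp) (by simp) (by simp) (fun g => ?_)
      rw [topCode_of_mod_ne hD0 hmod]
      by_cases hg : g = f k
      · subst hg
        have := hL.top (f k) (by rw [cntOf_self]; omega)
        rw [cntOf_self] at this
        simpa using this
      · simp [hg]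
    · have e1 := blockCode_start (β := 2 ^ e) (s := fun i => key (el f (f k) i)) hmod
      apply Runs.seq
      refine runs_putW (gd _ (by simpa using h29) (by simpa using h28) (by simpa using hD))
        ((gives_lit h1).cast e1.symm) (le_space (by omega)) ?_
      refine runs_cond (gives_var (by simpa using h28)) (fun hp0 => ?_) (fun hp0 => ?_)
      · have hDp : D ≤ pos f k := Nat.le_of_dvd (by omega) (Nat.dvd_of_mod_eq_zero hmod)
        have e1 := topCode_succ (β := 2 ^ e) (s := fun i => key (el f (f k) i)) hD0 hmod hp0
        simp only [hk] at e1
        have e2 := hL.top (f k) (by rw [cntOf_self]; omega)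
        rw [cntOf_self] at e2
        have e3 := hL.keys (f k) (pos f k - D) (by rw [cntOf_self]; omega)
        rw [← Nat.add_sub_assoc (by omega)] at e3
        have e4 := ht.sep _ (hkey (el f (f k) (pos f k - D))) _ (hkey k)
        have e5 := hkeyidx (pos f k - D)
        simp only [Nat.add_zero, Nat.reduceAdd] at e2 e3
        refine runs_putW (gives_var (by simpa using h26))
          (((((gives_var (by simpa using h26)).get
            (le_space (by omega)) (by simpa using e2)).mul (gives_var (by simpa using hβ))
            (by omega)).add ((((((gi _ (by simpa using h29) (by simpa using h28)).sub
            (gives_var (by simpa using hD))).get (le_space (by omega)) (by simpa using e3)).mul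
            (gives_var (by simpa using hB)) (by omega)).add (gives_var (by simpa using h27))
            (by omega)).get (le_space (by omega)) (by simpa using e4)) (by omega)).cast e1.symm)
          (le_space (by omega)) ?_
        apply Runs.seq
        refine runs_putW (gi _ (by simpa using h29) (by simpa using h28))
          (gives_var (by simpa using h27)) (le_space (by omega)) ?_
        refine runs_putW (gives_var (by simpa using h26))
          ((gives_var (by simpa using h28)).add (gives_lit h1) (by omega)) (le_space (by omega)) ?_
        refine hL.push hS hD0 (by simp) (by simp) (by simp) (by simp) (by simp) (fun g => ?_)
        by_cases hg : g = f k
        · simp [hg]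
        · simp [hg]
      · refine runs_putW (gives_var (by simpa using h26)) (gives_lit h1) (le_space (by omega)) ?_
        apply Runs.seq
        refine runs_putW (gi _ (by simpa using h29) (by simpa using h28))
          (gives_var (by simpa using h27)) (le_space (by omega)) ?_
        refine runs_putW (gives_var (by simpa using h26))
          ((gives_var (by simpa using h28)).add (gives_lit h1) (by omega)) (le_space (by omega)) ?_
        refine hL.push hS hD0 (by simp) (by simp) (by simp) (by simp) (by simp) (fun g => ?_)
        rw [hp0, topCode_one]
        by_cases hg : g = f k
        · simp [hg]
        · simp [hg]

end RealRAM

namespace RealRAM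

open BlindSearch

/-! ### Insertion of the points into the cells of all levels -/

/-- The number of the cell in column `u` and row `v` of level `i`. -/
def cellId (J i u v : ℕ) : ℕ := i * 2 ^ J + (u * 2 ^ (J - i) + v)

/-- Every level has 2^i · 2^(J-i) = 2^J cells, so the levels fit into consecutive ranges of equal
length. -/
theorem cellId_lt {J i u v : ℕ} (hi : i ≤ J) (hu : u < 2 ^ i) (hv : v < 2 ^ (J - i)) :
    cellId J i u v < (J + 1) * 2 ^ J := by
  have h1 := index_lt hu hv
  rw [← pow_add, Nat.add_sub_cancel' hi] at h1
  exact index_lt (by omega) h1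

theorem cellId_inj {J i u v i' u' v' : ℕ} (hi : i ≤ J) (hu : u < 2 ^ i) (hv : v < 2 ^ (J - i))
    (hi' : i' ≤ J) (hu' : u' < 2 ^ i') (hv' : v' < 2 ^ (J - i')) :
    cellId J i u v = cellId J i' u' v' ↔ i = i' ∧ u = u' ∧ v = v' := by
  have h1 := index_lt hu hv
  rw [← pow_add, Nat.add_sub_cancel' hi] at h1
  have h2 := index_lt hu' hv'
  rw [← pow_add, Nat.add_sub_cancel' hi'] at h2
  rw [cellId, cellId, index_inj h1 h2]
  refine and_congr_right ?_
  rintro rfl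
  exact index_inj hv hv'

theorem floor_mul_two_pow_lt {x : ℝ} (hx : 0 ≤ x) (hx' : x < 1) (k : ℕ) : ⌊x * 2 ^ k⌋₊ < 2 ^ k := by
  rw [Nat.floor_lt (by positivity)]
  push_cast
  nlinarith [show (0 : ℝ) < 2 ^ k by positivity]

/-- A single floor with `b` additional bits yields both the column, as quotient, and the key, as
remainder. -/
theorem floor_mul_two_pow_div (x : ℝ) (k b : ℕ) :
    ⌊x * 2 ^ (k + b)⌋₊ / 2 ^ b = ⌊x * 2 ^ k⌋₊ := by
  have := Nat.floor_div_natCast (x * 2 ^ (k + b)) (2 ^ b)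
  rw [← this]
  congr 1
  push_cast
  rw [pow_add]
  field_simp

/-- The cell of item `z`: point number `z % n` in the given order, on level `z / n`. -/
noncomputable def itemCell (n J : ℕ) (V U : ℕ → ℝ) (ord : ℕ → ℕ) (z : ℕ) : ℕ :=
  cellId J (z / n) ⌊V (ord (z % n)) * 2 ^ (z / n)⌋₊ ⌊U (ord (z % n)) * 2 ^ (J - z / n)⌋₊

/-- The key of item `z`. -/
noncomputable def itemKey (n b : ℕ) (V : ℕ → ℝ) (ord : ℕ → ℕ) (z : ℕ) : ℕ :=
  ⌊V (ord (z % n)) * 2 ^ (z / n + b)⌋₊ % 2 ^ b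

/-- The coordinate of item `z`. -/
def itemVal (n : ℕ) (V : ℕ → ℝ) (ord : ℕ → ℕ) (z : ℕ) : ℝ := V (ord (z % n))

/-- The bit of item `z`, from its position with respect to the other coordinate. -/
def itemBit (n J : ℕ) (ord yr : ℕ → ℕ) (z : ℕ) : ℕ := yr ((J - z / n) * n + ord (z % n))

/-- Compute the data of item `W 21` and enter its position in the table. -/
def locateCmd (a : ℕ) : Cmd :=
  setW 22 (W 21 / W 0) ;;
  setW 23 (WA (6 + a) (W 21 % W 0)) ;;
  setR 10 (RA a (W 23)) ;;
  setW 24 (.floor (R 10 * .cast (WA 0 (W 22) * W 6))) ;;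
  setW 25 (WA 0 (W 3 - W 22)) ;;
  setW 26 (W 22 * W 4 + (W 24 / W 6 * W 25 + .floor (RA (1 - a) (W 23) * .cast (W 25)))) ;;
  setW 27 (W 24 % W 6) ;;
  setW 28 (WA (30 + a) (W 26)) ;;
  setW 29 (W 26 * W 2) ;;
  setW 30 (WA (13 - a) ((W 3 - W 22) * W 0 + W 23)) ;;
  putW (12 + a) (W 22 * W 0 + W 23) (W 28 + Lit 1)

/-- Insert all points into the cells of all levels, in increasing order of coordinate `a`. -/
def insertCmd (a : ℕ) : Cmd := forCmd ((W 3 + Lit 1) * W 0) (locateCmd a ;; appendCmd a)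

section
variable {a w SP n S J b e D : ℕ} {V U : ℕ → ℝ} {ord yr : ℕ → ℕ} {s : Mem}

theorem runs_locate {k : ℕ} (ha : a = 0 ∨ a = 1) (hs : Small w SP S ((J + 1) * 2 ^ J) b e D)
    (ht : Tables S b e D s) (h0 : s.wv 0 = n) (h2 : s.wv 2 = S) (h3 : s.wv 3 = J)
    (h4 : s.wv 4 = 2 ^ J) (hV : s.ra a = V) (hU : s.ra (1 - a) = U) (hord : s.wa (6 + a) = ord)
    (hyr : s.wa (13 - a) = yr) (h21 : s.wv 21 = k) (hk : k < (J + 1) * n)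
    (hVm : ∀ p < n, 0 < V p ∧ V p < 1) (hUm : ∀ p < n, 0 < U p ∧ U p < 1)
    (ho : ∀ r < n, ord r < n)
    (hc : ∀ g, s.wa (30 + a) g = cntOf (itemCell n J V U ord) k g)
    (hpS : pos (itemCell n J V U ord) k < S)
    (hJS : J ≤ S) (hJb : 4 * (2 ^ J * 2 ^ b) < 2 ^ w) (hn : (J + 1) * n ≤ SP) :
    Runs w SP (locateCmd a) s fun s' =>
      s'.wv 26 = itemCell n J V U ord k ∧ s'.wv 27 = itemKey n b V ord k ∧
      s'.wv 28 = pos (itemCell n J V U ord) k ∧ s'.wv 29 = itemCell n J V U ord k * S ∧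
      s'.wv 30 = itemBit n J ord yr k ∧ s'.rv 10 = itemVal n V ord k ∧
      s'.wa (12 + a) = Function.update (s.wa (12 + a)) (k / n * n + ord (k % n))
        (pos (itemCell n J V U ord) k + 1) := by
  have hw1 := hs.one_le
  have hn0 : 0 < n := by
    rcases Nat.eq_zero_or_pos n with h | h
    · simp [h] at hk
    · exact h
  obtain ⟨hD0, hSD, hDS, hbe, hSSP, hNSP, hNS, hBB, hcode, hw⟩ := hs
  set i := k / n with hi
  set p := ord (k % n) with hp
  have hiJ : i ≤ J := by
    exact Nat.lt_succ_iff.1 (Nat.div_lt_of_lt_mul (by rwa [mul_comm]))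
  have hkn : k % n < n := Nat.mod_lt _ hn0
  have hpn : p < n := ho _ hkn
  have hnn : n ≤ (J + 1) * n := Nat.le_mul_of_pos_left _ (by omega)
  have hip : i * n + p < (J + 1) * n := index_lt (Nat.lt_succ_iff.2 hiJ) hpn
  have hip' : (J - i) * n + p < (J + 1) * n := index_lt (Nat.lt_succ_iff.2 (Nat.sub_le _ _)) hpn
  have hF : ⌊V p * 2 ^ (i + b)⌋₊ < 2 ^ (i + b) :=
    floor_mul_two_pow_lt (hVm p hpn).1.le (hVm p hpn).2 _
  have hv : ⌊U p * 2 ^ (J - i)⌋₊ < 2 ^ (J - i) :=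
    floor_mul_two_pow_lt (hUm p hpn).1.le (hUm p hpn).2 _
  have hu : ⌊V p * 2 ^ i⌋₊ < 2 ^ i :=
    floor_mul_two_pow_lt (hVm p hpn).1.le (hVm p hpn).2 _
  have hib : 2 ^ (i + b) ≤ 2 ^ J * 2 ^ b := by
    rw [← pow_add]
    exact Nat.pow_le_pow_right (by norm_num) (by omega)
  have hid := cellId_lt hiJ hu hv
  have hkey : itemKey n b V ord k = ⌊V p * 2 ^ (i + b)⌋₊ % 2 ^ b := rfl
  have hbit : itemBit n J ord yr k = yr ((J - i) * n + p) := rfl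
  have hdiv := floor_mul_two_pow_div (V p) i b
  have hcell : itemCell n J V U ord k = cellId J i ⌊V p * 2 ^ i⌋₊ ⌊U p * 2 ^ (J - i)⌋₊ := rfl
  have hid' := hid
  rw [cellId] at hid'
  clear_value i p
  have hcnt := hc (itemCell n J V U ord k)
  rw [cntOf_self] at hcnt
  have hidS := index_lt hid (show 0 < S by omega)
  rw [← hcell] at hid hidS
  have hB := ht.B
  have hpow1 := ht.pow i (by omega)
  have hpow2 := ht.pow (J - i) (by omega)
  rcases ha with rfl | rfl
  all_goals
    simp only [Nat.add_zero, Nat.reduceAdd, Nat.sub_zero, Nat.sub_self, Nat.reduceSub] at hcnt hU hord hyr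
    apply Runs.seq
    refine runs_setW (((gives_var h21).div (gives_var h0)).cast hi.symm) ?_
    apply Runs.seq
    refine runs_setW (v := p) (((gives_var (by simpa using h21)).mod
      (gives_var (by simpa using h0))).get (le_space (by omega)) (by simp [hord, hp])) ?_
    apply Runs.seq
    refine runs_setR ((gives_var (v := p) (by simp)).getR (x := V p) (le_space (by omega))
      (by simp [hV])) ?_
    apply Runs.seq
    refine runs_setW (v := ⌊V p * 2 ^ (i + b)⌋₊) (GivesR.floor ((GivesR.mul
      (givesR_var (x := V p) (by simp)) (Gives.toReal (((gives_var (v := i) (by simp)).get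
      (le_space (by omega)) (by simpa using hpow1)).mul (gives_var (by simpa using hB))
      (by rw [← pow_add]; omega)))).cast (by push_cast; rw [pow_add])) (by omega)) ?_
    apply Runs.seq
    refine runs_setW (v := 2 ^ (J - i)) (((gives_var (by simpa using h3)).sub
      (gives_var (v := i) (by simp))).get (le_space (by omega)) (by simpa using hpow2)) ?_
    apply Runs.seq
    refine runs_setW (v := itemCell n J V U ord k) (((((gives_var (v := i) (by simp)).mul
      (gives_var (by simpa using h4)) (by omega)).add (((((gives_var (v := ⌊V p * 2 ^ (i + b)⌋₊)
      (by simp)).div (gives_var (by simpa using hB))).cast hdiv).mul (gives_var (v := 2 ^ (J - i))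
      (by simp)) (by omega)).add (GivesR.floor (x := U p * 2 ^ (J - i)) ((GivesR.mul
      ((gives_var (v := p) (by simp)).getR (x := U p) (le_space (by omega)) (by simp [hU]))
      (Gives.toReal (gives_var (v := 2 ^ (J - i)) (by simp)))).cast (by push_cast; rfl)) (by omega))
      (by omega)) (by omega))).cast hcell.symm) ?_
    apply Runs.seq
    refine runs_setW (v := itemKey n b V ord k) (((gives_var (v := ⌊V p * 2 ^ (i + b)⌋₊)
      (by simp)).mod (gives_var (by simpa using hB))).cast hkey.symm) ?_
    apply Runs.seq
    refine runs_setW (v := pos (itemCell n J V U ord) k) ((gives_var (v := itemCell n J V U ord k)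
      (by simp)).get (le_space (by omega)) (by simpa using hcnt)) ?_
    apply Runs.seq
    refine runs_setW (v := itemCell n J V U ord k * S) ((gives_var (v := itemCell n J V U ord k)
      (by simp)).mul (gives_var (by simpa using h2)) (by omega)) ?_
    apply Runs.seq
    refine runs_setW (v := itemBit n J ord yr k) (((((gives_var (by simpa using h3)).sub
      (gives_var (v := i) (by simp))).mul (gives_var (by simpa using h0)) (by omega)).add
      (gives_var (v := p) (by simp)) (by omega)).get (le_space (by omega)) (by simp [hyr, hbit])) ?_
    refine runs_putW (((gives_var (v := i) (by simp)).mul (gives_var (by simpa using h0))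
      (by omega)).add (gives_var (v := p) (by simp)) (by omega))
      ((gives_var (v := pos (itemCell n J V U ord) k) (by simp)).add (gives_lit (by omega))
      (by omega)) (le_space (by omega)) ?_
    refine ⟨by simp, by simp, by simp, by simp, by simp, by simp [itemVal, hp], by simp⟩

/-- Items run through the points in sorted order on each level, so every list is filled in
increasing order. The array `12 + a` records the positions in the lists, and `13 - a` is the
corresponding array of the other coordinate, which supplies the bits of the masks. -/
theorem runsIn_insert (ha : a = 0 ∨ a = 1) (hs : Small w SP S ((J + 1) * 2 ^ J) b e D)
    (ht : Tables S b e D s) (h0 : s.wv 0 = n) (h2 : s.wv 2 = S) (h3 : s.wv 3 = J)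
    (h4 : s.wv 4 = 2 ^ J) (hV : s.ra a = V) (hU : s.ra (1 - a) = U) (hord : s.wa (6 + a) = ord)
    (hyr : s.wa (13 - a) = yr)
    (hVm : ∀ p < n, 0 < V p ∧ V p < 1) (hUm : ∀ p < n, 0 < U p ∧ U p < 1)
    (ho : IsOrder n V ord) (hz : s.wa (30 + a) = 0) (hz' : s.wa (34 + a) = 0)
    (hload : ∀ g, cntOf (itemCell n J V U ord) ((J + 1) * n) g < S)
    (hbit : ∀ z < (J + 1) * n, itemBit n J ord yr z ≤ S)
    (hm : ∀ g, ∀ r ≤ cntOf (itemCell n J V U ord) ((J + 1) * n) g,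
      maskSum (itemCell n J V U ord) (itemBit n J ord yr) g r < 2 ^ w)
    (hJS : J ≤ S) (hJb : 4 * (2 ^ J * 2 ^ b) < 2 ^ w) (hn : (J + 1) * n ≤ SP) :
    RunsIn w SP (insertCmd a) s fun s' =>
      Lists a S D (2 ^ e) (itemCell n J V U ord) (itemVal n V ord) (itemKey n b V ord)
        (itemBit n J ord yr) ((J + 1) * n) s' ∧
      ∀ z < (J + 1) * n, s'.wa (12 + a) (z / n * n + ord (z % n)) =
        pos (itemCell n J V U ord) z + 1 := by
  have hw1 := hs.one_le
  have hw := hs.word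
  have hSSP := hs.S_lt
  have ha' := ha
  rcases ha' with rfl | rfl
  all_goals
    refine runsIn_for hw1 (((gives_var h3).add (gives_lit (by omega)) (by omega)).mul (gives_var h0)
      (by omega)) (by omega) (by omega) (by omega) rfl rfl rfl (fun k s' =>
      Lists _ S D (2 ^ e) (itemCell n J V U ord) (itemVal n V ord) (itemKey n b V ord)
        (itemBit n J ord yr) k s' ∧
      ∀ z < k, s'.wa _ (z / n * n + ord (z % n)) = pos (itemCell n J V U ord) z + 1) ?_ ?_
    · refine ⟨lists_zero (by simpa using hz) (by simpa using hz'), fun z hz => by omega⟩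
    · rintro k hk r hF - h21 ⟨hL, hY⟩
      have hn0 : 0 < n := by
        rcases Nat.eq_zero_or_pos n with h | h
        · simp [h] at hk
        · exact h
      have ht' : Tables S b e D r := ht.congr (hF.wv rfl) (hF.wv rfl) (hF.wv rfl) (hF.wa rfl)
        (hF.wa rfl)
      have hS : ∀ g, cntOf (itemCell n J V U ord) (k + 1) g < S := fun g =>
        (cntOf_le (by omega) g).trans_lt (hload g)
      have hposk : pos (itemCell n J V U ord) k + 1 =
          cntOf (itemCell n J V U ord) (k + 1) (itemCell n J V U ord k) := by
        rw [cntOf_succ, if_pos rfl]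
      have hpS := hS (itemCell n J V U ord k)
      rw [← hposk] at hpS
      apply Runs.seq
      refine (runs_locate ha hs ht' ((hF.wv rfl).trans h0) ((hF.wv rfl).trans h2)
        ((hF.wv rfl).trans h3) ((hF.wv rfl).trans h4) ((hF.ra rfl).trans hV) ((hF.ra rfl).trans hU)
        ((hF.wa rfl).trans hord) ((hF.wa rfl).trans hyr) h21 hk hVm hUm ho.lt hL.cnt (by omega) hJS
        hJb hn).frame.mono ?_
      rintro s₁ ⟨F₁, e26, e27, e28, e29, e30, e10, e12⟩
      have ht₁ : Tables S b e D s₁ := ht'.congr (F₁.wv rfl) (F₁.wv rfl) (F₁.wv rfl) (F₁.wa rfl)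
        (F₁.wa rfl)
      have hL₁ := hL.congr (F₁.wa rfl) (F₁.ra rfl) (F₁.wa rfl) (F₁.wa rfl) (F₁.wa rfl) (F₁.wa rfl)
      have hcell : itemCell n J V U ord k < (J + 1) * 2 ^ J := by
        have hpn := ho.lt _ (Nat.mod_lt k hn0)
        refine cellId_lt ?_ (floor_mul_two_pow_lt (hVm _ hpn).1.le (hVm _ hpn).2 _)
          (floor_mul_two_pow_lt (hUm _ hpn).1.le (hUm _ hpn).2 _)
        have : k / n < J + 1 := Nat.div_lt_of_lt_mul (by rwa [mul_comm])
        omega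
      refine (runs_append ha hs ht₁ e26 e27 e28 e29 e30 e10 hcell
        (fun z => Nat.mod_lt _ (by positivity)) (hbit k hk)
        (hm _ _ (by rw [hposk]; exact cntOf_le (by omega) _)) hS hL₁).frame.mono ?_
      rintro s₂ ⟨F₂, hL₂⟩
      refine ⟨hL₂.congr rfl rfl rfl rfl rfl rfl, fun z hz => ?_⟩
      have e12' := (F₂.wa rfl).trans e12
      rw [Mem.wa_setVar, e12', Function.update_apply]
      by_cases hzk : z = k
      · subst hzk
        simp
      · rw [if_neg, hY z (by omega)]
        have hz1 := ho.lt _ (Nat.mod_lt z hn0)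
        have hk1 := ho.lt _ (Nat.mod_lt k hn0)
        rw [index_inj hz1 hk1]
        rintro ⟨h1, h2⟩
        -- Different items write to different cells, because a point occurs only once in the sorted
        -- order.
        have : z % n = k % n := by
          by_contra hne
          rcases lt_or_gt_of_ne hne with h | h
          · exact absurd (congrArg V h2) (ho.mono _ _ h (Nat.mod_lt k hn0)).ne
          · exact absurd (congrArg V h2) (ho.mono _ _ h (Nat.mod_lt z hn0)).ne'
        apply hzk
        rw [← Nat.div_add_mod' z n, ← Nat.div_add_mod' k n, h1, this]

end

end RealRAM

namespace RealRAM

open BlindSearch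

/-! ### The lists of the cells -/

/-- Point number `r` of list `g`. -/
noncomputable def pt (n J : ℕ) (V U : ℕ → ℝ) (ord : ℕ → ℕ) (g r : ℕ) : ℕ :=
  ord (el (itemCell n J V U ord) g r % n)

section
variable {n J b : ℕ} {V U : ℕ → ℝ} {ord : ℕ → ℕ}

theorem el_strictMono {f : ℕ → ℕ} {k g r r' : ℕ} (h : r < r') (hr' : r' < cntOf f k g) :
    el f g r < el f g r' := by
  obtain ⟨-, b1, c1⟩ := el_spec (h.trans hr')
  obtain ⟨-, b2, c2⟩ := el_spec hr'
  by_contra hc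
  rcases (not_lt.1 hc).lt_or_eq with hlt | heq
  · have := pos_lt_count (f := f) hlt
    rw [c2, b2] at this
    rw [pos, b1] at c1
    omega
  · rw [heq, c1] at c2
    omega

theorem el_pt {i u v r : ℕ} (hVm : ∀ p < n, 0 < V p ∧ V p < 1) (hUm : ∀ p < n, 0 < U p ∧ U p < 1)
    (ho : IsOrder n V ord) (hi : i ≤ J) (hu : u < 2 ^ i) (hv : v < 2 ^ (J - i))
    (hr : r < cntOf (itemCell n J V U ord) ((J + 1) * n) (cellId J i u v)) :
    pt n J V U ord (cellId J i u v) r < n ∧ el (itemCell n J V U ord) (cellId J i u v) r / n = i ∧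
      ⌊V (pt n J V U ord (cellId J i u v) r) * 2 ^ i⌋₊ = u ∧
      ⌊U (pt n J V U ord (cellId J i u v) r) * 2 ^ (J - i)⌋₊ = v := by
  obtain ⟨h1, h2, -⟩ := el_spec hr
  rw [pt]
  set z := el (itemCell n J V U ord) (cellId J i u v) r
  have hn0 : 0 < n := by
    rcases Nat.eq_zero_or_pos n with h | h
    · simp [h] at h1
    · exact h
  have hp := ho.lt _ (Nat.mod_lt z hn0)
  have hz : z / n ≤ J := Nat.lt_succ_iff.1 (Nat.div_lt_of_lt_mul (by rwa [mul_comm]))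
  rw [itemCell, cellId_inj hz (floor_mul_two_pow_lt (hVm _ hp).1.le (hVm _ hp).2 _)
    (floor_mul_two_pow_lt (hUm _ hp).1.le (hUm _ hp).2 _) hi hu hv] at h2
  obtain ⟨e1, e2, e3⟩ := h2
  rw [e1] at e2 e3
  exact ⟨hp, e1, e2, e3⟩

/-- All items of a cell belong to the same level, and a level enumerates the points in increasing
order. -/
theorem pt_mono {i u v r r' : ℕ} (hVm : ∀ p < n, 0 < V p ∧ V p < 1)
    (hUm : ∀ p < n, 0 < U p ∧ U p < 1) (ho : IsOrder n V ord) (hi : i ≤ J) (hu : u < 2 ^ i)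
    (hv : v < 2 ^ (J - i)) (hrr : r < r')
    (hr' : r' < cntOf (itemCell n J V U ord) ((J + 1) * n) (cellId J i u v)) :
    V (pt n J V U ord (cellId J i u v) r) < V (pt n J V U ord (cellId J i u v) r') := by
  have h := el_strictMono hrr hr'
  have h1 := el_pt hVm hUm ho hi hu hv (hrr.trans hr')
  have h2 := el_pt hVm hUm ho hi hu hv hr'
  have hn0 : 0 < n := by omega
  refine ho.mono _ _ ?_ (Nat.mod_lt _ hn0)
  have e1 := Nat.div_add_mod' (el (itemCell n J V U ord) (cellId J i u v) r) n
  have e2 := Nat.div_add_mod' (el (itemCell n J V U ord) (cellId J i u v) r') n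
  rw [h1.2.1] at e1
  rw [h2.2.1] at e2
  omega

theorem pt_inj {i u v r r' : ℕ} (hVm : ∀ p < n, 0 < V p ∧ V p < 1)
    (hUm : ∀ p < n, 0 < U p ∧ U p < 1) (ho : IsOrder n V ord) (hi : i ≤ J) (hu : u < 2 ^ i)
    (hv : v < 2 ^ (J - i))
    (hr : r < cntOf (itemCell n J V U ord) ((J + 1) * n) (cellId J i u v))
    (hr' : r' < cntOf (itemCell n J V U ord) ((J + 1) * n) (cellId J i u v))
    (h : pt n J V U ord (cellId J i u v) r = pt n J V U ord (cellId J i u v) r') : r = r' := by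
  by_contra hne
  rcases lt_or_gt_of_ne hne with hlt | hlt
  · exact (pt_mono hVm hUm ho hi hu hv hlt hr').ne (by rw [h])
  · exact (pt_mono hVm hUm ho hi hu hv hlt hr).ne (by rw [h])

theorem exists_item {p : ℕ} (ho : IsOrder n V ord) (hp : p < n) {i : ℕ} (hi : i ≤ J) :
    ∃ z < (J + 1) * n, z / n = i ∧ ord (z % n) = p ∧
      itemCell n J V U ord z = cellId J i ⌊V p * 2 ^ i⌋₊ ⌊U p * 2 ^ (J - i)⌋₊ := by
  obtain ⟨r, hr, rfl⟩ := ho.surj p hp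
  obtain ⟨e1, e2⟩ := div_mod_index (a := i) hr
  refine ⟨i * n + r, index_lt (by omega) hr, e1, by rw [e2], ?_⟩
  rw [itemCell, e1, e2]

theorem exists_pt (ho : IsOrder n V ord) {i : ℕ} (hi : i ≤ J) {p : ℕ} (hp : p < n) :
    ∃ r < cntOf (itemCell n J V U ord) ((J + 1) * n)
        (cellId J i ⌊V p * 2 ^ i⌋₊ ⌊U p * 2 ^ (J - i)⌋₊),
      pt n J V U ord (cellId J i ⌊V p * 2 ^ i⌋₊ ⌊U p * 2 ^ (J - i)⌋₊) r = p := by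
  obtain ⟨z, hz, h1, h2, h3⟩ := exists_item (U := U) ho hp hi
  have h4 : pos (itemCell n J V U ord) z < cntOf _ ((J + 1) * n) _ := pos_lt_count hz
  rw [h3] at h4
  refine ⟨_, h4, ?_⟩
  have := el_pos (itemCell n J V U ord) z
  rw [h3] at this
  rw [pt, this, h2]

/-- Transfers counts from points to positions in a list; this is how the bounds in `Typical` reach
the lists. -/
theorem card_filter_pt_le {i u v : ℕ} (hVm : ∀ p < n, 0 < V p ∧ V p < 1)
    (hUm : ∀ p < n, 0 < U p ∧ U p < 1) (ho : IsOrder n V ord) (hi : i ≤ J) (hu : u < 2 ^ i)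
    (hv : v < 2 ^ (J - i)) (A B : ℕ → Prop) [DecidablePred A] [DecidablePred B]
    (h : ∀ r < cntOf (itemCell n J V U ord) ((J + 1) * n) (cellId J i u v), A r →
      B (pt n J V U ord (cellId J i u v) r)) :
    ((Finset.range (cntOf (itemCell n J V U ord) ((J + 1) * n) (cellId J i u v))).filter A).card ≤
      ((Finset.range n).filter B).card := by
  refine Finset.card_le_card_of_injOn (pt n J V U ord (cellId J i u v)) ?_ ?_
  · intro r hr
    simp only [Finset.coe_filter, Finset.mem_range] at hr ⊢
    exact ⟨(el_pt hVm hUm ho hi hu hv hr.1).1, h r hr.1 hr.2⟩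
  · intro r hr r' hr'
    simp only [Finset.coe_filter, Finset.mem_range] at hr hr'
    exact pt_inj hVm hUm ho hi hu hv hr.1 hr'.1

theorem exists_of_cntOf_pos {g : ℕ} (hVm : ∀ p < n, 0 < V p ∧ V p < 1)
    (hUm : ∀ p < n, 0 < U p ∧ U p < 1) (ho : IsOrder n V ord)
    (hg : 0 < cntOf (itemCell n J V U ord) ((J + 1) * n) g) :
    ∃ i u v, i ≤ J ∧ u < 2 ^ i ∧ v < 2 ^ (J - i) ∧ g = cellId J i u v := by
  obtain ⟨h1, h2, -⟩ := el_spec hg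
  set z := el (itemCell n J V U ord) g 0
  have hn0 : 0 < n := by
    rcases Nat.eq_zero_or_pos n with h | h
    · simp [h] at h1
    · exact h
  have hp := ho.lt _ (Nat.mod_lt z hn0)
  have hz : z / n ≤ J := Nat.lt_succ_iff.1 (Nat.div_lt_of_lt_mul (by rwa [mul_comm]))
  exact ⟨z / n, _, _, hz, floor_mul_two_pow_lt (hVm _ hp).1.le (hVm _ hp).2 _,
    floor_mul_two_pow_lt (hUm _ hp).1.le (hUm _ hp).2 _, h2.symm⟩

/-- Stated for all numbers `g`, including those of no cell, whose lists are empty. -/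
theorem cntOf_lt_of_load {S : ℕ} (hVm : ∀ p < n, 0 < V p ∧ V p < 1)
    (hUm : ∀ p < n, 0 < U p ∧ U p < 1) (ho : IsOrder n V ord) (hS : 0 < S)
    (hload : ∀ i ≤ J, ∀ u v, ((Finset.range n).filter fun p =>
      ⌊V p * 2 ^ i⌋₊ = u ∧ ⌊U p * 2 ^ (J - i)⌋₊ = v).card < S) (g : ℕ) :
    cntOf (itemCell n J V U ord) ((J + 1) * n) g < S := by
  rcases Nat.eq_zero_or_pos (cntOf (itemCell n J V U ord) ((J + 1) * n) g) with h0 | h0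
  · omega
  · obtain ⟨i, u, v, hi, hu, hv, rfl⟩ := exists_of_cntOf_pos hVm hUm ho h0
    have := card_filter_pt_le hVm hUm ho hi hu hv (fun _ => True)
      (fun p => ⌊V p * 2 ^ i⌋₊ = u ∧ ⌊U p * 2 ^ (J - i)⌋₊ = v)
      (fun r hr _ => (el_pt hVm hUm ho hi hu hv hr).2.2)
    rw [Finset.filter_true, Finset.card_range] at this
    exact this.trans_lt (hload i hi u v)

/-! ### Masks -/

theorem sum_two_pow_lt {T : Finset ℕ} {m : ℕ} (h : ∀ k ∈ T, k < m) : ∑ k ∈ T, 2 ^ k < 2 ^ m :=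
  (Finset.sum_le_sum_of_subset (fun k hk => Finset.mem_range.2 (h k hk))).trans_lt
    (by rw [Nat.geomSum_eq le_rfl]; have : 0 < 2 ^ m := by positivity
        omega)

/-- The remainder keeps the bits up to `c`, and the quotient discards those up to `a`. -/
theorem mask_test (T : Finset ℕ) (a c : ℕ) :
    (∑ k ∈ T, 2 ^ k) % 2 ^ (c + 1) / 2 ^ (a + 1) ≠ 0 ↔ ∃ k ∈ T, a < k ∧ k ≤ c := by
  have hsplit : ∑ k ∈ T, 2 ^ k =
      ∑ k ∈ T.filter (· < c + 1), 2 ^ k + 2 ^ (c + 1) * ∑ k ∈ T.filter (¬ · < c + 1), 2 ^ (k - (c + 1)) := by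
    rw [← Finset.sum_filter_add_sum_filter_not T (· < c + 1), Finset.mul_sum]
    congr 1
    refine Finset.sum_congr rfl fun k hk => ?_
    rw [← pow_add, Nat.add_sub_cancel' (not_lt.1 (Finset.mem_filter.1 hk).2)]
  rw [hsplit, Nat.add_mul_mod_self_left, Nat.mod_eq_of_lt
    (sum_two_pow_lt fun k hk => (Finset.mem_filter.1 hk).2), Ne, Nat.div_eq_zero_iff]
  constructor
  · intro h
    by_contra hc
    push Not at hc
    refine h (.inr (sum_two_pow_lt fun k hk => ?_))
    rw [Finset.mem_filter] at hk
    by_contra hh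
    exact absurd (hc k hk.1 (by omega)) (by omega)
  · rintro ⟨k, hk, h1, h2⟩ (h | h)
    · simp at h
    · have : 2 ^ k ≤ ∑ k ∈ T.filter (· < c + 1), 2 ^ k :=
        Finset.single_le_sum (f := fun k => 2 ^ k) (fun _ _ => Nat.zero_le _)
          (Finset.mem_filter.2 ⟨hk, by omega⟩)
      have h3 : 2 ^ (a + 1) ≤ 2 ^ k := Nat.pow_le_pow_right (by norm_num) h1
      omega

/-- Distinct bits make a sum of powers a set, and the mask of a prefix is contained in that of a
longer prefix, so the subtraction has no borrows. -/
theorem maskSum_test {f ρ : ℕ → ℕ} {g r r' m a c : ℕ} (hr : r ≤ r') (hr' : r' ≤ m)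
    (hinj : ∀ x < m, ∀ y < m, ρ (el f g x) = ρ (el f g y) → x = y) :
    (maskSum f ρ g r' - maskSum f ρ g r) % 2 ^ (c + 1) / 2 ^ (a + 1) ≠ 0 ↔
      ∃ x, r ≤ x ∧ x < r' ∧ a < ρ (el f g x) ∧ ρ (el f g x) ≤ c := by
  have h1 : maskSum f ρ g r' - maskSum f ρ g r =
      ∑ k ∈ (Finset.Ico r r').image (fun x => ρ (el f g x)), 2 ^ k := by
    rw [Finset.sum_image, maskSum, maskSum, ← Finset.sum_range_add_sum_Ico _ hr,
      Nat.add_sub_cancel_left]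
    intro x hx y hy
    simp only [Finset.coe_Ico, Set.mem_Ico] at hx hy
    exact hinj x (by omega) y (by omega)
  rw [h1, mask_test]
  simp only [Finset.mem_image, Finset.mem_Ico]
  constructor
  · rintro ⟨k, ⟨x, ⟨h2, h3⟩, rfl⟩, h4, h5⟩
    exact ⟨x, h2, h3, h4, h5⟩
  · rintro ⟨x, h2, h3, h4, h5⟩
    exact ⟨_, ⟨x, ⟨h2, h3⟩, rfl⟩, h4, h5⟩

theorem maskSum_lt {f ρ : ℕ → ℕ} {g r S : ℕ}
    (hinj : ∀ x < r, ∀ y < r, ρ (el f g x) = ρ (el f g y) → x = y)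
    (h : ∀ x < r, ρ (el f g x) < S) : maskSum f ρ g r < 2 ^ S := by
  have : maskSum f ρ g r = ∑ k ∈ (Finset.range r).image (fun x => ρ (el f g x)), 2 ^ k := by
    rw [Finset.sum_image, maskSum]
    intro x hx y hy
    simp only [Finset.coe_range, Set.mem_Iio] at hx hy
    exact hinj x hx y hy
  rw [this]
  refine sum_two_pow_lt fun k hk => ?_
  obtain ⟨x, hx, rfl⟩ := Finset.mem_image.1 hk
  exact h x (Finset.mem_range.1 hx)

/-- In the row order of the other coordinate, the bit of a point is one more than its position. -/
theorem itemBit_pt {ord' yr : ℕ → ℕ} {i u v r : ℕ} (hVm : ∀ p < n, 0 < V p ∧ V p < 1)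
    (hUm : ∀ p < n, 0 < U p ∧ U p < 1) (ho : IsOrder n V ord) (ho' : IsOrder n U ord')
    (hyr : ∀ z < (J + 1) * n, yr (z / n * n + ord' (z % n)) = pos (itemCell n J U V ord') z + 1)
    (hi : i ≤ J) (hu : u < 2 ^ i) (hv : v < 2 ^ (J - i))
    (hr : r < cntOf (itemCell n J V U ord) ((J + 1) * n) (cellId J i u v)) :
    ∃ x < cntOf (itemCell n J U V ord') ((J + 1) * n) (cellId J (J - i) v u),
      pt n J U V ord' (cellId J (J - i) v u) x = pt n J V U ord (cellId J i u v) r ∧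
      itemBit n J ord yr (el (itemCell n J V U ord) (cellId J i u v) r) = x + 1 := by
  obtain ⟨h1, h2, h3, h4⟩ := el_pt hVm hUm ho hi hu hv hr
  obtain ⟨z, hz, e1, e2, e3⟩ := exists_item (V := U) (U := V) (J := J) ho' h1 (Nat.sub_le J i)
  rw [Nat.sub_sub_self hi, h3, h4] at e3
  have h5 : pos (itemCell n J U V ord') z < cntOf _ ((J + 1) * n) _ := pos_lt_count hz
  have h6 := el_pos (itemCell n J U V ord') z
  rw [e3] at h5 h6
  refine ⟨_, h5, ?_, ?_⟩
  · rw [pt, h6, e2]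
  · rw [itemBit, h2, ← hyr z hz, e1, e2, pt]

end

end RealRAM

namespace RealRAM

open BlindSearch

/-! ### Ranks -/

/-- Blind search for the word `W 33` in the node with code `W 34`. Word `i` of the node is at
position `W 35 + i * W 36`. -/
def nodeCmd (a : ℕ) : Cmd :=
  setW 37 (WA 3 (W 34 * W 6 + W 33)) ;;
  setW 38 (WA (32 + a) (W 35 + W 37 * W 36)) ;;
  setW 39 (WA 0 (WA 2 (W 33 * W 6 + W 38))) ;;
  setW 37 (WA 3 (W 34 * W 6 + (W 33 / W 39 * W 39 + Lt (W 38) (W 33) * (W 39 - Lit 1))))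

/-- Repetition of a program. -/
def iterCmd (c : Cmd) : ℕ → Cmd
  | 0 => .skip
  | k + 1 => c ;; iterCmd c k

/-- Advance the position `W 37` in the list at `W 32` of length `W 31`, if the coordinate there is
at most `R 11`. -/
def bumpCmd (a : ℕ) : Cmd :=
  .cond (Lt (W 37) (W 31))
    (.cond (.realLt (R 11) (RA (2 + a) (W 32 + W 37))) .skip (setW 37 (W 37 + Lit 1))) .skip

/-- Compute the number of points with coordinate at most `R 11` in a list. The level, the column and
the number of its cell are in the registers `50 + a`, `52 + a`, `54 + a`. -/
def rankCmd (a t : ℕ) : Cmd :=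
  setW 31 (WA (30 + a) (W (54 + a))) ;;
  .cond (W 31)
    (setW 32 (W (54 + a) * W 2) ;;
    setW 33 (minE (.floor (R 11 * .cast (WA 0 (W (50 + a)) * W 6)) - W (52 + a) * W 6)
      (W 6 - Lit 1)) ;;
    setW 34 (WA (38 + a) (W (54 + a))) ;;
    setW 35 (W 32) ;;
    setW 36 (W 7) ;;
    nodeCmd a ;;
    setW 37 (W 37 - (Lit 1 - Lt (WA (32 + a) (W 32 + W 37 * W 7)) (W 33))) ;;
    setW 35 (W 32 + W 37 * W 7) ;;
    setW 34 (WA (36 + a) (W 32 + W 37)) ;;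
    setW 36 (Lit 1) ;;
    nodeCmd a ;;
    setW 37 (W 35 - W 32 + W 37) ;;
    iterCmd (bumpCmd a) (2 * t))
    (setW 37 (Lit 0))

theorem runs_iter {w : ℕ} {S : ℕ∞} {c : Cmd} (I : ℕ → Mem → Prop)
    (h : ∀ j s, I j s → Runs w S c s (I (j + 1))) (k : ℕ) :
    ∀ {j : ℕ} {s : Mem}, I j s → Runs w S (iterCmd c k) s (I (j + k)) := by
  induction k with
  | zero => exact fun hs => runs_skip hs
  | succ k ih =>
    intro j s hs
    refine Runs.seq ((h j s hs).mono fun s' hs' => ?_)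
    rw [show j + (k + 1) = j + 1 + k by ring]
    exact ih hs'

theorem iterCmd_writesVar {c : Cmd} {τ : Ty} {x : ℕ} (h : c.writesVar τ x = false) (k : ℕ) :
    (iterCmd c k).writesVar τ x = false := by
  induction k with
  | zero => rfl
  | succ k ih => simp [iterCmd, Cmd.writesVar, h, ih]

theorem iterCmd_writesArr {c : Cmd} {τ : Ty} {x : ℕ} (h : c.writesArr τ x = false) (k : ℕ) :
    (iterCmd c k).writesArr τ x = false := by
  induction k with
  | zero => rfl
  | succ k ih => simp [iterCmd, Cmd.writesArr, h, ih]

theorem iterCmd_loopFree {c : Cmd} (h : c.loopFree = true) (k : ℕ) :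
    (iterCmd c k).loopFree = true := by
  induction k with
  | zero => rfl
  | succ k ih => simp [iterCmd, Cmd.loopFree, h, ih]

theorem rankCmd_loopFree (a t : ℕ) : (rankCmd a t).loopFree = true := by
  have := iterCmd_loopFree (c := bumpCmd a) rfl (2 * t)
  simp [rankCmd, Cmd.loopFree, nodeCmd, this]

/-- The memories agree outside of the word registers `31`, …, `39`. -/
structure Keeps (s s' : Mem) : Prop where
  wv : ∀ x, x < 31 ∨ 39 < x → s'.wv x = s.wv x
  rv : ∀ x, s'.rv x = s.rv x
  wa : ∀ a, s'.wa a = s.wa a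
  ra : ∀ a, s'.ra a = s.ra a

theorem Frame.keeps {a t : ℕ} {s s' : Mem} (h : Frame (rankCmd a t) s s') : Keeps s s' := by
  refine ⟨fun x hx => h.wv ?_, fun x => h.rv ?_, fun x => h.wa ?_, fun x => h.ra ?_⟩
  · have h1 : (iterCmd (bumpCmd a) (2 * t)).writesVar .word x = false :=
      iterCmd_writesVar (by simp [bumpCmd, Cmd.writesVar]; omega) _
    simp [rankCmd, Cmd.writesVar, nodeCmd, h1]
    omega
  · have h1 : (iterCmd (bumpCmd a) (2 * t)).writesVar .real x = false :=
      iterCmd_writesVar (by simp [bumpCmd, Cmd.writesVar]) _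
    simp [rankCmd, Cmd.writesVar, nodeCmd, h1]
  · have h1 : (iterCmd (bumpCmd a) (2 * t)).writesArr .word x = false :=
      iterCmd_writesArr (by simp [bumpCmd, Cmd.writesArr]) _
    simp [rankCmd, Cmd.writesArr, nodeCmd, h1]
  · have h1 : (iterCmd (bumpCmd a) (2 * t)).writesArr .real x = false :=
      iterCmd_writesArr (by simp [bumpCmd, Cmd.writesArr]) _
    simp [rankCmd, Cmd.writesArr, nodeCmd, h1]

theorem fillBits_lt {q d o b : ℕ} (hq : q < 2 ^ b) (hd : d ≤ b) (ho : o ≤ 1) :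
    fillBits q d o < 2 ^ b := by
  have h2 : 0 < 2 ^ d := by positivity
  have h1 : fillBits q d o / 2 ^ d < 2 ^ (b - d) := by
    rw [fillBits_div ho, Nat.div_lt_iff_lt_mul h2, ← pow_add, Nat.sub_add_cancel hd]
    exact hq
  rwa [Nat.div_lt_iff_lt_mul h2, ← pow_add, Nat.sub_add_cancel hd] at h1

/-- The table of the blind search. -/
def SearchTable (b e D : ℕ) (s : Mem) : Prop :=
  ∀ κ < 2 * (2 ^ e) ^ D, ∀ q < 2 ^ b, s.wa 3 (κ * 2 ^ b + q) = (tab (2 ^ e) q κ).1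

section
variable {a w SP S N b e D : ℕ} {s : Mem}

/-- Two lookups in the search table and one look at an actual key. The start `st` and the stride
`str` are parameters so that the same program searches the heads, with stride `D`, and a block, with
stride 1. -/
theorem runs_node {q st str k : ℕ} {σ : ℕ → ℕ} (ha : a = 0 ∨ a = 1) (hs : Small w SP S N b e D)
    (ht : Tables S b e D s) (htab : SearchTable b e D s) (he : 1 ≤ e) (hbS : b ≤ S)
    (hZ : 2 * (2 ^ e) ^ D * 2 ^ b ≤ SP)
    (hσ : ∀ i, σ i < 2 ^ b) (hmono : ∀ i < k, σ i ≤ σ (i + 1)) (hq : q < 2 ^ b)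
    (hcode : code (2 ^ e) σ k < 2 * (2 ^ e) ^ D)
    (h33 : s.wv 33 = q) (h34 : s.wv 34 = code (2 ^ e) σ k) (h35 : s.wv 35 = st)
    (h36 : s.wv 36 = str) (hkeys : ∀ i ≤ k, s.wa (32 + a) (st + i * str) = σ i)
    (hst : ∀ i ≤ k, st + i * str < 2 ^ w) :
    Runs w ⊤ (nodeCmd a) s fun s' => s'.wv 37 = search (2 ^ e) q σ k := by
  have hw1 := hs.one_le
  have hw := hs.word
  have hBB := hs.BB
  have hβ2 : 2 ≤ 2 ^ e := by
    calc 2 = 2 ^ 1 := rfl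
      _ ≤ 2 ^ e := Nat.pow_le_pow_right (by norm_num) he
  have hd : ∀ i < k, sep (σ i) (σ (i + 1)) < 2 ^ e := fun i _ =>
    (sep_le_of_lt (hσ _) (hσ _)).trans_lt hs.b_lt
  have hc := cand_le (q := q) hβ2 hmono hd
  have hi1 := index_lt hcode hq
  have htab1 := htab _ hcode q hq
  rw [search]
  set c := cand (2 ^ e) q σ k with hcdef
  have hst1 := hst c hc
  have hk1 := hkeys c hc
  have hi2 := index_lt hq (hσ c)
  have hsep1 := ht.sep q hq _ (hσ c)
  have hdb : sep q (σ c) ≤ b := sep_le_of_lt hq (hσ c)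
  set d := sep q (σ c) with hddef
  have hpow1 := ht.pow d (by omega)
  set o : ℕ := if σ c < q then 1 else 0 with ho
  have ho1 : o ≤ 1 := by rw [ho]; split_ifs <;> omega
  have hfl := fillBits_lt hq hdb ho1
  have hi3 := index_lt hcode hfl
  have htab2 := htab _ hcode _ hfl
  have hB := ht.B
  have hfl' := hfl
  rw [fillBits] at hfl'
  have hBw : 2 ^ b < 2 ^ w := by
    have : 2 ^ b ≤ 2 ^ b * 2 ^ b := Nat.le_mul_of_pos_left _ (by positivity)
    omega
  have hcs : c * str ≤ st + c * str := Nat.le_add_left _ _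
  rcases ha with rfl | rfl
  all_goals
    simp only [Nat.add_zero, Nat.reduceAdd] at hk1
    apply Runs.seq
    refine runs_setW (v := c) ((((gives_var h34).mul (gives_var hB) (by omega)).add (gives_var h33)
      (by omega)).get le_top htab1) ?_
    apply Runs.seq
    refine runs_setW (v := σ c) (((gives_var (by simpa using h35)).add ((gives_var (v := c)
      (by simp)).mul (gives_var (by simpa using h36)) (by omega)) hst1).get le_top
      (by simpa using hk1)) ?_
    apply Runs.seq
    refine runs_setW (v := 2 ^ d) (((((gives_var (by simpa using h33)).mul
      (gives_var (by simpa using hB)) (by omega)).add (gives_var (v := σ c) (by simp))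
      (by omega)).get (v := d) le_top (by simpa using hsep1)).get le_top (by simpa using hpow1)) ?_
    refine runs_setW ((((gives_var (by simpa using h34)).mul (gives_var (by simpa using hB))
      (by omega)).add (((((gives_var (by simpa using h33)).div (gives_var (v := 2 ^ d)
      (by simp))).mul (gives_var (v := 2 ^ d) (by simp)) (by omega)).add ((((gives_var (v := σ c)
      (by simp)).lt hw1 (gives_var (by simpa using h33))).cast ho.symm).mul ((gives_var (v := 2 ^ d)
      (by simp)).sub (gives_lit (by omega))) (by omega)) (by omega)).cast
      (v := fillBits q d o) rfl) (by omega)).get le_top (by simpa using htab2)) ?_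
    simp [cand]

/-- Rounding confuses only points with the same key. Between the position found and the true rank
there are only keys equal to the one found or to that of the query, each occurring fewer than `t`
times. -/
theorem find_rank {β D t qk m rk : ℕ} {κ : ℕ → ℕ} {v : ℕ → ℝ} {q : ℝ} (hβ : 2 ≤ β) (hD : 0 < D)
    (hm : 0 < m) (hs : ∀ i j, i ≤ j → j < m → κ i ≤ κ j)
    (hd : ∀ i j, i < m → j < m → sep (κ i) (κ j) < β)
    (hstrip : ∀ x, ((Finset.range m).filter (κ · = x)).card < t) (htD : t ≤ D)
    (hlow : ∀ r < m, κ r < qk → v r ≤ q) (hhigh : ∀ r < m, v r ≤ q → κ r ≤ qk)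
    (hrk : rk ≤ m) (hr : ∀ r < m, r < rk ↔ v r ≤ q) :
    find β D qk κ m ≤ rk ∧ rk ≤ find β D qk κ m + 2 * t := by
  -- Equal keys at distance `D` would give D+1 > t points with the same key, by monotonicity.
  obtain ⟨h1, h2, h3⟩ := find_spec (q := qk) hβ hD hm hs hd (fun i hi heq => by
    have : (Finset.Icc i (i + D)).card ≤ ((Finset.range m).filter (κ · = κ i)).card := by
      refine Finset.card_le_card fun j hj => ?_
      rw [Finset.mem_Icc] at hj
      rw [Finset.mem_filter, Finset.mem_range]
      have e1 := hs i j hj.1 (by omega)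
      have e2 := hs j (i + D) hj.2 hi
      omega
    have h4 := hstrip (κ i)
    rw [Nat.card_Icc] at this
    omega)
  set R := find β D qk κ m
  have hR : R ≤ rk := by
    by_contra hc
    have := (hr rk (by omega)).2 (hlow _ (by omega) (h2 rk (by omega)))
    omega
  refine ⟨hR, ?_⟩
  have hsub : Finset.Ico R rk ⊆
      (Finset.range m).filter (κ · = κ R) ∪ (Finset.range m).filter (κ · = qk) := by
    intro r hr'
    rw [Finset.mem_Ico] at hr'
    have hrm : r < m := by omega
    simp only [Finset.mem_union, Finset.mem_filter, Finset.mem_range]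
    rcases h3 r hrm hr'.1 with h | h
    · exact .inl ⟨hrm, h⟩
    · exact .inr ⟨hrm, le_antisymm (hhigh r hrm ((hr r hrm).1 hr'.2)) h⟩
  have := (Finset.card_le_card hsub).trans (Finset.card_union_le _ _)
  rw [Nat.card_Ico] at this
  have e1 := hstrip (κ R)
  have e2 := hstrip qk
  omega

/-- The key of the query is clamped to the cell: truncated subtraction gives 0 to the left of it,
and the minimum gives the last key to the right. `hlow` and `hhigh` are all that is needed of this
key. The position obtained is then moved by at most `2 * t` real comparisons. -/
theorem runs_rank {J t g i u m rk : ℕ} {κ : ℕ → ℕ} {v : ℕ → ℝ} {q : ℝ} (ha : a = 0 ∨ a = 1)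
    (hs : Small w SP S N b e D)
    (ht : Tables S b e D s) (htab : SearchTable b e D s) (he : 1 ≤ e) (hbS : b ≤ S)
    (hZ : 2 * (2 ^ e) ^ D * 2 ^ b ≤ SP) (hJS : J ≤ S) (hJb : 4 * (2 ^ J * 2 ^ b) < 2 ^ w)
    (h2 : s.wv 2 = S) (hlev : s.wv (50 + a) = i) (hcol : s.wv (52 + a) = u)
    (hid : s.wv (54 + a) = g) (hq : s.rv 11 = q) (hi : i ≤ J) (hu : u < 2 ^ i) (hg : g < N)
    (hq1 : q ≤ 1) (hmS : m < S) (hm : s.wa (30 + a) g = m)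
    (hvals : ∀ r < m, s.ra (2 + a) (g * S + r) = v r)
    (hkeys : ∀ r < m, s.wa (32 + a) (g * S + r) = κ r)
    (hleaf : ∀ j, j * D < m → s.wa (36 + a) (g * S + j) = blockCode (2 ^ e) D κ m j)
    (htop : 0 < m → s.wa (38 + a) g = topCode (2 ^ e) D κ m)
    (hκ : ∀ r, κ r < 2 ^ b) (hmono : ∀ i j, i ≤ j → j < m → κ i ≤ κ j)
    (hstrip : ∀ x, ((Finset.range m).filter (κ · = x)).card < t) (htD : t ≤ D)
    (hlow : ∀ r < m, κ r < min (⌊q * 2 ^ (i + b)⌋₊ - u * 2 ^ b) (2 ^ b - 1) → v r ≤ q)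
    (hhigh : ∀ r < m, v r ≤ q → κ r ≤ min (⌊q * 2 ^ (i + b)⌋₊ - u * 2 ^ b) (2 ^ b - 1))
    (hrk : rk ≤ m) (hr : ∀ r < m, r < rk ↔ v r ≤ q) :
    Runs w ⊤ (rankCmd a t) s fun s' => s'.wv 37 = rk := by
  have hw1 := hs.one_le
  have hw := hs.word
  have hSSP := hs.S_lt
  have hD0 := hs.D_pos
  have hNS := hs.NS
  have hDS := hs.D_lt
  have hgS : ∀ r < S, g * S + r < 2 ^ w := fun r hr => by
    have := index_lt hg hr
    omega
  have hB0 : 0 < 2 ^ b := by positivity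
  have hi2 : 2 ^ (i + b) ≤ 2 ^ J * 2 ^ b := by
    rw [← pow_add]
    exact Nat.pow_le_pow_right (by norm_num) (by omega)
  -- Equality is possible, for q = 1; the value still fits in a word.
  have hfl : ⌊q * 2 ^ (i + b)⌋₊ ≤ 2 ^ (i + b) := by
    have : q * 2 ^ (i + b) ≤ ((2 ^ (i + b) : ℕ) : ℝ) := by
      push_cast
      nlinarith [show (0 : ℝ) < 2 ^ (i + b) by positivity]
    exact (Nat.floor_le_floor this).trans_eq (Nat.floor_natCast _)
  have hub : u * 2 ^ b ≤ 2 ^ (i + b) := by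
    rw [pow_add]
    exact Nat.mul_le_mul_right _ hu.le
  have hβ2 : 2 ≤ 2 ^ e := by
    calc 2 = 2 ^ 1 := rfl
      _ ≤ 2 ^ e := Nat.pow_le_pow_right (by norm_num) he
  have hsepβ : ∀ i j, sep (κ i) (κ j) < 2 ^ e := fun i j =>
    (sep_le_of_lt (hκ _) (hκ _)).trans_lt hs.b_lt
  have hBB := hs.BB
  have hBBB : 2 ^ b ≤ 2 ^ b * 2 ^ b := Nat.le_mul_of_pos_left _ (by positivity)
  have hpow := ht.pow i (by omega)
  have hB := ht.B
  have hD := ht.D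
  set F := ⌊q * 2 ^ (i + b)⌋₊ with hF
  clear_value F
  obtain ⟨qk, hqk⟩ : ∃ qk, qk = min (F - u * 2 ^ b) (2 ^ b - 1) := ⟨_, rfl⟩
  rw [← hqk] at hlow hhigh
  have hqkb : qk < 2 ^ b := by omega
  have hfind : 0 < m → find (2 ^ e) D qk κ m ≤ rk ∧ rk ≤ find (2 ^ e) D qk κ m + 2 * t := fun h =>
    find_rank hβ2 hD0 h hmono (fun i j _ _ => hsepβ i j) hstrip htD hlow hhigh hrk hr
  have hlast : ∀ j ≤ (m - 1) / D, 0 < m → j * D < m := by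
    intro j hj hm
    have := (Nat.le_div_iff_mul_le hD0).1 hj
    omega
  have hfb : 0 < m → findBlock (2 ^ e) D qk κ m * D < m := fun h => by
    refine (findBlock_spec hβ2 hD0 h hmono (fun i j _ _ => hsepβ i j) (fun i hi heq => ?_)).1
    have : (Finset.Icc i (i + D)).card ≤ ((Finset.range m).filter (κ · = κ i)).card := by
      refine Finset.card_le_card fun j hj => ?_
      rw [Finset.mem_Icc] at hj
      rw [Finset.mem_filter, Finset.mem_range]
      have e1 := hmono i j hj.1 (by omega)
      have e2 := hmono j (i + D) hj.2 hi
      omega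
    have h4 := hstrip (κ i)
    rw [Nat.card_Icc] at this
    omega
  have ha' := ha
  rcases ha' with rfl | rfl
  all_goals
    simp only [Nat.add_zero, Nat.reduceAdd] at hlev hcol hid hm hvals hkeys hleaf htop
    apply Runs.seq
    refine runs_setW ((gives_var hid).get le_top hm) ?_
    refine runs_cond (gives_var (v := m) (by simp)) (fun hm0 => ?_) (fun hm0 => ?_)
    · have hm0 : 0 < m := by omega
      apply Runs.seq
      refine runs_setW (v := g * S) ((gives_var (by simpa using hid)).mul
        (gives_var (by simpa using h2)) (by have := hgS 0 (by omega); omega)) ?_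
      apply Runs.seq
      refine runs_setW (v := qk) ((((GivesR.floor (x := q * 2 ^ (i + b)) ((GivesR.mul
        (givesR_var (by simpa using hq)) (Gives.toReal (((gives_var (by simpa using hlev)).get
        le_top (by simpa using hpow)).mul (gives_var (by simpa using hB))
        (by rw [← pow_add]; omega)))).cast (by push_cast; rw [pow_add])) (by rw [← hF]; omega)).sub
        ((gives_var (by simpa using hcol)).mul (gives_var (by simpa using hB))
        (by omega))).minE ((gives_var (by simpa using hB)).sub (gives_lit (by omega)))).cast
        (by rw [← hF, hqk])) ?_
      apply Runs.seq
      refine runs_setW ((gives_var (by simpa using hid)).get le_top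
        (by simpa using htop hm0)) ?_
      apply Runs.seq
      refine runs_setW (gives_var (v := g * S) (by simp)) ?_
      apply Runs.seq
      refine runs_setW (gives_var (by simpa using hD)) ?_
      apply Runs.seq
      refine Runs.mono (Runs.frame (runs_node (q := qk) (st := g * S) (str := D) (σ := fun i => κ (i * D))
        (k := (m - 1) / D) ha hs (ht.congr (by simp) (by simp) (by simp) (by simp) (by simp))
        htab he hbS hZ (fun i => hκ _)
        (fun i hi => hmono _ _ (Nat.mul_le_mul_right _ (by omega)) (hlast _ (by omega) hm0)) hqkb
        (topCode_lt (by omega) hsepβ (by have := hs.S_le; omega)) (by simp) (by simp [topCode])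
        (by simp) (by simp) (fun j hj => by simpa using hkeys _ (hlast j hj hm0))
        (fun j hj => hgS _ (by have := hlast j hj hm0; omega)))) ?_
      rintro s₁ ⟨F₁, e37⟩
      have f31 : s₁.wv 31 = m := (F₁.wv rfl).trans (by simp)
      have f32 : s₁.wv 32 = g * S := (F₁.wv rfl).trans (by simp)
      have f33 : s₁.wv 33 = qk := (F₁.wv rfl).trans (by simp)
      have f7 : s₁.wv 7 = D := (F₁.wv rfl).trans (by simpa using hD)
      have f11 : s₁.rv 11 = q := (F₁.rv rfl).trans (by simpa using hq)
      have fwa : ∀ x, s₁.wa x = s.wa x := fun x => (F₁.wa rfl).trans (by simp)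
      have fra : ∀ x, s₁.ra x = s.ra x := fun x => (F₁.ra rfl).trans (by simp)
      have ht₁ : Tables S b e D s₁ := ht.congr ((F₁.wv rfl).trans (by simp))
        ((F₁.wv rfl).trans (by simp)) ((F₁.wv rfl).trans (by simp)) (fwa 0) (fwa 2)
      have htab₁ : SearchTable b e D s₁ := by rw [SearchTable, fwa]; exact htab
      set j := search (2 ^ e) qk (fun i => κ (i * D)) ((m - 1) / D) with hj
      have hjle : j ≤ (m - 1) / D := (search_spec hβ2
        (fun i hi => hmono _ _ (Nat.mul_le_mul_right _ (by omega)) (hlast _ (by omega) hm0))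
        (fun i _ => hsepβ _ _)).1
      have hjD := hlast j hjle hm0
      have hblock : j - (1 - if κ (j * D) < qk then 1 else 0) = findBlock (2 ^ e) D qk κ m := rfl
      have hbD := hfb hm0
      have hbb : findBlock (2 ^ e) D qk κ m ≤ findBlock (2 ^ e) D qk κ m * D :=
        Nat.le_mul_of_pos_right _ hD0
      have hfdef : find (2 ^ e) D qk κ m = findBlock (2 ^ e) D qk κ m * D +
        search (2 ^ e) qk (fun i => κ (findBlock (2 ^ e) D qk κ m * D + i))
          (blockLast D m (findBlock (2 ^ e) D qk κ m)) := rfl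
      have hlast' : ∀ i ≤ blockLast D m (findBlock (2 ^ e) D qk κ m),
          findBlock (2 ^ e) D qk κ m * D + i < m := by
        intro i hi
        rw [blockLast] at hi
        omega
      obtain ⟨hf1, hf2⟩ := hfind hm0
      set bl := findBlock (2 ^ e) D qk κ m with hbl
      set R := find (2 ^ e) D qk κ m with hR
      clear_value j bl R
      have hgjD := hgS (j * D) (by omega)
      have hgbD := hgS (bl * D) (by omega)
      have hgb := hgS bl (by omega)
      have hgR := hgS R (by omega)
      apply Runs.seq
      refine runs_setW (v := bl) (((gives_var e37).sub ((gives_lit (by omega)).sub (Gives.lt hw1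
        (((gives_var f32).add ((gives_var e37).mul (gives_var f7) (by omega)) (by omega)).get
        (v := κ (j * D)) le_top (by rw [fwa]; simpa using hkeys _ hjD)) (gives_var f33)))).cast
        hblock) ?_
      apply Runs.seq
      refine runs_setW (v := g * S + bl * D) ((gives_var (by simpa using f32)).add
        ((gives_var (v := bl) (by simp)).mul (gives_var (by simpa using f7)) (by omega))
        (by omega)) ?_
      apply Runs.seq
      refine runs_setW (v := blockCode (2 ^ e) D κ m bl) (((gives_var (by simpa using f32)).add
        (gives_var (v := bl) (by simp)) (by omega)).get le_top
        (by simpa [fwa] using hleaf bl hbD)) ?_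
      apply Runs.seq
      refine runs_setW (gives_lit (k := 1) (by omega)) ?_
      apply Runs.seq
      refine Runs.mono (Runs.frame (runs_node (q := qk) (st := g * S + bl * D) (str := 1) (σ := fun i => κ (bl * D + i))
        (k := blockLast D m bl) ha hs
        (ht₁.congr (by simp) (by simp) (by simp) (by simp) (by simp))
        htab₁ he hbS hZ (fun i => hκ _)
        (fun i hi => hmono _ _ (by omega) (hlast' _ (by omega))) hqkb
        (blockCode_lt (by omega) hsepβ) (by simpa using f33) (by simp [blockCode])
        (by simp) (by simp)
        (fun j hj => by simpa [fwa, add_assoc] using hkeys _ (hlast' j hj))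
        (fun j hj => by
          have := hgS _ ((hlast' j hj).trans hmS)
          omega))) ?_
      rintro s₂ ⟨F₂, e37'⟩
      apply Runs.seq
      refine runs_setW (v := R) (((((gives_var (v := g * S + bl * D) ((F₂.wv rfl).trans
        (by simp))).sub (gives_var (v := g * S) ((F₂.wv rfl).trans (by simpa using f32)))).add
        (gives_var e37') (by omega)).cast (by omega))) ?_
      -- The position advances by one until it reaches the rank and then stays there; after `2 * t`
      -- rounds it has arrived, by `find_rank`.
      refine (runs_iter (fun k s' => s'.wv 37 = min (R + k) rk ∧ s'.wv 31 = m ∧ s'.wv 32 = g * S ∧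
        s'.rv 11 = q ∧ ∀ x, s'.ra x = s.ra x) ?_ (2 * t) (j := 0) ?_).mono ?_
      · rintro k s₃ ⟨g37, g31, g32, g11, gra⟩
        have hmin : min (R + k) rk ≤ rk := min_le_right _ _
        obtain ⟨x, hx⟩ : ∃ x, x = min (R + k) rk := ⟨_, rfl⟩
        rw [← hx] at hmin g37
        refine runs_cond ((gives_var g37).lt hw1 (gives_var g31)) (fun h => ?_)
          (fun h => runs_skip ?_)
        · have hxm : x < m := by by_contra hh; simp [hh] at h
          have hgx := hgS x (by omega)
          refine runs_cond (GivesR.lt hw1 (givesR_var g11) (((gives_var g32).add (gives_var g37)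
            (by omega)).getR (x := v x) le_top (by rw [gra]; simpa using hvals x hxm)))
            (fun h' => runs_skip ?_) (fun h' => ?_)
          · have hlt : q < v x := by by_contra hh; simp [hh] at h'
            have : ¬ x < rk := fun hh => absurd ((hr x hxm).1 hh) (not_le.2 hlt)
            exact ⟨by rw [g37]; omega, g31, g32, g11, gra⟩
          · have hle : v x ≤ q := by
              by_contra hh
              simp [not_le.1 hh] at h'
            have := (hr x hxm).2 hle
            refine runs_setW ((gives_var g37).add (gives_lit (by omega)) (by omega)) ?_
            refine ⟨?_, by simpa using g31, by simpa using g32, by simpa using g11,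
              by simpa using gra⟩
            simp only [Mem.wv_setVar_word, if_true]
            omega
        · have hxm : ¬ x < m := by intro hh; simp [hh] at h
          exact ⟨by rw [g37]; omega, g31, g32, g11, gra⟩
      · refine ⟨?_, ?_, ?_, ?_, fun x => ?_⟩
        · simp only [Mem.wv_setVar_word, if_true]
          omega
        · simpa using (F₂.wv rfl).trans (by simpa using f31)
        · simpa using (F₂.wv rfl).trans (by simpa using f32)
        · simpa using (F₂.rv rfl).trans (by simpa using f11)
        · simpa using (F₂.ra rfl).trans (by simpa using fra x)
      · rintro s₃ ⟨g37, -⟩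
        rw [g37]
        omega
    · refine runs_setW (gives_lit (k := 0) (by omega)) ?_
      simp only [Mem.wv_setVar_word, if_true]
      omega

end

end RealRAM

/-! ### Ranks and emptiness tests inside one cell -/

namespace RealRAM

open BlindSearch

/-- The number of points with coordinate at most `q` in list `g`. -/
noncomputable def cellRank (n J : ℕ) (V U : ℕ → ℝ) (ord : ℕ → ℕ) (g : ℕ) (q : ℝ) : ℕ :=
  open Classical in
  ((Finset.range (cntOf (itemCell n J V U ord) ((J + 1) * n) g)).filter
    fun r => V (pt n J V U ord g r) ≤ q).card

section
variable {a w SP n S J b e D t i u v : ℕ} {V U : ℕ → ℝ} {ord ρ : ℕ → ℕ} {s : Mem} {q : ℝ}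

/-- A downward closed subset of an initial segment is itself an initial segment, of length its
cardinality. -/
theorem card_filter_range_of_lower {m : ℕ} {A : ℕ → Prop} [DecidablePred A]
    (h : ∀ r r', r < r' → r' < m → A r' → A r) :
    ((Finset.range m).filter A).card ≤ m ∧
      ∀ r < m, r < ((Finset.range m).filter A).card ↔ A r := by
  refine ⟨(Finset.card_filter_le _ _).trans_eq (Finset.card_range m), fun r hr => ⟨fun hlt => ?_,
    fun hA => ?_⟩⟩
  · by_contra hA
    have : (Finset.range m).filter A ⊆ Finset.range r := by
      intro x hx
      rw [Finset.mem_filter, Finset.mem_range] at hx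
      rw [Finset.mem_range]
      by_contra hc
      rcases (not_lt.1 hc).lt_or_eq with h1 | h1
      · exact hA (h r x h1 hx.1 hx.2)
      · exact hA (h1 ▸ hx.2)
    have := Finset.card_le_card this
    rw [Finset.card_range] at this
    omega
  · have : Finset.range (r + 1) ⊆ (Finset.range m).filter A := by
      intro x hx
      rw [Finset.mem_range] at hx
      rw [Finset.mem_filter, Finset.mem_range]
      refine ⟨by omega, ?_⟩
      rcases (Nat.lt_succ_iff.1 hx).lt_or_eq with h1 | h1
      · exact h x r h1 hr hA
      · exact h1 ▸ hA
    have := Finset.card_le_card this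
    rw [Finset.card_range] at this
    omega

theorem cellRank_spec (hVm : ∀ p < n, 0 < V p ∧ V p < 1) (hUm : ∀ p < n, 0 < U p ∧ U p < 1)
    (ho : IsOrder n V ord) (hi : i ≤ J) (hu : u < 2 ^ i) (hv : v < 2 ^ (J - i)) :
    cellRank n J V U ord (cellId J i u v) q ≤
        cntOf (itemCell n J V U ord) ((J + 1) * n) (cellId J i u v) ∧
      ∀ r < cntOf (itemCell n J V U ord) ((J + 1) * n) (cellId J i u v),
        r < cellRank n J V U ord (cellId J i u v) q ↔ V (pt n J V U ord (cellId J i u v) r) ≤ q := by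
  classical
  unfold cellRank
  convert card_filter_range_of_lower (A := fun r => V (pt n J V U ord (cellId J i u v) r) ≤ q) ?_
  exact fun r r' hrr hr' h => (pt_mono hVm hUm ho hi hu hv hrr hr').le.trans h

theorem key_add {x : ℝ} (hx : ⌊x * 2 ^ i⌋₊ = u) :
    ⌊x * 2 ^ (i + b)⌋₊ = u * 2 ^ b + ⌊x * 2 ^ (i + b)⌋₊ % 2 ^ b := by
  have h1 := floor_mul_two_pow_div x i b
  have h2 := Nat.div_add_mod' ⌊x * 2 ^ (i + b)⌋₊ (2 ^ b)
  rw [h1, hx] at h2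
  exact h2.symm

theorem runs_rank_of_lists (ha : a = 0 ∨ a = 1) (hs : Small w SP S ((J + 1) * 2 ^ J) b e D)
    (ht : Tables S b e D s) (htab : SearchTable b e D s) (he : 1 ≤ e) (hbS : b ≤ S)
    (hZ : 2 * (2 ^ e) ^ D * 2 ^ b ≤ SP) (hJS : J ≤ S) (hJb : 4 * (2 ^ J * 2 ^ b) < 2 ^ w) (htD : t ≤ D)
    (hVm : ∀ p < n, 0 < V p ∧ V p < 1) (hUm : ∀ p < n, 0 < U p ∧ U p < 1) (ho : IsOrder n V ord)
    (hL : Lists a S D (2 ^ e) (itemCell n J V U ord) (itemVal n V ord) (itemKey n b V ord) ρ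
      ((J + 1) * n) s)
    (hload : ∀ i ≤ J, ∀ u v, ((Finset.range n).filter fun p =>
      ⌊V p * 2 ^ i⌋₊ = u ∧ ⌊U p * 2 ^ (J - i)⌋₊ = v).card < S)
    (hstrip : ∀ i ≤ J, ∀ u v, ((Finset.range n).filter fun p =>
      ⌊V p * 2 ^ (i + b)⌋₊ = u ∧ ⌊U p * 2 ^ (J - i)⌋₊ = v).card < t)
    (hi : i ≤ J) (hu : u < 2 ^ i) (hv : v < 2 ^ (J - i)) (hq1 : q ≤ 1)
    (h2 : s.wv 2 = S) (hlev : s.wv (50 + a) = i) (hcol : s.wv (52 + a) = u)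
    (hid : s.wv (54 + a) = cellId J i u v) (hq : s.rv 11 = q) :
    Runs w ⊤ (rankCmd a t) s fun s' =>
      s'.wv 37 = cellRank n J V U ord (cellId J i u v) q := by
  obtain ⟨hrk, hr⟩ := cellRank_spec (q := q) hVm hUm ho hi hu hv
  have hS0 : 0 < S := by have := hs.D_lt; omega
  have hkey : ∀ r < cntOf (itemCell n J V U ord) ((J + 1) * n) (cellId J i u v),
      ⌊V (pt n J V U ord (cellId J i u v) r) * 2 ^ (i + b)⌋₊ =
        u * 2 ^ b + itemKey n b V ord (el (itemCell n J V U ord) (cellId J i u v) r) := by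
    intro r hr
    obtain ⟨h1, h2, h3, h4⟩ := el_pt hVm hUm ho hi hu hv hr
    rw [itemKey, h2]
    exact key_add h3
  have hkb : ∀ z, itemKey n b V ord z < 2 ^ b := fun z => Nat.mod_lt _ (by positivity)
  have hfl : ∀ {x y : ℝ}, x ≤ y → ⌊x * 2 ^ (i + b)⌋₊ ≤ ⌊y * 2 ^ (i + b)⌋₊ := fun h =>
    Nat.floor_le_floor (mul_le_mul_of_nonneg_right h (by positivity))
  refine runs_rank (κ := fun r => itemKey n b V ord (el (itemCell n J V U ord) (cellId J i u v) r))
    (v := fun r => V (pt n J V U ord (cellId J i u v) r))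
    ha hs ht htab he hbS hZ hJS hJb h2 hlev hcol hid hq hi hu (cellId_lt hi hu hv) hq1
    (cntOf_lt_of_load hVm hUm ho hS0 hload _) (hL.cnt _) (hL.vals _) (hL.keys _) (hL.leaf _)
    (hL.top _) (fun r => hkb _) ?_ ?_ htD ?_ ?_ hrk hr
  · intro r r' hrr hr'
    rcases hrr.lt_or_eq with h | h
    · have h1 := hkey r (h.trans hr')
      have h2 := hkey r' hr'
      have h3 := hfl (pt_mono hVm hUm ho hi hu hv h hr').le
      omega
    · rw [h]
  -- Points of a cell with the same key lie in one strip of `Typical`, with index `u * 2 ^ b + x`.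
  · intro x
    refine (card_filter_pt_le hVm hUm ho hi hu hv _ (fun p =>
      ⌊V p * 2 ^ (i + b)⌋₊ = u * 2 ^ b + x ∧ ⌊U p * 2 ^ (J - i)⌋₊ = v) ?_).trans_lt
      (hstrip i hi (u * 2 ^ b + x) v)
    intro r hr hx
    exact ⟨by rw [hkey r hr, hx], (el_pt hVm hUm ho hi hu hv hr).2.2.2⟩
  · intro r hr hlt
    by_contra hc
    have h1 := hkey r hr
    have h2 := hfl (not_le.1 hc).le
    omega
  · intro r hr hle
    have h1 := hkey r hr
    have h2 := hfl hle
    have h3 := hkb (el (itemCell n J V U ord) (cellId J i u v) r)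
    omega

end

/-! ### Queries in a cell -/

/-- The data structure for the points with coordinates `X` and `Y`. -/
structure Ready (w SP n S J b e D t : ℕ) (X Y : ℕ → ℝ) (ordX ordY yr ρ : ℕ → ℕ) (s : Mem) :
    Prop where
  small : Small w SP S ((J + 1) * 2 ^ J) b e D
  e_pos : 1 ≤ e
  b_le : b ≤ S
  J_le : J ≤ S
  pow_le : 2 ^ J ≤ n
  n_lt : n < 2 ^ w
  table : 2 * (2 ^ e) ^ D * 2 ^ b ≤ SP
  key : 4 * (2 ^ J * 2 ^ b) < 2 ^ w
  t_le : t ≤ D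
  reg0 : s.wv 0 = n
  reg2 : s.wv 2 = S
  reg3 : s.wv 3 = J
  reg4 : s.wv 4 = 2 ^ J
  tables : Tables S b e D s
  searchTable : SearchTable b e D s
  log : ∀ k ≤ n, s.wa 1 k = Nat.log 2 k
  orderX : IsOrder n X ordX
  orderY : IsOrder n Y ordY
  bits : ∀ z < (J + 1) * n, yr (z / n * n + ordY (z % n)) = pos (itemCell n J Y X ordY) z + 1
  listsX : Lists 0 S D (2 ^ e) (itemCell n J X Y ordX) (itemVal n X ordX) (itemKey n b X ordX)
    (itemBit n J ordX yr) ((J + 1) * n) s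
  listsY : Lists 1 S D (2 ^ e) (itemCell n J Y X ordY) (itemVal n Y ordY) (itemKey n b Y ordY) ρ
    ((J + 1) * n) s

section
variable {w SP n S J b e D t : ℕ} {X Y : ℕ → ℝ} {ordX ordY yr ρ : ℕ → ℕ} {s s' : Mem}

theorem Ready.congr (h : Ready w SP n S J b e D t X Y ordX ordY yr ρ s)
    (hv : ∀ x < 10, s'.wv x = s.wv x) (hwa : ∀ x, s'.wa x = s.wa x) (hra : ∀ x, s'.ra x = s.ra x) :
    Ready w SP n S J b e D t X Y ordX ordY yr ρ s' :=
  { h with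
    reg0 := (hv _ (by omega)).trans h.reg0
    reg2 := (hv _ (by omega)).trans h.reg2
    reg3 := (hv _ (by omega)).trans h.reg3
    reg4 := (hv _ (by omega)).trans h.reg4
    tables := h.tables.congr (hv _ (by omega)) (hv _ (by omega)) (hv _ (by omega)) (hwa _) (hwa _)
    searchTable := by rw [SearchTable, hwa]; exact h.searchTable
    log := by rw [hwa]; exact h.log
    listsX := h.listsX.congr (hwa _) (hra _) (hwa _) (hwa _) (hwa _) (hwa _)
    listsY := h.listsY.congr (hwa _) (hra _) (hwa _) (hwa _) (hwa _) (hwa _) }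

/-- Set `W 60` to `1` if the rectangle contains a point in the cell of level `W 50`, column `W 52`
and row `W 53`. -/
def cellCmd (t : ℕ) : Cmd :=
  setW 54 (W 50 * W 4 + (W 52 * WA 0 (W 51) + W 53)) ;;
  setW 55 (W 51 * W 4 + (W 53 * WA 0 (W 50) + W 52)) ;;
  setR 11 (R 0) ;; rankCmd 0 t ;; setW 56 (W 37) ;;
  setR 11 (R 1) ;; rankCmd 0 t ;; setW 57 (W 37) ;;
  setR 11 (R 2) ;; rankCmd 1 t ;; setW 58 (W 37) ;;
  setR 11 (R 3) ;; rankCmd 1 t ;; setW 59 (W 37) ;;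
  Cmd.cond ((WA 34 (W 54 * W 2 + W 57) - WA 34 (W 54 * W 2 + W 56)) % WA 0 (W 59 + Lit 1) /
    WA 0 (W 58 + Lit 1)) (setW 60 (Lit 1)) .skip

/-- A point lies in the horizontal range iff its index in the list by abscissa is between the ranks
of `x` and `x'`, and similarly for the ordinate. The bit of a point is one more than its position,
so the points above `y` and up to `y'` have exactly the bits greater than the rank of `y` and at
most that of `y'`. In the list by ordinate the same cell has level `J - i`, with column and row
exchanged. -/
theorem cell_test {x x' y y' : ℝ} {i u v : ℕ} (hT : RandomPoints.Typical n J S b t X Y)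
    (hoX : IsOrder n X ordX) (hoY : IsOrder n Y ordY)
    (hbits : ∀ z < (J + 1) * n,
      yr (z / n * n + ordY (z % n)) = pos (itemCell n J Y X ordY) z + 1)
    (hx : x ≤ x') (hi : i ≤ J) (hu : u < 2 ^ i) (hv : v < 2 ^ (J - i)) :
    (maskSum (itemCell n J X Y ordX) (itemBit n J ordX yr) (cellId J i u v)
        (cellRank n J X Y ordX (cellId J i u v) x') -
      maskSum (itemCell n J X Y ordX) (itemBit n J ordX yr) (cellId J i u v)
        (cellRank n J X Y ordX (cellId J i u v) x)) %
      2 ^ (cellRank n J Y X ordY (cellId J (J - i) v u) y' + 1) /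
      2 ^ (cellRank n J Y X ordY (cellId J (J - i) v u) y + 1) ≠ 0 ↔
    ∃ p < n, (⌊X p * 2 ^ i⌋₊ = u ∧ ⌊Y p * 2 ^ (J - i)⌋₊ = v) ∧ (x < X p ∧ X p ≤ x') ∧
      (y < Y p ∧ Y p ≤ y') := by
  have hi' : J - i ≤ J := Nat.sub_le _ _
  have hJi : J - (J - i) = i := Nat.sub_sub_self hi
  have hu' : u < 2 ^ (J - (J - i)) := by rwa [hJi]
  obtain ⟨h1, h2⟩ := cellRank_spec (q := x) hT.X_mem hT.Y_mem hoX hi hu hv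
  obtain ⟨h1', h2'⟩ := cellRank_spec (q := x') hT.X_mem hT.Y_mem hoX hi hu hv
  obtain ⟨-, h4⟩ := cellRank_spec (q := y) hT.Y_mem hT.X_mem hoY hi' hv hu'
  obtain ⟨-, h4'⟩ := cellRank_spec (q := y') hT.Y_mem hT.X_mem hoY hi' hv hu'
  have hbit := fun r hr => itemBit_pt (r := r) hT.X_mem hT.Y_mem hoX hoY hbits hi hu hv hr
  -- Needed because the subtraction of the masks is truncated.
  have hle : cellRank n J X Y ordX (cellId J i u v) x ≤
      cellRank n J X Y ordX (cellId J i u v) x' := by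
    by_contra hc
    have h5 := (h2 (cellRank n J X Y ordX (cellId J i u v) x') (by omega)).1 (by omega)
    have h6 := (h2' (cellRank n J X Y ordX (cellId J i u v) x') (by omega)).2 (h5.trans hx)
    omega
  rw [maskSum_test hle h1' (fun r hr r' hr' h => by
    obtain ⟨z, -, e2, e3⟩ := hbit r hr
    obtain ⟨z', -, e5, e6⟩ := hbit r' hr'
    obtain rfl : z = z' := by omega
    exact pt_inj hT.X_mem hT.Y_mem hoX hi hu hv hr hr' (e2.symm.trans e5))]
  constructor
  · rintro ⟨r, hr1, hr2, hr3, hr4⟩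
    have hr : r < cntOf (itemCell n J X Y ordX) ((J + 1) * n) (cellId J i u v) := by omega
    obtain ⟨z, hz, e2, e3⟩ := hbit r hr
    obtain ⟨k1, -, k3, k4⟩ := el_pt hT.X_mem hT.Y_mem hoX hi hu hv hr
    rw [e3] at hr3 hr4
    refine ⟨_, k1, ⟨k3, k4⟩, ⟨?_, (h2' r hr).1 hr2⟩, ?_, ?_⟩
    · by_contra hc
      have := (h2 r hr).2 (not_lt.1 hc)
      omega
    · by_contra hc
      rw [← e2] at hc
      have := (h4 z hz).2 (not_lt.1 hc)
      omega
    · rw [← e2]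
      exact (h4' z hz).1 (by omega)
  · rintro ⟨p, hp, ⟨rfl, rfl⟩, ⟨q1, q2⟩, q3, q4⟩
    obtain ⟨r, hr, hrp⟩ := exists_pt (U := Y) hoX hi hp
    obtain ⟨z, hz, e2, e3⟩ := hbit r hr
    rw [hrp] at e2
    refine ⟨r, ?_, (h2' r hr).2 (by rwa [hrp]), ?_, ?_⟩
    · by_contra hc
      have := (h2 r hr).1 (by omega)
      rw [hrp] at this
      exact absurd this (not_le.2 q1)
    · rw [e3]
      by_contra hc
      have := (h4 z hz).1 (by omega)
      rw [e2] at this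
      exact absurd this (not_le.2 q3)
    · rw [e3]
      have := (h4' z hz).2 (by rw [e2]; exact q4)
      omega

theorem runs_cell {x x' y y' : ℝ} {i u v : ℕ} (hT : RandomPoints.Typical n J S b t X Y)
    (h : Ready w SP n S J b e D t X Y ordX ordY yr ρ s) (hx : x ≤ x') (hx1 : x' ≤ 1)
    (hy : y ≤ y') (hy1 : y' ≤ 1) (hi : i ≤ J) (hu : u < 2 ^ i) (hv : v < 2 ^ (J - i))
    (h0 : s.rv 0 = x) (h1 : s.rv 1 = x') (h2 : s.rv 2 = y) (h3 : s.rv 3 = y')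
    (h50 : s.wv 50 = i) (h51 : s.wv 51 = J - i) (h52 : s.wv 52 = u) (h53 : s.wv 53 = v) :
    Runs w ⊤ (cellCmd t) s fun s' =>
      (s'.wv 60 ≠ 0 ↔ s.wv 60 ≠ 0 ∨ ∃ p < n,
        (⌊X p * 2 ^ i⌋₊ = u ∧ ⌊Y p * 2 ^ (J - i)⌋₊ = v) ∧ (x < X p ∧ X p ≤ x') ∧
          (y < Y p ∧ Y p ≤ y')) ∧
      (∀ z, z < 31 ∨ z = 50 ∨ z = 51 ∨ 60 < z → s'.wv z = s.wv z) ∧ (∀ z < 10, s'.rv z = s.rv z) ∧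
      (∀ z, s'.wa z = s.wa z) ∧ ∀ z, s'.ra z = s.ra z := by
  have hw1 := h.small.one_le
  have hw := h.small.word
  have hSSP := h.small.S_lt
  have hi' : J - i ≤ J := Nat.sub_le _ _
  have hJi : J - (J - i) = i := Nat.sub_sub_self hi
  have hu' : u < 2 ^ (J - (J - i)) := by rwa [hJi]
  -- Exchanging the coordinates exchanges level `i` with level `J - i`.
  have hloadY : ∀ i ≤ J, ∀ u v, ((Finset.range n).filter fun p =>
      ⌊Y p * 2 ^ i⌋₊ = u ∧ ⌊X p * 2 ^ (J - i)⌋₊ = v).card < S := by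
    intro i hi u v
    have := hT.load (J - i) (Nat.sub_le _ _) v u
    simp only [Nat.sub_sub_self hi] at this
    simpa only [and_comm] using this
  have hstripY : ∀ i ≤ J, ∀ u v, ((Finset.range n).filter fun p =>
      ⌊Y p * 2 ^ (i + b)⌋₊ = u ∧ ⌊X p * 2 ^ (J - i)⌋₊ = v).card < t := by
    intro i hi u v
    have := hT.stripY (J - i) (Nat.sub_le _ _) v u
    simp only [Nat.sub_sub_self hi] at this
    simpa only [and_comm] using this
  have hS0 : 0 < S := by have := h.small.D_lt; omega
  have hJS := h.J_le
  have hid := cellId_lt hi hu hv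
  have hid' := cellId_lt hi' hv hu'
  have hidd := hid
  have hidd' := hid'
  rw [cellId] at hidd hidd'
  rw [hJi] at hidd'
  have hN := h.small.N_lt
  have hNS := h.small.NS
  have hmX := cntOf_lt_of_load hT.X_mem hT.Y_mem h.orderX hS0 hT.load (cellId J i u v)
  have hmY := cntOf_lt_of_load hT.Y_mem hT.X_mem h.orderY hS0 hloadY (cellId J (J - i) v u)
  have hpow1 := h.tables.pow i (by omega)
  have hpow2 := h.tables.pow (J - i) (by omega)
  have rkX : ∀ q, q ≤ 1 → ∀ r : Mem, Ready w SP n S J b e D t X Y ordX ordY yr ρ r →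
      r.wv 50 = i → r.wv 52 = u → r.wv 54 = cellId J i u v → r.rv 11 = q →
      Runs w ⊤ (rankCmd 0 t) r fun r' =>
        r'.wv 37 = cellRank n J X Y ordX (cellId J i u v) q := by
    intro q hq r hr k1 k2 k3 k4
    exact runs_rank_of_lists (.inl rfl) hr.small hr.tables hr.searchTable hr.e_pos hr.b_le hr.table
      hr.J_le hr.key hr.t_le hT.X_mem hT.Y_mem hr.orderX hr.listsX hT.load hT.stripX hi hu hv hq
      hr.reg2 k1 k2 k3 k4
  have rkY : ∀ q, q ≤ 1 → ∀ r : Mem, Ready w SP n S J b e D t X Y ordX ordY yr ρ r →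
      r.wv 51 = J - i → r.wv 53 = v → r.wv 55 = cellId J (J - i) v u → r.rv 11 = q →
      Runs w ⊤ (rankCmd 1 t) r fun r' =>
        r'.wv 37 = cellRank n J Y X ordY (cellId J (J - i) v u) q := by
    intro q hq r hr k1 k2 k3 k4
    exact runs_rank_of_lists (.inr rfl) hr.small hr.tables hr.searchTable hr.e_pos hr.b_le hr.table
      hr.J_le hr.key hr.t_le hT.Y_mem hT.X_mem hr.orderY hr.listsY hloadY hstripY hi' hv hu' hq
      hr.reg2 k1 k2 k3 k4
  have hrX := (cellRank_spec (q := x) hT.X_mem hT.Y_mem h.orderX hi hu hv).1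
  have hrX' := (cellRank_spec (q := x') hT.X_mem hT.Y_mem h.orderX hi hu hv).1
  have hrY := (cellRank_spec (q := y) hT.Y_mem hT.X_mem h.orderY hi' hv hu').1
  have hrY' := (cellRank_spec (q := y') hT.Y_mem hT.X_mem h.orderY hi' hv hu').1
  have htest := cell_test (x := x) (x' := x') (y := y) (y' := y') hT h.orderX h.orderY h.bits hx hi
    hu hv
  have hmask := fun r hr => h.listsX.mask (cellId J i u v) r hr
  simp only [Nat.add_zero] at hmask
  have hidx := fun r (hr : r < S) => index_lt hid hr
  set cX := cellRank n J X Y ordX (cellId J i u v) x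
  set cX' := cellRank n J X Y ordX (cellId J i u v) x'
  set cY := cellRank n J Y X ordY (cellId J (J - i) v u) y
  set cY' := cellRank n J Y X ordY (cellId J (J - i) v u) y'
  apply Runs.seq
  refine runs_setW (v := cellId J i u v) (((gives_var h50).mul (gives_var h.reg4) (by omega)).add
    (((gives_var h52).mul ((gives_var h51).get le_top hpow2) (by omega)).add (gives_var h53)
    (by omega)) (by omega)) ?_
  apply Runs.seq
  refine runs_setW (v := cellId J (J - i) v u) ((((gives_var (by simpa using h51)).mul
    (gives_var (by simpa using h.reg4)) (by omega)).add (((gives_var (by simpa using h53)).mul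
    ((gives_var (by simpa using h50)).get le_top (by simpa using hpow1)) (by omega)).add
    (gives_var (by simpa using h52)) (by omega)) (by omega)).cast (by rw [cellId, hJi])) ?_
  apply Runs.seq
  refine runs_setR (givesR_var (by simpa using h0)) ?_
  have hR1 : Ready w SP n S J b e D t X Y ordX ordY yr ρ
      (((s.setVar .word 54 (cellId J i u v)).setVar .word 55 (cellId J (J - i) v u)).setVar
        .real 11 x) := h.congr (fun z hz => by
          simp [show z ≠ 54 by omega, show z ≠ 55 by omega]) (by simp) (by simp)
  apply Runs.seq
  refine Runs.mono (Runs.frame (rkX x (hx.trans hx1) _ hR1 (by simpa using h50) (by simpa using h52)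
    (by simp) (by simp))) ?_
  rintro s₁ ⟨F₁, e₁⟩
  have K₁ := F₁.keeps
  have hR1' := hR1.congr (fun z hz => K₁.wv z (by omega)) K₁.wa K₁.ra
  have a50 := (K₁.wv 50 (by omega)).trans (by simpa using h50)
  have a51 := (K₁.wv 51 (by omega)).trans (by simpa using h51)
  have a52 := (K₁.wv 52 (by omega)).trans (by simpa using h52)
  have a53 := (K₁.wv 53 (by omega)).trans (by simpa using h53)
  have a54 : s₁.wv 54 = cellId J i u v := (K₁.wv 54 (by omega)).trans (by simp)
  have a55 : s₁.wv 55 = cellId J (J - i) v u := (K₁.wv 55 (by omega)).trans (by simp)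
  have a0 := (K₁.rv 0).trans (by simpa using h0)
  have a1 := (K₁.rv 1).trans (by simpa using h1)
  have a2 := (K₁.rv 2).trans (by simpa using h2)
  have a3 := (K₁.rv 3).trans (by simpa using h3)
  have aw : ∀ z, z < 31 ∨ z = 50 ∨ z = 51 ∨ 59 < z → s₁.wv z = s.wv z := fun z hz => by
    rw [K₁.wv z (by omega)]
    simp [show z ≠ 54 by omega, show z ≠ 55 by omega]
  have ar : ∀ z < 10, s₁.rv z = s.rv z := fun z hz => by
    rw [K₁.rv z]
    simp [show z ≠ 11 by omega]
  have awa : ∀ z, s₁.wa z = s.wa z := fun z => by rw [K₁.wa z]; simp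
  have ara : ∀ z, s₁.ra z = s.ra z := fun z => by rw [K₁.ra z]; simp
  clear K₁ F₁ hR1
  apply Runs.seq
  refine runs_setW (gives_var (v := cX) e₁) ?_
  apply Runs.seq
  refine runs_setR (givesR_var (by simpa using a1)) ?_
  have hR2 : Ready w SP n S J b e D t X Y ordX ordY yr ρ
      ((s₁.setVar .word 56 cX).setVar .real 11 x') := hR1'.congr (fun z hz => by
          simp [show z ≠ 56 by omega]) (by simp) (by simp)
  apply Runs.seq
  refine Runs.mono (Runs.frame (rkX x' hx1 _ hR2 (by simpa using a50) (by simpa using a52)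
    (by simpa using a54) (by simp))) ?_
  rintro s₂ ⟨F₂, e₂⟩
  have K₂ := F₂.keeps
  have hR2' := hR2.congr (fun z hz => K₂.wv z (by omega)) K₂.wa K₂.ra
  have b51 := (K₂.wv 51 (by omega)).trans (by simpa using a51)
  have b53 := (K₂.wv 53 (by omega)).trans (by simpa using a53)
  have b54 := (K₂.wv 54 (by omega)).trans (by simpa using a54)
  have b55 := (K₂.wv 55 (by omega)).trans (by simpa using a55)
  have b56 : s₂.wv 56 = cX := (K₂.wv 56 (by omega)).trans (by simp)
  have b2 := (K₂.rv 2).trans (by simpa using a2)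
  have b3 := (K₂.rv 3).trans (by simpa using a3)
  have bw : ∀ z, z < 31 ∨ z = 50 ∨ z = 51 ∨ 59 < z → s₂.wv z = s.wv z := fun z hz => by
    rw [K₂.wv z (by omega), ← aw z hz]
    simp [show z ≠ 56 by omega]
  have br : ∀ z < 10, s₂.rv z = s.rv z := fun z hz => by
    rw [K₂.rv z, ← ar z hz]
    simp [show z ≠ 11 by omega]
  have bwa : ∀ z, s₂.wa z = s.wa z := fun z => by rw [K₂.wa z, ← awa]; simp
  have bra : ∀ z, s₂.ra z = s.ra z := fun z => by rw [K₂.ra z, ← ara]; simp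
  clear K₂ F₂ hR2 hR1' aw ar awa ara
  apply Runs.seq
  refine runs_setW (gives_var (v := cX') e₂) ?_
  apply Runs.seq
  refine runs_setR (givesR_var (by simpa using b2)) ?_
  have hR3 : Ready w SP n S J b e D t X Y ordX ordY yr ρ
      ((s₂.setVar .word 57 cX').setVar .real 11 y) := hR2'.congr (fun z hz => by
          simp [show z ≠ 57 by omega]) (by simp) (by simp)
  apply Runs.seq
  refine Runs.mono (Runs.frame (rkY y (hy.trans hy1) _ hR3 (by simpa using b51) (by simpa using b53)
    (by simpa using b55) (by simp))) ?_
  rintro s₃ ⟨F₃, e₃⟩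
  have K₃ := F₃.keeps
  have hR3' := hR3.congr (fun z hz => K₃.wv z (by omega)) K₃.wa K₃.ra
  have c51 := (K₃.wv 51 (by omega)).trans (by simpa using b51)
  have c53 := (K₃.wv 53 (by omega)).trans (by simpa using b53)
  have c54 := (K₃.wv 54 (by omega)).trans (by simpa using b54)
  have c55 := (K₃.wv 55 (by omega)).trans (by simpa using b55)
  have c56 := (K₃.wv 56 (by omega)).trans (by simpa using b56)
  have c57 : s₃.wv 57 = cX' := (K₃.wv 57 (by omega)).trans (by simp)
  have c3 := (K₃.rv 3).trans (by simpa using b3)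
  have cw : ∀ z, z < 31 ∨ z = 50 ∨ z = 51 ∨ 59 < z → s₃.wv z = s.wv z := fun z hz => by
    rw [K₃.wv z (by omega), ← bw z hz]
    simp [show z ≠ 57 by omega]
  have cr : ∀ z < 10, s₃.rv z = s.rv z := fun z hz => by
    rw [K₃.rv z, ← br z hz]
    simp [show z ≠ 11 by omega]
  have cwa : ∀ z, s₃.wa z = s.wa z := fun z => by rw [K₃.wa z, ← bwa]; simp
  have cra : ∀ z, s₃.ra z = s.ra z := fun z => by rw [K₃.ra z, ← bra]; simp
  clear K₃ F₃ hR3 hR2' bw br bwa bra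
  apply Runs.seq
  refine runs_setW (gives_var (v := cY) e₃) ?_
  apply Runs.seq
  refine runs_setR (givesR_var (by simpa using c3)) ?_
  have hR4 : Ready w SP n S J b e D t X Y ordX ordY yr ρ
      ((s₃.setVar .word 58 cY).setVar .real 11 y') := hR3'.congr (fun z hz => by
          simp [show z ≠ 58 by omega]) (by simp) (by simp)
  apply Runs.seq
  refine Runs.mono (Runs.frame (rkY y' hy1 _ hR4 (by simpa using c51) (by simpa using c53)
    (by simpa using c55) (by simp))) ?_
  rintro s₄ ⟨F₄, e₄⟩
  have K₄ := F₄.keeps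
  have d54 := (K₄.wv 54 (by omega)).trans (by simpa using c54)
  have d56 := (K₄.wv 56 (by omega)).trans (by simpa using c56)
  have d57 := (K₄.wv 57 (by omega)).trans (by simpa using c57)
  have d58 : s₄.wv 58 = cY := (K₄.wv 58 (by omega)).trans (by simp)
  have dw : ∀ z, z < 31 ∨ z = 50 ∨ z = 51 ∨ 59 < z → s₄.wv z = s.wv z := fun z hz => by
    rw [K₄.wv z (by omega), ← cw z hz]
    simp [show z ≠ 58 by omega]
  have dr : ∀ z < 10, s₄.rv z = s.rv z := fun z hz => by
    rw [K₄.rv z, ← cr z hz]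
    simp [show z ≠ 11 by omega]
  have dwa : ∀ z, s₄.wa z = s.wa z := fun z => by rw [K₄.wa z, ← cwa]; simp
  have dra : ∀ z, s₄.ra z = s.ra z := fun z => by rw [K₄.ra z, ← cra]; simp
  clear K₄ F₄ hR4 hR3' cw cr cwa cra
  have d2 : s₄.wv 2 = S := (dw 2 (by omega)).trans h.reg2
  apply Runs.seq
  refine runs_setW (gives_var (v := cY') e₄) ?_
  have i1 := hidx cX (by omega)
  have i2 := hidx cX' (by omega)
  have p1 := h.tables.pow (cY + 1) (by omega)
  have p2 := h.tables.pow (cY' + 1) (by omega)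
  have m1 := hmask cX hrX
  have m2 := hmask cX' hrX'
  refine runs_cond (Gives.div (Gives.mod (Gives.sub
    (Gives.get (((gives_var (by simpa using d54)).mul (gives_var (by simpa using d2))
      (by omega)).add (gives_var (by simpa using d57)) (by omega)) le_top
      (by simpa [dwa] using m2))
    (Gives.get (((gives_var (by simpa using d54)).mul (gives_var (by simpa using d2))
      (by omega)).add (gives_var (by simpa using d56)) (by omega)) le_top
      (by simpa [dwa] using m1)))
    (Gives.get ((gives_var (v := cY') (by simp)).add (gives_lit (by omega)) (by omega)) le_top
      (by simpa [dwa] using p2)))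
    (Gives.get ((gives_var (v := cY) (by simpa using d58)).add (gives_lit (by omega)) (by omega))
      le_top (by simpa [dwa] using p1))) (fun hne => ?_) (fun heq => ?_)
  · refine runs_setW (gives_lit (k := 1) (by omega)) ⟨?_, fun z hz => ?_, fun z hz => ?_, by simpa,
      by simpa⟩
    · rw [← htest]
      simp [hne]
    · simpa [show z ≠ 60 by omega, show z ≠ 59 by omega] using dw z (by omega)
    · simpa using dr z hz
  · refine runs_skip ⟨?_, fun z hz => ?_, fun z hz => ?_, by simpa, by simpa⟩
    · rw [← htest, ← dw 60 (by omega)]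
      simp [heq]
    · simpa [show z ≠ 60 by omega, show z ≠ 59 by omega] using dw z (by omega)
    · simpa using dr z hz

end

end RealRAM

namespace RealRAM

open BlindSearch

/-! ### Queries -/

/-- Replace `R r` by the nearest point of the unit interval. -/
def clampCmd (r : ℕ) : Cmd :=
  .cond (.realLt (R r) (.cast (Lit 0))) (setR r (.cast (Lit 0)))
    (.cond (.realLt (.cast (Lit 1)) (R r)) (setR r (.cast (Lit 1))) .skip)

/-- Search the cell in column `W 61 + dx` and row `W 62 + dy`. -/
def probeCmd (t dx dy : ℕ) : Cmd :=
  setW 52 (minE (W 61 + Lit dx) (W 63)) ;; setW 53 (minE (W 62 + Lit dy) (W 64)) ;; cellCmd t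

/-- Answer a query for a nonempty rectangle in the unit square in `W 60`. -/
def levelCmd (t : ℕ) : Cmd :=
  setW 50 (WA 1 (minE (.floor (.cast (Lit 1) / (R 1 - R 0))) (W 4))) ;;
  setW 51 (W 3 - W 50) ;;
  .cond (.realLt (.cast (Lit 1)) ((R 3 - R 2) * .cast (WA 0 (W 51)))) (setW 60 (Lit 1))
    (setW 61 (.floor (R 0 * .cast (WA 0 (W 50)))) ;;
    setW 62 (.floor (R 2 * .cast (WA 0 (W 51)))) ;;
    setW 63 (WA 0 (W 50) - Lit 1) ;;
    setW 64 (WA 0 (W 51) - Lit 1) ;;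
    probeCmd t 0 0 ;; probeCmd t 0 1 ;; probeCmd t 1 0 ;; probeCmd t 1 1)

/-- Answer a query with the data structure. -/
def lookupCmd (t : ℕ) : Cmd :=
  clampCmd 0 ;; clampCmd 1 ;; clampCmd 2 ;; clampCmd 3 ;;
  setW 60 (Lit 0) ;;
  .cond (.realLt (R 0) (R 1)) (.cond (.realLt (R 2) (R 3)) (levelCmd t) .skip) .skip ;;
  setW 0 (W 60)

/-- Test whether point `W 51` is in the rectangle. -/
def testCmd : Cmd :=
  .cond (Lt (W 51) (W 0))
    (.cond (.realLt (R 0) (RA 0 (W 51)))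
      (.cond (.realLt (R 1) (RA 0 (W 51))) .skip
        (.cond (.realLt (R 2) (RA 1 (W 51)))
          (.cond (.realLt (R 3) (RA 1 (W 51))) .skip (setW 50 (Lit 1))) .skip)) .skip) .skip ;;
  setW 51 (W 51 + Lit 1)

/-- Answer a query for fewer than `n₀` points by testing all of them. -/
def scanCmd (n₀ : ℕ) : Cmd :=
  setW 50 (Lit 0) ;; setW 51 (Lit 0) ;; iterCmd testCmd n₀ ;; setW 0 (W 50)

/-- The query program. -/
def queryCmd (t n₀ : ℕ) : Cmd := .cond (Lt (W 0) (Lit n₀)) (scanCmd n₀) (lookupCmd t)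

theorem queryCmd_loopFree (t n₀ : ℕ) : (queryCmd t n₀).loopFree = true := by
  have h1 := iterCmd_loopFree (c := testCmd) rfl n₀
  have h2 := rankCmd_loopFree 0 t
  have h3 := rankCmd_loopFree 1 t
  simp [queryCmd, scanCmd, lookupCmd, levelCmd, probeCmd, cellCmd, clampCmd, Cmd.loopFree, h1, h2,
    h3]

theorem runs_scan {w n₀ n : ℕ} {X Y : ℕ → ℝ} {x x' y y' : ℝ} {s : Mem} (hw : n₀ + 1 < 2 ^ w)
    (hn : n ≤ n₀) (hn0 : s.wv 0 = n) (hX : s.ra 0 = X) (hY : s.ra 1 = Y) (h0 : s.rv 0 = x)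
    (h1 : s.rv 1 = x') (h2 : s.rv 2 = y) (h3 : s.rv 3 = y') :
    Runs w ⊤ (scanCmd n₀) s fun s' => s'.wv 0 ≠ 0 ↔
      ∃ p < n, (x < X p ∧ X p ≤ x') ∧ y < Y p ∧ Y p ≤ y' := by
  have hw1 : 1 ≤ w := by by_contra h; interval_cases w; omega
  apply Runs.seq
  refine runs_setW (gives_lit (k := 0) (by omega)) ?_
  apply Runs.seq
  refine runs_setW (gives_lit (k := 0) (by omega)) ?_
  apply Runs.seq
  refine Runs.mono (runs_iter (fun k s' => k ≤ n₀ → s'.wv 51 = k ∧ s'.wv 0 = n ∧ s'.ra 0 = X ∧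
    s'.ra 1 = Y ∧ s'.rv 0 = x ∧ s'.rv 1 = x' ∧ s'.rv 2 = y ∧ s'.rv 3 = y' ∧
    (s'.wv 50 ≠ 0 ↔ ∃ p < n, p < k ∧ (x < X p ∧ X p ≤ x') ∧ y < Y p ∧ Y p ≤ y')) ?_ n₀ (j := 0) ?_) ?_
  · intro k r hI
    by_cases hk : k + 1 ≤ n₀
    swap
    -- `runs_iter` demands the step for all `k`, but beyond `n₀` the counter might overflow. The
    -- invariant is empty there, and only halting has to be shown.
    · obtain ⟨r', t, m, h, -⟩ := Cmd.exists_exec_of_loopFree w testCmd rfl r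
      exact ⟨r', t, m, h, le_top, fun hh => absurd hh hk⟩
    obtain ⟨e51, e0, eX, eY, f0, f1, f2, f3, hiff⟩ := hI (by omega)
    have hsucc : (∃ p < n, p < k + 1 ∧ (x < X p ∧ X p ≤ x') ∧ y < Y p ∧ Y p ≤ y') ↔
        (∃ p < n, p < k ∧ (x < X p ∧ X p ≤ x') ∧ y < Y p ∧ Y p ≤ y') ∨
          (k < n ∧ (x < X k ∧ X k ≤ x') ∧ y < Y k ∧ Y k ≤ y') := by
      constructor
      · rintro ⟨p, hp, hpk, h⟩
        rcases (Nat.lt_succ_iff.1 hpk).lt_or_eq with h' | rfl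
        · exact .inl ⟨p, hp, h', h⟩
        · exact .inr ⟨hp, h⟩
      · rintro (⟨p, hp, hpk, h⟩ | ⟨hk, h⟩)
        · exact ⟨p, hp, by omega, h⟩
        · exact ⟨k, hk, by omega, h⟩
    have gX : GivesR w ⊤ r (RA 0 (W 51)) (X k) := (gives_var e51).getR le_top (by rw [eX])
    have gY : GivesR w ⊤ r (RA 1 (W 51)) (Y k) := (gives_var e51).getR le_top (by rw [eY])
    have fin : ∀ r' : Mem, Frame (setW 50 (Lit 1)) r r' →
        (r'.wv 50 ≠ 0 ↔ ∃ p < n, p < k + 1 ∧ (x < X p ∧ X p ≤ x') ∧ y < Y p ∧ Y p ≤ y') →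
        Runs w ⊤ (setW 51 (W 51 + Lit 1)) r' fun s' => k + 1 ≤ n₀ → s'.wv 51 = k + 1 ∧
          s'.wv 0 = n ∧ s'.ra 0 = X ∧ s'.ra 1 = Y ∧ s'.rv 0 = x ∧ s'.rv 1 = x' ∧ s'.rv 2 = y ∧
          s'.rv 3 = y' ∧ (s'.wv 50 ≠ 0 ↔
            ∃ p < n, p < k + 1 ∧ (x < X p ∧ X p ≤ x') ∧ y < Y p ∧ Y p ≤ y') := by
      intro r' F hr'
      refine runs_setW ((gives_var ((F.wv rfl).trans e51)).add (gives_lit (by omega)) (by omega))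
        fun _ => ⟨by simp, ?_, ?_, ?_, ?_, ?_, ?_, ?_, by simpa using hr'⟩
      · simpa using (F.wv rfl).trans e0
      · simpa using (F.ra rfl).trans eX
      · simpa using (F.ra rfl).trans eY
      · simpa using (F.rv rfl).trans f0
      · simpa using (F.rv rfl).trans f1
      · simpa using (F.rv rfl).trans f2
      · simpa using (F.rv rfl).trans f3
    have miss : ¬ (k < n ∧ (x < X k ∧ X k ≤ x') ∧ y < Y k ∧ Y k ≤ y') →
        Runs w ⊤ (setW 51 (W 51 + Lit 1)) r fun s' => k + 1 ≤ n₀ → s'.wv 51 = k + 1 ∧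
          s'.wv 0 = n ∧ s'.ra 0 = X ∧ s'.ra 1 = Y ∧ s'.rv 0 = x ∧ s'.rv 1 = x' ∧ s'.rv 2 = y ∧
          s'.rv 3 = y' ∧ (s'.wv 50 ≠ 0 ↔
            ∃ p < n, p < k + 1 ∧ (x < X p ∧ X p ≤ x') ∧ y < Y p ∧ Y p ≤ y') := fun h =>
      fin r ⟨fun _ => rfl, fun _ => rfl, fun _ => rfl, fun _ => rfl⟩
        (by rw [hsucc, hiff]; simp [h])
    apply Runs.seq
    refine runs_cond ((gives_var e51).lt hw1 (gives_var e0)) (fun c1 => ?_)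
      (fun c1 => runs_skip (miss ?_))
    swap
    · rintro ⟨h, -⟩
      simp [h] at c1
    have hkn : k < n := by by_contra hh; simp [hh] at c1
    refine runs_cond ((givesR_var f0).lt hw1 gX) (fun c2 => ?_) (fun c2 => runs_skip (miss ?_))
    swap
    · rintro ⟨-, ⟨h, -⟩, -⟩
      simp [h] at c2
    have hx : x < X k := by by_contra hh; simp [hh] at c2
    refine runs_cond ((givesR_var f1).lt hw1 gX) (fun c3 => runs_skip (miss ?_)) (fun c3 => ?_)
    · rintro ⟨-, ⟨-, h⟩, -⟩
      simp [not_lt.2 h] at c3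
    have hx' : X k ≤ x' := by by_contra hh; simp [not_le.1 hh] at c3
    refine runs_cond ((givesR_var f2).lt hw1 gY) (fun c4 => ?_) (fun c4 => runs_skip (miss ?_))
    swap
    · rintro ⟨-, -, h, -⟩
      simp [h] at c4
    have hy : y < Y k := by by_contra hh; simp [hh] at c4
    refine runs_cond ((givesR_var f3).lt hw1 gY) (fun c5 => runs_skip (miss ?_)) (fun c5 => ?_)
    · rintro ⟨-, -, -, h⟩
      simp [not_lt.2 h] at c5
    have hy' : Y k ≤ y' := by by_contra hh; simp [not_le.1 hh] at c5
    refine Runs.mono (Runs.frame (runs_setW (Q := fun s' => s'.wv 50 = 1) (gives_lit (k := 1)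
      (by omega)) (by simp))) ?_
    rintro r' ⟨F, h50⟩
    refine fin r' F ?_
    rw [h50]
    simp only [ne_eq, one_ne_zero, not_false_eq_true, true_iff]
    exact ⟨k, hkn, by omega, ⟨hx, hx'⟩, hy, hy'⟩
  · intro _
    refine ⟨by simp, by simpa using hn0, by simpa using hX, by simpa using hY, by simpa using h0,
      by simpa using h1, by simpa using h2, by simpa using h3, by simp⟩
  · rintro r hr
    obtain ⟨-, -, -, -, -, -, -, -, hiff⟩ := hr (by omega)
    refine runs_setW (gives_var rfl) ?_
    simp only [Mem.wv_setVar_word, if_true]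
    rw [hiff]
    constructor
    · rintro ⟨p, hp, -, h⟩
      exact ⟨p, hp, h⟩
    · rintro ⟨p, hp, h⟩
      exact ⟨p, hp, by omega, h⟩

theorem runs_clamp {w : ℕ} (hw1 : 1 ≤ w) (s : Mem) (r : ℕ) :
    Runs w ⊤ (clampCmd r) s fun s' => s'.rv r = max 0 (min (s.rv r) 1) ∧
      (∀ z ≠ r, s'.rv z = s.rv z) ∧ (∀ z, s'.wv z = s.wv z) ∧ (∀ z, s'.wa z = s.wa z) ∧
      ∀ z, s'.ra z = s.ra z := by
  have h2 : 1 < 2 ^ w := Nat.one_lt_two_pow (by omega)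
  have g0 : GivesR w ⊤ s (.cast (Lit 0)) ((0 : ℕ) : ℝ) := (gives_lit (by omega)).toReal
  have g1 : GivesR w ⊤ s (.cast (Lit 1)) ((1 : ℕ) : ℝ) := (gives_lit (by omega)).toReal
  push_cast at g0 g1
  refine runs_cond ((givesR_var rfl).lt hw1 g0) (fun h => ?_) (fun h => ?_)
  · have hlt : s.rv r < 0 := by by_contra hh; simp [hh] at h
    refine runs_setR g0 ⟨?_, fun z hz => by simp [hz], by simp, by simp, by simp⟩
    rw [min_eq_left (by linarith), max_eq_left hlt.le]
    simp
  · have hle : 0 ≤ s.rv r := by by_contra hh; simp [not_le.1 hh] at h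
    refine runs_cond (g1.lt hw1 (givesR_var rfl)) (fun h' => ?_) (fun h' => runs_skip ?_)
    · have hlt : 1 < s.rv r := by by_contra hh; simp [hh] at h'
      refine runs_setR g1 ⟨?_, fun z hz => by simp [hz], by simp, by simp, by simp⟩
      rw [min_eq_right hlt.le, max_eq_right zero_le_one]
      simp
    · have hle' : s.rv r ≤ 1 := by by_contra hh; simp [not_le.1 hh] at h'
      rw [min_eq_left hle', max_eq_right hle]
      simp

/-- Points lie strictly inside the unit interval, so moving a side of the rectangle to the boundary
does not change which points are inside. -/
theorem lt_clamp_iff {x p : ℝ} (h0 : 0 < p) (h1 : p < 1) : max 0 (min x 1) < p ↔ x < p := by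
  rw [max_lt_iff, min_lt_iff]
  constructor
  · rintro ⟨-, h | h⟩
    · exact h
    · linarith
  · exact fun h => ⟨h0, .inl h⟩

theorem le_clamp_iff {x p : ℝ} (h0 : 0 < p) (h1 : p < 1) : p ≤ max 0 (min x 1) ↔ p ≤ x := by
  rw [le_max_iff, le_min_iff]
  constructor
  · rintro (h | h)
    · linarith
    · exact h.1
  · exact fun h => .inr ⟨h, h1.le⟩

/-- An interval of length at most `2 ^ (-i)` meets at most two consecutive columns. -/
theorem column_mem {i : ℕ} {x x' p : ℝ} (hx : 0 ≤ x) (hp : p < 1) (h : (x' - x) * 2 ^ i ≤ 1)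
    (h1 : x < p) (h2 : p ≤ x') :
    ⌊p * 2 ^ i⌋₊ = min (⌊x * 2 ^ i⌋₊ + 0) (2 ^ i - 1) ∨
      ⌊p * 2 ^ i⌋₊ = min (⌊x * 2 ^ i⌋₊ + 1) (2 ^ i - 1) := by
  have h2i : (0 : ℝ) < 2 ^ i := by positivity
  have e1 := floor_mul_two_pow_lt (hx.trans h1.le) hp i
  have e2 : ⌊x * 2 ^ i⌋₊ ≤ ⌊p * 2 ^ i⌋₊ :=
    Nat.floor_le_floor (mul_le_mul_of_nonneg_right h1.le h2i.le)
  have e3 : ⌊p * 2 ^ i⌋₊ ≤ ⌊x * 2 ^ i⌋₊ + 1 := by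
    rw [← Nat.floor_add_one (by positivity)]
    refine Nat.floor_le_floor ?_
    nlinarith
  omega

/-- An interval of length more than two dyadic intervals contains a dyadic interval. -/
theorem exists_dyadic {k : ℕ} {x x' : ℝ} (hx : 0 ≤ x) (hx' : x' ≤ 1) (h : 2 < (x' - x) * 2 ^ k) :
    ∃ u < 2 ^ k, ∀ p : ℝ, 0 ≤ p → ⌊p * 2 ^ k⌋₊ = u → x < p ∧ p ≤ x' := by
  have h2k : (0 : ℝ) < 2 ^ k := by positivity
  have hf := Nat.floor_le (show 0 ≤ x * 2 ^ k by positivity)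
  have hf' := Nat.lt_floor_add_one (x * 2 ^ k)
  refine ⟨⌊x * 2 ^ k⌋₊ + 1, ?_, fun p hp hpu => ?_⟩
  · have : ((⌊x * 2 ^ k⌋₊ + 1 : ℕ) : ℝ) < ((2 ^ k : ℕ) : ℝ) := by
      push_cast
      nlinarith
    exact_mod_cast this
  · have h1 := Nat.floor_le (show 0 ≤ p * 2 ^ k by positivity)
    have h2 := Nat.lt_floor_add_one (p * 2 ^ k)
    rw [hpu] at h1 h2
    push_cast at h1 h2
    constructor
    · by_contra hc
      nlinarith
    · by_contra hc
      nlinarith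

section
variable {w SP n S J b e D t : ℕ} {X Y : ℕ → ℝ} {ordX ordY yr ρ : ℕ → ℕ} {s : Mem}

/-- The state of a query: the data structure, the rectangle, the level and the first cell. The result
is nonzero if and only if `A` holds. -/
structure Probing (w SP n S J b e D t : ℕ) (X Y : ℕ → ℝ) (ordX ordY yr ρ : ℕ → ℕ) (x x' y y' : ℝ)
    (i u v : ℕ) (A : Prop) (s : Mem) : Prop where
  ready : Ready w SP n S J b e D t X Y ordX ordY yr ρ s
  x : s.rv 0 = x
  x' : s.rv 1 = x'
  y : s.rv 2 = y
  y' : s.rv 3 = y'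
  level : s.wv 50 = i
  level' : s.wv 51 = J - i
  col : s.wv 61 = u
  row : s.wv 62 = v
  lastCol : s.wv 63 = 2 ^ i - 1
  lastRow : s.wv 64 = 2 ^ (J - i) - 1
  result : s.wv 60 ≠ 0 ↔ A

/-- The minimum with the last column and row keeps the probe inside the grid. At the border a cell
may be probed twice, which does no harm to a disjunction. -/
theorem runs_probe {x x' y y' : ℝ} {i u v dx dy : ℕ} {A : Prop}
    (hT : RandomPoints.Typical n J S b t X Y) (hx : x ≤ x') (hx1 : x' ≤ 1)
    (hy : y ≤ y') (hy1 : y' ≤ 1) (hi : i ≤ J) (hu : u ≤ 2 ^ i) (hv : v ≤ 2 ^ (J - i))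
    (hdx : dx ≤ 1) (hdy : dy ≤ 1)
    (h : Probing w SP n S J b e D t X Y ordX ordY yr ρ x x' y y' i u v A s) :
    Runs w ⊤ (probeCmd t dx dy) s (Probing w SP n S J b e D t X Y ordX ordY yr ρ x x' y y' i u v
      (A ∨ ∃ p < n, (⌊X p * 2 ^ i⌋₊ = min (u + dx) (2 ^ i - 1) ∧
        ⌊Y p * 2 ^ (J - i)⌋₊ = min (v + dy) (2 ^ (J - i) - 1)) ∧ (x < X p ∧ X p ≤ x') ∧
          (y < Y p ∧ Y p ≤ y'))) := by
  have hw := h.ready.small.word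
  have hN := h.ready.small.N_lt
  have h2i : 2 ^ i ≤ 2 ^ J := Nat.pow_le_pow_right (by norm_num) hi
  have h2i' : 2 ^ (J - i) ≤ 2 ^ J := Nat.pow_le_pow_right (by norm_num) (by omega)
  have h2J : 2 ^ J ≤ (J + 1) * 2 ^ J := Nat.le_mul_of_pos_left _ (by omega)
  have hi0 : 0 < 2 ^ i := by positivity
  have hi0' : 0 < 2 ^ (J - i) := by positivity
  apply Runs.seq
  refine runs_setW (((gives_var h.col).add (gives_lit (by omega)) (by omega)).minE
    (gives_var h.lastCol)) ?_
  apply Runs.seq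
  refine runs_setW (((gives_var (by simpa using h.row)).add (gives_lit (by omega)) (by omega)).minE
    (gives_var (by simpa using h.lastRow))) ?_
  have hR := h.ready.congr (s' := (s.setVar .word 52 (min (u + dx) (2 ^ i - 1))).setVar .word 53
    (min (v + dy) (2 ^ (J - i) - 1))) (fun z hz => by
      simp [show z ≠ 52 by omega, show z ≠ 53 by omega]) (by simp) (by simp)
  refine Runs.mono (runs_cell (u := min (u + dx) (2 ^ i - 1)) (v := min (v + dy) (2 ^ (J - i) - 1))
    hT hR hx hx1 hy hy1 hi (by omega) (by omega) (by simpa using h.x) (by simpa using h.x')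
    (by simpa using h.y) (by simpa using h.y') (by simpa using h.level) (by simpa using h.level')
    (by simp) (by simp)) ?_
  rintro s' ⟨h60, hwv, hrv, hwa, hra⟩
  refine ⟨hR.congr (fun z hz => hwv z (by omega)) hwa hra, (hrv 0 (by omega)).trans
    (by simpa using h.x), (hrv 1 (by omega)).trans (by simpa using h.x'), (hrv 2 (by omega)).trans
    (by simpa using h.y), (hrv 3 (by omega)).trans (by simpa using h.y'), (hwv 50 (by omega)).trans
    (by simpa using h.level), (hwv 51 (by omega)).trans (by simpa using h.level'),
    (hwv 61 (by omega)).trans (by simpa using h.col), (hwv 62 (by omega)).trans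
    (by simpa using h.row), (hwv 63 (by omega)).trans (by simpa using h.lastCol),
    (hwv 64 (by omega)).trans (by simpa using h.lastRow), ?_⟩
  rw [h60, ← h.result]
  simp

/-- The level is the largest `i ≤ J` with (x' - x) · 2^i ≤ 1. A rectangle higher than its cells
contains a box that has a point by `Typical.big`; otherwise its points are distributed over two
columns and two rows. -/
theorem runs_level {x x' y y' : ℝ} (hT : RandomPoints.Typical n J S b t X Y)
    (h : Ready w SP n S J b e D t X Y ordX ordY yr ρ s) (hx0 : 0 ≤ x) (hx : x < x') (hx1 : x' ≤ 1)
    (hy0 : 0 ≤ y) (hy : y < y') (hy1 : y' ≤ 1)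
    (h0 : s.rv 0 = x) (h1 : s.rv 1 = x') (h2 : s.rv 2 = y) (h3 : s.rv 3 = y')
    (h60 : s.wv 60 = 0) :
    Runs w ⊤ (levelCmd t) s fun s' => s'.wv 60 ≠ 0 ↔
      ∃ p < n, (x < X p ∧ X p ≤ x') ∧ y < Y p ∧ Y p ≤ y' := by
  have hw1 := h.small.one_le
  have hw := h.small.word
  have hN := h.small.N_lt
  have hnw := h.n_lt
  have hJn := h.pow_le
  have hJS := h.J_le
  have h2J : 2 ^ J ≤ (J + 1) * 2 ^ J := Nat.le_mul_of_pos_left _ (by omega)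
  have hJ0 : 0 < 2 ^ J := by positivity
  have ha : 0 < x' - x := sub_pos.2 hx
  have ha1 : x' - x ≤ 1 := by linarith
  obtain ⟨i, hi⟩ : ∃ i, i = Nat.log 2 (min ⌊1 / (x' - x)⌋₊ (2 ^ J)) := ⟨_, rfl⟩
  have hfl : 1 ≤ ⌊1 / (x' - x)⌋₊ := by
    rw [Nat.one_le_floor_iff, le_div_iff₀ ha]
    linarith
  have hiJ : i ≤ J := by
    rw [hi]
    refine (Nat.log_mono_right (min_le_right _ _)).trans_eq (Nat.log_pow (by norm_num) J)
  have hwidth : (x' - x) * 2 ^ i ≤ 1 := by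
    have h4 : 2 ^ i ≤ min ⌊1 / (x' - x)⌋₊ (2 ^ J) := by
      rw [hi]
      exact Nat.pow_log_le_self 2 (by omega)
    have h5 : ((2 ^ i : ℕ) : ℝ) ≤ 1 / (x' - x) :=
      (Nat.le_floor_iff (by positivity)).1 (h4.trans (min_le_left _ _))
    rw [le_div_iff₀ ha] at h5
    push_cast at h5
    linarith
  -- Maximality of the level; at i = J the cap may be active and the rectangle arbitrarily narrow.
  have hwide : i < J → 1 < (x' - x) * 2 ^ (i + 1) := by
    intro hlt
    have h4 : min ⌊1 / (x' - x)⌋₊ (2 ^ J) < 2 ^ (i + 1) := by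
      rw [hi]
      exact Nat.lt_pow_succ_log_self (by norm_num) _
    have h5 : 2 ^ (i + 1) ≤ 2 ^ J := Nat.pow_le_pow_right (by norm_num) hlt
    have h6 : ⌊1 / (x' - x)⌋₊ < 2 ^ (i + 1) := by omega
    rw [Nat.floor_lt (by positivity), div_lt_iff₀ ha] at h6
    push_cast at h6
    linarith
  have hpow1 := h.tables.pow i (by omega)
  have hpow2 := h.tables.pow (J - i) (by omega)
  have g1 : GivesR w ⊤ s (.cast (Lit 1)) ((1 : ℕ) : ℝ) := (gives_lit (by omega)).toReal
  push_cast at g1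
  apply Runs.seq
  -- Saturation of the floor is harmless, because the minimum with 2^J ≤ n < 2^w is taken
  -- afterwards.
  refine runs_setW (v := i) ((((g1.div ((givesR_var h1).sub (givesR_var h0))).floor_min.minE
    (gives_var h.reg4)).cast (v := min ⌊1 / (x' - x)⌋₊ (2 ^ J)) (by omega)).get le_top
    (by rw [h.log _ (by omega), hi])) ?_
  apply Runs.seq
  refine runs_setW (v := J - i) ((gives_var (by simpa using h.reg3)).sub
    (gives_var (by simp))) ?_
  have g1' : ∀ r : Mem, GivesR w ⊤ r (.cast (Lit 1)) (1 : ℝ) := fun r =>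
    ((gives_lit (k := 1) (by omega)).toReal).cast (by simp)
  refine runs_cond ((g1' _).lt hw1 (GivesR.mul ((givesR_var (by simpa using h3)).sub
    (givesR_var (by simpa using h2))) (Gives.toReal ((gives_var (v := J - i) (by simp)).get le_top
    (by simpa using hpow2))))) (fun hc => ?_) (fun hc => ?_)
  · have hc : 1 < (y' - y) * 2 ^ (J - i) := by
      by_contra hh
      push_cast at hc
      simp [hh] at hc
    refine runs_setW (gives_lit (k := 1) (by omega)) ?_
    simp only [Mem.wv_setVar_word, if_true, ne_eq, one_ne_zero, not_false_eq_true, true_iff]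
    -- On the last level cells have height 1, so no rectangle in the unit square is higher.
    have hlt : i < J := by
      by_contra hh
      rw [show J - i = 0 by omega] at hc
      linarith
    -- The width exceeds 2^(-(i+1)), twice that of a column of the box, and the height exceeds
    -- 2^(-(J-i)), twice that of a row.
    obtain ⟨u, hu, hu'⟩ := exists_dyadic (k := i + 2) hx0 hx1 (by
      have := hwide hlt
      rw [pow_succ]
      nlinarith)
    obtain ⟨v, hv, hv'⟩ := exists_dyadic (k := J - i + 1) hy0 hy1 (by
      rw [pow_succ]
      nlinarith)
    obtain ⟨p, hp, e1, e2⟩ := hT.big i hiJ u hu v hv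
    exact ⟨p, hp, hu' _ (hT.X_mem p hp).1.le e1, hv' _ (hT.Y_mem p hp).1.le e2⟩
  · have hc : (y' - y) * 2 ^ (J - i) ≤ 1 := by
      by_contra hh
      push_cast at hc
      simp [not_le.1 hh] at hc
    have hfx : ⌊x * 2 ^ i⌋₊ < 2 ^ i := floor_mul_two_pow_lt hx0 (by linarith) i
    have hfy : ⌊y * 2 ^ (J - i)⌋₊ < 2 ^ (J - i) := floor_mul_two_pow_lt hy0 (by linarith) _
    have h2i : 2 ^ i ≤ 2 ^ J := Nat.pow_le_pow_right (by norm_num) hiJ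
    have h2i' : 2 ^ (J - i) ≤ 2 ^ J := Nat.pow_le_pow_right (by norm_num) (by omega)
    apply Runs.seq
    refine runs_setW (v := ⌊x * 2 ^ i⌋₊) (GivesR.floor (((givesR_var (by simpa using h0)).mul
      (Gives.toReal ((gives_var (v := i) (by simp)).get le_top (by simpa using hpow1)))).cast
      (by push_cast; rfl)) (by omega)) ?_
    apply Runs.seq
    refine runs_setW (v := ⌊y * 2 ^ (J - i)⌋₊) (GivesR.floor (((givesR_var (by simpa using h2)).mul
      (Gives.toReal ((gives_var (v := J - i) (by simp)).get le_top (by simpa using hpow2)))).cast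
      (by push_cast; rfl)) (by omega)) ?_
    apply Runs.seq
    refine runs_setW (((gives_var (v := i) (by simp)).get le_top (by simpa using hpow1)).sub
      (gives_lit (k := 1) (by omega))) ?_
    apply Runs.seq
    refine runs_setW (((gives_var (v := J - i) (by simp)).get le_top (by simpa using hpow2)).sub
      (gives_lit (k := 1) (by omega))) ?_
    have hP := fun {r : Mem} {A : Prop} {dx dy : ℕ} (hdx : dx ≤ 1) (hdy : dy ≤ 1)
      (hr : Probing w SP n S J b e D t X Y ordX ordY yr ρ x x' y y' i ⌊x * 2 ^ i⌋₊
        ⌊y * 2 ^ (J - i)⌋₊ A r) => runs_probe hT hx.le hx1 hy.le hy1 hiJ hfx.le hfy.le hdx hdy hr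
    apply Runs.seq
    refine Runs.mono (hP (A := False) (by omega) (by omega) ⟨h.congr (fun z hz => by
      simp [show z ≠ 50 by omega, show z ≠ 51 by omega, show z ≠ 61 by omega,
        show z ≠ 62 by omega, show z ≠ 63 by omega, show z ≠ 64 by omega]) (by simp) (by simp),
      by simpa using h0, by simpa using h1, by simpa using h2, by simpa using h3, by simp, by simp,
      by simp, by simp, by simp, by simp, by simpa using h60⟩) fun r₁ k₁ => ?_
    apply Runs.seq
    refine Runs.mono (hP (by omega) (by omega) k₁) fun r₂ k₂ => ?_
    apply Runs.seq
    refine Runs.mono (hP (by omega) (by omega) k₂) fun r₃ k₃ => ?_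
    refine Runs.mono (hP (by omega) (by omega) k₃) fun r₄ k₄ => ?_
    rw [k₄.result]
    constructor
    · rintro ((((h | ⟨p, hp, -, h⟩) | ⟨p, hp, -, h⟩) | ⟨p, hp, -, h⟩) | ⟨p, hp, -, h⟩)
      · exact h.elim
      all_goals exact ⟨p, hp, h⟩
    · rintro ⟨p, hp, h⟩
      rcases column_mem hx0 (hT.X_mem p hp).2 hwidth h.1.1 h.1.2 with c1 | c1 <;>
        rcases column_mem hy0 (hT.Y_mem p hp).2 hc h.2.1 h.2.2 with c2 | c2
      · exact .inl (.inl (.inl (.inr ⟨p, hp, ⟨c1, c2⟩, h⟩)))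
      · exact .inl (.inl (.inr ⟨p, hp, ⟨c1, c2⟩, h⟩))
      · exact .inl (.inr ⟨p, hp, ⟨c1, c2⟩, h⟩)
      · exact .inr ⟨p, hp, ⟨c1, c2⟩, h⟩

theorem runs_lookup {x x' y y' : ℝ} (hT : RandomPoints.Typical n J S b t X Y)
    (h : Ready w SP n S J b e D t X Y ordX ordY yr ρ s)
    (h0 : s.rv 0 = x) (h1 : s.rv 1 = x') (h2 : s.rv 2 = y) (h3 : s.rv 3 = y') :
    Runs w ⊤ (lookupCmd t) s fun s' => s'.wv 0 ≠ 0 ↔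
      ∃ p < n, (x < X p ∧ X p ≤ x') ∧ y < Y p ∧ Y p ≤ y' := by
  have hw1 := h.small.one_le
  have hone : 1 < 2 ^ w := Nat.one_lt_two_pow (by omega)
  have hclamp : (∃ p < n, (x < X p ∧ X p ≤ x') ∧ y < Y p ∧ Y p ≤ y') ↔
      ∃ p < n, (max 0 (min x 1) < X p ∧ X p ≤ max 0 (min x' 1)) ∧
        max 0 (min y 1) < Y p ∧ Y p ≤ max 0 (min y' 1) := by
    refine exists_congr fun p => and_congr_right fun hp => ?_
    obtain ⟨a1, a2⟩ := hT.X_mem p hp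
    obtain ⟨a3, a4⟩ := hT.Y_mem p hp
    rw [lt_clamp_iff a1 a2, le_clamp_iff a1 a2, lt_clamp_iff a3 a4, le_clamp_iff a3 a4]
  have hcl : ∀ z : ℝ, 0 ≤ max 0 (min z 1) ∧ max 0 (min z 1) ≤ 1 := fun z =>
    ⟨le_max_left _ _, max_le zero_le_one (min_le_right _ _)⟩
  simp only [hclamp]
  apply Runs.seq
  refine Runs.mono (runs_clamp hw1 s 0) ?_
  rintro s₁ ⟨a1, a2, a3, a4, a5⟩
  apply Runs.seq
  refine Runs.mono (runs_clamp hw1 s₁ 1) ?_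
  rintro s₂ ⟨b1, b2, b3, b4, b5⟩
  apply Runs.seq
  refine Runs.mono (runs_clamp hw1 s₂ 2) ?_
  rintro s₃ ⟨c1, c2, c3, c4, c5⟩
  apply Runs.seq
  refine Runs.mono (runs_clamp hw1 s₃ 3) ?_
  rintro s₄ ⟨d1, d2, d3, d4, d5⟩
  have r0 : s₄.rv 0 = max 0 (min x 1) := by
    rw [d2 0 (by omega), c2 0 (by omega), b2 0 (by omega), a1, h0]
  have r1 : s₄.rv 1 = max 0 (min x' 1) := by
    rw [d2 1 (by omega), c2 1 (by omega), b1, a2 1 (by omega), h1]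
  have r2 : s₄.rv 2 = max 0 (min y 1) := by
    rw [d2 2 (by omega), c1, b2 2 (by omega), a2 2 (by omega), h2]
  have r3 : s₄.rv 3 = max 0 (min y' 1) := by
    rw [d1, c2 3 (by omega), b2 3 (by omega), a2 3 (by omega), h3]
  have hR : Ready w SP n S J b e D t X Y ordX ordY yr ρ (s₄.setVar .word 60 0) :=
    h.congr (fun z hz => by simp [show z ≠ 60 by omega, d3, c3, b3, a3])
      (by simp [d4, c4, b4, a4]) (by simp [d5, c5, b5, a5])
  apply Runs.seq
  refine runs_setW (gives_lit (k := 0) (by omega)) ?_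
  apply Runs.seq
  have fin : ∀ s' : Mem, (s'.wv 60 ≠ 0 ↔
      ∃ p < n, (max 0 (min x 1) < X p ∧ X p ≤ max 0 (min x' 1)) ∧
        max 0 (min y 1) < Y p ∧ Y p ≤ max 0 (min y' 1)) →
      Runs w ⊤ (setW 0 (W 60)) s' fun s'' => s''.wv 0 ≠ 0 ↔
      ∃ p < n, (max 0 (min x 1) < X p ∧ X p ≤ max 0 (min x' 1)) ∧
        max 0 (min y 1) < Y p ∧ Y p ≤ max 0 (min y' 1) := fun s' hs' =>
    runs_setW (gives_var rfl) (by simpa using hs')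
  refine runs_cond (GivesR.lt hw1 (givesR_var (by simpa using r0)) (givesR_var (by simpa using r1)))
    (fun hc => ?_) (fun hc => runs_skip (fin _ ?_))
  · have hlt : max 0 (min x 1) < max 0 (min x' 1) := by by_contra hh; simp [hh] at hc
    refine runs_cond (GivesR.lt hw1 (givesR_var (by simpa using r2))
      (givesR_var (by simpa using r3))) (fun hc' => ?_) (fun hc' => runs_skip (fin _ ?_))
    · have hlt' : max 0 (min y 1) < max 0 (min y' 1) := by by_contra hh; simp [hh] at hc'
      exact Runs.mono (runs_level hT hR (hcl x).1 hlt (hcl x').2 (hcl y).1 hlt' (hcl y').2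
        (by simpa using r0) (by simpa using r1) (by simpa using r2) (by simpa using r3) (by simp)) fin
    · have hle : max 0 (min y' 1) ≤ max 0 (min y 1) := by
        by_contra hh
        rw [if_pos (not_le.1 hh)] at hc'
        omega
      simp only [Mem.wv_setVar_word, if_true, ne_eq, not_true_eq_false, false_iff]
      rintro ⟨p, hp, -, e1, e2⟩
      linarith
  · have hle : max 0 (min x' 1) ≤ max 0 (min x 1) := by
      by_contra hh
      rw [if_pos (not_le.1 hh)] at hc
      omega
    simp only [Mem.wv_setVar_word, if_true, ne_eq, not_true_eq_false, false_iff]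
    rintro ⟨p, hp, ⟨e1, e2⟩, -⟩
    linarith

end

end RealRAM

namespace RealRAM

open BlindSearch RandomPoints

/-! ### The construction -/

/-- Compute the parameters of the data structure. -/
def paramCmd (A B : ℕ) : Cmd :=
  setW 3 (WA 1 (W 0 / (Lit A * W 1))) ;;
  setW 4 (WA 0 (W 3)) ;;
  setW 6 (WA 0 (W 1 / Lit 4)) ;;
  setW 7 (Lit B * WA 0 (WA 1 (W 1) / Lit 2 + Lit 1)) ;;
  setW 9 (WA 1 (W 1) + Lit 1) ;;
  setW 8 (WA 0 (W 9))

/-- Compute the data structure. The number of points, its binary length, and the capacity of the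
cells are in the registers `0`, `1`, and `2`. -/
def structureCmd (A B : ℕ) : Cmd :=
  powCmd ;; logCmd ;; paramCmd A B ;; sepCmd ;; tabCmd ;; sortCmd 0 ;; sortCmd 1 ;; insertCmd 1 ;;
    insertCmd 0

/-- The parameters of the data structure fit in words and in the allowed space. -/
structure Fits (w SP n S J b e D t : ℕ) : Prop where
  small : Small w SP S ((J + 1) * 2 ^ J) b e D
  S_lt : S < w
  e_pos : 1 ≤ e
  pow_e : 2 ^ e ≤ S
  code_le : e * D + 1 ≤ S
  J_le : J ≤ S
  pow_J : 2 ^ J ≤ n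
  n_le : n + 2 ≤ SP
  n_mul : n * S ≤ SP
  items : (J + 1) * n ≤ SP
  table : 2 * (2 ^ e) ^ D * 2 ^ b ≤ SP
  key : 4 * (2 ^ J * 2 ^ b) < 2 ^ w
  t_le : t ≤ D

theorem Frame.seq {c d : Cmd} {s s' s'' : Mem} (h : Frame c s s') (h' : Frame d s' s'') :
    Frame (c ;; d) s s'' := by
  refine ⟨fun {x} hx => ?_, fun {x} hx => ?_, fun {a} ha => ?_, fun {a} ha => ?_⟩
  · simp only [Cmd.writesVar, Bool.or_eq_false_iff] at hx
    exact (h'.wv hx.2).trans (h.wv hx.1)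
  · simp only [Cmd.writesVar, Bool.or_eq_false_iff] at hx
    exact (h'.rv hx.2).trans (h.rv hx.1)
  · simp only [Cmd.writesArr, Bool.or_eq_false_iff] at ha
    exact (h'.wa ha.2).trans (h.wa ha.1)
  · simp only [Cmd.writesArr, Bool.or_eq_false_iff] at ha
    exact (h'.ra ha.2).trans (h.ra ha.1)

section
variable {w SP n S J b e D t A B ℓ : ℕ} {X Y : ℕ → ℝ} {s : Mem}

theorem runsIn_param (hF : Fits w SP n S J b e D t) (h0 : s.wv 0 = n) (h1 : s.wv 1 = ℓ)
    (hpow : ∀ k ≤ S, s.wa 0 k = 2 ^ k) (hlog : ∀ k ≤ n, s.wa 1 k = Nat.log 2 k)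
    (hℓ : ℓ ≤ n) (hAℓ : A * ℓ ≤ n) (hA : 1 ≤ A) (hℓ0 : 1 ≤ ℓ)
    (hJ : J = Nat.log 2 (n / (A * ℓ))) (hb : b = ℓ / 4) (he : e = Nat.log 2 ℓ + 1)
    (hD : D = B * 2 ^ (Nat.log 2 ℓ / 2 + 1)) :
    RunsIn w SP (paramCmd A B) s fun s' =>
      s'.wv 3 = J ∧ s'.wv 4 = 2 ^ J ∧ s'.wv 6 = 2 ^ b ∧ s'.wv 7 = D ∧ s'.wv 8 = 2 ^ e ∧
        s'.wv 9 = e := by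
  have hw := hF.small.word
  have hSSP := hF.small.S_lt
  have hn := hF.n_le
  have hDS := hF.small.D_lt
  have hbe := hF.small.b_lt
  have heS := hF.pow_e
  have he2 : e < 2 ^ e := Nat.lt_two_pow_self
  have hJS := hF.J_le
  have hAn : A ≤ A * ℓ := Nat.le_mul_of_pos_right _ hℓ0
  have hBD : B ≤ D := by rw [hD]; exact Nat.le_mul_of_pos_right _ (by positivity)
  have hdiv : n / (A * ℓ) ≤ n := Nat.div_le_self _ _
  refine Runs.runsIn ?_ rfl (by omega)
  apply Runs.seq
  refine runs_setW (((gives_var h0).div ((gives_lit (by omega)).mul (gives_var h1) (by omega))).get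
    (le_space (by omega)) ((hlog _ hdiv).trans hJ.symm)) ?_
  apply Runs.seq
  refine runs_setW ((gives_var (v := J) (by simp)).get (le_space (by omega))
    (v := 2 ^ J) (by simpa using hpow _ hJS)) ?_
  apply Runs.seq
  refine runs_setW (((gives_var (v := ℓ) (by simpa using h1)).div (gives_lit (by omega))).get
    (le_space (by omega)) (v := 2 ^ b) (by rw [← hb]; simpa using hpow _ (by omega))) ?_
  apply Runs.seq
  refine runs_setW (v := D) (((gives_lit (by omega)).mul (((((gives_var (v := ℓ)
    (by simpa using h1)).get (le_space (by omega)) (v := Nat.log 2 ℓ) (by simpa using hlog _ hℓ)).div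
    (gives_lit (by omega))).add (gives_lit (by omega)) (by omega)).get (le_space (by omega))
    (v := 2 ^ (Nat.log 2 ℓ / 2 + 1)) (by simpa using hpow _ (by omega))) (by omega)).cast hD.symm) ?_
  apply Runs.seq
  refine runs_setW (v := e) ((((gives_var (v := ℓ)
    (by simpa using h1)).get (le_space (by omega)) (v := Nat.log 2 ℓ) (by simpa using hlog _ hℓ)).add
    (gives_lit (by omega)) (by omega)).cast he.symm) ?_
  refine runs_setW ((gives_var (v := e) (by simp)).get (le_space (by omega))
    (v := 2 ^ e) (by simpa using hpow _ (by omega))) ?_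
  simp

/-- A slab is a cell of full length in the other direction, so its load is bounded by that of an
extreme level. -/
theorem count_slab_lt {U V : ℕ → ℝ} (hUm : ∀ p < n, 0 < U p ∧ U p < 1)
    (hload : ∀ u v, ((Finset.range n).filter fun p => ⌊V p * 2 ^ J⌋₊ = u ∧ ⌊U p * 2 ^ 0⌋₊ = v).card < S)
    (g : ℕ) : Nat.count (fun q => slab J V q = g) n < S := by
  rw [Nat.count_eq_card_filter_range]
  refine lt_of_le_of_lt (Finset.card_le_card fun p hp => ?_) (hload g 0)
  rw [Finset.mem_filter] at hp ⊢
  have h := hUm p (Finset.mem_range.1 hp.1)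
  exact ⟨hp.1, hp.2, by rw [pow_zero, mul_one, Nat.floor_eq_zero]; exact h.2⟩

theorem itemBit_le {V U : ℕ → ℝ} {ord ord' yr : ℕ → ℕ} (hVm : ∀ p < n, 0 < V p ∧ V p < 1)
    (hUm : ∀ p < n, 0 < U p ∧ U p < 1) (ho : IsOrder n V ord) (ho' : IsOrder n U ord')
    (hyr : ∀ z < (J + 1) * n, yr (z / n * n + ord' (z % n)) = pos (itemCell n J U V ord') z + 1)
    (hload : ∀ g, cntOf (itemCell n J U V ord') ((J + 1) * n) g < S) {g r : ℕ}
    (hr : r < cntOf (itemCell n J V U ord) ((J + 1) * n) g) :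
    itemBit n J ord yr (el (itemCell n J V U ord) g r) < S := by
  obtain ⟨i, u, v, hi, hu, hv, rfl⟩ := exists_of_cntOf_pos hVm hUm ho (lt_of_le_of_lt (Nat.zero_le _) hr)
  obtain ⟨x, hx, -, h⟩ := itemBit_pt hVm hUm ho ho' hyr hi hu hv hr
  have := hload (cellId J (J - i) v u)
  omega

theorem itemBit_inj {V U : ℕ → ℝ} {ord ord' yr : ℕ → ℕ} (hVm : ∀ p < n, 0 < V p ∧ V p < 1)
    (hUm : ∀ p < n, 0 < U p ∧ U p < 1) (ho : IsOrder n V ord) (ho' : IsOrder n U ord')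
    (hyr : ∀ z < (J + 1) * n, yr (z / n * n + ord' (z % n)) = pos (itemCell n J U V ord') z + 1)
    {g r r' : ℕ} (hr : r < cntOf (itemCell n J V U ord) ((J + 1) * n) g)
    (hr' : r' < cntOf (itemCell n J V U ord) ((J + 1) * n) g)
    (h : itemBit n J ord yr (el (itemCell n J V U ord) g r) =
      itemBit n J ord yr (el (itemCell n J V U ord) g r')) : r = r' := by
  obtain ⟨i, u, v, hi, hu, hv, rfl⟩ := exists_of_cntOf_pos hVm hUm ho (lt_of_le_of_lt (Nat.zero_le _) hr)
  obtain ⟨x, -, e1, h1⟩ := itemBit_pt hVm hUm ho ho' hyr hi hu hv hr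
  obtain ⟨y, -, e2, h2⟩ := itemBit_pt hVm hUm ho ho' hyr hi hu hv hr'
  obtain rfl : x = y := by omega
  exact pt_inj hVm hUm ho hi hu hv hr hr' (e1.symm.trans e2)

/-- The ordinates are inserted first: their positions are the bits of the masks in the lists of the
abscissae. -/
theorem runsIn_structure (hF : Fits w SP n S J b e D t) (hT : Typical n J S b t X Y)
    (h0 : s.wv 0 = n) (h1 : s.wv 1 = ℓ) (h2 : s.wv 2 = S) (hz : ∀ a, s.wa a = 0)
    (hX : s.ra 0 = X) (hY : s.ra 1 = Y)
    (hℓ : ℓ ≤ n) (hAℓ : A * ℓ ≤ n) (hA : 1 ≤ A) (hℓ0 : 1 ≤ ℓ)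
    (hJ : J = Nat.log 2 (n / (A * ℓ))) (hb : b = ℓ / 4) (he : e = Nat.log 2 ℓ + 1)
    (hD : D = B * 2 ^ (Nat.log 2 ℓ / 2 + 1)) :
    RunsIn w SP (structureCmd A B) s fun s' =>
      ∃ ordX ordY yr ρ, Ready w SP n S J b e D t X Y ordX ordY yr ρ s' := by
  have hw := hF.small.word
  have hSSP := hF.small.S_lt
  have hNSP := hF.small.N_lt
  have hNS := hF.small.NS
  have hn := hF.n_le
  have hSw := hF.S_lt
  have hbe := hF.small.b_lt
  have heS := hF.pow_e
  have hS0 : 1 ≤ SP := by omega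
  have hJ1 : 2 ^ J ≤ (J + 1) * 2 ^ J := Nat.le_mul_of_pos_left _ (by omega)
  have hJ2 : 2 ^ J * S ≤ (J + 1) * 2 ^ J * S := Nat.mul_le_mul_right _ hJ1
  have hcode : 2 ^ (e * D + 1) = 2 * (2 ^ e) ^ D := by rw [← pow_mul, pow_succ, mul_comm]
  have h2S : 2 ^ S < 2 ^ w := Nat.pow_lt_pow_right (by norm_num) hSw
  have hS2 : S < 2 ^ S := Nat.lt_two_pow_self
  have hXm := hT.X_mem
  have hYm := hT.Y_mem
  refine ((runsIn_pow h2 hSw hSSP (by omega)).frame.mono ?_).seq hS0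
  rintro s₁ ⟨F₁, pow₁⟩
  refine ((runsIn_log ((F₁.wv rfl).trans h0) ((F₁.wa rfl).trans (hz _)) hn (by omega)).frame.mono
    ?_).seq hS0
  rintro s₂ ⟨f₂, log₂⟩
  have F₂ := F₁.seq f₂
  refine ((runsIn_param (A := A) (B := B) hF ((F₂.wv rfl).trans h0)
    ((F₂.wv rfl).trans h1) (by rw [f₂.wa rfl]; exact pow₁) log₂ hℓ hAℓ hA hℓ0 hJ hb
    he hD).frame.mono ?_).seq hS0
  rintro s₃ ⟨f₃, r3, r4, r6, r7, r8, r9⟩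
  have F₃ := F₂.seq f₃
  refine ((runsIn_sep r6 hF.small.BB (by omega) (by omega)).frame.mono ?_).seq hS0
  rintro s₄ ⟨f₄, sep₄⟩
  have F₄ := F₃.seq f₄
  have pow₄ : ∀ k ≤ S, s₄.wa 0 k = 2 ^ k := by
    rw [f₄.wa rfl, f₃.wa rfl, f₂.wa rfl]; exact pow₁
  refine ((runsIn_tab ((f₄.wv rfl).trans r6) ((f₄.wv rfl).trans r7) ((f₄.wv rfl).trans r8)
    ((f₄.wv rfl).trans r9) pow₄ ((F₄.wa rfl).trans (hz _)) ((F₄.wa rfl).trans (hz _))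
    ((F₄.wa rfl).trans (hz _)) hF.e_pos heS hF.code_le hSSP (by rw [hcode]; exact hF.table)
    hw).frame.mono ?_).seq hS0
  rintro s₅ ⟨f₅, tab₅⟩
  have F₅ := F₄.seq f₅
  have g₅ := f₄.seq f₅
  refine ((runsIn_sort (a := 0) (J := J) (V := X) (.inl rfl) ((F₅.wv rfl).trans h0)
    ((F₅.wv rfl).trans h2) ((g₅.wv rfl).trans r4) ((F₅.ra rfl).trans hX)
    (fun x hx hx' _ => by interval_cases x <;> exact (F₅.wa rfl).trans (hz _))
    (fun p hp => floor_mul_two_pow_lt (hXm p hp).1.le (hXm p hp).2 _) hT.X_ne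
    (count_slab_lt hYm fun u v => by simpa using hT.load J le_rfl u v)
    (by omega) hF.n_mul (by omega) (by omega) hw).frame.mono ?_).seq hS0
  rintro s₆ ⟨f₆, oX⟩
  have F₆ := F₅.seq f₆
  have g₆ := g₅.seq f₆
  refine ((runsIn_sort (a := 1) (J := J) (V := Y) (.inr rfl) ((F₆.wv rfl).trans h0)
    ((F₆.wv rfl).trans h2) ((g₆.wv rfl).trans r4) ((F₆.ra rfl).trans hY)
    (fun x hx hx' hx2 => by interval_cases x <;> first | exact (F₆.wa rfl).trans (hz _) | omega)
    (fun p hp => floor_mul_two_pow_lt (hYm p hp).1.le (hYm p hp).2 _) hT.Y_ne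
    (count_slab_lt hXm fun u v => by simpa [and_comm] using hT.load 0 (Nat.zero_le _) v u)
    (by omega) hF.n_mul (by omega) (by omega) hw).frame.mono ?_).seq hS0
  rintro s₇ ⟨f₇, oY⟩
  have F₇ := F₆.seq f₇
  have g₇ := g₆.seq f₇
  rw [← f₇.wa rfl] at oX
  have T₇ : Tables S b e D s₇ :=
    ⟨(g₇.wv rfl).trans r6, (g₇.wv rfl).trans r7, (g₇.wv rfl).trans r8, by
      rw [f₇.wa rfl, f₆.wa rfl, f₅.wa rfl]; exact pow₄, by
      rw [f₇.wa rfl, f₆.wa rfl, f₅.wa rfl]; exact sep₄⟩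
  have cX := cntOf_lt_of_load hXm hYm oX (by omega) hT.load
  have cY : ∀ g, cntOf (itemCell n J Y X (s₇.wa (6 + 1))) ((J + 1) * n) g < S :=
    cntOf_lt_of_load hYm hXm oY (by omega) fun i hi u v => by
      have := hT.load (J - i) (Nat.sub_le _ _) v u
      rw [Nat.sub_sub_self hi] at this
      simpa [and_comm] using this
  have z₇ : s₇.wa 12 = 0 := (F₇.wa rfl).trans (hz _)
  -- In this first insertion the array of bits is still zero. The masks then merely count items, and
  -- they are never used.
  refine ((runsIn_insert (a := 1) (.inr rfl) hF.small T₇ ((F₇.wv rfl).trans h0)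
    ((F₇.wv rfl).trans h2) ((g₇.wv rfl).trans r3) ((g₇.wv rfl).trans r4) ((F₇.ra rfl).trans hY)
    ((F₇.ra rfl).trans hX) rfl rfl hYm hXm oY ((F₇.wa rfl).trans (hz _))
    ((F₇.wa rfl).trans (hz _)) cY (fun z _ => ?_) (fun g r hr => ?_) hF.J_le hF.key
    hF.items).frame.mono ?_).seq hS0
  · simp [itemBit, z₇]
  · have := cY g
    simp only [maskSum, itemBit, Nat.add_one_sub_one, z₇, Pi.zero_apply, pow_zero,
      Finset.sum_const, Finset.card_range, smul_eq_mul, mul_one]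
    omega
  rintro s₈ ⟨f₈, LY, yr₈⟩
  have F₈ := F₇.seq f₈
  have g₈ := g₇.seq f₈
  rw [← f₈.wa (a := 6) rfl] at oX cX
  have T₈ := T₇.congr (f₈.wv rfl) (f₈.wv rfl) (f₈.wv rfl) (f₈.wa rfl) (f₈.wa rfl)
  refine (runsIn_insert (a := 0) (.inl rfl) hF.small T₈ ((F₈.wv rfl).trans h0)
    ((F₈.wv rfl).trans h2) ((g₈.wv rfl).trans r3) ((g₈.wv rfl).trans r4) ((F₈.ra rfl).trans hX)
    ((F₈.ra rfl).trans hY) rfl rfl hXm hYm oX ((F₈.wa rfl).trans (hz _))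
    ((F₈.wa rfl).trans (hz _)) cX (fun z hz => ?_) (fun g r hr => ?_) hF.J_le hF.key
    hF.items).frame.mono ?_
  · have := itemBit_le hXm hYm oX oY yr₈ cY (pos_lt_count hz)
    rw [el_pos] at this
    exact this.le
  -- Here the word length matters: bits are positions below `S` and S < w, so every mask fits in a
  -- word.
  · exact (maskSum_lt (fun x hx y hy => itemBit_inj hXm hYm oX oY yr₈ (hx.trans_le hr)
      (hy.trans_le hr)) fun x hx => itemBit_le hXm hYm oX oY yr₈ cY (hx.trans_le hr)).trans h2S
  rintro s₉ ⟨f₉, LX, -⟩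
  have F₉ := F₈.seq f₉
  have g₉ := g₈.seq f₉
  exact ⟨_, _, _, _, {
    small := hF.small
    e_pos := hF.e_pos
    b_le := by omega
    J_le := hF.J_le
    pow_le := hF.pow_J
    n_lt := by omega
    table := hF.table
    key := hF.key
    t_le := hF.t_le
    reg0 := (F₉.wv rfl).trans h0
    reg2 := (F₉.wv rfl).trans h2
    reg3 := (g₉.wv rfl).trans r3
    reg4 := (g₉.wv rfl).trans r4
    tables := T₈.congr (f₉.wv rfl) (f₉.wv rfl) (f₉.wv rfl) (f₉.wa rfl) (f₉.wa rfl)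
    searchTable := by
      rw [SearchTable, ← hcode, f₉.wa rfl, f₈.wa rfl, f₇.wa rfl, f₆.wa rfl]; exact tab₅
    log := by
      rw [f₉.wa rfl, f₈.wa rfl, f₇.wa rfl, f₆.wa rfl, f₅.wa rfl, f₄.wa rfl, f₃.wa rfl]; exact log₂
    orderX := oX
    orderY := oY
    bits := yr₈
    listsX := LX
    listsY := LY.congr (f₉.wa rfl) (f₉.ra rfl) (f₉.wa rfl) (f₉.wa rfl) (f₉.wa rfl) (f₉.wa rfl) }⟩

end

end RealRAM

namespace RealRAM

open BlindSearch RandomPoints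

/-! ### Parameters -/

/-- All conditions on the binary length `ℓ` of the number of points. -/
structure LongEnough (A B ℓ : ℕ) : Prop where
  le : 8 ≤ ℓ
  load : 2 * (A * ℓ) ≤ 2 ^ (ℓ / 8)
  code : (Nat.log 2 ℓ + 1) * (B * 2 ^ (Nat.log 2 ℓ / 2 + 1)) + 2 ≤ 2 ^ (Nat.log 2 ℓ - 1)

theorem eventually_mul_add_le_two_pow (a b : ℕ) : ∀ᶠ x : ℕ in Filter.atTop, a * x + b ≤ 2 ^ x := by
  have h := (tendsto_pow_const_div_const_pow_of_one_lt 1 (r := (2 : ℝ)) (by norm_num)).eventually_lt_const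
    (u := 1 / ((a : ℝ) + b + 1)) (by positivity)
  filter_upwards [h, Filter.eventually_ge_atTop 1] with x hx hx1
  rw [div_lt_div_iff₀ (by positivity) (by positivity), pow_one, one_mul] at hx
  have hx' : x * (a + b + 1) < 2 ^ x := by exact_mod_cast hx
  nlinarith

theorem tendsto_log_two : Filter.Tendsto (Nat.log 2) Filter.atTop Filter.atTop :=
  Filter.tendsto_atTop.2 fun k => Filter.eventually_atTop.2
    ⟨2 ^ k, fun x hx => by simpa using Nat.log_mono_right (b := 2) hx⟩

theorem tendsto_div_const {d : ℕ} (hd : 0 < d) :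
    Filter.Tendsto (fun x : ℕ => x / d) Filter.atTop Filter.atTop :=
  Filter.tendsto_atTop.2 fun k => Filter.eventually_atTop.2
    ⟨k * d, fun _ hx => (Nat.le_div_iff_mul_le hd).2 hx⟩

/-- Exponential growth against linear growth, applied to ℓ/8 for the load and to half the logarithm
of ℓ for the code. -/
theorem eventually_longEnough (A B : ℕ) : ∀ᶠ ℓ in Filter.atTop, LongEnough A B ℓ := by
  have h1 := (tendsto_div_const (d := 8) (by norm_num)).eventually
    (eventually_mul_add_le_two_pow (16 * A) (16 * A))
  have h2 := ((tendsto_div_const (d := 2) (by norm_num)).comp tendsto_log_two).eventually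
    (eventually_mul_add_le_two_pow (8 * B) (8 * B + 4))
  filter_upwards [h1, h2, Filter.eventually_ge_atTop 8] with ℓ h1 h2 h8
  simp only [Function.comp_apply] at h2
  have hL : 3 ≤ Nat.log 2 ℓ := by
    have := Nat.log_mono_right (b := 2) h8
    rwa [show (8 : ℕ) = 2 ^ 3 by norm_num, Nat.log_pow (by norm_num)] at this
  refine ⟨h8, le_trans ?_ h1, ?_⟩
  · have : ℓ ≤ 8 * (ℓ / 8) + 8 := by omega
    nlinarith
  -- With x = 2^h the left side is of order h · x and the right side at least x²/2, so it suffices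
  -- that x exceeds a linear function of h.
  · set h := Nat.log 2 ℓ / 2
    have e1 : Nat.log 2 ℓ + 1 ≤ 2 * h + 2 := by omega
    have e2 : 2 ^ (2 * h) ≤ 2 ^ (Nat.log 2 ℓ - 1) * 2 := by
      rw [← pow_succ]
      exact Nat.pow_le_pow_right (by norm_num) (by omega)
    have e3 : 2 ^ (2 * h) = 2 ^ h * 2 ^ h := by rw [two_mul, pow_add]
    have e4 : 2 ^ (h + 1) = 2 * 2 ^ h := pow_succ' _ _
    have e5 : 1 ≤ 2 ^ h := Nat.one_le_two_pow
    rw [e4]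
    have e6 := Nat.mul_le_mul_right (B * (2 * 2 ^ h)) e1
    have e7 := Nat.mul_le_mul_left (2 ^ h) h2
    generalize 2 ^ h = x at *
    nlinarith

theorem two_pow_log_div_mul_le {n q : ℕ} (hq : 0 < q) (h : q ≤ n) :
    2 ^ Nat.log 2 (n / q) * q ≤ n :=
  (Nat.mul_le_mul_right q (Nat.pow_log_le_self 2 (Nat.div_pos h hq).ne')).trans
    (Nat.div_mul_le_self n q)

theorem le_two_pow_log_div_mul {n q : ℕ} (hq : 0 < q) :
    n ≤ 2 ^ (Nat.log 2 (n / q) + 1) * q := by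
  have h1 : n / q < 2 ^ (Nat.log 2 (n / q) + 1) := Nat.lt_pow_succ_log_self (by norm_num) _
  exact ((Nat.div_lt_iff_lt_mul hq).1 h1).le

theorem two_pow_size_sub_one_le {n : ℕ} (hn : 1 ≤ n) : 2 ^ (Nat.size n - 1) ≤ n := by
  have : 0 < Nat.size n := Nat.size_pos.2 hn
  exact Nat.lt_size.1 (by omega)

theorem LongEnough.mul_le {A B n : ℕ} (hE : LongEnough A B (Nat.size n)) (hn : 1 ≤ n) :
    A * Nat.size n ≤ n := by
  have h1 := hE.load
  have h2 : 2 ^ (Nat.size n / 8) ≤ 2 ^ (Nat.size n - 1) :=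
    Nat.pow_le_pow_right (by norm_num) (by have := hE.le; omega)
  have h3 := two_pow_size_sub_one_le hn
  omega

/-- The space `B * (n * ℓ)` is governed by the lists: J+1 ≤ ℓ levels of 2^J cells with `B * ℓ` slots
each, where 2^J ℓ ≤ n. The search table has at most `n` entries. The number 260 is the least value
taken by `B` in the application, for c = 0. -/
theorem fits_of_longEnough {n A B w t : ℕ} (hn : 3 ≤ n) (hSw : B * Nat.size n < w)
    (hw : 4 * (B * (n * Nat.size n)) < 2 ^ w) (hw' : 2 * Nat.size n + 2 < w)
    (hB : 260 ≤ B) (hA : 1 ≤ A) (hE : LongEnough A B (Nat.size n)) (htB : t ≤ B) :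
    Fits w (B * (n * Nat.size n)) n (B * Nat.size n) (Nat.log 2 (n / (A * Nat.size n)))
      (Nat.size n / 4) (Nat.log 2 (Nat.size n) + 1)
      (B * 2 ^ (Nat.log 2 (Nat.size n) / 2 + 1)) t := by
  have hAn := hE.mul_le (by omega)
  have hnℓ := Nat.lt_size_self n
  have hℓn := two_pow_size_sub_one_le (n := n) (by omega)
  obtain ⟨h8, hload, hcode⟩ := hE
  set ℓ := Nat.size n
  have hAℓ : ℓ ≤ A * ℓ := Nat.le_mul_of_pos_left _ hA
  have hJ := two_pow_log_div_mul_le (n := n) (q := A * ℓ) (by omega) hAn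
  set J := Nat.log 2 (n / (A * ℓ))
  set L := Nat.log 2 ℓ
  have hL1 : 2 ^ L ≤ ℓ := Nat.pow_log_le_self 2 (by omega)
  have hL2 : ℓ < 2 ^ (L + 1) := Nat.lt_pow_succ_log_self (by norm_num) _
  have hL3 : 3 ≤ L := by
    by_contra h
    have : 2 ^ (L + 1) ≤ 2 ^ 3 := Nat.pow_le_pow_right (by norm_num) (by omega)
    omega
  have hLs : 2 ^ (L + 1) = 2 * 2 ^ L := pow_succ' _ _
  have hLp : 2 ^ L = 2 * 2 ^ (L - 1) := by rw [← pow_succ', Nat.sub_add_cancel (by omega)]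
  have hJn : 2 ^ J * ℓ ≤ n := (Nat.mul_le_mul_left _ hAℓ).trans hJ
  have hJ0 : 0 < 2 ^ J := by positivity
  have hJn' : 2 ^ J ≤ n := (Nat.le_mul_of_pos_right _ (by omega)).trans hJn
  have hJℓ : J < ℓ := (Nat.pow_lt_pow_iff_right (by norm_num : 1 < 2)).1 (hJn'.trans_lt hnℓ)
  have hSℓ : ℓ ≤ B * ℓ := Nat.le_mul_of_pos_left _ (by omega)
  have hS2 : 260 * ℓ ≤ B * ℓ := Nat.mul_le_mul_right _ hB
  have hSP : n * ℓ ≤ B * (n * ℓ) := Nat.le_mul_of_pos_left _ (by omega)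
  have hnℓ' : n * 8 ≤ n * ℓ := Nat.mul_le_mul_left _ h8
  have hNS : (J + 1) * 2 ^ J * (B * ℓ) ≤ B * (n * ℓ) := by
    calc (J + 1) * 2 ^ J * (B * ℓ) = B * ((2 ^ J * ℓ) * (J + 1)) := by ring
      _ ≤ B * (n * ℓ) := Nat.mul_le_mul_left _ (Nat.mul_le_mul hJn hJℓ)
  have hN0 : 0 < (J + 1) * 2 ^ J := by positivity
  -- The code takes fewer than ℓ/2 bits and the key ℓ/4, together at most ℓ - 1.
  have hcode' : 2 * (2 ^ (L + 1)) ^ (B * 2 ^ (L / 2 + 1)) * 2 ^ (ℓ / 4) ≤ n := by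
    refine le_trans ?_ hℓn
    rw [← pow_mul, ← pow_succ', ← pow_add]
    exact Nat.pow_le_pow_right (by norm_num) (by omega)
  have hpos : 0 < 2 ^ (ℓ / 4) := by positivity
  have hhalf : 2 ^ (L / 2 + 1) < 2 ^ L := Nat.pow_lt_pow_right (by norm_num) (by omega)
  constructor
  · constructor
    · positivity
    -- The summand 1 in the exponent of the block length makes up for the rounding of L/2, so that
    -- D² covers the capacity.
    · calc B * ℓ ≤ B * B * 2 ^ (L + 1) := Nat.mul_le_mul (Nat.le_mul_self B) hL2.le
        _ ≤ B * B * 2 ^ (L / 2 + 1 + (L / 2 + 1)) :=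
          Nat.mul_le_mul_left _ (Nat.pow_le_pow_right (by norm_num) (by omega))
        _ = _ := by rw [pow_add]; ring
    · exact Nat.mul_lt_mul_of_pos_left (hhalf.trans_le hL1) (by omega)
    · omega
    · calc B * ℓ < B * ℓ * 3 := by omega
        _ ≤ B * ℓ * n := Nat.mul_le_mul_left _ hn
        _ = _ := by ring
    · exact (lt_mul_of_one_lt_right hN0 (by omega)).trans_le hNS
    · exact hNS
    · rw [← pow_add]
      have : 2 ^ (ℓ / 4 + ℓ / 4) ≤ 2 ^ (ℓ - 1) := Nat.pow_le_pow_right (by norm_num) (by omega)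
      omega
    · have := Nat.le_mul_of_pos_right (2 * (2 ^ (L + 1)) ^ (B * 2 ^ (L / 2 + 1))) hpos
      omega
    · exact hw
  · exact hSw
  · omega
  · omega
  · omega
  · omega
  · exact hJn'
  · omega
  · exact le_of_eq (by ring)
  · calc (J + 1) * n ≤ ℓ * n := Nat.mul_le_mul_right _ hJℓ
      _ = n * ℓ := mul_comm _ _
      _ ≤ _ := hSP
  · omega
  · calc 4 * (2 ^ J * 2 ^ (ℓ / 4)) ≤ 2 ^ 2 * (2 ^ ℓ * 2 ^ ℓ) := by
          refine Nat.mul_le_mul_left _ (Nat.mul_le_mul (Nat.pow_le_pow_right (by norm_num) (by omega))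
            (Nat.pow_le_pow_right (by norm_num) (by omega)))
      _ = 2 ^ (2 * ℓ + 2) := by rw [← pow_add, ← pow_add]; congr 1; ring
      _ < 2 ^ w := Nat.pow_lt_pow_right (by norm_num) hw'
  · exact htB.trans (Nat.le_mul_of_pos_right _ (by positivity))

/-! ### The start of the construction -/

/-- Compute the binary length of `W 0` in register `1`. -/
def sizeCmd : Cmd :=
  setW 10 (W 0) ;; .loop (W 10) (setW 10 (W 10 / Lit 2) ;; setW 1 (W 1 + Lit 1))

/-- Compute the binary length, the capacity of the cells, and the bounds for space and time. -/
def preludeCmd (B M : ℕ) : Cmd :=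
  sizeCmd ;; setW 2 (Lit B * W 1) ;; setW 41 (Lit B * (W 0 * W 1)) ;; setW 40 (Lit M * W 41)

theorem size_eq_size_div_two_add_one {m : ℕ} (hm : m ≠ 0) :
    Nat.size m = Nat.size (m / 2) + 1 := by
  have h : Nat.bit (m.bodd) (m / 2) = m := by
    rw [← Nat.div2_val]; exact Nat.bit_bodd_div2 m
  conv_lhs => rw [← h]
  exact Nat.size_bit (by rwa [h])

theorem exec_size_loop {w : ℕ} (hw : 2 ≤ w) (m : ℕ) : ∀ s : Mem, s.wv 10 = m →
    s.wv 1 + Nat.size m < 2 ^ w →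
    ∃ s' t, Exec w (.loop (W 10) (setW 10 (W 10 / Lit 2) ;; setW 1 (W 1 + Lit 1))) s s' t 0 ∧
      t ≤ 11 * Nat.size m + 2 ∧ s'.wv 1 = s.wv 1 + Nat.size m := by
  have h2 : 2 < 2 ^ w := lt_of_lt_of_le (by norm_num) (Nat.pow_le_pow_right (by norm_num) hw)
  induction m using Nat.strong_induction_on with
  | _ m ih =>
    intro s hs hlt
    by_cases hm : m = 0
    · exact ⟨s, _, .loopFalse (hs.trans hm), by simp [Expr.cost], by simp [hm]⟩
    · have hsz := size_eq_size_div_two_add_one hm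
      obtain ⟨s₁, t₁, m₁, e₁, b₁, h10, h1⟩ : Runs w 0
          (setW 10 (W 10 / Lit 2) ;; setW 1 (W 1 + Lit 1)) s
          fun s' => s'.wv 10 = m / 2 ∧ s'.wv 1 = s.wv 1 + 1 := by
        apply Runs.seq
        refine runs_setW ((gives_var hs).div (gives_lit h2)) ?_
        refine runs_setW ((gives_var (v := s.wv 1) (by simp)).add (gives_lit (by omega))
          (by omega)) ?_
        simp
      obtain rfl : m₁ = 0 := by simpa using b₁
      obtain ⟨s₂, t₂, e₂, ht, hv⟩ := ih (m / 2) (by omega) s₁ h10 (by omega)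
      have ht₁ : t₁ ≤ 9 := e₁.time_le_maxTime rfl
      have hne : Expr.eval w s (W 10) ≠ (0 : ℕ) := fun h => hm (hs.symm.trans h)
      refine ⟨s₂, _, .loopTrue hne e₁ e₂, ?_, by omega⟩
      simp only [Expr.cost]
      omega

/-- The bounds for time and space are themselves computed by the machine, in a part that cannot be
guarded yet. It takes O(ℓ) steps and touches no array. -/
theorem exec_prelude {w n B M : ℕ} {s : Mem} (h0 : s.wv 0 = n) (h1 : s.wv 1 = 0) (hw : 2 ≤ w)
    (hn : 1 ≤ n) (hB0 : 1 ≤ B) (hB : B < 2 ^ w) (hM : M < 2 ^ w) (hSP : B * (n * Nat.size n) < 2 ^ w)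
    (hT : M * (B * (n * Nat.size n)) < 2 ^ w) :
    ∃ s' t, Exec w (preludeCmd B M) s s' t 0 ∧ t ≤ 11 * Nat.size n + 30 ∧
      s'.wv 1 = Nat.size n ∧ s'.wv 2 = B * Nat.size n ∧ s'.wv 41 = B * (n * Nat.size n) ∧
      s'.wv 40 = M * (B * (n * Nat.size n)) := by
  have e1 : Nat.size n ≤ n * Nat.size n := Nat.le_mul_of_pos_left _ hn
  have e2 : n * Nat.size n ≤ B * (n * Nat.size n) := Nat.le_mul_of_pos_left _ hB0
  have e3 : B * Nat.size n ≤ B * (n * Nat.size n) := Nat.mul_le_mul_left _ e1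
  have hset : Exec w (setW 10 (W 0)) s (s.setVar .word 10 n) 2 0 := by
    have := Exec.set (w := w) s .word 10 (W 0)
    rwa [show Expr.eval w s (W 0) = n from h0] at this
  obtain ⟨s₁, t₁, x₁, ht₁, hv⟩ := exec_size_loop hw n (s.setVar .word 10 n) (by simp)
    (by simp [h1]; omega)
  have x₂ : Exec w sizeCmd s s₁ _ _ := .seq hset x₁
  have h0' : s₁.wv 0 = n := (x₂.frame.wv rfl).trans h0
  have h1' : s₁.wv 1 = Nat.size n := by simpa [h1] using hv
  obtain ⟨s₂, t₂, m₂, x₃, b₃, hq⟩ : Runs w 0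
      (setW 2 (Lit B * W 1) ;; setW 41 (Lit B * (W 0 * W 1)) ;; setW 40 (Lit M * W 41)) s₁
      fun s' => s'.wv 1 = Nat.size n ∧ s'.wv 2 = B * Nat.size n ∧
        s'.wv 41 = B * (n * Nat.size n) ∧ s'.wv 40 = M * (B * (n * Nat.size n)) := by
    apply Runs.seq
    refine runs_setW ((gives_lit hB).mul (gives_var h1') (by omega)) ?_
    apply Runs.seq
    refine runs_setW ((gives_lit hB).mul ((gives_var (v := n) (by simpa using h0')).mul
      (gives_var (v := Nat.size n) (by simpa using h1')) (by omega)) (by omega)) ?_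
    refine runs_setW ((gives_lit hM).mul (gives_var (by simp)) hT) ?_
    simp [h1']
  obtain rfl : m₂ = 0 := by simpa using b₃
  have ht₂ : t₂ ≤ 16 := x₃.time_le_maxTime rfl
  exact ⟨s₂, _, .seq x₂ x₃, by omega, hq⟩

end RealRAM

namespace RealRAM

open BlindSearch RandomPoints

/-! ### The complete construction program -/

/-- The number of steps per cell that the construction may use. -/
def fuelFactor (A B : ℕ) : ℕ := 20 * (structureCmd A B).maxTime

/-- The construction program. Inputs of fewer than `n₀` points are left as they are. -/
def buildCmd (A B n₀ : ℕ) : Cmd :=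
  preludeCmd B (fuelFactor A B) ;;
    .cond (Lt (W 0) (Lit n₀)) .skip ((structureCmd A B).guard 40 41)

/-- The words are long enough for `n` points. -/
structure WideWords (w n B M n₀ : ℕ) : Prop where
  two_le : 2 ≤ w
  B_lt : B < 2 ^ w
  M_lt : M < 2 ^ w
  n₀_lt : n₀ + 1 < 2 ^ w
  space : 4 * (B * (n * Nat.size n)) < 2 ^ w
  fuel : M * (B * (n * Nat.size n)) < 2 ^ w
  load : B * Nat.size n < w
  length : 2 * Nat.size n + 2 < w

/-- All required quantities are at most q · n · ℓ for a constant q, or at most q · ℓ. The multiple q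
+ 2 suffices because q < 2^q, n < 2^ℓ and ℓ < 2^ℓ. -/
theorem exists_wideWords (B M n₀ : ℕ) :
    ∃ κ, 1 ≤ κ ∧ ∀ n, 1 ≤ n → WideWords (κ * Nat.size n) n B M n₀ := by
  set q := 4 * B + M * B + M + n₀ + 10 with hq
  refine ⟨q + 2, by omega, fun n hn => ?_⟩
  have hℓ : 1 ≤ Nat.size n := Nat.size_pos.2 hn
  have hn' := Nat.lt_size_self n
  set ℓ := Nat.size n
  have hℓ' : ℓ < 2 ^ ℓ := Nat.lt_two_pow_self
  have e1 : 2 ^ q ≤ 2 ^ (q * ℓ) :=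
    Nat.pow_le_pow_right (by norm_num) (Nat.le_mul_of_pos_right _ hℓ)
  have e2 : q < 2 ^ q := Nat.lt_two_pow_self
  have e3 : 2 ^ ((q + 2) * ℓ) = 2 ^ (q * ℓ) * (2 ^ ℓ * 2 ^ ℓ) := by
    rw [← pow_add, ← pow_add]; congr 1; ring
  have e4 : n * ℓ ≤ 2 ^ ℓ * 2 ^ ℓ := Nat.mul_le_mul hn'.le hℓ'.le
  have hp : 0 < 2 ^ ℓ * 2 ^ ℓ := by positivity
  have key : ∀ x ≤ q, x * (n * ℓ) < 2 ^ ((q + 2) * ℓ) := by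
    intro x hx
    calc x * (n * ℓ) ≤ q * (2 ^ ℓ * 2 ^ ℓ) := Nat.mul_le_mul hx e4
      _ < 2 ^ (q * ℓ) * (2 ^ ℓ * 2 ^ ℓ) := Nat.mul_lt_mul_of_pos_right (by omega) hp
      _ = _ := e3.symm
  have key' : q < 2 ^ ((q + 2) * ℓ) :=
    (Nat.le_mul_of_pos_right _ (by positivity)).trans_lt (key q le_rfl)
  have hqℓ : (q + 2) * 1 ≤ (q + 2) * ℓ := Nat.mul_le_mul_left _ hℓ
  refine ⟨by omega, by omega, by omega, by omega, ?_, ?_, ?_, ?_⟩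
  · rw [← mul_assoc]; exact key _ (by omega)
  · rw [← mul_assoc]; exact key _ (by omega)
  · exact Nat.mul_lt_mul_of_pos_right (by omega) hℓ
  · nlinarith

section
variable {w n A B n₀ : ℕ} {s : Mem}

theorem exec_branch {c d : Cmd} {s' : Mem} {t m : ℕ} (hw : 2 ≤ w) (hn₀ : n₀ + 1 < 2 ^ w)
    (h0 : s.wv 0 = n) (hc : n < n₀ → Exec w c s s' t m) (hd : n₀ ≤ n → Exec w d s s' t m) :
    Exec w (.cond (Lt (W 0) (Lit n₀)) c d) s s' (t + 4) m := by
  have hg : Gives w 0 s (Lt (W 0) (Lit n₀)) (if n < n₀ then 1 else 0) :=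
    (gives_var h0).lt (by omega) (gives_lit (by omega))
  have hsp : (Lt (W 0) (Lit n₀)).space w s = 0 := by simpa using hg.2
  by_cases h : n < n₀
  · have e : Expr.eval w s (Lt (W 0) (Lit n₀)) ≠ (0 : ℕ) := by
      rw [show Expr.eval w s (Lt (W 0) (Lit n₀)) = _ from hg.1, if_pos h]; norm_num
    have := Exec.condTrue (d := d) e (hc h)
    rw [hsp, Nat.zero_max] at this
    convert this using 1
    simp [Expr.cost]; omega
  · have e : Expr.eval w s (Lt (W 0) (Lit n₀)) = (0 : ℕ) := by
      rw [show Expr.eval w s (Lt (W 0) (Lit n₀)) = _ from hg.1, if_neg h]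
    have := Exec.condFalse (c := c) e (hd (not_lt.1 h))
    rw [hsp, Nat.zero_max] at this
    convert this using 1
    simp [Expr.cost]; omega

/-- A worst-case bound for every input, without any assumption on the points: the guarded program
stops when its fuel of order n · ℓ is used up. The expected bounds follow from it. -/
theorem exec_build_halts (A B n₀ : ℕ) (hB : 1 ≤ B) : ∃ C : ℕ, ∀ w n, ∀ s : Mem, 1 ≤ n →
    WideWords w n B (fuelFactor A B) n₀ → s.wv 0 = n → s.wv 1 = 0 →
    ∃ s' t m, Exec w (buildCmd A B n₀) s s' t m ∧ t ≤ C * (n * Nat.size n) ∧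
      m ≤ C * (n * Nat.size n) := by
  obtain ⟨K, hK⟩ := (structureCmd A B).guard_halts (f := 40) (k := 41) (by norm_num) rfl rfl
  refine ⟨K * (fuelFactor A B * B + 1) + B + 50, fun w n s hn hw h0 h1 => ?_⟩
  obtain ⟨s₁, t₁, x₁, ht₁, -, -, h41, h40⟩ := exec_prelude (B := B) (M := fuelFactor A B) h0 h1
    hw.two_le hn hB hw.B_lt hw.M_lt (by have := hw.space; omega) hw.fuel
  have h0' : s₁.wv 0 = n := (x₁.frame.wv rfl).trans h0
  have hℓ : 1 ≤ Nat.size n := Nat.size_pos.2 hn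
  have e1 : Nat.size n ≤ n * Nat.size n := Nat.le_mul_of_pos_left _ hn
  have hpos : 1 ≤ n * Nat.size n := by omega
  by_cases h : n < n₀
  · have x₂ := exec_branch (d := (structureCmd A B).guard 40 41) hw.two_le hw.n₀_lt h0'
      (fun _ => Exec.skip (w := w) s₁) (fun h' => absurd h (not_lt.2 h'))
    refine ⟨s₁, _, _, .seq x₁ x₂, ?_, by simp⟩
    nlinarith [Nat.zero_le (K * (fuelFactor A B * B + 1) * (n * Nat.size n)),
      Nat.zero_le (B * (n * Nat.size n))]
  · obtain ⟨s₂, t₂, m₂, x₂, hm, -, -, ht⟩ := hK w (by have := hw.two_le; omega) s₁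
      (by rw [h41]; positivity)
    have x₃ := exec_branch (c := .skip) hw.two_le hw.n₀_lt h0' (fun h' => absurd h' h) (fun _ => x₂)
    refine ⟨s₂, _, _, .seq x₁ x₃, ?_, ?_⟩
    · rw [h40] at ht
      have : K * (fuelFactor A B * (B * (n * Nat.size n)) + 1) ≤
          K * (fuelFactor A B * B + 1) * (n * Nat.size n) := by
        rw [mul_assoc]
        refine Nat.mul_le_mul_left K ?_
        nlinarith
      nlinarith [Nat.zero_le (B * (n * Nat.size n)), Nat.zero_le (K * s₂.wv 40)]
    · rw [h41] at hm
      rw [Nat.zero_max]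
      nlinarith [Nat.zero_le (K * (fuelFactor A B * B + 1) * (n * Nat.size n))]

theorem exec_build_small (hw : WideWords w n B (fuelFactor A B) n₀) (hB : 1 ≤ B) (hn : 1 ≤ n)
    (h : n < n₀) (h0 : s.wv 0 = n) (h1 : s.wv 1 = 0) :
    ∃ s' t m, Exec w (buildCmd A B n₀) s s' t m ∧ s'.wv 0 = n ∧ s'.ra 0 = s.ra 0 ∧
      s'.ra 1 = s.ra 1 := by
  obtain ⟨s₁, t₁, x₁, -⟩ := exec_prelude (B := B) (M := fuelFactor A B) h0 h1
    hw.two_le hn hB hw.B_lt hw.M_lt (by have := hw.space; omega) hw.fuel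
  have h0' : s₁.wv 0 = n := (x₁.frame.wv rfl).trans h0
  exact ⟨s₁, _, _, .seq x₁ (exec_branch hw.two_le hw.n₀_lt h0' (fun _ => Exec.skip (w := w) s₁)
    (fun h' => absurd h (not_lt.2 h'))), h0', x₁.frame.ra rfl, x₁.frame.ra rfl⟩

theorem exec_build_large {t : ℕ} {X Y : ℕ → ℝ} (hw : WideWords w n B (fuelFactor A B) n₀)
    (hB : 260 ≤ B) (hA : 1 ≤ A) (htB : t ≤ B) (hn : 3 ≤ n) (h : n₀ ≤ n)
    (hE : LongEnough A B (Nat.size n))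
    (hT : Typical n (Nat.log 2 (n / (A * Nat.size n))) (B * Nat.size n) (Nat.size n / 4) t X Y)
    (h0 : s.wv 0 = n) (h1 : s.wv 1 = 0) (hz : ∀ a, s.wa a = 0) (hX : s.ra 0 = X)
    (hY : s.ra 1 = Y) :
    ∃ s' u m, Exec w (buildCmd A B n₀) s s' u m ∧ ∃ ordX ordY yr ρ,
      Ready w (B * (n * Nat.size n)) n (B * Nat.size n) (Nat.log 2 (n / (A * Nat.size n)))
        (Nat.size n / 4) (Nat.log 2 (Nat.size n) + 1) (B * 2 ^ (Nat.log 2 (Nat.size n) / 2 + 1)) t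
        X Y ordX ordY yr ρ s' := by
  obtain ⟨s₁, t₁, x₁, -, r1, r2, h41, h40⟩ := exec_prelude (B := B) (M := fuelFactor A B) h0 h1
    hw.two_le (by omega) (by omega) hw.B_lt hw.M_lt (by have := hw.space; omega) hw.fuel
  have F := x₁.frame
  have h0' : s₁.wv 0 = n := (F.wv rfl).trans h0
  have hF := fits_of_longEnough hn hw.load hw.space hw.length hB hA hE htB
  have hAn := hE.mul_le (by omega)
  have hAℓ : Nat.size n ≤ A * Nat.size n := Nat.le_mul_of_pos_left _ hA
  obtain ⟨s₂, t₂, m₂, x₂, ht, hm, ordX, ordY, yr, ρ, hR⟩ := runsIn_structure (A := A) (B := B) hF hT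
    h0' r1 r2 (fun a => (F.wa rfl).trans (hz a)) ((F.ra rfl).trans hX) ((F.ra rfl).trans hY)
    (by omega) hAn hA (by have := hE.le; omega) rfl rfl rfl rfl
  -- The program uses word registers below 40 only, so 40 and 41 are free. The fuel is exactly the
  -- bound in `RunsIn`, by the choice of `fuelFactor`.
  obtain ⟨s₃, t₃, m₃, x₃, hag, -, -⟩ := Cmd.guard_sim (f := 40) (k := 41) (N := 40)
    (by have := hw.two_le; omega) (by norm_num) le_rfl (by norm_num) x₂ rfl s₁
    ⟨rfl, rfl, fun _ _ _ => rfl⟩ (by rw [h41]; exact hm) (by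
      rw [h40]
      refine ht.trans (le_of_eq ?_)
      rw [fuelFactor]
      ring)
  refine ⟨s₃, _, _, .seq x₁ (exec_branch hw.two_le hw.n₀_lt h0'
    (fun h' => absurd h' (not_lt.2 h)) (fun _ => x₃)), ordX, ordY, yr, ρ, hR.congr
    (fun x hx => hag.2.2 x (by omega) (by omega)) (fun x => ?_) (fun x => ?_)⟩
  · change s₃.arr .word x = s₂.arr .word x
    rw [hag.1]
  · change s₃.arr .real x = s₂.arr .real x
    rw [hag.1]

end

end RealRAM

/-! ### From runs of the programs to expectations and probabilities -/

namespace RandomPoints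

open RealRAM MeasureTheory

theorem runTime_le {w : ℕ} {c : Cmd} {s s' : Mem} {t m : ℕ} (h : Exec w c s s' t m) :
    runTime w c s ≤ t :=
  iInf_le_of_le s' (iInf_le_of_le t (iInf_le_of_le m (iInf_le _ h)))

theorem runSpace_le {w : ℕ} {c : Cmd} {s s' : Mem} {t m : ℕ} (h : Exec w c s s' t m) :
    runSpace w c s ≤ m :=
  iInf_le_of_le s' (iInf_le_of_le t (iInf_le_of_le m (iInf_le _ h)))

/-- A pointwise bound integrates against a probability measure without any measurability of the
integrand. -/
theorem lintegral_law_le {n k : ℕ} {f : (Fin n → ℝ × ℝ) → ENNReal} (h : ∀ P, f P ≤ k) :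
    ∫⁻ P, f P ∂(law n) ≤ k := by
  calc ∫⁻ P, f P ∂(law n) ≤ ∫⁻ _, k ∂(law n) := lintegral_mono h
    _ = k := by simp

section
variable {n : ℕ} (P : Fin n → ℝ × ℝ)

theorem inputMem_wa (a : ℕ) : (inputMem P).wa a = 0 := rfl

theorem inputMem_abscissa : (inputMem P).ra 0 = abscissa P := by
  funext i
  simp [inputMem, Mem.ra, abscissa]

theorem inputMem_ordinate : (inputMem P).ra 1 = ordinate P := by
  funext i
  simp [inputMem, Mem.ra, ordinate]

theorem exists_mem_rectangle_iff {x x' y y' : ℝ} : (∃ i, P i ∈ rectangle x x' y y') ↔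
    ∃ p < n, (x < abscissa P p ∧ abscissa P p ≤ x') ∧ y < ordinate P p ∧ ordinate P p ≤ y' := by
  constructor
  · rintro ⟨i, hi⟩
    refine ⟨i, i.2, ?_⟩
    simpa [abscissa, ordinate, rectangle] using hi
  · rintro ⟨p, hp, h⟩
    refine ⟨⟨p, hp⟩, ?_⟩
    simpa [abscissa, ordinate, rectangle, hp] using h

theorem correctQueries_of_runs {w : ℕ} {query : Cmd} {s : Mem}
    (h : ∀ x x' y y', Runs w ⊤ query (s.withQuery x x' y y') fun s' => s'.wv 0 ≠ 0 ↔
      ∃ p < n, (x < abscissa P p ∧ abscissa P p ≤ x') ∧ y < ordinate P p ∧ ordinate P p ≤ y') :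
    CorrectQueries w query P s := by
  intro x x' y y'
  obtain ⟨s', t, m, h1, -, h2⟩ := h x x' y y'
  exact ⟨s', t, m, h1, h2.trans (exists_mem_rectangle_iff P).symm⟩

theorem buildsWith_correctQueries_small {w A B n₀ t : ℕ}
    (hw : WideWords w n B (fuelFactor A B) n₀) (hB : 1 ≤ B) (hn : 1 ≤ n) (h : n < n₀) :
    BuildsWith w (buildCmd A B n₀) P (CorrectQueries w (queryCmd t n₀) P) := by
  obtain ⟨s', u, m, h1, r0, hX, hY⟩ := exec_build_small (s := inputMem P) hw hB hn h rfl rfl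
  refine ⟨s', u, m, h1, correctQueries_of_runs P fun x x' y y' => ?_⟩
  have hw1 := hw.two_le
  have hn₀ := hw.n₀_lt
  have r0' : (s'.withQuery x x' y y').wv 0 = n := by simpa [Mem.withQuery] using r0
  refine runs_cond ((gives_var r0').lt (by omega) (gives_lit (by omega))) (fun _ => ?_)
    (fun h' => absurd h' (by simp [h]))
  refine runs_scan hn₀ h.le r0' ?_ ?_ ?_ ?_ ?_ ?_
  · simpa [Mem.withQuery, inputMem_abscissa] using hX
  · simpa [Mem.withQuery, inputMem_ordinate] using hY
  all_goals simp [Mem.withQuery]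

theorem buildsWith_correctQueries_large {w A B n₀ t : ℕ}
    (hw : WideWords w n B (fuelFactor A B) n₀) (hB : 260 ≤ B) (hA : 1 ≤ A) (htB : t ≤ B)
    (hn : 3 ≤ n) (h : n₀ ≤ n) (hE : LongEnough A B (Nat.size n))
    (hT : Typical n (Nat.log 2 (n / (A * Nat.size n))) (B * Nat.size n) (Nat.size n / 4) t
      (abscissa P) (ordinate P)) :
    BuildsWith w (buildCmd A B n₀) P (CorrectQueries w (queryCmd t n₀) P) := by
  obtain ⟨s', u, m, h1, ordX, ordY, yr, ρ, hR⟩ := exec_build_large (s := inputMem P) hw hB hA htB hn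
    h hE hT rfl rfl (inputMem_wa P) (inputMem_abscissa P) (inputMem_ordinate P)
  refine ⟨s', u, m, h1, correctQueries_of_runs P fun x x' y y' => ?_⟩
  have hw1 := hw.two_le
  have hn₀ := hw.n₀_lt
  have hR' := hR.congr (s' := s'.withQuery x x' y y') (fun x _ => by simp [Mem.withQuery])
    (fun x => by simp [Mem.withQuery]) (fun x => by simp [Mem.withQuery])
  refine runs_cond ((gives_var hR'.reg0).lt (by omega) (gives_lit (by omega)))
    (fun h' => absurd (if_neg (not_lt.2 h)) h') (fun _ => ?_)
  refine runs_lookup hT hR' ?_ ?_ ?_ ?_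
  all_goals simp [Mem.withQuery]

end

/-- From (size - 1) · log 2 ≤ log n, with log 2 > 2/3 and log n ≥ 1. -/
theorem size_le_log {n : ℕ} (hn : 3 ≤ n) : (Nat.size n : ℝ) ≤ 3 * Real.log n := by
  have h1 := two_pow_size_sub_one_le (n := n) (by omega)
  have hpos : 1 ≤ Nat.size n := Nat.size_pos.2 (by omega)
  have h2 : ((2 : ℝ) ^ (Nat.size n - 1)) ≤ n := by exact_mod_cast h1
  have h3 := Real.log_le_log (by positivity) h2
  rw [Real.log_pow] at h3
  push_cast [hpos] at h3
  have h4 := Real.log_two_gt_d9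
  have h5 : 1 ≤ Real.log n := by
    rw [Real.le_log_iff_exp_le (by positivity)]
    have : (3 : ℝ) ≤ n := by exact_mod_cast hn
    linarith [Real.exp_one_lt_d9]
  have h6 : (1 : ℝ) ≤ Nat.size n := by exact_mod_cast hpos
  nlinarith

/-- The bound `n log n (log log n)²` dominates the number of input bits up to a constant. -/
theorem exists_mul_size_le (C : ℕ) : ∃ C' : ℝ, ∀ n : ℕ, 3 ≤ n →
    ((C * (n * Nat.size n) : ℕ) : ENNReal) ≤
      ENNReal.ofReal (C' * (n * Real.log n * Real.log (Real.log n) ^ 2)) := by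
  have h3 : 1 < Real.log 3 := by
    rw [Real.lt_log_iff_exp_lt (by norm_num)]
    linarith [Real.exp_one_lt_d9]
  -- The iterated logarithm is increasing, so its positive value at 3 bounds the superfluous factor
  -- from below.
  set δ := Real.log (Real.log 3) with hδ
  have hδ0 : 0 < δ := Real.log_pos h3
  refine ⟨C * 3 / δ ^ 2, fun n hn => ?_⟩
  rw [← ENNReal.ofReal_natCast]
  refine ENNReal.ofReal_le_ofReal ?_
  have hn' : (3 : ℝ) ≤ n := by exact_mod_cast hn
  have h1 : Real.log 3 ≤ Real.log n := Real.log_le_log (by norm_num) hn'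
  have h2 : δ ≤ Real.log (Real.log n) := Real.log_le_log (by linarith) h1
  have h4 := size_le_log hn
  have h5 : 1 ≤ Real.log (Real.log n) ^ 2 / δ ^ 2 := by
    rw [one_le_div (by positivity)]
    exact pow_le_pow_left₀ hδ0.le h2 2
  push_cast
  calc (C : ℝ) * (n * Nat.size n) ≤ C * (n * (3 * Real.log n)) := by gcongr
    _ ≤ C * (n * (3 * Real.log n)) * (Real.log (Real.log n) ^ 2 / δ ^ 2) :=
      le_mul_of_one_le_right (by have : 0 ≤ Real.log n := by linarith
                                 positivity) h5
    _ = _ := by ring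

theorem law_not_typical_le_of_longEnough {n c : ℕ} (hn : 3 ≤ n)
    (hE : LongEnough (8 * (c + 4)) (8 * (8 * (c + 4)) + c + 4) (Nat.size n)) :
    law n {P | ¬ Typical n (Nat.log 2 (n / (8 * (c + 4) * Nat.size n)))
      ((8 * (8 * (c + 4)) + c + 4) * Nat.size n) (Nat.size n / 4) (16 * (c + 5)) (abscissa P)
      (ordinate P)} ≤ ENNReal.ofReal (1 / (n : ℝ) ^ c) := by
  have hAn := hE.mul_le (by omega)
  have h8 := hE.le
  have hload := hE.load
  have hq : 0 < 8 * (c + 4) * Nat.size n := by positivity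
  have hJ := two_pow_log_div_mul_le hq hAn
  refine law_not_typical_le (by omega) (Nat.lt_size_self n) (by omega) ?_ hJ
    (le_two_pow_log_div_mul hq) (by omega) (by omega) ?_
  · exact (Nat.pow_lt_pow_iff_right (by norm_num : 1 < 2)).1
      (((Nat.le_mul_of_pos_right _ hq).trans hJ).trans_lt (Nat.lt_size_self n))
  · calc (2 * (8 * (c + 4) * Nat.size n)) ^ 2 ≤ (2 ^ (Nat.size n / 8)) ^ 2 :=
        Nat.pow_le_pow_left hload 2
      _ = 2 ^ (Nat.size n / 8 * 2) := (pow_mul _ _ _).symm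
      _ ≤ _ := Nat.pow_le_pow_right (by norm_num) (by omega)

end RandomPoints

theorem mainTheorem1 (c : ℕ) :
    ∃ (build query : RealRAM.Cmd) (κ K : ℕ) (C : ℝ), 1 ≤ κ ∧
      ∀ (n w : ℕ), 3 ≤ n → w = κ * Nat.size n →
        -- expected construction time and space
        (∫⁻ P, RealRAM.runTime w build (RealRAM.inputMem P) ∂(RandomPoints.law n) ≤
          ENNReal.ofReal (C * (n * Real.log n * Real.log (Real.log n) ^ 2))) ∧
        (∫⁻ P, RealRAM.runSpace w build (RealRAM.inputMem P) ∂(RandomPoints.law n) ≤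
          ENNReal.ofReal (C * (n * Real.log n * Real.log (Real.log n) ^ 2))) ∧
        -- constant query time
        (∀ᵐ P ∂(RandomPoints.law n), RandomPoints.BuildsWith w build P
          (RandomPoints.FastQueries w query K)) ∧
        -- correctness of all answers with high probability
        RandomPoints.law n {P | ¬ RandomPoints.BuildsWith w build P
          (RandomPoints.CorrectQueries w query P)} ≤ ENNReal.ofReal (1 / (n : ℝ) ^ c) := by
  -- `A` fixes the mean load of a cell, `B` its capacity, and `t` the bound for strips; these are
  -- the values in `law_not_typical_le`.
  set A := 8 * (c + 4) with hA
  set B := 8 * A + c + 4 with hB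
  set t := 16 * (c + 5) with ht
  obtain ⟨ℓ₀, hℓ₀⟩ := Filter.eventually_atTop.1 (RealRAM.eventually_longEnough A B)
  -- For n ≥ n₀ the binary length exceeds ℓ₀, so the asymptotic conditions hold; smaller inputs are
  -- scanned.
  set n₀ := 2 ^ ℓ₀ with hn₀
  -- The factor κ may depend on the running time of the program, because the program text does not
  -- depend on κ.
  obtain ⟨κ, hκ, hwide⟩ := RealRAM.exists_wideWords B (RealRAM.fuelFactor A B) n₀
  obtain ⟨C, hC⟩ := RealRAM.exec_build_halts A B n₀ (by omega)
  obtain ⟨C', hC'⟩ := RandomPoints.exists_mul_size_le C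
  refine ⟨RealRAM.buildCmd A B n₀, RealRAM.queryCmd t n₀, κ, (RealRAM.queryCmd t n₀).maxTime, C', hκ,
    ?_⟩
  rintro n w hn rfl
  have hw := hwide n (by omega)
  have hhalt := fun P : Fin n → ℝ × ℝ =>
    hC _ n (RealRAM.inputMem P) (by omega) hw rfl rfl
  refine ⟨le_trans (RandomPoints.lintegral_law_le fun P => ?_) (hC' n hn),
    le_trans (RandomPoints.lintegral_law_le fun P => ?_) (hC' n hn),
    -- Halting of both programs holds for every point set, not only almost surely.
    Filter.Eventually.of_forall fun P => ?_, ?_⟩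
  · obtain ⟨s', u, m, h1, h2, -⟩ := hhalt P
    exact (RandomPoints.runTime_le h1).trans (by exact_mod_cast h2)
  · obtain ⟨s', u, m, h1, -, h2⟩ := hhalt P
    exact (RandomPoints.runSpace_le h1).trans (by exact_mod_cast h2)
  · obtain ⟨s', u, m, h1, -⟩ := hhalt P
    exact ⟨s', u, m, h1, fun x x' y y' => RealRAM.Cmd.exists_exec_of_loopFree _ _
      (RealRAM.queryCmd_loopFree t n₀) _⟩
  · by_cases h : n < n₀
    -- Scanning never errs, so the set of bad inputs is empty.
    · refine le_of_eq_of_le ?_ zero_le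
      convert MeasureTheory.measure_empty (μ := RandomPoints.law n)
      exact Set.eq_empty_of_forall_notMem fun P hP =>
        hP (RandomPoints.buildsWith_correctQueries_small P hw (by omega) (by omega) h)
    · have hE : RealRAM.LongEnough A B (Nat.size n) :=
        hℓ₀ _ (Nat.lt_size.2 (not_lt.1 h)).le
      refine (MeasureTheory.measure_mono ?_).trans
        (RandomPoints.law_not_typical_le_of_longEnough (c := c) hn hE)
      intro P hP hT
      exact hP (RandomPoints.buildsWith_correctQueries_large P hw (by omega) (by omega) (by omega) hn
        (not_lt.1 h) hE hT)
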